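/- **Setting.** Let $n\ge 2$ and let $\Omega\subset\mathbb{R}^n$ be a nonempty bounded open set with Lipschitz boundary (locally, after a rigid motion, the region above the graph of a Lipschitz function; $\Omega$ need not be connected), with surface measure $\omega$ on $\partial\Omega$. $H^{1}(\Omega)$ and $H^{1/2}(\partial\Omega)$ are the usual complex $L^2$-based Sobolev spaces, $H^{-1/2}(\partial\Omega)=(H^{1/2}(\partial\Omega))^*$ is the space of bounded conjugate-linear functionals on $H^{1/2}(\partial\Omega)$, and $\langle\cdot,\cdot\rangle_{1/2}$ (antilinear in the first, linear in the second entry) is the duality pairing between $H^{1/2}(\partial\Omega)$ and $H^{-1/2}(\partial\Omega)$. Let $\gamma_D\colon H^1(\Omega)\to H^{1/2}(\partial\Omega)$ be the Dirichlet trace, i.e. the unique bounded linear operator with $\gamma_Du=u|_{\partial\Omega}$ for $u\in H^1(\Omega)\cap C(\overline\Omega)$. For $u\in H^1(\Omega)$ with $\Delta u\in L^2(\Omega)$, the weak Neumann trace $\widetilde\gamma_Nu\in H^{-1/2}(\partial\Omega)$ is the unique functional with $$\langle\gamma_D\Phi,\widetilde\gamma_Nu\rangle_{1/2}=\int_\Omega\overline{\nabla\Phi}\cdot\nabla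 u\,d^nx+\int_\Omega\overline{\Phi}\,\Delta u\,d^nx,\qquad \Phi\in H^1(\Omega).$$ For $j=1,2$ let $\widetilde\Theta_j\colon H^{1/2}(\partial\Omega)\to H^{-1/2}(\partial\Omega)$ be a compact linear operator whose sesquilinear form $a_j(f,g)=\langle f,\widetilde\Theta_jg\rangle_{1/2}$ is symmetric, $a_j(f,g)=\overline{a_j(g,f)}$, and bounded from below in $L^2(\partial\Omega;d\omega)$: $a_j(f,f)\ge c_j\|f\|^2_{L^2(\partial\Omega;d\omega)}$ for all $f\in H^{1/2}(\partial\Omega)$, for some $c_j\in\mathbb{R}$. The generalized Robin Laplacian $-\Delta_{\Theta_j,\Omega}$ is the operator $u\mapsto-\Delta u$ in $L^2(\Omega)$ with domain $\{u\in H^1(\Omega) : \Delta u\in L^2(\Omega),\ (\widetilde\gamma_N+\widetilde\Theta_j\gamma_D)u=0\}$, and $\sigma(-\Delta_{\Theta_j,\Omega})$ is its spectrum. For $z\in\mathbb{C}\setminus\sigma(-\Delta_{\Theta_j,\Omega})$ and $f\in H^{-1/2}(\partial\Omega)$ let $u_{\Theta_j}=u_{\Theta_j}(z,f)$ be the solution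 of $$(-\Delta-z)u=0\ \text{ in }\Omega,\qquad u\in H^1(\Omega),\qquad (\widetilde\gamma_N+\widetilde\Theta_j\gamma_D)u=f\ \text{ on }\partial\Omega,$$ and define the Robin-to-Dirichlet map $\widetilde M_{\Theta_j,D,\Omega}(z)f=\gamma_Du_{\Theta_j}\in H^{1/2}(\partial\Omega)$ and, for $k\in\{1,2\}$, the Robin-to-Robin map $\widetilde M_{\Theta_j,\Theta_k,\Omega}(z)f=-(\widetilde\gamma_N+\widetilde\Theta_k\gamma_D)u_{\Theta_j}\in H^{-1/2}(\partial\Omega)$. **Theorem.** The traces $\gamma_D$ and $\widetilde\gamma_N$ are well defined as described. Let $z\in\mathbb{C}\setminus\sigma(-\Delta_{\Theta_1,\Omega})$. Then the above boundary value problem for $\widetilde\Theta_1$ has a unique solution for every $f\in H^{-1/2}(\partial\Omega)$, the map $\widetilde M_{\Theta_1,D,\Omega}(z)\colon H^{-1/2}(\partial\Omega)\to H^{1/2}(\partial\Omega)$ is linear and bounded, and $$\widetilde M_{\Theta_1,\Theta_2,\Omega}(z)\in\mathcal{B}\big(H^{-1/2}(\partial\Omega)\big),\qquad \widetilde M_{\Theta_1,\Theta_2,\Omega}(z)=-I_{\partial\Omega}+(\widetilde\Theta_1-\widetilde\Theta_2)\widetilde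 M_{\Theta_1,D,\Omega}(z).$$ In particular, as operators from $H^{1/2}(\partial\Omega)$ to $H^{-1/2}(\partial\Omega)$, $$\widetilde M_{\Theta_1,\Theta_2,\Omega}(z)(\widetilde\Theta_1-\widetilde\Theta_2)=-(\widetilde\Theta_1-\widetilde\Theta_2)+(\widetilde\Theta_1-\widetilde\Theta_2)\widetilde M_{\Theta_1,D,\Omega}(z)(\widetilde\Theta_1-\widetilde\Theta_2),$$ and, moreover, $\overline z\notin\sigma(-\Delta_{\Theta_1,\Omega})$ and $$\big[\widetilde M_{\Theta_1,\Theta_2,\Omega}(z)(\widetilde\Theta_1-\widetilde\Theta_2)\big]^*=\widetilde M_{\Theta_1,\Theta_2,\Omega}(\overline z)(\widetilde\Theta_1-\widetilde\Theta_2),$$ where the adjoint $T^*\colon H^{1/2}(\partial\Omega)\to H^{-1/2}(\partial\Omega)$ of an operator $T\colon H^{1/2}(\partial\Omega)\to H^{-1/2}(\partial\Omega)$ is given by $\langle f,Tg\rangle_{1/2}=\overline{\langle g,T^*f\rangle_{1/2}}$ for $f,g\in H^{1/2}(\partial\Omega)$. Finally, if $z\in\mathbb{C}\setminus\big(\sigma(-\Delta_{\Theta_1,\Omega})\cup\sigma(-\Delta_{\Theta_2,\Omega})\big)$,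 then $\widetilde M_{\Theta_2,\Theta_1,\Omega}(z)$ is invertible on $H^{-1/2}(\partial\Omega)$ and $$\widetilde M_{\Theta_1,\Theta_2,\Omega}(z)=\widetilde M_{\Theta_2,\Theta_1,\Omega}(z)^{-1}.$$ -/

import Mathlib

open MeasureTheory
open scoped ContDiff ComplexConjugate Laplacian

namespace RobinMaps

noncomputable section

/-! ### Lipschitz domains, surface measure, test functions -/

/-- `ℝⁿ` with the Euclidean norm. -/
abbrev E (n : ℕ) := EuclideanSpace ℝ (Fin n)

/-- The boundary of `Ω` is covered by finitely many open sets `O j`; inside each of them, after a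
rigid motion `T j : ℝⁿ → ℝⁿ⁻¹ × ℝ`, the set `Ω` is the region above the graph of a Lipschitz
function `h j : ℝⁿ⁻¹ → ℝ`. -/
def HasLipschitzBoundary {n : ℕ} (Ω : Set (E n)) : Prop :=
  ∃ (N : ℕ) (O : Fin N → Set (E n))
    (T : Fin N → (E n ≃ᵃⁱ[ℝ] WithLp 2 (E (n - 1) × ℝ)))
    (h : Fin N → E (n - 1) → ℝ),
    (∀ j, IsOpen (O j)) ∧ frontier Ω ⊆ ⋃ j, O j ∧
    (∀ j, ∃ K, LipschitzWith K (h j)) ∧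
    ∀ j, O j ∩ Ω = O j ∩ {x | h j (T j x).fst < (T j x).snd}

/-- A nonempty bounded open set with Lipschitz boundary (not necessarily connected). -/
structure IsBoundedLipschitzDomain {n : ℕ} (Ω : Set (E n)) : Prop where
  isOpen : IsOpen Ω
  isBounded : Bornology.IsBounded Ω
  nonempty : Ω.Nonempty
  lipschitz : HasLipschitzBoundary Ω

/-- Surface measure on `∂Ω`: the `(n-1)`-dimensional Hausdorff measure, normalised so as to agree
with Lebesgue measure on `ℝⁿ⁻¹`, restricted to `∂Ω`. -/
def surfaceMeasure {n : ℕ} (Ω : Set (E n)) : Measure (E n) :=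
  (Measure.euclideanHausdorffMeasure (n - 1) : Measure (E n)).restrict (frontier Ω)

/-- `φ ∈ C₀^∞(Ω)`, complex valued. -/
structure IsTestFunction {n : ℕ} (Ω : Set (E n)) (φ : E n → ℂ) : Prop where
  contDiff : ContDiff ℝ ∞ φ
  hasCompactSupport : HasCompactSupport φ
  tsupport_subset : tsupport φ ⊆ Ω

/-- `L²(Ω)`, complex valued. -/
abbrev L2 {n : ℕ} (Ω : Set (E n)) := Lp ℂ 2 (volume.restrict Ω)

/-- `L²(Ω)ⁿ`, square integrable complex vector fields on `Ω`. -/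
abbrev L2Vec {n : ℕ} (Ω : Set (E n)) := Lp (EuclideanSpace ℂ (Fin n)) 2 (volume.restrict Ω)

/-- `L²(∂Ω)` with respect to surface measure. -/
abbrev L2Bdry {n : ℕ} (Ω : Set (E n)) := Lp ℂ 2 (surfaceMeasure Ω)

/-- The `i`-th partial derivative of `φ`. -/
def partialDeriv {n : ℕ} (i : Fin n) (φ : E n → ℂ) (x : E n) : ℂ :=
  fderiv ℝ φ x (EuclideanSpace.single i 1)

/-- `G` is the gradient of `u` in the sense of distributions on `Ω`. -/
def HasWeakGradient {n : ℕ} {Ω : Set (E n)} (u : L2 Ω) (G : L2Vec Ω) : Prop :=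
  ∀ φ, IsTestFunction Ω φ → ∀ i : Fin n,
    ∫ x in Ω, u x * partialDeriv i φ x = -∫ x in Ω, G x i * φ x

/-- `Δ u = f` in the sense of distributions on `Ω`. -/
def HasWeakLaplacian {n : ℕ} {Ω : Set (E n)} (u f : L2 Ω) : Prop :=
  ∀ φ, IsTestFunction Ω φ → ∫ x in Ω, u x * (Δ φ) x = ∫ x in Ω, f x * φ x

section aux

variable {n : ℕ} {Ω : Set (E n)}

theorem integrable_mul_of_compact (u : L2 Ω) {ψ : E n → ℂ} (hc : Continuous ψ)
    (hs : HasCompactSupport ψ) : Integrable (fun x => u x * ψ x) (volume.restrict Ω) := by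
  have h1 : MemLp u 2 (volume.restrict Ω) := Lp.memLp u
  have h2 : MemLp ψ 2 (volume.restrict Ω) := hc.memLp_of_hasCompactSupport hs
  exact h1.integrable_mul h2

theorem IsTestFunction.integrable {φ : E n → ℂ} (hφ : IsTestFunction Ω φ) (u : L2 Ω) :
    Integrable (fun x => u x * φ x) (volume.restrict Ω) :=
  integrable_mul_of_compact u hφ.contDiff.continuous hφ.hasCompactSupport

theorem IsTestFunction.integrable_partialDeriv {φ : E n → ℂ} (hφ : IsTestFunction Ω φ)
    (i : Fin n) (u : L2 Ω) :
    Integrable (fun x => u x * partialDeriv i φ x) (volume.restrict Ω) :=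
  integrable_mul_of_compact u
    ((hφ.contDiff.continuous_fderiv (by simp)).clm_apply continuous_const)
    (hφ.hasCompactSupport.fderiv_apply ℝ _)

theorem IsTestFunction.integrable_laplacian {φ : E n → ℂ} (hφ : IsTestFunction Ω φ) (u : L2 Ω) :
    Integrable (fun x => u x * (Δ φ) x) (volume.restrict Ω) := by
  have hd : ContDiff ℝ 2 φ := hφ.contDiff.of_le (by norm_cast)
  refine integrable_mul_of_compact u ?_ ?_
  · rw [InnerProductSpace.laplacian_eq_iteratedFDeriv_stdOrthonormalBasis]
    have := hd.continuous_iteratedFDeriv (m := 2) le_rfl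
    fun_prop
  · refine (hφ.hasCompactSupport.iteratedFDeriv (𝕜 := ℝ) 2).mono ?_
    intro x hx hx0
    apply hx
    rw [InnerProductSpace.laplacian_eq_iteratedFDeriv_stdOrthonormalBasis]
    simp [hx0]

theorem integrable_vec_mul (G : L2Vec Ω) {φ : E n → ℂ} (hφ : IsTestFunction Ω φ) (i : Fin n) :
    Integrable (fun x => G x i * φ x) (volume.restrict Ω) := by
  have h1 : MemLp (fun x => G x i) 2 (volume.restrict Ω) := (Lp.memLp G).eval_piLp i
  have h2 : MemLp φ 2 (volume.restrict Ω) :=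
    hφ.contDiff.continuous.memLp_of_hasCompactSupport hφ.hasCompactSupport
  exact h1.integrable_mul h2

theorem L2.integral_add_mul (u v : L2 Ω) {ψ : E n → ℂ}
    (hu : Integrable (fun x => u x * ψ x) (volume.restrict Ω))
    (hv : Integrable (fun x => v x * ψ x) (volume.restrict Ω)) :
    ∫ x in Ω, (u + v : L2 Ω) x * ψ x = (∫ x in Ω, u x * ψ x) + ∫ x in Ω, v x * ψ x := by
  rw [← integral_add hu hv]
  refine integral_congr_ae ?_
  filter_upwards [Lp.coeFn_add u v] with x hx
  rw [hx, Pi.add_apply, add_mul]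

theorem L2.integral_smul_mul (c : ℂ) (u : L2 Ω) (ψ : E n → ℂ) :
    ∫ x in Ω, (c • u : L2 Ω) x * ψ x = c * ∫ x in Ω, u x * ψ x := by
  rw [← integral_const_mul]
  refine integral_congr_ae ?_
  filter_upwards [Lp.coeFn_smul c u] with x hx
  rw [hx, Pi.smul_apply, smul_eq_mul, mul_assoc]

theorem L2.integral_zero_mul (ψ : E n → ℂ) : ∫ x in Ω, (0 : L2 Ω) x * ψ x = 0 := by
  simpa using L2.integral_smul_mul 0 (0 : L2 Ω) ψ

theorem HasWeakGradient.add {u v : L2 Ω} {G H : L2Vec Ω} (hu : HasWeakGradient u G)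
    (hv : HasWeakGradient v H) : HasWeakGradient (u + v) (G + H) := by
  intro φ hφ i
  rw [L2.integral_add_mul u v (hφ.integrable_partialDeriv i u) (hφ.integrable_partialDeriv i v),
    hu φ hφ i, hv φ hφ i, ← neg_add,
    ← integral_add (integrable_vec_mul G hφ i) (integrable_vec_mul H hφ i)]
  congr 1
  refine integral_congr_ae ?_
  filter_upwards [Lp.coeFn_add G H] with x hx
  rw [hx, Pi.add_apply, PiLp.add_apply, add_mul]

theorem HasWeakGradient.smul (c : ℂ) {u : L2 Ω} {G : L2Vec Ω} (hu : HasWeakGradient u G) :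
    HasWeakGradient (c • u) (c • G) := by
  intro φ hφ i
  rw [L2.integral_smul_mul, hu φ hφ i, mul_neg, ← integral_const_mul]
  congr 1
  refine integral_congr_ae ?_
  filter_upwards [Lp.coeFn_smul c G] with x hx
  rw [hx, Pi.smul_apply, PiLp.smul_apply, smul_eq_mul, mul_assoc]

theorem HasWeakGradient.zero : HasWeakGradient (0 : L2 Ω) (0 : L2Vec Ω) := by
  intro φ hφ i
  rw [L2.integral_zero_mul, eq_comm, neg_eq_zero]
  refine integral_eq_zero_of_ae ?_
  filter_upwards [Lp.coeFn_zero (EuclideanSpace ℂ (Fin n)) 2 (volume.restrict Ω)] with x hx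
  rw [hx]
  simp

theorem HasWeakLaplacian.zero : HasWeakLaplacian (0 : L2 Ω) 0 := by
  intro φ hφ
  rw [L2.integral_zero_mul, L2.integral_zero_mul]

theorem HasWeakLaplacian.add {u v f g : L2 Ω} (hu : HasWeakLaplacian u f)
    (hv : HasWeakLaplacian v g) : HasWeakLaplacian (u + v) (f + g) := by
  intro φ hφ
  rw [L2.integral_add_mul u v (hφ.integrable_laplacian u) (hφ.integrable_laplacian v),
    L2.integral_add_mul f g (hφ.integrable f) (hφ.integrable g), hu φ hφ, hv φ hφ]

theorem HasWeakLaplacian.smul (c : ℂ) {u f : L2 Ω} (hu : HasWeakLaplacian u f) :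
    HasWeakLaplacian (c • u) (c • f) := by
  intro φ hφ
  rw [L2.integral_smul_mul, L2.integral_smul_mul, hu φ hφ]

theorem HasWeakLaplacian.eq_zero (hΩ : IsOpen Ω) {f : L2 Ω} (h : HasWeakLaplacian 0 f) :
    f = 0 := by
  have hf : LocallyIntegrableOn f Ω volume := fun x _ => by
    obtain ⟨t, ht, hi⟩ := ((Lp.memLp f).locallyIntegrable (by norm_num)) x
    refine ⟨t ∩ Ω, Filter.inter_mem (mem_nhdsWithin_of_mem_nhds ht) self_mem_nhdsWithin, ?_⟩
    rwa [IntegrableOn, Measure.restrict_restrict' hΩ.measurableSet] at hi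
  have key := hΩ.ae_eq_zero_of_integral_contDiff_smul_eq_zero hf ?_
  · rw [Lp.eq_zero_iff_ae_eq_zero]
    exact (ae_restrict_iff' hΩ.measurableSet).2 key
  · intro g hg hgc hgs
    have ht : IsTestFunction Ω (fun x => (g x : ℂ)) :=
      ⟨Complex.ofRealCLM.contDiff.comp hg, hgc.comp_left (g := ((↑) : ℝ → ℂ)) rfl,
        (tsupport_comp_subset (g := ((↑) : ℝ → ℂ)) rfl g).trans hgs⟩
    have h1 := h _ ht
    rw [L2.integral_zero_mul] at h1
    rw [← setIntegral_eq_integral_of_forall_compl_eq_zero (s := Ω), h1]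
    · simp [mul_comm]
    · intro x hx
      have : g x = 0 := by
        by_contra h0
        exact hx (hgs (subset_tsupport _ h0))
      simp [this]

end aux

/-! ### The Sobolev spaces -/

/-- `H¹(Ω)`: pairs `(u, ∇u)` with `u ∈ L²(Ω)` and distributional gradient `∇u ∈ L²(Ω)ⁿ`. The norm
inherited from the product is `(‖u‖² + ‖∇u‖²)^(1/2)`. -/
def H1 {n : ℕ} (Ω : Set (E n)) : Submodule ℂ (WithLp 2 (L2 Ω × L2Vec Ω)) where
  carrier := {p | HasWeakGradient p.fst p.snd}
  add_mem' hp hq := hp.add hq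
  zero_mem' := HasWeakGradient.zero
  smul_mem' c _ hp := HasWeakGradient.smul c hp

/-- The inclusion of `H¹(Ω)` into `L²(Ω)`. -/
def toL2 {n : ℕ} {Ω : Set (E n)} (u : H1 Ω) : L2 Ω := u.1.fst

/-- The gradient of an element of `H¹(Ω)`. -/
def grad {n : ℕ} {Ω : Set (E n)} (u : H1 Ω) : L2Vec Ω := u.1.snd

theorem toL2_add {n : ℕ} {Ω : Set (E n)} (u v : H1 Ω) : toL2 (u + v) = toL2 u + toL2 v := rfl

theorem toL2_smul {n : ℕ} {Ω : Set (E n)} (c : ℂ) (u : H1 Ω) : toL2 (c • u) = c • toL2 u := rfl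

theorem toL2_zero {n : ℕ} {Ω : Set (E n)} : toL2 (0 : H1 Ω) = 0 := rfl

theorem grad_add {n : ℕ} {Ω : Set (E n)} (u v : H1 Ω) : grad (u + v) = grad u + grad v := rfl

theorem grad_smul {n : ℕ} {Ω : Set (E n)} (c : ℂ) (u : H1 Ω) : grad (c • u) = c • grad u := rfl

theorem grad_zero {n : ℕ} {Ω : Set (E n)} : grad (0 : H1 Ω) = 0 := rfl

/-- The difference quotient `(f(x) - f(y)) / |x - y|^(n/2)`. As `n/2 = ((n-1) + 2s)/2` with
`s = 1/2` and `n - 1 = dim ∂Ω`, its square integrability over `∂Ω × ∂Ω` describes `H^{1/2}(∂Ω)`. -/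
def gagliardoQuotient {n : ℕ} (f : E n → ℂ) (p : E n × E n) : ℂ :=
  (f p.1 - f p.2) / ((‖p.1 - p.2‖ ^ ((n : ℝ) / 2) : ℝ) : ℂ)

/-- `H^{1/2}(∂Ω)`: the functions `f ∈ L²(∂Ω)` whose Gagliardo-Slobodeckij seminorm
`∬ |f(x) - f(y)|² / |x - y|ⁿ dω(x) dω(y)` is finite, realised as pairs of `f` and its difference
quotient in `L²(∂Ω × ∂Ω)`. The inherited norm squared is `‖f‖²` plus the above double integral. -/
def H12 {n : ℕ} (Ω : Set (E n)) : Submodule ℂ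
    (WithLp 2 (L2Bdry Ω × Lp ℂ 2 ((surfaceMeasure Ω).prod (surfaceMeasure Ω)))) where
  carrier := {p | p.snd =ᵐ[(surfaceMeasure Ω).prod (surfaceMeasure Ω)] gagliardoQuotient p.fst}
  add_mem' := by
    intro p q hp hq
    have h := Lp.coeFn_add p.fst q.fst
    filter_upwards [hp, hq, Lp.coeFn_add p.snd q.snd,
      Measure.quasiMeasurePreserving_fst.ae h, Measure.quasiMeasurePreserving_snd.ae h]
      with x h1 h2 h3 h4 h5
    change (p.snd + q.snd : Lp ℂ 2 _) x = gagliardoQuotient (p.fst + q.fst : Lp ℂ 2 _) x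
    rw [h3, Pi.add_apply, h1, h2]
    simp only [gagliardoQuotient]
    rw [h4, h5, Pi.add_apply, Pi.add_apply]
    ring
  zero_mem' := by
    have h := Lp.coeFn_zero ℂ 2 (surfaceMeasure Ω)
    filter_upwards [Lp.coeFn_zero ℂ 2 ((surfaceMeasure Ω).prod (surfaceMeasure Ω)),
      Measure.quasiMeasurePreserving_fst.ae h, Measure.quasiMeasurePreserving_snd.ae h]
      with x h3 h4 h5
    change (0 : Lp ℂ 2 _) x = gagliardoQuotient (0 : Lp ℂ 2 _) x
    rw [h3]
    simp only [gagliardoQuotient]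
    rw [h4, h5]
    simp
  smul_mem' := by
    intro c p hp
    have h := Lp.coeFn_smul c p.fst
    filter_upwards [hp, Lp.coeFn_smul c p.snd,
      Measure.quasiMeasurePreserving_fst.ae h, Measure.quasiMeasurePreserving_snd.ae h]
      with x h1 h3 h4 h5
    change (c • p.snd : Lp ℂ 2 _) x = gagliardoQuotient (c • p.fst : Lp ℂ 2 _) x
    rw [h3, Pi.smul_apply, h1]
    simp only [gagliardoQuotient]
    rw [h4, h5, Pi.smul_apply, Pi.smul_apply, smul_eq_mul, smul_eq_mul, smul_eq_mul]
    ring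

/-- The inclusion of `H^{1/2}(∂Ω)` into `L²(∂Ω)`. -/
def toL2Bdry {n : ℕ} {Ω : Set (E n)} (f : H12 Ω) : L2Bdry Ω := f.1.fst

/-- `H^{-1/2}(∂Ω)`: the continuous conjugate linear functionals on `H^{1/2}(∂Ω)`. -/
abbrev Hm12 {n : ℕ} (Ω : Set (E n)) := H12 Ω →SL[starRingEnd ℂ] ℂ

/-- The duality pairing `⟨f, g⟩_{1/2}` of `f ∈ H^{1/2}(∂Ω)` and `g ∈ H^{-1/2}(∂Ω)`, antilinear in
`f` and linear in `g`. -/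
def pairing {n : ℕ} {Ω : Set (E n)} (f : H12 Ω) (g : Hm12 Ω) : ℂ := g f

/-! ### Trace operators -/

/-- `γ : H¹(Ω) → H^{1/2}(∂Ω)` is compatible with restriction to the boundary: `γ u = w|_∂Ω`
whenever `u` has a representative `w` that is continuous on the closure of `Ω`. -/
def IsDirichletTrace {n : ℕ} {Ω : Set (E n)} (γ : H1 Ω →L[ℂ] H12 Ω) : Prop :=
  ∀ (u : H1 Ω) (w : E n → ℂ), ContinuousOn w (closure Ω) →
    toL2 u =ᵐ[volume.restrict Ω] w → toL2Bdry (γ u) =ᵐ[surfaceMeasure Ω] w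

open Classical in
/-- The Dirichlet trace `γ_D : H¹(Ω) → H^{1/2}(∂Ω)`, the bounded operator that is compatible with
restriction to the boundary. It exists and is unique on bounded Lipschitz domains. -/
def dirichletTrace {n : ℕ} (Ω : Set (E n)) : H1 Ω →L[ℂ] H12 Ω :=
  if h : ∃ γ : H1 Ω →L[ℂ] H12 Ω, IsDirichletTrace γ then h.choose else 0

/-- `ν ∈ H^{-1/2}(∂Ω)` is the weak Neumann trace of `u ∈ H¹(Ω)`, where `Δ u ∈ L²(Ω)`:
`⟨γ_D Φ, ν⟩_{1/2} = ∫_Ω conj(∇Φ) · ∇u + ∫_Ω conj(Φ) Δu` for all `Φ ∈ H¹(Ω)`. -/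
def HasNeumannTrace {n : ℕ} {Ω : Set (E n)} (u : H1 Ω) (ν : Hm12 Ω) : Prop :=
  ∃ f : L2 Ω, HasWeakLaplacian (toL2 u) f ∧
    ∀ Φ : H1 Ω, pairing (dirichletTrace Ω Φ) ν = inner ℂ (grad Φ) (grad u) + inner ℂ (toL2 Φ) f

open Classical in
/-- The weak Neumann trace of `u ∈ H¹(Ω)` with `Δ u ∈ L²(Ω)`. -/
def neumannTrace {n : ℕ} {Ω : Set (E n)} (u : H1 Ω) : Hm12 Ω :=
  if h : ∃ ν : Hm12 Ω, HasNeumannTrace u ν then h.choose else 0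

/-! ### Robin boundary conditions -/

/-- The operator `Θ : H^{1/2}(∂Ω) → H^{-1/2}(∂Ω)` comes from a symmetric sesquilinear form
`a(f, g) = ⟨f, Θ g⟩_{1/2}` with domain `H^{1/2}(∂Ω)` that is bounded from below in `L²(∂Ω)`, and
`Θ` is compact. -/
structure IsBoundaryOperator {n : ℕ} {Ω : Set (E n)} (Θ : H12 Ω →L[ℂ] Hm12 Ω) : Prop where
  symm : ∀ f g : H12 Ω, pairing f (Θ g) = conj (pairing g (Θ f))
  bounded_below : ∃ c : ℝ, ∀ f : H12 Ω, c * ‖toL2Bdry f‖ ^ 2 ≤ (pairing f (Θ f)).re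
  compact : IsCompactOperator Θ

/-- `(γ̃_N + Θ γ_D) u = g`. -/
def HasRobinTrace {n : ℕ} {Ω : Set (E n)} (Θ : H12 Ω →L[ℂ] Hm12 Ω) (u : H1 Ω) (g : Hm12 Ω) :
    Prop :=
  ∃ ν : Hm12 Ω, HasNeumannTrace u ν ∧ ν + Θ (dirichletTrace Ω u) = g

theorem HasNeumannTrace.add {n : ℕ} {Ω : Set (E n)} {u v : H1 Ω} {ν μ : Hm12 Ω}
    (hu : HasNeumannTrace u ν) (hv : HasNeumannTrace v μ) : HasNeumannTrace (u + v) (ν + μ) := by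
  obtain ⟨f, hf, hν⟩ := hu
  obtain ⟨k, hk, hμ⟩ := hv
  refine ⟨f + k, ?_, fun Φ => ?_⟩
  · rw [toL2_add]; exact hf.add hk
  · have h1 := hν Φ
    have h2 := hμ Φ
    simp only [pairing] at h1 h2 ⊢
    rw [add_apply, h1, h2, grad_add, inner_add_right, inner_add_right]
    ring

theorem HasNeumannTrace.smul {n : ℕ} {Ω : Set (E n)} {u : H1 Ω} {ν : Hm12 Ω} (c : ℂ)
    (hu : HasNeumannTrace u ν) : HasNeumannTrace (c • u) (c • ν) := by
  obtain ⟨f, hf, hν⟩ := hu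
  refine ⟨c • f, ?_, fun Φ => ?_⟩
  · rw [toL2_smul]; exact hf.smul c
  · have h1 := hν Φ
    simp only [pairing] at h1 ⊢
    rw [smul_apply, h1, grad_smul, inner_smul_right, inner_smul_right,
      smul_eq_mul]
    ring

theorem HasNeumannTrace.zero {n : ℕ} {Ω : Set (E n)} :
    HasNeumannTrace (0 : H1 Ω) (0 : Hm12 Ω) := by
  refine ⟨0, ?_, fun Φ => ?_⟩
  · rw [toL2_zero]; exact HasWeakLaplacian.zero
  · rw [grad_zero, inner_zero_right, inner_zero_right, add_zero]; rfl

theorem HasRobinTrace.add {n : ℕ} {Ω : Set (E n)} {Θ : H12 Ω →L[ℂ] Hm12 Ω} {u v : H1 Ω}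
    {g h : Hm12 Ω} (hu : HasRobinTrace Θ u g) (hv : HasRobinTrace Θ v h) :
    HasRobinTrace Θ (u + v) (g + h) := by
  obtain ⟨ν, hν, rfl⟩ := hu
  obtain ⟨μ, hμ, rfl⟩ := hv
  refine ⟨ν + μ, hν.add hμ, ?_⟩
  rw [map_add, map_add]
  abel

theorem HasRobinTrace.smul {n : ℕ} {Ω : Set (E n)} {Θ : H12 Ω →L[ℂ] Hm12 Ω} {u : H1 Ω}
    {g : Hm12 Ω} (c : ℂ) (hu : HasRobinTrace Θ u g) : HasRobinTrace Θ (c • u) (c • g) := by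
  obtain ⟨ν, hν, rfl⟩ := hu
  exact ⟨c • ν, hν.smul c, by rw [map_smul, map_smul, smul_add]⟩

theorem HasRobinTrace.zero {n : ℕ} {Ω : Set (E n)} {Θ : H12 Ω →L[ℂ] Hm12 Ω} :
    HasRobinTrace Θ (0 : H1 Ω) 0 :=
  ⟨0, HasNeumannTrace.zero, by rw [map_zero, map_zero, add_zero]⟩

/-- The graph of the Robin Laplacian `-Δ_Θ` in `L²(Ω) × L²(Ω)`: pairs `(u, -Δu)` with `u ∈ H¹(Ω)`,
`Δu ∈ L²(Ω)` and `(γ̃_N + Θ γ_D) u = 0`. -/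
def robinGraph {n : ℕ} {Ω : Set (E n)} (Θ : H12 Ω →L[ℂ] Hm12 Ω) :
    Submodule ℂ (L2 Ω × L2 Ω) where
  carrier := {p | ∃ u : H1 Ω, toL2 u = p.1 ∧ HasWeakLaplacian p.1 (-p.2) ∧ HasRobinTrace Θ u 0}
  add_mem' := by
    rintro ⟨p, p'⟩ ⟨q, q'⟩ ⟨u, hu, hul, hur⟩ ⟨v, hv, hvl, hvr⟩
    refine ⟨u + v, ?_, ?_, ?_⟩
    · rw [toL2_add, hu, hv, Prod.mk_add_mk]
    · simp only [Prod.mk_add_mk, neg_add]; exact hul.add hvl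
    · have := hur.add hvr
      rwa [add_zero] at this
  zero_mem' := by
    refine ⟨0, toL2_zero, ?_, HasRobinTrace.zero⟩
    rw [Prod.snd_zero, neg_zero]; exact HasWeakLaplacian.zero
  smul_mem' := by
    rintro c ⟨p, p'⟩ ⟨u, hu, hul, hur⟩
    refine ⟨c • u, ?_, ?_, ?_⟩
    · rw [toL2_smul, hu, Prod.smul_mk]
    · simp only [Prod.smul_mk, ← smul_neg]; exact hul.smul c
    · have h0 : c • (0 : Hm12 Ω) = 0 := smul_zero (M := ℂ) (A := Hm12 Ω) c
      exact h0 ▸ hur.smul c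

/-- The Robin Laplacian `-Δ_Θ` as an unbounded operator in `L²(Ω)`, with domain
`{u ∈ H¹(Ω) : Δu ∈ L²(Ω), (γ̃_N + Θ γ_D) u = 0}`. -/
def robinLaplacian {n : ℕ} {Ω : Set (E n)} (Θ : H12 Ω →L[ℂ] Hm12 Ω) : L2 Ω →ₗ.[ℂ] L2 Ω :=
  (robinGraph Θ).toLinearPMap

/-- The graph above is that of a (single valued) operator. -/
theorem robinLaplacian_graph {n : ℕ} {Ω : Set (E n)} (hΩ : IsOpen Ω)
    (Θ : H12 Ω →L[ℂ] Hm12 Ω) : (robinLaplacian Θ).graph = robinGraph Θ := by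
  refine Submodule.toLinearPMap_graph_eq _ ?_
  rintro ⟨p, q⟩ ⟨u, -, hul, -⟩ hp
  dsimp only at hp hul ⊢
  rw [hp] at hul
  exact neg_eq_zero.1 (hul.eq_zero hΩ)

/-- The spectrum of an unbounded operator `A`: the set of all `z` for which `A - z`, from the
domain of `A` to the whole space, has no bounded two-sided inverse `R`. -/
def pmapSpectrum {H : Type*} [NormedAddCommGroup H] [NormedSpace ℂ H] (A : H →ₗ.[ℂ] H) : Set ℂ :=
  {z | ¬ ∃ R : H →L[ℂ] H,
    (∀ f : H, ∃ h : R f ∈ A.domain, A ⟨R f, h⟩ - z • R f = f) ∧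
    ∀ u : A.domain, R (A u - z • (u : H)) = u}

/-! ### Robin boundary value problem, Robin-to-Dirichlet and Robin-to-Robin maps -/

/-- `u ∈ H¹(Ω)` solves `(-Δ - z) u = 0` in `Ω`, `(γ̃_N + Θ γ_D) u = g` on `∂Ω`. -/
def IsRobinSolution {n : ℕ} {Ω : Set (E n)} (Θ : H12 Ω →L[ℂ] Hm12 Ω) (z : ℂ) (g : Hm12 Ω)
    (u : H1 Ω) : Prop :=
  HasWeakLaplacian (toL2 u) (-(z • toL2 u)) ∧ HasRobinTrace Θ u g

open Classical in
/-- The solution of the Robin problem with boundary datum `g`. -/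
def robinSolution {n : ℕ} {Ω : Set (E n)} (Θ : H12 Ω →L[ℂ] Hm12 Ω) (z : ℂ) (g : Hm12 Ω) : H1 Ω :=
  if h : ∃ u : H1 Ω, IsRobinSolution Θ z g u then h.choose else 0

/-- The Robin-to-Dirichlet map `g ↦ γ_D u`, where `u` solves the Robin problem for `Θ` with
datum `g`. -/
def robinToDirichlet {n : ℕ} {Ω : Set (E n)} (Θ : H12 Ω →L[ℂ] Hm12 Ω) (z : ℂ) (g : Hm12 Ω) :
    H12 Ω :=
  dirichletTrace Ω (robinSolution Θ z g)

/-- The Robin-to-Robin map `g ↦ -(γ̃_N + Θ₂ γ_D) u`, where `u` solves the Robin problem for `Θ₁`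
with datum `g`. -/
def robinToRobin {n : ℕ} {Ω : Set (E n)} (Θ₁ Θ₂ : H12 Ω →L[ℂ] Hm12 Ω) (z : ℂ) (g : Hm12 Ω) :
    Hm12 Ω :=
  -(neumannTrace (robinSolution Θ₁ z g) + Θ₂ (dirichletTrace Ω (robinSolution Θ₁ z g)))

/-- `S = T*` for maps `T, S : H^{1/2}(∂Ω) → H^{-1/2}(∂Ω)`, where `T*` is determined by
`⟨f, T g⟩_{1/2} = conj ⟨g, T* f⟩_{1/2}` (using the reflexivity of `H^{1/2}(∂Ω)`). -/
def IsDualAdjoint {n : ℕ} {Ω : Set (E n)} (T S : H12 Ω → Hm12 Ω) : Prop :=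
  ∀ f g : H12 Ω, pairing f (T g) = conj (pairing g (S f))

end

end RobinMaps

namespace RobinMaps

noncomputable section

section

/-! ### Geometry of Lipschitz domains -/

/-! Once the boundary value problem has a solution operator, the identities are algebra. If `ν + Θ₁
γ u = g`, then `-(ν + Θ₂ γ u) = -g + (Θ₁ - Θ₂) γ u`, which is the formula for the Robin-to-Robin map
(`ConeData.robinToRobin_eq`). A solution of one Robin problem also solves the other, and the two
data determine each other through the two maps, so these are mutually inverse
(`ConeData.robinToRobin_comp`). The adjoint formula comes from testing the problem at `z` with a
solution at `conj z` and conversely (`ConeData.pairing_dirichletTrace_symm`).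

The solution operator comes from a form. The problem is equivalent to `⟨∇v, ∇u⟩ + ⟨γ v, Θ γ u⟩ = ⟨γ
v, g⟩ + z ⟨v, u⟩` for all `v` in `H¹(Ω)` (`ConeData.robinWeakEq_iff`). A trace inequality with an
arbitrarily small constant in front of the gradient absorbs the negative part of `Θ`, so the form is
coercive up to a multiple of the `L²` norm (`ConeData.isFormCoercive`). Lax-Milgram inverts the
shifted form, and the resolvent of the Robin Laplacian at `z` corrects the shift
(`IsFormResolvent.exists_solution`). Since the form is hermitian, the adjoint of a resolvent at `z`
is a resolvent at `conj z` (`IsFormResolvent.adjoint`).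

The analytic work is the construction of the traces. Every boundary estimate passes through one
quantity, the cone energy: the integral of `|u(y + w) - g(y)|² |w|^(-n-1)` over boundary points `y`
and vectors `w` of an interior cone. For smooth `u` and `g = u` it is at most a multiple of the
Dirichlet integral (`ConeData.coneEnergy_le`). Together with the `L²` norm of `u` it dominates the
`H^{1/2}` norm of `g` (`ConeData.exists_H12_bound`). If it is finite and `u` has limits in the
cones, then `g` is that limit (`ConeData.toL2Bdry_ae_eq`). With the density of smooth functions this
yields the Dirichlet trace and its uniqueness.

The trace is onto: averaging `f` over the boundary with the kernel `|x - y|^(-2n)` extends it to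
`Ω`, the gradient of the extension is controlled by the Gagliardo seminorm, and its cone limits are
`f` almost everywhere (`ConeData.surjective_dirichletTrace`). For `g = 0` the cone energy dominates
the integral of `|u|² / dist²` near the boundary, so cutting off shows that the kernel of the trace
lies in the closure of the test functions (`ConeData.mem_closure_test_of_dirichletTrace_eq_zero`).
Green's identity therefore holds on this kernel, and the functional that defines the Neumann trace
descends through the surjection `γ_D` to `H^{-1/2}(∂Ω)` (`ConeData.existsUnique_neumannTrace`). -/

theorem euclideanHausdorffMeasure_image_le {X Y : Type*} [MetricSpace X] [MetricSpace Y]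
    [MeasurableSpace X] [BorelSpace X] [MeasurableSpace Y] [BorelSpace Y]
    {K : NNReal} {f : X → Y} {s : Set X} (h : LipschitzOnWith K f s) (d : ℕ) :
    (Measure.euclideanHausdorffMeasure d : Measure Y) (f '' s) ≤
      (K : ENNReal) ^ d * (Measure.euclideanHausdorffMeasure d : Measure X) s := by
  simp only [Measure.euclideanHausdorffMeasure_def, Measure.smul_apply]
  have := h.hausdorffMeasure_image_le (d := d) (by positivity)
  rw [ENNReal.smul_def, ENNReal.smul_def, smul_eq_mul, smul_eq_mul, mul_left_comm]
  gcongr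
  simpa using this

/-- The open cone with axis `e` and aperture `κ`. -/
def cone {n : ℕ} (κ : ℝ) (e : E n) : Set (E n) := {w | ‖w - ‖w‖ • e‖ < κ * ‖w‖}

theorem isOpen_cone {n : ℕ} (κ : ℝ) (e : E n) : IsOpen (cone κ e) :=
  isOpen_lt (by fun_prop) (by fun_prop)

/-- The inequality that defines the cone is strict, so the vertex is excluded. -/
theorem norm_pos_of_mem_cone {n : ℕ} {κ : ℝ} {e w : E n} (h : w ∈ cone κ e) : 0 < ‖w‖ := by
  rcases (norm_nonneg w).eq_or_lt with h0 | h0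
  · have h' : ‖w - ‖w‖ • e‖ < κ * ‖w‖ := h
    rw [← h0] at h'
    simp only [mul_zero] at h'
    exact absurd h' (not_lt.2 (norm_nonneg _))
  · exact h0

theorem smul_mem_cone {n : ℕ} {κ : ℝ} {e w : E n} (h : w ∈ cone κ e) {t : ℝ} (ht : 0 < t) :
    t • w ∈ cone κ e := by
  change ‖t • w - ‖t • w‖ • e‖ < κ * ‖t • w‖
  have h' : ‖w - ‖w‖ • e‖ < κ * ‖w‖ := h
  rw [norm_smul, Real.norm_of_nonneg ht.le, mul_smul, ← smul_sub, norm_smul,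
    Real.norm_of_nonneg ht.le]
  nlinarith

/-- The norm of `t • e + v` differs from `t` by at most `‖v‖`, so the deviation from the axis is at
most `2‖v‖ ≤ κt/2`, which is less than `κ(t - ‖v‖)`. This is how balls are placed inside cones
below. -/
theorem smul_add_mem_cone {n : ℕ} {κ : ℝ} {e v : E n} (hκ : κ ≤ 1) (he : ‖e‖ = 1)
    {t : ℝ} (ht : 0 < t) (hv : ‖v‖ ≤ κ / 4 * t) (hκ0 : 0 < κ) : t • e + v ∈ cone κ e := by
  change ‖t • e + v - ‖t • e + v‖ • e‖ < κ * ‖t • e + v‖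
  have h1 : ‖t • e‖ = t := by rw [norm_smul, he, mul_one, Real.norm_of_nonneg ht.le]
  have h2 : |‖t • e + v‖ - t| ≤ ‖v‖ := by
    have := abs_norm_sub_norm_le (t • e + v) (t • e)
    rwa [h1, add_sub_cancel_left] at this
  have h3 : t • e + v - ‖t • e + v‖ • e = v - (‖t • e + v‖ - t) • e := by
    rw [sub_smul]; abel
  have h4 : ‖t • e + v - ‖t • e + v‖ • e‖ ≤ ‖v‖ + ‖v‖ := by
    rw [h3]
    refine (norm_sub_le _ _).trans ?_
    rw [norm_smul, he, mul_one, Real.norm_eq_abs]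
    gcongr
  have h5 := (abs_le.1 h2).1
  have h6 : κ * (t - ‖v‖) ≤ κ * ‖t • e + v‖ := by gcongr; linarith
  have h7 : κ * ‖v‖ ≤ 1 * ‖v‖ := by gcongr
  have h8 : 0 < κ * t := by positivity
  linarith

/-- Quantitative data of a bounded Lipschitz domain: the uniform cone property and the Ahlfors
regularity of the surface measure. -/
structure ConeData {n : ℕ} (Ω : Set (E n)) where
  N : ℕ
  O : Fin N → Set (E n)
  e : Fin N → E n
  κ : ℝ
  r : ℝ
  C : ℝ
  c : ℝ
  κ_pos : 0 < κ
  κ_le : κ ≤ 1 / 4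
  r_pos : 0 < r
  one_le_C : 1 ≤ C
  c_pos : 0 < c
  isOpen_O : ∀ j, IsOpen (O j)
  norm_e : ∀ j, ‖e j‖ = 1
  cover : ∀ y ∈ frontier Ω, ∃ j, Metric.ball y r ⊆ O j
  cone_subset : ∀ j, ∀ x ∈ closure Ω, ∀ ρ, Metric.ball x ρ ⊆ O j → ∀ w ∈ cone κ (e j),
    2 * ‖w‖ < ρ → Metric.ball (x + w) (κ * ‖w‖) ⊆ Ω
  vertical : ∀ x ∈ Ω, C * Metric.infDist x Ωᶜ < r → ∃ j, ∃ t, x - t • e j ∈ frontier Ω ∧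
    Metric.infDist x Ωᶜ ≤ t ∧ t ≤ C * Metric.infDist x Ωᶜ ∧ Metric.ball (x - t • e j) r ⊆ O j
  upper : ∀ x ρ, 0 < ρ → surfaceMeasure Ω (Metric.ball x ρ) ≤ ENNReal.ofReal (C * ρ ^ (n - 1))
  lower : ∀ y ∈ frontier Ω, ∀ ρ, 0 < ρ → ρ ≤ r →
    ENNReal.ofReal (c * ρ ^ (n - 1)) ≤ surfaceMeasure Ω (Metric.ball y ρ)

/-! ### Estimates in a single chart, above the graph of a Lipschitz function. -/

section chart

variable {n : ℕ} {Ω O : Set (E n)} {T : E n ≃ᵃⁱ[ℝ] WithLp 2 (E (n - 1) × ℝ)}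
  {h : E (n - 1) → ℝ} {K : NNReal}

/-- The vertical direction of a chart. -/
def chartAxis (T : E n ≃ᵃⁱ[ℝ] WithLp 2 (E (n - 1) × ℝ)) : E n :=
  T.linearIsometryEquiv.symm (WithLp.toLp 2 (0, 1))

theorem norm_chartAxis : ‖chartAxis T‖ = 1 := by
  rw [chartAxis, LinearIsometryEquiv.norm_map, WithLp.prod_norm_eq_of_L2]
  simp

theorem chart_add (x w : E n) : T (x + w) = T x + T.linearIsometryEquiv w := by
  have := T.map_vadd x w
  rw [vadd_eq_add, vadd_eq_add] at this
  rw [add_comm, this, add_comm]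

theorem chart_add_smul_axis_fst (x : E n) (t : ℝ) :
    (T (x + t • chartAxis T)).fst = (T x).fst := by
  rw [chart_add, map_smul, chartAxis, LinearIsometryEquiv.apply_symm_apply]
  simp

theorem chart_add_smul_axis_snd (x : E n) (t : ℝ) :
    (T (x + t • chartAxis T)).snd = (T x).snd + t := by
  rw [chart_add, map_smul, chartAxis, LinearIsometryEquiv.apply_symm_apply]
  simp

theorem norm_fst_le_norm (p : WithLp 2 (E (n - 1) × ℝ)) : ‖p.fst‖ ≤ ‖p‖ := by
  rw [WithLp.prod_norm_eq_of_L2]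
  exact Real.le_sqrt_of_sq_le (by nlinarith [sq_nonneg ‖p.snd‖])

theorem abs_snd_le_norm (p : WithLp 2 (E (n - 1) × ℝ)) : |p.snd| ≤ ‖p‖ := by
  rw [WithLp.prod_norm_eq_of_L2, ← Real.norm_eq_abs]
  exact Real.le_sqrt_of_sq_le (by nlinarith [sq_nonneg ‖p.fst‖])

theorem dist_chart_fst_le (x y : E n) : ‖(T x).fst - (T y).fst‖ ≤ dist x y := by
  rw [← T.dist_map, dist_eq_norm]
  exact norm_fst_le_norm (T x - T y)

theorem dist_chart_snd_le (x y : E n) : |(T x).snd - (T y).snd| ≤ dist x y := by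
  rw [← T.dist_map, dist_eq_norm]
  exact abs_snd_le_norm (T x - T y)

theorem lipschitz_le (hK : LipschitzWith K h) (p q : E (n - 1)) : |h p - h q| ≤ K * ‖p - q‖ := by
  have := hK.dist_le_mul p q
  rwa [Real.dist_eq, dist_eq_norm] at this

theorem chart_mem_iff (hΩ : O ∩ Ω = O ∩ {x | h (T x).fst < (T x).snd}) {x : E n} (hx : x ∈ O) :
    x ∈ Ω ↔ h (T x).fst < (T x).snd := by
  have := Set.ext_iff.1 hΩ x
  simpa [hx] using this

theorem chart_le_of_mem_closure (hK : LipschitzWith K h)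
    (hΩ : O ∩ Ω = O ∩ {x | h (T x).fst < (T x).snd}) (hO : IsOpen O) {x : E n} (hx : x ∈ O)
    (hxc : x ∈ closure Ω) : h (T x).fst ≤ (T x).snd := by
  have h1 : x ∈ closure (O ∩ Ω) := hO.inter_closure ⟨hx, hxc⟩
  have hcl : IsClosed {x | h (T x).fst ≤ (T x).snd} := by
    have hTc : Continuous T := T.continuous
    have hc := hK.continuous
    refine isClosed_le ?_ ?_
    · exact hc.comp ((WithLp.prod_continuous_ofLp 2 _ _).fst.comp hTc)
    · exact (WithLp.prod_continuous_ofLp 2 _ _).snd.comp hTc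
  refine closure_minimal ?_ hcl h1
  rw [hΩ]
  exact fun y hy => (show h (T y).fst < (T y).snd from hy.2).le

theorem chart_mem_frontier_iff (hK : LipschitzWith K h)
    (hΩ : O ∩ Ω = O ∩ {x | h (T x).fst < (T x).snd}) (hO : IsOpen O) (hΩo : IsOpen Ω) {x : E n}
    (hx : x ∈ O) : x ∈ frontier Ω ↔ h (T x).fst = (T x).snd := by
  rw [hΩo.frontier_eq]
  constructor
  · rintro ⟨h1, h2⟩
    refine le_antisymm (chart_le_of_mem_closure hK hΩ hO hx h1) ?_
    rw [chart_mem_iff hΩ hx] at h2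
    exact not_lt.1 h2
  · intro he
    refine ⟨?_, ?_⟩
    · rw [Metric.mem_closure_iff]
      intro ε hε
      obtain ⟨δ, hδ, hb⟩ := Metric.isOpen_iff.1 hO x hx
      have hm : 0 < min ε δ / 2 := by positivity
      have hd : dist (x + (min ε δ / 2) • chartAxis T) x = min ε δ / 2 := by
        rw [dist_eq_norm, add_sub_cancel_left, norm_smul, norm_chartAxis, mul_one,
          Real.norm_of_nonneg hm.le]
      refine ⟨x + (min ε δ / 2) • chartAxis T, ?_, ?_⟩
      · rw [chart_mem_iff hΩ, chart_add_smul_axis_fst, chart_add_smul_axis_snd, he]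
        · linarith
        · apply hb
          rw [Metric.mem_ball, hd]
          have := min_le_right ε δ
          have := lt_min hε hδ
          linarith
      · rw [dist_comm, hd]
        have := min_le_left ε δ
        linarith
    · rw [chart_mem_iff hΩ hx, he]
      exact lt_irrefl _

/-- A displacement within `2κ‖w‖` of `‖w‖ • axis` rises by more than `(1 - 2κ)‖w‖`, while its
horizontal part is shorter than `2κ‖w‖`, so that the graph rises by at most `2κK‖w‖`. The condition
`2κ(1 + K) < 1` keeps the end point above the graph, even when the starting point lies on it. -/
theorem chart_cone_subset (hK : LipschitzWith K h)
    (hΩ : O ∩ Ω = O ∩ {x | h (T x).fst < (T x).snd}) (hO : IsOpen O) {κ : ℝ} (hκ0 : 0 < κ)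
    (hκ : 2 * κ * (1 + K) < 1) {x : E n} (hx : x ∈ closure Ω) {ρ : ℝ}
    (hρ : Metric.ball x ρ ⊆ O) {w : E n} (hw : w ∈ cone κ (chartAxis T)) (hwρ : 2 * ‖w‖ < ρ) :
    Metric.ball (x + w) (κ * ‖w‖) ⊆ Ω := by
  intro z hz
  have hw0 := norm_pos_of_mem_cone hw
  obtain ⟨v, rfl⟩ : ∃ v, z = x + v := ⟨z - x, by abel⟩
  rw [Metric.mem_ball, dist_eq_norm, add_sub_add_left_eq_sub] at hz
  have hw' : ‖w - ‖w‖ • chartAxis T‖ < κ * ‖w‖ := hw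
  set L := T.linearIsometryEquiv with hL
  have hκ1 : κ < 1 / 2 := by nlinarith [K.2]
  have hv : ‖v - ‖w‖ • chartAxis T‖ < 2 * κ * ‖w‖ := by
    have : v - ‖w‖ • chartAxis T = (v - w) + (w - ‖w‖ • chartAxis T) := by abel
    rw [this]
    have := norm_add_le (v - w) (w - ‖w‖ • chartAxis T)
    linarith
  have hLv : L (v - ‖w‖ • chartAxis T) = L v - ‖w‖ • WithLp.toLp 2 (0, 1) := by
    rw [map_sub, map_smul, chartAxis, LinearIsometryEquiv.apply_symm_apply]
  have h1 : ‖(L v).fst‖ < 2 * κ * ‖w‖ := by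
    refine lt_of_le_of_lt ?_ hv
    rw [← L.norm_map (v - ‖w‖ • chartAxis T), hLv]
    refine le_trans (le_of_eq ?_) (norm_fst_le_norm _)
    simp
  have h2 : |(L v).snd - ‖w‖| < 2 * κ * ‖w‖ := by
    refine lt_of_le_of_lt ?_ hv
    rw [← L.norm_map (v - ‖w‖ • chartAxis T), hLv]
    refine le_trans (le_of_eq ?_) (abs_snd_le_norm _)
    simp
  have hxO : x ∈ O := hρ (Metric.mem_ball_self (by linarith))
  have hzO : x + v ∈ O := by
    apply hρ
    rw [Metric.mem_ball, dist_eq_norm, add_sub_cancel_left]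
    have : v = (v - w) + w := by abel
    rw [this]
    have := norm_add_le (v - w) w
    nlinarith
  rw [chart_mem_iff hΩ hzO, chart_add]
  have h3 := chart_le_of_mem_closure hK hΩ hO hxO hx
  have h4 := lipschitz_le hK ((T x).fst + (L v).fst) (T x).fst
  rw [add_sub_cancel_left] at h4
  have h5 := (abs_le.1 h4).2
  have h6 := (abs_lt.1 h2).1
  have h7 : (K : ℝ) * ‖(L v).fst‖ ≤ K * (2 * κ * ‖w‖) := by gcongr
  simp only [WithLp.add_fst, WithLp.add_snd]
  nlinarith

/-- The height over the graph is a `(1 + K)`-Lipschitz function that vanishes at the boundary point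
`y`, so it is at most `(1 + K) * dist x y` at `x`. Descending by this height reaches the boundary
without leaving the chart. -/
theorem chart_vertical (hK : LipschitzWith K h)
    (hΩ : O ∩ Ω = O ∩ {x | h (T x).fst < (T x).snd}) (hO : IsOpen O) (hΩo : IsOpen Ω) {x y : E n}
    (hx : x ∈ Ω) (hy : y ∈ frontier Ω) {r : ℝ} (hyO : Metric.ball y (2 * r) ⊆ O)
    (hr : (2 + K) * dist x y < r) :
    ∃ t, x - t • chartAxis T ∈ frontier Ω ∧ t ≤ (1 + K) * dist x y ∧ 0 < t ∧
      Metric.ball (x - t • chartAxis T) r ⊆ O := by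
  have hd := dist_nonneg (x := x) (y := y)
  have hr0 : 0 < r := lt_of_le_of_lt (by positivity) hr
  have hK0 : (0 : ℝ) ≤ K := K.2
  have hxO : x ∈ O := hyO (by rw [Metric.mem_ball]; nlinarith)
  have hyO' : y ∈ O := hyO (Metric.mem_ball_self (by linarith))
  set t := (T x).snd - h (T x).fst with ht
  have ht0 : 0 < t := by
    have := (chart_mem_iff hΩ hxO).1 hx
    linarith
  have hyh := (chart_mem_frontier_iff hK hΩ hO hΩo hyO').1 hy
  have ht1 : t ≤ (1 + K) * dist x y := by
    have h1 := lipschitz_le hK (T x).fst (T y).fst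
    have h2 := dist_chart_fst_le (T := T) x y
    have h3 := dist_chart_snd_le (T := T) x y
    have h4 : (K : ℝ) * ‖(T x).fst - (T y).fst‖ ≤ K * dist x y := by gcongr
    have h5 := (abs_le.1 h1).1
    have h6 := (abs_le.1 h3).2
    linarith
  have hb : Metric.ball (x - t • chartAxis T) r ⊆ O := by
    refine subset_trans (Metric.ball_subset_ball' ?_) hyO
    have : dist (x - t • chartAxis T) y ≤ t + dist x y := by
      refine (dist_triangle _ x _).trans ?_
      gcongr
      rw [dist_eq_norm, sub_sub_cancel_left, norm_neg, norm_smul, norm_chartAxis, mul_one,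
        Real.norm_of_nonneg ht0.le]
    linarith
  refine ⟨t, ?_, ht1, ht0, hb⟩
  rw [chart_mem_frontier_iff hK hΩ hO hΩo (hb (Metric.mem_ball_self hr0)), sub_eq_add_neg,
    ← neg_smul, chart_add_smul_axis_fst, chart_add_smul_axis_snd]
  rw [ht]; ring

/-- The parametrization of the boundary by the graph. -/
def graphMap (T : E n ≃ᵃⁱ[ℝ] WithLp 2 (E (n - 1) × ℝ)) (h : E (n - 1) → ℝ) (p : E (n - 1)) : E n :=
  T.symm (WithLp.toLp 2 (p, h p))

theorem chart_graphMap (p : E (n - 1)) : T (graphMap T h p) = WithLp.toLp 2 (p, h p) := by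
  rw [graphMap, AffineIsometryEquiv.apply_symm_apply]

theorem graphMap_lipschitz (hK : LipschitzWith K h) : LipschitzWith (1 + K) (graphMap T h) := by
  refine LipschitzWith.of_dist_le_mul fun p q => ?_
  rw [← T.dist_map, chart_graphMap, chart_graphMap, dist_eq_norm, WithLp.prod_norm_eq_of_L2]
  have h1 := lipschitz_le hK p q
  rw [dist_eq_norm]
  refine Real.sqrt_le_iff.2 ⟨by positivity, ?_⟩
  have h2 : ‖h p - h q‖ ^ 2 ≤ (K * ‖p - q‖) ^ 2 := by
    rw [Real.norm_eq_abs]; gcongr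
  have hK0 : (0 : ℝ) ≤ K := K.2
  change ‖p - q‖ ^ 2 + ‖h p - h q‖ ^ 2 ≤ ((1 + K) * ‖p - q‖) ^ 2
  nlinarith [mul_nonneg hK0 (sq_nonneg ‖p - q‖)]

/-- The boundary inside the ball is contained in the image of a ball of `ℝⁿ⁻¹` under the Lipschitz
graph map. -/
theorem chart_upper (hK : LipschitzWith K h)
    (hΩ : O ∩ Ω = O ∩ {x | h (T x).fst < (T x).snd}) (hO : IsOpen O) (hΩo : IsOpen Ω) {y : E n}
    {ρ : ℝ} (hρ : 0 < ρ) (hy : Metric.ball y ρ ⊆ O) :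
    surfaceMeasure Ω (Metric.ball y ρ) ≤ ((1 + K : NNReal) : ENNReal) ^ (n - 1) *
      (ENNReal.ofReal (ρ ^ (n - 1)) * volume (Metric.ball (0 : E (n - 1)) 1)) := by
  rw [surfaceMeasure, Measure.restrict_apply Metric.isOpen_ball.measurableSet]
  have hsub : Metric.ball y ρ ∩ frontier Ω ⊆ graphMap T h '' (Metric.ball (T y).fst ρ) := by
    rintro x ⟨hx, hxf⟩
    refine ⟨(T x).fst, ?_, ?_⟩
    · rw [Metric.mem_ball, dist_eq_norm]
      exact (dist_chart_fst_le x y).trans_lt hx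
    · apply T.injective
      rw [chart_graphMap, (chart_mem_frontier_iff hK hΩ hO hΩo (hy hx)).1 hxf]
      rfl
  refine (measure_mono hsub).trans ?_
  refine (euclideanHausdorffMeasure_image_le
    ((graphMap_lipschitz hK).lipschitzOnWith) (n - 1)).trans ?_
  rw [EuclideanSpace.euclideanHausdorffMeasure_eq_volume, Measure.addHaar_ball_of_pos _ _ hρ,
    finrank_euclideanSpace_fin]

/-- The horizontal projection is 1-Lipschitz, and the part of the graph inside the ball projects
onto a set that contains a ball of radius `ρ / (1 + K)`. -/
theorem chart_lower (hK : LipschitzWith K h)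
    (hΩ : O ∩ Ω = O ∩ {x | h (T x).fst < (T x).snd}) (hO : IsOpen O) (hΩo : IsOpen Ω) {y : E n}
    (hyf : y ∈ frontier Ω) {ρ : ℝ} (hρ : 0 < ρ) (hy : Metric.ball y ρ ⊆ O) :
    ENNReal.ofReal ((ρ / (1 + K)) ^ (n - 1)) * volume (Metric.ball (0 : E (n - 1)) 1) ≤
      surfaceMeasure Ω (Metric.ball y ρ) := by
  rw [surfaceMeasure, Measure.restrict_apply Metric.isOpen_ball.measurableSet]
  have hK0 : (0 : ℝ) ≤ K := K.2
  have hρ' : 0 < ρ / (1 + K) := by positivity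
  have hyh := (chart_mem_frontier_iff hK hΩ hO hΩo (hy (Metric.mem_ball_self hρ))).1 hyf
  have hyg : y = graphMap T h (T y).fst := by
    apply T.injective
    rw [chart_graphMap, hyh]; rfl
  have hsub : Metric.ball (T y).fst (ρ / (1 + K)) ⊆
      (fun x => (T x).fst) '' (Metric.ball y ρ ∩ frontier Ω) := by
    intro p hp
    have hpb : graphMap T h p ∈ Metric.ball y ρ := by
      rw [hyg, Metric.mem_ball]
      refine ((graphMap_lipschitz hK).dist_le_mul _ _).trans_lt ?_
      rw [Metric.mem_ball, lt_div_iff₀ (by positivity)] at hp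
      simpa [mul_comm] using hp
    refine ⟨graphMap T h p, ⟨hpb, ?_⟩, ?_⟩
    · simp [chart_mem_frontier_iff hK hΩ hO hΩo (hy hpb), chart_graphMap]
    · simp [chart_graphMap]
  have hlip : LipschitzWith 1 (fun x => (T x).fst) :=
    LipschitzWith.of_dist_le_mul fun x y => by
      rw [dist_eq_norm, NNReal.coe_one, one_mul]; exact dist_chart_fst_le x y
  have h1 := (measure_mono hsub).trans (euclideanHausdorffMeasure_image_le
    (hlip.lipschitzOnWith (s := Metric.ball y ρ ∩ frontier Ω)) (n - 1))
  rw [EuclideanSpace.euclideanHausdorffMeasure_eq_volume, Measure.addHaar_ball_of_pos _ _ hρ',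
    finrank_euclideanSpace_fin] at h1
  simpa using h1

end chart

/-- A bounded Lipschitz domain has the uniform cone property and an Ahlfors regular boundary. -/
theorem IsBoundedLipschitzDomain.exists_coneData {n : ℕ} (hn : 1 ≤ n) {Ω : Set (E n)}
    (hΩ : IsBoundedLipschitzDomain Ω) : Nonempty (ConeData Ω) := by
  obtain ⟨N, O, T, h, hO, hcov, hlip, hchart⟩ := hΩ.lipschitz
  choose K hK using hlip
  have hfc : IsCompact (frontier Ω) :=
    hΩ.isBounded.isCompact_closure.of_isClosed_subset isClosed_frontier frontier_subset_closure
  obtain ⟨δ, hδ, hδO⟩ := lebesgue_number_lemma_of_metric hfc hO hcov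
  -- The sum serves as a common Lipschitz constant of all charts.
  set M : NNReal := ∑ j, K j with hM
  have hKM : ∀ j, K j ≤ M := fun j =>
    Finset.single_le_sum (f := K) (fun _ _ => zero_le) (Finset.mem_univ j)
  have hKM' : ∀ j, (K j : ℝ) ≤ M := fun j => by exact_mod_cast hKM j
  have hM0 : (0 : ℝ) ≤ M := M.2
  have hKL : ∀ j, LipschitzWith M (h j) := fun j => (hK j).weaken (hKM j)
  set V := (volume (Metric.ball (0 : E (n - 1)) 1)) with hV
  have hVt : V ≠ ⊤ := measure_ball_lt_top.ne
  have hV0 : 0 < V.toReal := ENNReal.toReal_pos (Metric.measure_ball_pos _ _ one_pos).ne' hVt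
  have hVr : V = ENNReal.ofReal V.toReal := (ENNReal.ofReal_toReal hVt).symm
  set A : ℝ := (1 + M) ^ (n - 1) * V.toReal with hA
  have hA0 : 0 ≤ A := by positivity
  have hup : ∀ y ∈ frontier Ω, ∀ ρ, 0 < ρ → ρ ≤ δ →
      surfaceMeasure Ω (Metric.ball y ρ) ≤ ENNReal.ofReal (A * ρ ^ (n - 1)) := by
    intro y hy ρ hρ hρδ
    obtain ⟨j, hj⟩ := hδO y hy
    refine (chart_upper (hKL j) (hchart j) (hO j) hΩ.isOpen hρ
      ((Metric.ball_subset_ball hρδ).trans hj)).trans (le_of_eq ?_)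
    rw [← hV, hVr, ← ENNReal.ofReal_coe_nnreal, ← ENNReal.ofReal_pow (by positivity),
      ← ENNReal.ofReal_mul (by positivity), ← ENNReal.ofReal_mul (by positivity)]
    congr 1
    rw [hA]; push_cast; ring
  have hfin : surfaceMeasure Ω Set.univ ≠ ⊤ := by
    rw [surfaceMeasure, Measure.restrict_apply_univ]
    obtain ⟨t, ht, htc⟩ := hfc.elim_nhds_subcover (fun y => Metric.ball y δ)
      (fun y _ => Metric.ball_mem_nhds y hδ)
    have h1 : frontier Ω ⊆ ⋃ y ∈ t, (Metric.ball y δ ∩ frontier Ω) := by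
      intro y hy
      have := htc hy
      simp only [Set.mem_iUnion] at this ⊢
      obtain ⟨i, hi, hyi⟩ := this
      exact ⟨i, hi, hyi, hy⟩
    refine ne_top_of_le_ne_top ?_ ((measure_mono h1).trans (measure_biUnion_finset_le _ _))
    refine ENNReal.sum_ne_top.2 fun y hy => ?_
    have := hup y (ht y hy) δ hδ le_rfl
    rw [surfaceMeasure, Measure.restrict_apply Metric.isOpen_ball.measurableSet] at this
    exact ne_top_of_le_ne_top ENNReal.ofReal_ne_top this
  set B := (surfaceMeasure Ω Set.univ).toReal with hB
  have hB0 : 0 ≤ B := ENNReal.toReal_nonneg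
  -- One summand for each demand: `1 + M` for the vertical distance, `A * 2 ^ (n - 1)` for small
  -- balls not centred on the boundary, and the last term for balls of radius at least `δ / 2`.
  set C : ℝ := 1 + M + A * 2 ^ (n - 1) + B / (δ / 2) ^ (n - 1) with hC
  have hC1 : 1 + (M : ℝ) ≤ C := by
    have : 0 ≤ A * 2 ^ (n - 1) := by positivity
    have : 0 ≤ B / (δ / 2) ^ (n - 1) := by positivity
    linarith
  have hlow : ∀ y ∈ frontier Ω, ∀ ρ, 0 < ρ → ρ ≤ δ →
      ENNReal.ofReal (V.toReal / (1 + M) ^ (n - 1) * ρ ^ (n - 1)) ≤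
        surfaceMeasure Ω (Metric.ball y ρ) := by
    intro y hy ρ hρ hρδ
    obtain ⟨j, hj⟩ := hδO y hy
    refine le_trans (le_of_eq ?_) (chart_lower (hKL j) (hchart j) (hO j) hΩ.isOpen hy hρ
      ((Metric.ball_subset_ball hρδ).trans hj))
    rw [← hV, hVr, ← ENNReal.ofReal_mul (by positivity), ENNReal.toReal_ofReal hV0.le, div_pow]
    congr 1
    ring
  -- The aperture makes `2κ(1 + M) = 1/2`. The radius `r` is such that `C * d < r` implies `(2 + M)
  -- * d < δ / 2`, as `chart_vertical` demands with radius `δ / 2`.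
  refine ⟨⟨N, O, fun j => chartAxis (T j), 1 / (4 * (1 + M)), δ / (4 * (2 + M)), C,
    V.toReal / (1 + M) ^ (n - 1), by positivity, ?_, by positivity, by linarith, by positivity, hO,
    fun j => norm_chartAxis, ?_, ?_, ?_, ?_, ?_⟩⟩
  · rw [div_le_div_iff₀ (by positivity) (by norm_num)]; linarith
  · intro y hy
    obtain ⟨j, hj⟩ := hδO y hy
    refine ⟨j, (Metric.ball_subset_ball ?_).trans hj⟩
    exact div_le_self hδ.le (by linarith)
  · intro j x hx ρ hρ w hw hwρ
    refine chart_cone_subset (hKL j) (hchart j) (hO j) (by positivity) ?_ hx hρ hw hwρ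
    have : (1 + (M : ℝ)) ≠ 0 := by positivity
    have : 2 * (1 / (4 * (1 + (M : ℝ)))) * (1 + M) = 1 / 2 := by field_simp; norm_num
    linarith
  · intro x hx hxr
    have hne : (Ωᶜ).Nonempty := by
      rw [Set.nonempty_compl]
      rintro rfl
      have : Nonempty (Fin n) := ⟨⟨0, hn⟩⟩
      have : Nontrivial (E n) := inferInstance
      exact NormedSpace.unbounded_univ ℝ (E n) hΩ.isBounded
    obtain ⟨y, hyc, hyd⟩ := hΩ.isOpen.isClosed_compl.exists_infDist_eq_dist hne x
    have hd0 : 0 < Metric.infDist x Ωᶜ :=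
      (hΩ.isOpen.isClosed_compl.notMem_iff_infDist_pos hne).1 (by simpa using hx)
    have hyf : y ∈ frontier Ω := by
      rw [hΩ.isOpen.frontier_eq]
      refine ⟨?_, hyc⟩
      have h1 : closure (Metric.ball x (Metric.infDist x Ωᶜ)) ⊆ closure Ω :=
        closure_mono Metric.ball_infDist_compl_subset
      rw [closure_ball _ hd0.ne'] at h1
      apply h1
      rw [Metric.mem_closedBall, dist_comm, hyd]
    obtain ⟨j, hj⟩ := hδO y hyf
    have hr2 : 2 * (δ / (4 * (2 + M))) ≤ δ := by
      rw [mul_div_assoc', div_le_iff₀ (by positivity)]; nlinarith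
    have hd2 : (2 + M) * dist x y < δ / 2 := by
      rw [← hyd]
      rw [lt_div_iff₀ (by positivity)] at hxr
      have : Metric.infDist x Ωᶜ ≤ C * Metric.infDist x Ωᶜ :=
        le_mul_of_one_le_left hd0.le (by linarith)
      nlinarith
    obtain ⟨t, ht1, ht2, ht3, ht4⟩ := chart_vertical (hKL j) (hchart j) (hO j) hΩ.isOpen hx hyf
      (r := δ / 2) (by rwa [mul_div_cancel₀ _ (two_ne_zero)]) hd2
    refine ⟨j, t, ht1, ?_, ?_, (Metric.ball_subset_ball (by linarith)).trans ht4⟩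
    · have hmem : x - t • chartAxis (T j) ∈ Ωᶜ := by
        rw [hΩ.isOpen.frontier_eq] at ht1; exact ht1.2
      refine (Metric.infDist_le_dist_of_mem hmem).trans (le_of_eq ?_)
      rw [dist_eq_norm, sub_sub_cancel, norm_smul, norm_chartAxis, mul_one,
        Real.norm_of_nonneg ht3.le]
    · rw [← hyd] at ht2
      refine ht2.trans ?_
      gcongr
  · intro x ρ hρ
    -- Large balls are estimated by the total mass. A small ball that meets the boundary is
    -- recentred there at the price of doubling its radius.
    rcases le_or_gt (δ / 2) ρ with h1 | h1
    · refine (measure_mono (Set.subset_univ _)).trans ?_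
      rw [← ENNReal.ofReal_toReal hfin, ← hB]
      apply ENNReal.ofReal_le_ofReal
      have h2 : B / (δ / 2) ^ (n - 1) ≤ C := by
        have : 0 ≤ A * 2 ^ (n - 1) := by positivity
        linarith
      have h3 : (δ / 2) ^ (n - 1) ≤ ρ ^ (n - 1) := by gcongr
      calc B = B / (δ / 2) ^ (n - 1) * (δ / 2) ^ (n - 1) := by field_simp
        _ ≤ C * ρ ^ (n - 1) := by gcongr
    · by_cases hempty : (Metric.ball x ρ ∩ frontier Ω).Nonempty
      · obtain ⟨y, hyb, hyf⟩ := hempty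
        have hsub : Metric.ball x ρ ⊆ Metric.ball y (2 * ρ) := by
          apply Metric.ball_subset_ball'
          rw [dist_comm]
          rw [Metric.mem_ball] at hyb
          linarith
        refine (measure_mono hsub).trans ((hup y hyf (2 * ρ) (by linarith) (by linarith)).trans ?_)
        apply ENNReal.ofReal_le_ofReal
        have h2 : A * 2 ^ (n - 1) ≤ C := by
          have : 0 ≤ B / (δ / 2) ^ (n - 1) := by positivity
          linarith
        rw [mul_pow, ← mul_assoc]
        gcongr
      · rw [surfaceMeasure, Measure.restrict_apply Metric.isOpen_ball.measurableSet,
          Set.not_nonempty_iff_eq_empty.1 hempty]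
        simp
  · intro y hy ρ hρ hρr
    exact hlow y hy ρ hρ (hρr.trans (div_le_self hδ.le (by linarith)))

end

section

/-! ### Square integrable functions -/

section L2

variable {α F : Type*} [MeasurableSpace α] {μ : Measure α} [NormedAddCommGroup F]

theorem eLpNorm_two_sq (f : α → F) : eLpNorm f 2 μ ^ 2 = ∫⁻ x, ‖f x‖ₑ ^ 2 ∂μ := by
  rw [eLpNorm_eq_lintegral_rpow_enorm_toReal (by norm_num) (by norm_num), ← ENNReal.rpow_natCast,
    ← ENNReal.rpow_mul]
  norm_num

theorem memLp_two_of_lintegral_lt_top {f : α → F} (hf : AEStronglyMeasurable f μ)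
    (h : ∫⁻ x, ‖f x‖ₑ ^ 2 ∂μ < ⊤) : MemLp f 2 μ := by
  refine ⟨hf, ?_⟩
  rw [← eLpNorm_two_sq] at h
  by_contra h'
  rw [not_lt, top_le_iff] at h'
  rw [h'] at h
  simp at h

theorem Lp.lintegral_enorm_sq (f : Lp F 2 μ) : ∫⁻ x, ‖f x‖ₑ ^ 2 ∂μ = ‖f‖ₑ ^ 2 := by
  rw [← eLpNorm_two_sq, Lp.enorm_def]

theorem Lp.enorm_sq_eq_of_ae_eq {f : Lp F 2 μ} {g : α → F} (h : f =ᵐ[μ] g) :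
    ‖f‖ₑ ^ 2 = ∫⁻ x, ‖g x‖ₑ ^ 2 ∂μ := by
  rw [← Lp.lintegral_enorm_sq]
  refine lintegral_congr_ae ?_
  filter_upwards [h] with x hx
  rw [hx]

theorem Lp.integral_mul_eq_inner (f : Lp ℂ 2 μ) {ψ : α → ℂ} (hψ : MemLp ψ 2 μ) :
    ∫ x, f x * ψ x ∂μ = inner ℂ (MemLp.toLp _ hψ.star) f := by
  rw [L2.inner_def]
  refine integral_congr_ae ?_
  filter_upwards [MemLp.coeFn_toLp hψ.star] with x hx
  rw [hx]
  simp [RCLike.inner_apply]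

end L2

/-! ### Weak gradients -/

variable {n : ℕ} {Ω : Set (E n)}

/-- The vector field `G` is the weak gradient of the function `u` on `Ω`. -/
def WeakGrad (Ω : Set (E n)) (u : E n → ℂ) (G : E n → EuclideanSpace ℂ (Fin n)) : Prop :=
  ∀ φ, IsTestFunction Ω φ → ∀ i : Fin n,
    ∫ x in Ω, u x * partialDeriv i φ x = -∫ x in Ω, G x i * φ x

theorem exists_H1 {u : E n → ℂ} {G : E n → EuclideanSpace ℂ (Fin n)}
    (hu : MemLp u 2 (volume.restrict Ω)) (hG : MemLp G 2 (volume.restrict Ω))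
    (h : WeakGrad Ω u G) :
    ∃ v : H1 Ω, toL2 v =ᵐ[volume.restrict Ω] u ∧ grad v =ᵐ[volume.restrict Ω] G := by
  refine ⟨⟨WithLp.toLp 2 (hu.toLp u, hG.toLp G), ?_⟩, hu.coeFn_toLp, hG.coeFn_toLp⟩
  intro φ hφ i
  have h1 : ∫ x in Ω, (hu.toLp u) x * partialDeriv i φ x = ∫ x in Ω, u x * partialDeriv i φ x := by
    refine integral_congr_ae ?_
    filter_upwards [hu.coeFn_toLp] with x hx
    rw [hx]
  have h2 : ∫ x in Ω, (hG.toLp G) x i * φ x = ∫ x in Ω, G x i * φ x := by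
    refine integral_congr_ae ?_
    filter_upwards [hG.coeFn_toLp] with x hx
    rw [hx]
  change ∫ x in Ω, (hu.toLp u) x * partialDeriv i φ x = -∫ x in Ω, (hG.toLp G) x i * φ x
  rw [h1, h2, h φ hφ i]

theorem H1.weakGrad (u : H1 Ω) : WeakGrad Ω (toL2 u) (grad u) := u.2

/-- To say that `f` is the weak Laplacian of zero is to say that it annihilates every test function,
so `HasWeakLaplacian.eq_zero` applies. -/
theorem ae_eq_zero_of_forall_test (hΩ : IsOpen Ω) {f : E n → ℂ}
    (hf : MemLp f 2 (volume.restrict Ω))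
    (h : ∀ φ, IsTestFunction Ω φ → ∫ x in Ω, f x * φ x = 0) : f =ᵐ[volume.restrict Ω] 0 := by
  have h0 : HasWeakLaplacian (0 : L2 Ω) (hf.toLp f) := by
    intro φ hφ
    rw [L2.integral_zero_mul]
    rw [← h φ hφ]
    refine integral_congr_ae ?_
    filter_upwards [hf.coeFn_toLp] with x hx
    rw [hx]
  have h1 := h0.eq_zero hΩ
  refine hf.coeFn_toLp.symm.trans ?_
  rw [h1]
  exact Lp.coeFn_zero _ _ _

theorem HasWeakGradient.eq_zero (hΩ : IsOpen Ω) {G : L2Vec Ω} (h : HasWeakGradient 0 G) :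
    G = 0 := by
  rw [Lp.eq_zero_iff_ae_eq_zero]
  have : ∀ i : Fin n, (fun x => G x i) =ᵐ[volume.restrict Ω] 0 := by
    intro i
    refine ae_eq_zero_of_forall_test hΩ ((Lp.memLp G).eval_piLp i) fun φ hφ => ?_
    have := h φ hφ i
    rw [L2.integral_zero_mul] at this
    exact neg_eq_zero.1 this.symm
  filter_upwards [ae_all_iff.2 this] with x hx
  ext i
  exact hx i

/-- The weak gradient is determined by the function, so the inclusion of `H¹(Ω)` into `L²(Ω)` is
injective. -/
theorem H1.eq_zero_of_toL2 (hΩ : IsOpen Ω) {u : H1 Ω} (h : toL2 u = 0) : u = 0 := by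
  have h1 : HasWeakGradient (toL2 u) (grad u) := u.2
  rw [h] at h1
  have h2 := h1.eq_zero hΩ
  apply Subtype.ext
  have h3 : u.1 = WithLp.toLp 2 (toL2 u, grad u) := rfl
  rw [h3, h, h2]
  rfl

theorem H1.ext_toL2 (hΩ : IsOpen Ω) {u v : H1 Ω} (h : toL2 u = toL2 v) : u = v := by
  rw [← sub_eq_zero]
  apply H1.eq_zero_of_toL2 hΩ
  change toL2 u - toL2 v = 0
  rw [h, sub_self]

theorem IsTestFunction.continuous_partialDeriv {φ : E n → ℂ} (hφ : IsTestFunction Ω φ)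
    (i : Fin n) : Continuous (partialDeriv i φ) :=
  (hφ.contDiff.continuous_fderiv (by simp)).clm_apply continuous_const

theorem IsTestFunction.hasCompactSupport_partialDeriv {φ : E n → ℂ} (hφ : IsTestFunction Ω φ)
    (i : Fin n) : HasCompactSupport (partialDeriv i φ) :=
  hφ.hasCompactSupport.fderiv_apply ℝ _

theorem tsupport_partialDeriv_subset (φ : E n → ℂ) (i : Fin n) :
    tsupport (partialDeriv i φ) ⊆ tsupport φ := by
  refine (closure_mono ?_).trans (tsupport_fderiv_subset ℝ (f := φ))
  intro x hx h0
  apply hx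
  simp only [partialDeriv]
  rw [h0]
  rfl

theorem IsTestFunction.partialDeriv {φ : E n → ℂ} (hφ : IsTestFunction Ω φ)
    (i : Fin n) : IsTestFunction Ω (partialDeriv i φ) where
  contDiff := by
    have h : ContDiff ℝ ∞ (fderiv ℝ φ) := hφ.contDiff.fderiv_right (by simp)
    exact h.clm_apply contDiff_const
  hasCompactSupport := hφ.hasCompactSupport_partialDeriv i
  tsupport_subset := (tsupport_partialDeriv_subset φ i).trans hφ.tsupport_subset

theorem IsTestFunction.memLp {φ : E n → ℂ} (hφ : IsTestFunction Ω φ) {μ : Measure (E n)}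
    [IsFiniteMeasureOnCompacts μ] : MemLp φ 2 μ :=
  hφ.contDiff.continuous.memLp_of_hasCompactSupport hφ.hasCompactSupport

theorem IsTestFunction.memLp_partialDeriv {φ : E n → ℂ} (hφ : IsTestFunction Ω φ) (i : Fin n)
    {μ : Measure (E n)} [IsFiniteMeasureOnCompacts μ] : MemLp (RobinMaps.partialDeriv i φ) 2 μ :=
  (hφ.continuous_partialDeriv i).memLp_of_hasCompactSupport (hφ.hasCompactSupport_partialDeriv i)

/-- The weak gradient of a function that is differentiable on `Ω` is its classical gradient. -/
theorem WeakGrad.of_differentiableAt {w : E n → ℂ}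
    {G : E n → EuclideanSpace ℂ (Fin n)} (hw : MemLp w 2 (volume.restrict Ω))
    (hG : MemLp G 2 (volume.restrict Ω)) (hd : ∀ x ∈ Ω, DifferentiableAt ℝ w x)
    (hGd : ∀ i, ∀ᵐ x ∂volume.restrict Ω, G x i = partialDeriv i w x) : WeakGrad Ω w G := by
  intro φ hφ i
  -- The integrals are moved to the whole space, where integration by parts asks for
  -- differentiability of `w` only on the support of `φ`.
  have hz : ∀ x ∉ Ω, φ x = 0 := fun x hx => by
    by_contra h0
    exact hx (hφ.tsupport_subset (subset_tsupport _ h0))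
  have hz' : ∀ x ∉ Ω, RobinMaps.partialDeriv i φ x = 0 := fun x hx => by
    by_contra h0
    exact hx ((hφ.partialDeriv i).tsupport_subset (subset_tsupport _ h0))
  have e1 : ∫ x in Ω, w x * RobinMaps.partialDeriv i φ x =
      ∫ x, w x * RobinMaps.partialDeriv i φ x :=
    setIntegral_eq_integral_of_forall_compl_eq_zero fun x hx => by rw [hz' x hx, mul_zero]
  have e2 : ∫ x in Ω, G x i * φ x = ∫ x, RobinMaps.partialDeriv i w x * φ x := by
    rw [← setIntegral_eq_integral_of_forall_compl_eq_zero (s := Ω)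
      (f := fun x => RobinMaps.partialDeriv i w x * φ x)]
    · refine integral_congr_ae ?_
      filter_upwards [hGd i] with x hx
      rw [hx]
    · intro x hx
      rw [hz x hx, mul_zero]
  have ind : ∀ (f g : E n → ℂ), (∀ x ∉ Ω, g x = 0) →
      Integrable (fun x => f x * g x) (volume.restrict Ω) → Integrable fun x => f x * g x := by
    intro f g hg hi
    refine (integrableOn_iff_integrable_of_support_subset (s := Ω) ?_).1 hi
    intro x hx
    by_contra h0
    exact hx (by simp [hg x h0])
  rw [e1, e2]
  refine integral_mul_fderiv_eq_neg_fderiv_mul_of_integrable (f := w) (g := φ) ?_ ?_ ?_ ?_ ?_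
  · refine ind _ _ hz ?_
    refine ((hG.eval_piLp i).integrable_mul hφ.memLp).congr ?_
    filter_upwards [hGd i] with x hx
    simp only [Pi.mul_apply]
    rw [hx]
    rfl
  · exact ind _ _ hz' (hw.integrable_mul (hφ.memLp_partialDeriv i))
  · exact ind _ _ hz (hw.integrable_mul hφ.memLp)
  · intro x hx
    exact hd x (hφ.tsupport_subset hx)
  · intro x _
    exact (hφ.contDiff.differentiable (by simp)).differentiableAt

/-- The product rule for weak gradients. -/
theorem WeakGrad.smooth_mul {u : E n → ℂ} {G : E n → EuclideanSpace ℂ (Fin n)} {χ : E n → ℂ}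
    (hu : MemLp u 2 (volume.restrict Ω)) (hG : MemLp G 2 (volume.restrict Ω))
    (h : WeakGrad Ω u G) (hχ : ContDiff ℝ ∞ χ) :
    WeakGrad Ω (fun x => χ x * u x)
      (fun x => χ x • G x + u x • WithLp.toLp 2 (fun i => partialDeriv i χ x)) := by
  intro φ hφ i
  -- The identity for `u` is tested with `χφ`; the product rule leaves the term `u φ ∂ᵢχ`, which
  -- becomes the second part of the gradient.
  have ht : IsTestFunction Ω (fun x => χ x * φ x) :=
    ⟨hχ.mul hφ.contDiff, hφ.hasCompactSupport.mul_left,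
      (tsupport_mul_subset_right (f := χ) (g := φ)).trans hφ.tsupport_subset⟩
  have h1 := h _ ht i
  have hd : ∀ x, partialDeriv i (fun x => χ x * φ x) x =
      χ x * partialDeriv i φ x + φ x * partialDeriv i χ x := by
    intro x
    simp only [partialDeriv]
    rw [fderiv_fun_mul (hχ.differentiable (by simp)).differentiableAt
      (hφ.contDiff.differentiable (by simp)).differentiableAt]
    simp
  have hχc : Continuous (partialDeriv i χ) :=
    (hχ.continuous_fderiv (by simp)).clm_apply continuous_const
  have m1 : MemLp (fun x => χ x * partialDeriv i φ x) 2 (volume.restrict Ω) :=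
    (hχ.continuous.mul (hφ.continuous_partialDeriv i)).memLp_of_hasCompactSupport
      ((hφ.hasCompactSupport_partialDeriv i).mul_left)
  have m2 : MemLp (fun x => φ x * partialDeriv i χ x) 2 (volume.restrict Ω) :=
    (hφ.contDiff.continuous.mul hχc).memLp_of_hasCompactSupport hφ.hasCompactSupport.mul_right
  have i1 : Integrable (fun x => u x * (χ x * partialDeriv i φ x)) (volume.restrict Ω) :=
    hu.integrable_mul m1
  have i2 : Integrable (fun x => u x * (φ x * partialDeriv i χ x)) (volume.restrict Ω) :=
    hu.integrable_mul m2
  have i3 : Integrable (fun x => G x i * (χ x * φ x)) (volume.restrict Ω) :=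
    (hG.eval_piLp i).integrable_mul ht.memLp
  have e1 : ∫ x in Ω, u x * partialDeriv i (fun x => χ x * φ x) x =
      (∫ x in Ω, u x * (χ x * partialDeriv i φ x)) + ∫ x in Ω, u x * (φ x * partialDeriv i χ x) := by
    rw [← integral_add i1 i2]
    congr 1
    ext x
    rw [hd]; ring
  rw [e1] at h1
  have e2 : ∫ x in Ω, χ x * u x * partialDeriv i φ x =
      ∫ x in Ω, u x * (χ x * partialDeriv i φ x) := by
    congr 1; ext x; ring
  have e3 : ∫ x in Ω, (χ x • G x + u x • WithLp.toLp 2 (fun i => partialDeriv i χ x)) i * φ x =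
      (∫ x in Ω, G x i * (χ x * φ x)) + ∫ x in Ω, u x * (φ x * partialDeriv i χ x) := by
    rw [← integral_add i3 i2]
    congr 1
    ext x
    simp only [PiLp.add_apply, PiLp.smul_apply, smul_eq_mul]
    ring
  rw [e2, e3, eq_sub_of_add_eq h1]
  ring

/-! ### Completeness -/

/-- Each identity defining a weak gradient equates two inner products against fixed square
integrable fields, so it is a closed condition. -/
theorem isClosed_H1 : IsClosed (H1 Ω : Set (WithLp 2 (L2 Ω × L2Vec Ω))) := by
  have : (H1 Ω : Set (WithLp 2 (L2 Ω × L2Vec Ω))) =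
      ⋂ φ : {φ : E n → ℂ // IsTestFunction Ω φ}, ⋂ i : Fin n,
        {p | ∫ x in Ω, p.fst x * partialDeriv i φ.1 x = -∫ x in Ω, p.snd x i * φ.1 x} := by
    ext p
    simp only [Set.mem_iInter, Set.mem_ofPred_eq, Subtype.forall]
    rfl
  rw [this]
  refine isClosed_iInter fun φ => isClosed_iInter fun i => isClosed_eq ?_ (Continuous.neg ?_)
  · simp_rw [Lp.integral_mul_eq_inner _ (φ.2.memLp_partialDeriv i)]
    exact continuous_const.inner (WithLp.prod_continuous_ofLp 2 _ _).fst
  · let Ψ : E n → EuclideanSpace ℂ (Fin n) := fun x => EuclideanSpace.single i (conj (φ.1 x))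
    have hΨ : MemLp Ψ 2 (volume.restrict Ω) := by
      refine MemLp.of_eval_piLp fun k => ?_
      by_cases hk : k = i
      · subst hk
        have : (fun x => Ψ x k) = star φ.1 := by ext x; simp [Ψ]
        rw [this]
        exact φ.2.memLp.star
      · simp [Ψ, hk]
    have : ∀ p : WithLp 2 (L2 Ω × L2Vec Ω), ∫ x in Ω, p.snd x i * φ.1 x =
        inner ℂ (hΨ.toLp Ψ) p.snd := by
      intro p
      rw [L2.inner_def]
      refine integral_congr_ae ?_
      filter_upwards [hΨ.coeFn_toLp] with x hx
      rw [hx]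
      simp [Ψ, EuclideanSpace.inner_single_left]
      ring
    simp_rw [this]
    exact continuous_const.inner (WithLp.prod_continuous_ofLp 2 _ _).snd

instance : CompleteSpace (H1 Ω) := isClosed_H1.completeSpace_coe

/-- The second component is tied to the first by a pointwise relation almost everywhere. It survives
the limit along a subsequence for which both components converge almost everywhere. -/
theorem isClosed_H12 [SFinite (surfaceMeasure Ω)] : IsClosed (H12 Ω :
    Set (WithLp 2 (L2Bdry Ω × Lp ℂ 2 ((surfaceMeasure Ω).prod (surfaceMeasure Ω))))) := by
  refine isClosed_of_closure_subset fun p hp => ?_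
  obtain ⟨q, hq, hqp⟩ := mem_closure_iff_seq_limit.1 hp
  have h1 : Filter.Tendsto (fun k => (q k).fst) Filter.atTop (nhds p.fst) :=
    ((WithLp.prod_continuous_ofLp 2 _ _).fst.tendsto p).comp hqp
  have h2 : Filter.Tendsto (fun k => (q k).snd) Filter.atTop (nhds p.snd) :=
    ((WithLp.prod_continuous_ofLp 2 _ _).snd.tendsto p).comp hqp
  obtain ⟨s, hs, hs'⟩ := (tendstoInMeasure_of_tendsto_Lp h1).exists_seq_tendsto_ae
  obtain ⟨t, ht, ht'⟩ := (tendstoInMeasure_of_tendsto_Lp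
    (h2.comp hs.tendsto_atTop)).exists_seq_tendsto_ae
  have h3 : ∀ k, (q (s (t k))).snd =ᵐ[(surfaceMeasure Ω).prod (surfaceMeasure Ω)]
    gagliardoQuotient (q (s (t k))).fst := fun k => hq _
  change p.snd =ᵐ[(surfaceMeasure Ω).prod (surfaceMeasure Ω)] gagliardoQuotient p.fst
  filter_upwards [ht', ae_all_iff.2 h3, Measure.quasiMeasurePreserving_fst.ae hs',
    Measure.quasiMeasurePreserving_snd.ae hs'] with x hx1 hx2 hx3 hx4
  refine tendsto_nhds_unique hx1 ?_
  simp only [Function.comp_apply] at hx1 ⊢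
  simp_rw [hx2]
  exact ((hx3.comp ht.tendsto_atTop).sub (hx4.comp ht.tendsto_atTop)).div_const _

theorem ConeData.isFiniteMeasure (D : ConeData Ω) (hb : Bornology.IsBounded Ω) :
    IsFiniteMeasure (surfaceMeasure Ω) := by
  obtain ⟨R, hR⟩ := hb.subset_ball 0
  refine ⟨?_⟩
  have h1 : frontier Ω ⊆ Metric.ball 0 (max R 0 + 1) :=
    frontier_subset_closure.trans ((closure_mono hR).trans (Metric.closure_ball_subset_closedBall.trans
      (Metric.closedBall_subset_ball (by have := le_max_left R 0; linarith))))
  have h2 : surfaceMeasure Ω Set.univ ≤ surfaceMeasure Ω (Metric.ball 0 (max R 0 + 1)) := by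
    rw [surfaceMeasure, Measure.restrict_apply_univ,
      Measure.restrict_apply Metric.isOpen_ball.measurableSet, Set.inter_eq_right.2 h1]
  exact h2.trans_lt ((D.upper _ _ (by positivity)).trans_lt ENNReal.ofReal_lt_top)

end

section

/-! ### Cauchy-Schwarz inequalities for the Lebesgue integral -/

section CauchySchwarz

variable {α : Type*} [MeasurableSpace α] {μ : Measure α}

theorem lintegral_mul_sq_le {f g : α → ENNReal} (hf : AEMeasurable f μ) (hg : AEMeasurable g μ) :
    (∫⁻ x, f x * g x ∂μ) ^ 2 ≤ (∫⁻ x, f x ^ 2 ∂μ) * ∫⁻ x, g x ^ 2 ∂μ := by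
  have h := ENNReal.lintegral_mul_le_Lp_mul_Lq μ Real.HolderConjugate.two_two hf hg
  calc (∫⁻ x, f x * g x ∂μ) ^ 2 ≤ ((∫⁻ x, f x ^ (2 : ℝ) ∂μ) ^ (1 / (2 : ℝ)) *
        (∫⁻ x, g x ^ (2 : ℝ) ∂μ) ^ (1 / (2 : ℝ))) ^ 2 := by
        gcongr
        exact h
    _ = (∫⁻ x, f x ^ 2 ∂μ) * ∫⁻ x, g x ^ 2 ∂μ := by
        rw [mul_pow, ← ENNReal.rpow_natCast, ← ENNReal.rpow_mul, ← ENNReal.rpow_natCast,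
          ← ENNReal.rpow_mul]
        norm_num

/-- Cauchy-Schwarz for the splitting `a * b = a^(1/2) * (a^(1/2) * b)`. -/
theorem lintegral_weighted_sq_le {a b : α → ENNReal} (ha : AEMeasurable a μ)
    (hb : AEMeasurable b μ) :
    (∫⁻ x, a x * b x ∂μ) ^ 2 ≤ (∫⁻ x, a x ∂μ) * ∫⁻ x, a x * b x ^ 2 ∂μ := by
  have h2 : ∀ x, a x ^ (1 / 2 : ℝ) * a x ^ (1 / 2 : ℝ) = a x := fun x => by
    rw [← ENNReal.rpow_add_of_nonneg _ _ (by norm_num) (by norm_num)]; norm_num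
  have h := lintegral_mul_sq_le (μ := μ) (f := fun x => a x ^ (1 / 2 : ℝ))
    (g := fun x => a x ^ (1 / 2 : ℝ) * b x) (ha.pow_const _) ((ha.pow_const _).mul hb)
  have h3 : ∀ x, (a x ^ (1 / 2 : ℝ)) ^ 2 = a x := fun x => by rw [pow_two, h2]
  simpa only [← mul_assoc, h2, mul_pow, h3] using h

end CauchySchwarz

/-! ### Mollification -/

open Convolution

variable {n : ℕ} {Ω : Set (E n)}

section mollify

variable {F : Type*} [NormedAddCommGroup F]

/-- Translations are a continuous family of measure preserving maps, hence act continuously on `L²`.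
-/
theorem exists_translation_close {V : E n → F} (hV : MemLp V 2 volume) {ε : ENNReal}
    (hε : ε ≠ 0) : ∃ δ > 0, ∀ z : E n, ‖z‖ < δ → ∫⁻ x, ‖V (x - z) - V x‖ₑ ^ 2 ≤ ε := by
  let g : E n → C(E n, E n) := fun z => ⟨fun x => x - z, by fun_prop⟩
  have hg : Continuous g := ContinuousMap.continuous_of_continuous_uncurry _ (by
    change Continuous fun p : E n × E n => p.2 - p.1
    fun_prop)
  have hgm : ∀ z, MeasurePreserving (g z) volume volume := fun z =>
    measurePreserving_sub_right volume z
  have hc := Continuous.compMeasurePreservingLp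
    (continuous_const (y := hV.toLp V)) hg hgm (by norm_num)
  have h0 : Lp.compMeasurePreserving (g 0) (hgm 0) (hV.toLp V) = hV.toLp V := by
    apply Lp.ext
    refine (Lp.coeFn_compMeasurePreserving _ (hgm 0)).trans ?_
    filter_upwards with x
    simp [g]
  -- `min ε 1` works without a square root, since one of the two factors may be bounded by `ε` and
  -- the other by `1`.
  obtain ⟨η, hη, hηε⟩ : ∃ η : ENNReal, η ≠ 0 ∧ η ^ 2 ≤ ε :=
    ⟨min ε 1, by simp [hε], by
      rw [pow_two]
      exact (mul_le_mul' (min_le_left _ _) (min_le_right _ _)).trans (by simp)⟩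
  have h1 := EMetric.tendsto_nhds.1 (hc.tendsto 0) η (pos_iff_ne_zero.2 hη)
  obtain ⟨δ, hδ, hb⟩ := Metric.eventually_nhds_iff.1 h1
  refine ⟨δ, hδ, fun z hz => ?_⟩
  have h2 := hb (y := z) (by simpa using hz)
  rw [h0, edist_eq_enorm_sub] at h2
  refine le_trans ?_ ((pow_le_pow_left' h2.le 2).trans hηε)
  rw [Lp.enorm_sq_eq_of_ae_eq (g := fun x => V (x - z) - V x)]
  refine (Lp.coeFn_sub _ _).trans ?_
  filter_upwards [Lp.coeFn_compMeasurePreserving (hV.toLp V) (hgm z),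
    (hgm z).quasiMeasurePreserving.ae hV.coeFn_toLp, hV.coeFn_toLp] with x h3 h4 h5
  rw [Pi.sub_apply, h3, h5]
  simp only [Function.comp_apply]
  rw [h4]
  rfl

variable [NormedSpace ℝ F]

/-- The mollification of `V` by the bump function `b`. -/
def mollify {c : E n} (b : ContDiffBump c) (V : E n → F) : E n → F :=
  b.normed volume ⋆[ContinuousLinearMap.lsmul ℝ ℝ, volume] V

theorem mollify_apply {c : E n} (b : ContDiffBump c) (V : E n → F) (x : E n) :
    mollify b V x = ∫ t, b.normed volume t • V (x - t) := rfl

theorem norm_lt_of_mem_tsupport {c : E n} (b : ContDiffBump c) {t : E n}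
    (ht : b.normed volume t ≠ 0) : t ∈ Metric.ball c b.rOut := by
  rw [← b.support_normed_eq (μ := volume)]
  exact ht

theorem integrable_normed_smul {c : E n} (b : ContDiffBump c) {V : E n → F}
    (hV : LocallyIntegrable V volume) (x : E n) :
    Integrable (fun t => b.normed volume t • V (x - t)) :=
  (b.hasCompactSupport_normed (μ := volume)).convolutionExists_left
    (ContinuousLinearMap.lsmul ℝ ℝ) b.continuous_normed hV x

/-- The bump is a probability density, so the mollification is an average of translates: Jensen's
inequality bounds its square error pointwise, and Tonelli reduces the claim to single translates.
The bump need not be centred at the origin. -/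
theorem lintegral_mollify_sub_le {c : E n} (b : ContDiffBump c) {V : E n → F}
    [CompleteSpace F] (hV : MemLp V 2 volume) {ε : ENNReal}
    (h : ∀ z ∈ Metric.ball c b.rOut, ∫⁻ x, ‖V (x - z) - V x‖ₑ ^ 2 ≤ ε) :
    ∫⁻ x, ‖mollify b V x - V x‖ₑ ^ 2 ≤ ε := by
  -- A strongly measurable representative makes `V (x - t)` jointly measurable for Tonelli.
  wlog hVm : StronglyMeasurable V generalizing V
  · have hae := hV.1.ae_eq_mk
    have hm : mollify b V = mollify b (hV.1.mk V) := by
      ext x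
      rw [mollify_apply, mollify_apply]
      refine integral_congr_ae ?_
      filter_upwards [(Measure.measurePreserving_sub_left volume x).quasiMeasurePreserving.ae hae]
        with t ht
      rw [ht]
    have := this (V := hV.1.mk V) (hV.ae_eq hae) (fun z hz => ?_) hV.1.stronglyMeasurable_mk
    · rw [hm]
      refine le_trans (le_of_eq (lintegral_congr_ae ?_)) this
      filter_upwards [hae] with x hx
      rw [hx]
    · refine le_trans (le_of_eq (lintegral_congr_ae ?_)) (h z hz)
      filter_upwards [hae, (measurePreserving_sub_right volume z).quasiMeasurePreserving.ae hae]
        with x hx hx'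
      rw [hx, hx']
  have hloc : LocallyIntegrable V volume := hV.locallyIntegrable (by norm_num)
  set ρ : E n → ℝ := b.normed volume with hρ
  have hρ0 : ∀ t, 0 ≤ ρ t := fun t => b.nonneg_normed t
  have hρc : Continuous ρ := b.continuous_normed
  have hρ1 : ∫⁻ t, ‖ρ t‖ₑ = 1 := by
    have h1 : ∫ t, ρ t = 1 := b.integral_normed
    have h2 := ofReal_integral_eq_lintegral_ofReal (μ := volume) b.integrable_normed
      (Filter.Eventually.of_forall hρ0)
    rw [← hρ, h1, ENNReal.ofReal_one] at h2
    rw [h2]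
    congr 1
    ext t
    rw [Real.enorm_of_nonneg (hρ0 t)]
  have hρm : Measurable fun t => ‖ρ t‖ₑ := hρc.measurable.enorm
  have hpt : ∀ x, ‖mollify b V x - V x‖ₑ ^ 2 ≤ ∫⁻ t, ‖ρ t‖ₑ * ‖V (x - t) - V x‖ₑ ^ 2 := by
    intro x
    have h1 : mollify b V x - V x = ∫ t, ρ t • (V (x - t) - V x) := by
      have h2 : V x = ∫ t, ρ t • V x := by
        rw [integral_smul_const, b.integral_normed, one_smul]
      conv_lhs => rw [h2, mollify_apply]
      rw [← integral_sub (integrable_normed_smul b hloc x) (b.integrable_normed.smul_const _)]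
      simp only [smul_sub]
      rfl
    have hVx : Measurable fun t => ‖V (x - t) - V x‖ₑ :=
      ((hVm.comp_measurable (measurable_const.sub measurable_id)).sub
        stronglyMeasurable_const).enorm
    have h3 := lintegral_weighted_sq_le (μ := volume) hρm.aemeasurable hVx.aemeasurable
    rw [hρ1, one_mul] at h3
    refine le_trans ?_ h3
    gcongr
    rw [h1]
    refine (enorm_integral_le_lintegral_enorm _).trans (le_of_eq ?_)
    congr 1
    ext t
    rw [enorm_smul]
  calc ∫⁻ x, ‖mollify b V x - V x‖ₑ ^ 2
      ≤ ∫⁻ x, ∫⁻ t, ‖ρ t‖ₑ * ‖V (x - t) - V x‖ₑ ^ 2 := lintegral_mono hpt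
    _ = ∫⁻ t, ∫⁻ x, ‖ρ t‖ₑ * ‖V (x - t) - V x‖ₑ ^ 2 := by
        apply lintegral_lintegral_swap
        apply Measurable.aemeasurable
        have h1 : Measurable fun p : E n × E n => ‖V (p.1 - p.2) - V p.1‖ₑ :=
          ((hVm.comp_measurable (measurable_fst.sub measurable_snd)).sub
            (hVm.comp_measurable measurable_fst)).enorm
        exact (hρm.comp measurable_snd).mul (h1.pow_const 2)
    _ ≤ ∫⁻ t, ‖ρ t‖ₑ * ε := by
        refine lintegral_mono fun t => ?_
        rw [lintegral_const_mul' _ _ enorm_ne_top]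
        by_cases ht : ρ t = 0
        · simp [ht]
        · gcongr
          exact h t (norm_lt_of_mem_tsupport b ht)
    _ = ε := by rw [lintegral_mul_const _ hρm, hρ1, one_mul]

end mollify

/-- The classical gradient of `w`. -/
def gradFun (w : E n → ℂ) (x : E n) : EuclideanSpace ℂ (Fin n) :=
  WithLp.toLp 2 fun i => partialDeriv i w x

theorem contDiff_mollify {c : E n} (b : ContDiffBump c) {V : E n → ℂ}
    (hV : LocallyIntegrable V volume) : ContDiff ℝ ∞ (mollify b V) :=
  (b.hasCompactSupport_normed (μ := volume)).contDiff_convolution_left _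
    (b.contDiff_normed (n := ⊤)) hV

theorem partialDeriv_mollify {c : E n} (b : ContDiffBump c) {V : E n → ℂ}
    (hV : LocallyIntegrable V volume) (i : Fin n) (x : E n) :
    partialDeriv i (mollify b V) x =
      ∫ t, (fderiv ℝ (b.normed volume) t (EuclideanSpace.single i 1)) • V (x - t) := by
  have h := (b.hasCompactSupport_normed (μ := volume)).hasFDerivAt_convolution_left
    (ContinuousLinearMap.lsmul ℝ ℝ) (b.contDiff_normed (n := 1)) hV x
  rw [partialDeriv, mollify, h.fderiv]
  have hi := (((b.hasCompactSupport_normed (μ := volume)).fderiv ℝ).convolutionExists_left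
    ((ContinuousLinearMap.lsmul ℝ ℝ : ℝ →L[ℝ] ℂ →L[ℝ] ℂ).precompL (E n))
    ((b.contDiff_normed (n := 1)).continuous_fderiv (by simp)) hV x)
  exact ContinuousLinearMap.integral_apply hi _

theorem mollify_eq_zero {F : Type*} [NormedAddCommGroup F] [NormedSpace ℝ F] {c : E n}
    (b : ContDiffBump c) {V : E n → F} {x : E n}
    (h : ∀ z ∈ Metric.closedBall c b.rOut, V (x - z) = 0) : mollify b V x = 0 := by
  rw [mollify_apply]
  refine integral_eq_zero_of_ae (Filter.Eventually.of_forall fun t => ?_)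
  by_cases ht : b.normed volume t = 0
  · simp [ht]
  · simp [h t (Metric.ball_subset_closedBall (norm_lt_of_mem_tsupport b ht))]

theorem tsupport_normed_subset {c : E n} (b : ContDiffBump c) :
    tsupport (b.normed volume) ⊆ Metric.closedBall c b.rOut := by
  rw [b.tsupport_normed_eq (μ := volume)]

theorem fderiv_normed_eq_zero {c : E n} (b : ContDiffBump c) {t : E n}
    (ht : t ∉ Metric.closedBall c b.rOut) : fderiv ℝ (b.normed volume) t = 0 := by
  by_contra h0
  exact ht (tsupport_normed_subset b
    ((tsupport_fderiv_subset ℝ) (subset_tsupport _ h0)))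

theorem partialDeriv_mollify_eq_zero {c : E n} (b : ContDiffBump c) {V : E n → ℂ}
    (hV : LocallyIntegrable V volume) (i : Fin n) {x : E n}
    (h : ∀ z ∈ Metric.closedBall c b.rOut, V (x - z) = 0) :
    partialDeriv i (mollify b V) x = 0 := by
  rw [partialDeriv_mollify b hV]
  refine integral_eq_zero_of_ae (Filter.Eventually.of_forall fun t => ?_)
  by_cases ht : t ∈ Metric.closedBall c b.rOut
  · simp [h t ht]
  · simp [fderiv_normed_eq_zero b ht]

/-- If every sampled point `x - z` lies in `Ω`, then `t ↦ b(x - t)` is a test function on `Ω`;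
differentiating under the integral and applying the definition of the weak gradient to it moves the
derivative onto `V`. -/
theorem gradFun_mollify {c : E n} (b : ContDiffBump c) {V : E n → ℂ}
    {G : E n → EuclideanSpace ℂ (Fin n)} (hV : LocallyIntegrable V volume)
    (hG : LocallyIntegrable G volume) (hVz : ∀ x ∉ Ω, V x = 0) (hGz : ∀ x ∉ Ω, G x = 0)
    (h : WeakGrad Ω V G) {x : E n} (hx : ∀ z ∈ Metric.closedBall c b.rOut, x - z ∈ Ω) :
    gradFun (mollify b V) x = mollify b G x := by
  ext i
  have e1 : mollify b G x i = ∫ t, b.normed volume t • G (x - t) i := by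
    rw [mollify_apply]
    exact ((EuclideanSpace.proj (𝕜 := ℂ) i).restrictScalars ℝ).integral_comp_comm
      (integrable_normed_smul b hG x) |>.symm
  change partialDeriv i (mollify b V) x = mollify b G x i
  rw [e1, partialDeriv_mollify b hV]
  set φ : E n → ℂ := fun z => ((b.normed volume (x - z) : ℝ) : ℂ) with hφdef
  have hd : ContDiff ℝ ∞ (b.normed (volume : Measure (E n))) := b.contDiff_normed
  have hφ : IsTestFunction Ω φ := by
    have hK : IsCompact ((fun z => x - z) '' Metric.closedBall c b.rOut) :=
      (isCompact_closedBall c b.rOut).image (by fun_prop)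
    have hsupp : tsupport φ ⊆ (fun z => x - z) '' Metric.closedBall c b.rOut := by
      refine closure_minimal (fun z hz => ?_) hK.isClosed
      have : b.normed volume (x - z) ≠ 0 := fun h0 => hz (by simp [hφdef, h0])
      exact ⟨x - z, Metric.ball_subset_closedBall (norm_lt_of_mem_tsupport b this), by simp⟩
    refine ⟨?_, HasCompactSupport.of_support_subset_isCompact hK
      ((subset_tsupport _).trans hsupp), hsupp.trans ?_⟩
    · exact Complex.ofRealCLM.contDiff.comp (hd.comp (contDiff_const.sub contDiff_id))
    · rintro _ ⟨z, hz, rfl⟩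
      exact hx z hz
  have hpd : ∀ z, partialDeriv i φ z =
      -((fderiv ℝ (b.normed volume) (x - z) (EuclideanSpace.single i 1) : ℝ) : ℂ) := by
    intro z
    have h1 : HasFDerivAt (b.normed (volume : Measure (E n)))
        (fderiv ℝ (b.normed volume) (x - z)) (x - z) :=
      (hd.differentiable (by simp)).differentiableAt.hasFDerivAt
    have h2 := Complex.ofRealCLM.hasFDerivAt.comp z (h1.comp z ((hasFDerivAt_id z).const_sub x))
    rw [partialDeriv]
    have h3 : fderiv ℝ φ z = _ := h2.fderiv
    rw [h3]
    simp
  have h1 := h φ hφ i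
  have e2 : ∫ z in Ω, V z * partialDeriv i φ z = ∫ z, V z * partialDeriv i φ z :=
    setIntegral_eq_integral_of_forall_compl_eq_zero fun z hz => by rw [hVz z hz, zero_mul]
  have e3 : ∫ z in Ω, G z i * φ z = ∫ z, G z i * φ z :=
    setIntegral_eq_integral_of_forall_compl_eq_zero fun z hz => by rw [hGz z hz]; simp
  rw [e2, e3] at h1
  rw [← integral_sub_left_eq_self (fun t => fderiv ℝ (b.normed volume) t
    (EuclideanSpace.single i 1) • V (x - t)) volume x,
    ← integral_sub_left_eq_self (fun t => b.normed volume t • G (x - t) i) volume x]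
  simp only [sub_sub_cancel]
  have e4 : ∫ z, V z * partialDeriv i φ z = -∫ z, (fderiv ℝ (b.normed volume) (x - z)
      (EuclideanSpace.single i 1)) • V z := by
    rw [← integral_neg]
    congr 1
    ext z
    rw [hpd]
    simp [mul_comm]
  have e5 : ∫ z, G z i * φ z = ∫ z, b.normed volume (x - z) • G z i := by
    congr 1
    ext z
    simp [hφdef, mul_comm]
  rw [e4, e5] at h1
  exact neg_injective h1

end

section

/-! ### Density of smooth functions in `H¹` -/

variable {n : ℕ} {Ω : Set (E n)}

/-- The extension of `u` by zero is mollified with a bump centred at a small vector `c`. By `H`,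
near `S` the convolution samples only points of `Ω`, so it commutes with the gradient; away from `S`
everything vanishes. A nonzero `c` shifts the samples into the domain near its boundary. -/
theorem exists_smooth_approx (hΩ : IsOpen Ω) {u : E n → ℂ} {G : E n → EuclideanSpace ℂ (Fin n)}
    {S : Set (E n)} (hu : MemLp u 2 (volume.restrict Ω)) (hG : MemLp G 2 (volume.restrict Ω))
    (h : WeakGrad Ω u G) (hS : ∀ x ∉ S, u x = 0 ∧ G x = 0) {η : ℝ} (hη : 0 < η)
    (H : ∀ ε > 0, ∃ (c : E n) (R : ℝ), 0 < R ∧ ‖c‖ + R < ε ∧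
      ∀ x ∈ Ω, ∀ s ∈ S, dist x s < η → ∀ z ∈ Metric.closedBall c R, x - z ∈ Ω)
    {ε : ENNReal} (hε : ε ≠ 0) {δ : ℝ} (hδ : 0 < δ) :
    ∃ w : E n → ℂ, ContDiff ℝ ∞ w ∧ (∀ x, w x ≠ 0 → ∃ s ∈ S, dist x s < δ) ∧
      ∫⁻ x in Ω, ‖w x - u x‖ₑ ^ 2 ≤ ε ∧ ∫⁻ x in Ω, ‖gradFun w x - G x‖ₑ ^ 2 ≤ ε := by
  set V := Ω.indicator u with hVdef
  set W := Ω.indicator G with hWdef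
  have hV : MemLp V 2 volume := (memLp_indicator_iff_restrict hΩ.measurableSet).2 hu
  have hW : MemLp W 2 volume := (memLp_indicator_iff_restrict hΩ.measurableSet).2 hG
  obtain ⟨δ₁, hδ₁, h₁⟩ := exists_translation_close hV hε
  obtain ⟨δ₂, hδ₂, h₂⟩ := exists_translation_close hW hε
  -- `δ₁` and `δ₂` control the translation errors of the function and of its gradient, `δ` controls
  -- the support, and `η` makes points far from `S` sample only zeros.
  obtain ⟨c, R, hR, hcR, hH⟩ := H (min (min δ₁ δ₂) (min δ η)) (by positivity)
  simp only [lt_min_iff] at hcR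
  obtain ⟨⟨hc1, hc2⟩, hc3, hc4⟩ := hcR
  let b : ContDiffBump c := ⟨R / 2, R, by positivity, by linarith⟩
  have hb : b.rOut = R := rfl
  have hz : ∀ z ∈ Metric.closedBall c R, ‖z‖ ≤ ‖c‖ + R := fun z hz => by
    have h1 : z = c + (z - c) := by abel
    rw [h1]
    refine (norm_add_le _ _).trans ?_
    rw [Metric.mem_closedBall, dist_eq_norm] at hz
    linarith
  have hVS : ∀ x ∉ S, V x = 0 := fun x hx => by
    classical rw [hVdef, Set.indicator_apply, (hS x hx).1, ite_self]
  have hWS : ∀ x ∉ S, W x = 0 := fun x hx => by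
    classical rw [hWdef, Set.indicator_apply, (hS x hx).2, ite_self]
  have hVl : LocallyIntegrable V volume := hV.locallyIntegrable (by norm_num)
  have hWl : LocallyIntegrable W volume := hW.locallyIntegrable (by norm_num)
  have hw : WeakGrad Ω V W := by
    intro φ hφ i
    have e1 : ∫ x in Ω, V x * partialDeriv i φ x = ∫ x in Ω, u x * partialDeriv i φ x :=
      setIntegral_congr_fun hΩ.measurableSet fun x hx => by
        simp only [hVdef, Set.indicator_of_mem hx]
    have e2 : ∫ x in Ω, W x i * φ x = ∫ x in Ω, G x i * φ x :=
      setIntegral_congr_fun hΩ.measurableSet fun x hx => by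
        simp only [hWdef, Set.indicator_of_mem hx]
    rw [e1, e2, h φ hφ i]
  have hgrad : ∀ x ∈ Ω, gradFun (mollify b V) x = mollify b W x := by
    intro x hx
    by_cases hs : ∃ s ∈ S, dist x s < η
    · obtain ⟨s, hs, hsx⟩ := hs
      exact gradFun_mollify b hVl hWl (fun x hx => Set.indicator_of_notMem hx _)
        (fun x hx => Set.indicator_of_notMem hx _) hw (hH x hx s hs hsx)
    · have hout : ∀ z ∈ Metric.closedBall c R, x - z ∉ S := fun z hzb hzS => by
        refine hs ⟨x - z, hzS, ?_⟩
        rw [dist_eq_norm, sub_sub_cancel]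
        exact (hz z hzb).trans_lt hc4
      rw [mollify_eq_zero b (fun z hz => hWS _ (hout z hz))]
      ext i
      exact partialDeriv_mollify_eq_zero b hVl i fun z hz => hVS _ (hout z hz)
  refine ⟨mollify b V, contDiff_mollify b hVl, ?_, ?_, ?_⟩
  · intro x hx
    by_contra! hs
    apply hx
    refine mollify_eq_zero b fun z hzb => hVS _ fun hzS => ?_
    have := hs _ hzS
    rw [dist_eq_norm, sub_sub_cancel] at this
    exact absurd ((hz z hzb).trans_lt hc3) (not_lt.2 this)
  · refine le_trans ?_ (lintegral_mollify_sub_le b hV (ε := ε) fun z hzb =>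
      h₁ z ((hz z (Metric.ball_subset_closedBall hzb)).trans_lt hc1))
    refine le_trans (le_of_eq ?_) (setLIntegral_le_lintegral Ω _)
    refine setLIntegral_congr_fun hΩ.measurableSet fun x hx => ?_
    simp only [hVdef, Set.indicator_of_mem hx]
  · refine le_trans ?_ (lintegral_mollify_sub_le b hW (ε := ε) fun z hzb =>
      h₂ z ((hz z (Metric.ball_subset_closedBall hzb)).trans_lt hc2))
    refine le_trans (le_of_eq ?_) (setLIntegral_le_lintegral Ω _)
    refine setLIntegral_congr_fun hΩ.measurableSet fun x hx => ?_
    simp only [hgrad x hx, hWdef, Set.indicator_of_mem hx]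

/-- The smooth function `w` represents the element `v` of `H¹(Ω)`. -/
structure SmoothRep (v : H1 Ω) (w : E n → ℂ) : Prop where
  contDiff : ContDiff ℝ ∞ w
  toL2_ae : toL2 v =ᵐ[volume.restrict Ω] w
  grad_ae : grad v =ᵐ[volume.restrict Ω] gradFun w

theorem H1.norm_sq (v : H1 Ω) : ‖v‖ ^ 2 = ‖toL2 v‖ ^ 2 + ‖grad v‖ ^ 2 :=
  WithLp.prod_norm_sq_eq_of_L2 v.1

theorem continuous_gradFun {w : E n → ℂ} (hw : ContDiff ℝ ∞ w) : Continuous (gradFun w) := by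
  refine (PiLp.continuous_toLp 2 _).comp (continuous_pi fun i => ?_)
  exact (hw.continuous_fderiv (by simp)).clm_apply continuous_const

theorem mem_closure_of_smooth_approx {v : H1 Ω} {u : E n → ℂ}
    {G : E n → EuclideanSpace ℂ (Fin n)} (hvu : toL2 v =ᵐ[volume.restrict Ω] u)
    (hvG : grad v =ᵐ[volume.restrict Ω] G) {P : (E n → ℂ) → Prop}
    (h : ∀ ε : ENNReal, ε ≠ 0 → ∃ w : E n → ℂ, ContDiff ℝ ∞ w ∧ P w ∧
      ∫⁻ x in Ω, ‖w x - u x‖ₑ ^ 2 ≤ ε ∧ ∫⁻ x in Ω, ‖gradFun w x - G x‖ₑ ^ 2 ≤ ε) :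
    v ∈ closure {v' : H1 Ω | ∃ w, P w ∧ SmoothRep v' w} := by
  rw [Metric.mem_closure_iff]
  intro δ hδ
  have hu : MemLp u 2 (volume.restrict Ω) := (memLp_congr_ae hvu).1 (Lp.memLp _)
  have hG : MemLp G 2 (volume.restrict Ω) := (memLp_congr_ae hvG).1 (Lp.memLp _)
  -- The function and the gradient each contribute at most `δ² / 4` to the squared distance, so the
  -- total stays strictly below `δ²`.
  obtain ⟨w, hw, hP, h1, h2⟩ := h (ENNReal.ofReal (δ ^ 2 / 4)) (by simp; positivity)
  have m1 : MemLp (fun x => w x - u x) 2 (volume.restrict Ω) :=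
    memLp_two_of_lintegral_lt_top (hw.continuous.aestronglyMeasurable.sub hu.1)
      (h1.trans_lt ENNReal.ofReal_lt_top)
  have m2 : MemLp (fun x => gradFun w x - G x) 2 (volume.restrict Ω) :=
    memLp_two_of_lintegral_lt_top ((continuous_gradFun hw).aestronglyMeasurable.sub hG.1)
      (h2.trans_lt ENNReal.ofReal_lt_top)
  have mw : MemLp w 2 (volume.restrict Ω) := by
    have := m1.add hu
    refine (memLp_congr_ae (Filter.Eventually.of_forall fun x => ?_)).1 this
    simp
  have mg : MemLp (gradFun w) 2 (volume.restrict Ω) := by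
    have := m2.add hG
    refine (memLp_congr_ae (Filter.Eventually.of_forall fun x => ?_)).1 this
    simp
  obtain ⟨v', hv1, hv2⟩ := exists_H1 mw mg (WeakGrad.of_differentiableAt mw mg
    (fun x _ => (hw.differentiable (by simp)).differentiableAt)
    (fun i => Filter.Eventually.of_forall fun x => rfl))
  refine ⟨v', ⟨w, hP, hw, hv1, hv2⟩, ?_⟩
  have e1 : ‖toL2 (v' - v)‖ₑ ^ 2 ≤ ENNReal.ofReal (δ ^ 2 / 4) := by
    refine le_trans (le_of_eq (Lp.enorm_sq_eq_of_ae_eq ?_)) h1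
    filter_upwards [Lp.coeFn_sub (toL2 v') (toL2 v), hv1, hvu] with x h3 h4 h5
    rw [← h4, ← h5]
    exact h3
  have e2 : ‖grad (v' - v)‖ₑ ^ 2 ≤ ENNReal.ofReal (δ ^ 2 / 4) := by
    refine le_trans (le_of_eq (Lp.enorm_sq_eq_of_ae_eq ?_)) h2
    filter_upwards [Lp.coeFn_sub (grad v') (grad v), hv2, hvG] with x h3 h4 h5
    rw [← h4, ← h5]
    exact h3
  rw [← ofReal_norm, ← ENNReal.ofReal_pow (norm_nonneg _),
    ENNReal.ofReal_le_ofReal_iff (by positivity)] at e1 e2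
  rw [dist_comm, dist_eq_norm]
  refine lt_of_pow_lt_pow_left₀ 2 hδ.le ?_
  rw [H1.norm_sq]
  have : 0 < δ ^ 2 := by positivity
  linarith

theorem exists_bound_of_continuous {F : Type*} [NormedAddCommGroup F]
    (hb : Bornology.IsBounded Ω) {f : E n → F} (hf : Continuous f) :
    ∃ M, 0 ≤ M ∧ ∀ x ∈ Ω, ‖f x‖ ≤ M := by
  obtain ⟨M, hM⟩ := hb.isCompact_closure.exists_bound_of_continuousOn hf.continuousOn
  exact ⟨max M 0, le_max_right _ _, fun x hx => (hM x (subset_closure hx)).trans (le_max_left _ _)⟩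

theorem memLp_continuous_smul {F : Type*} [NormedAddCommGroup F] [NormedSpace ℂ F] (hΩ : IsOpen Ω)
    (hb : Bornology.IsBounded Ω) {χ : E n → ℂ} (hχ : Continuous χ) {g : E n → F}
    (hg : MemLp g 2 (volume.restrict Ω)) : MemLp (fun x => χ x • g x) 2 (volume.restrict Ω) := by
  obtain ⟨M, -, hM⟩ := exists_bound_of_continuous hb hχ
  refine MemLp.of_le_mul (c := M) hg (hχ.aestronglyMeasurable.smul hg.1) ?_
  filter_upwards [ae_restrict_mem hΩ.measurableSet] with x hx
  rw [norm_smul]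
  gcongr
  exact hM x hx

theorem memLp_smul_continuous {F : Type*} [NormedAddCommGroup F] [NormedSpace ℂ F] (hΩ : IsOpen Ω)
    (hb : Bornology.IsBounded Ω) {χ : E n → F} (hχ : Continuous χ) {g : E n → ℂ}
    (hg : MemLp g 2 (volume.restrict Ω)) : MemLp (fun x => g x • χ x) 2 (volume.restrict Ω) := by
  obtain ⟨M, -, hM⟩ := exists_bound_of_continuous hb hχ
  refine MemLp.of_le_mul (c := M) hg (hg.1.smul hχ.aestronglyMeasurable) ?_
  filter_upwards [ae_restrict_mem hΩ.measurableSet] with x hx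
  rw [norm_smul, mul_comm]
  gcongr
  exact hM x hx

theorem H1.exists_smooth_mul (hΩ : IsOpen Ω) (hb : Bornology.IsBounded Ω) (v : H1 Ω)
    {χ : E n → ℂ} (hχ : ContDiff ℝ ∞ χ) :
    ∃ v' : H1 Ω, toL2 v' =ᵐ[volume.restrict Ω] (fun x => χ x * toL2 v x) ∧
      grad v' =ᵐ[volume.restrict Ω] fun x => χ x • grad v x + toL2 v x • gradFun χ x := by
  refine exists_H1 ?_ ?_ ((H1.weakGrad v).smooth_mul (Lp.memLp _) (Lp.memLp _) hχ)
  · exact memLp_continuous_smul hΩ hb hχ.continuous (Lp.memLp (toL2 v))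
  · exact (memLp_continuous_smul hΩ hb hχ.continuous (Lp.memLp (grad v))).add
      (memLp_smul_continuous hΩ hb (continuous_gradFun hχ) (Lp.memLp (toL2 v)))

theorem gradFun_eq_zero_of_notMem_tsupport {χ : E n → ℂ} {x : E n} (hx : x ∉ tsupport χ) :
    gradFun χ x = 0 := by
  have : fderiv ℝ χ x = 0 := by
    by_contra h0
    exact hx ((tsupport_fderiv_subset ℝ) (subset_tsupport _ h0))
  ext i
  simp [gradFun, partialDeriv, this]

theorem exists_interior_bumps {S : Set (E n)} (hΩ : IsOpen Ω) (hS : IsCompact S) (hSΩ : S ⊆ Ω) :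
    ∃ η > 0, ∀ ε > 0, ∃ (c : E n) (R : ℝ), 0 < R ∧ ‖c‖ + R < ε ∧
      ∀ x ∈ Ω, ∀ s ∈ S, dist x s < η → ∀ z ∈ Metric.closedBall c R, x - z ∈ Ω := by
  obtain ⟨η, hη, hηΩ⟩ := hS.exists_cthickening_subset_open hΩ hSΩ
  refine ⟨η / 2, by positivity, fun ε hε => ⟨0, min (ε / 2) (η / 2), by positivity, ?_, ?_⟩⟩
  · rw [norm_zero, zero_add]
    exact (min_le_left _ _).trans_lt (by linarith)
  · intro x _ s hs hxs z hz
    apply hηΩ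
    refine Metric.mem_cthickening_of_dist_le _ s _ _ hs ?_
    refine (dist_triangle _ x _).trans ?_
    rw [dist_comm (x - z) x, dist_eq_norm, sub_sub_cancel]
    rw [Metric.mem_closedBall, dist_zero_right] at hz
    have := hz.trans (min_le_right _ _)
    linarith

/-- The bump is centred at `-t • e` with radius `κt/4`, so that for `z` in its support `-z` lies in
the cone about `e`. The cone property then puts `x - z` inside `Ω`. -/
theorem ConeData.exists_boundary_bumps (D : ConeData Ω) (j : Fin D.N) {S : Set (E n)}
    (hS : IsCompact S) (hSO : S ⊆ D.O j) :
    ∃ η > 0, ∀ ε > 0, ∃ (c : E n) (R : ℝ), 0 < R ∧ ‖c‖ + R < ε ∧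
      ∀ x ∈ Ω, ∀ s ∈ S, dist x s < η → ∀ z ∈ Metric.closedBall c R, x - z ∈ Ω := by
  obtain ⟨η, hη, hηO⟩ := hS.exists_cthickening_subset_open (D.isOpen_O j) hSO
  refine ⟨η / 2, by positivity, fun ε hε => ?_⟩
  set t := min (ε / 4) (η / 16) with ht
  have ht0 : 0 < t := by positivity
  have ht1 : t ≤ ε / 4 := min_le_left _ _
  have ht2 : t ≤ η / 16 := min_le_right _ _
  have hκ := D.κ_pos
  have hκ1 := D.κ_le
  have hn : ‖-(t • D.e j)‖ = t := by
    rw [norm_neg, norm_smul, D.norm_e, mul_one, Real.norm_of_nonneg ht0.le]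
  refine ⟨-(t • D.e j), D.κ / 4 * t, by positivity, ?_, ?_⟩
  · rw [hn]; nlinarith
  · intro x hx s hs hxs z hz
    have hz' : ‖-z - t • D.e j‖ ≤ D.κ / 4 * t := by
      rw [Metric.mem_closedBall, dist_eq_norm] at hz
      rw [← norm_neg]
      have h1 : -(-z - t • D.e j) = z - -(t • D.e j) := by abel
      rwa [h1]
    have hcone : -z ∈ cone D.κ (D.e j) := by
      have := smul_add_mem_cone (v := -z - t • D.e j) (by linarith) (D.norm_e j) ht0 hz' hκ
      rwa [add_sub_cancel] at this
    have hzn : ‖-z‖ ≤ 2 * t := by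
      have h1 : -z = (-z - t • D.e j) + t • D.e j := by abel
      rw [h1]
      refine (norm_add_le _ _).trans ?_
      rw [← norm_neg (t • D.e j), hn]
      nlinarith
    have hball : Metric.ball x (η / 2) ⊆ D.O j := by
      intro y hy
      apply hηO
      refine Metric.mem_cthickening_of_dist_le _ s _ _ hs ?_
      rw [Metric.mem_ball] at hy
      have := dist_triangle y x s
      linarith
    have := D.cone_subset j x (subset_closure hx) (η / 2) hball (-z) hcone (by linarith)
    rw [sub_eq_add_neg]
    exact this (Metric.mem_ball_self (mul_pos hκ (norm_pos_of_mem_cone hcone)))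

theorem H1.weakGrad_congr {v : H1 Ω} {u : E n → ℂ} {G : E n → EuclideanSpace ℂ (Fin n)}
    (hvu : toL2 v =ᵐ[volume.restrict Ω] u) (hvG : grad v =ᵐ[volume.restrict Ω] G) :
    WeakGrad Ω u G := by
  intro φ hφ i
  have h1 : ∫ x in Ω, u x * partialDeriv i φ x = ∫ x in Ω, toL2 v x * partialDeriv i φ x := by
    refine integral_congr_ae ?_
    filter_upwards [hvu] with x hx
    rw [hx]
  have h2 : ∫ x in Ω, G x i * φ x = ∫ x in Ω, grad v x i * φ x := by
    refine integral_congr_ae ?_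
    filter_upwards [hvG] with x hx
    rw [hx]
  rw [h1, h2]
  exact H1.weakGrad v φ hφ i

/-- Mollification enlarges the support only slightly, so for a function supported in a compact
subset of `Ω` the approximants are test functions. -/
theorem mem_closure_test (hΩ : IsOpen Ω) {v : H1 Ω} {u : E n → ℂ}
    {G : E n → EuclideanSpace ℂ (Fin n)} (hvu : toL2 v =ᵐ[volume.restrict Ω] u)
    (hvG : grad v =ᵐ[volume.restrict Ω] G) {S : Set (E n)} (hS : IsCompact S) (hSΩ : S ⊆ Ω)
    (h0 : ∀ x ∉ S, u x = 0 ∧ G x = 0) :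
    v ∈ closure {v' : H1 Ω | ∃ φ, IsTestFunction Ω φ ∧ SmoothRep v' φ} := by
  have hu : MemLp u 2 (volume.restrict Ω) := (memLp_congr_ae hvu).1 (Lp.memLp _)
  have hG : MemLp G 2 (volume.restrict Ω) := (memLp_congr_ae hvG).1 (Lp.memLp _)
  have hw : WeakGrad Ω u G := H1.weakGrad_congr hvu hvG
  obtain ⟨δ, hδ, hδΩ⟩ := hS.exists_cthickening_subset_open hΩ hSΩ
  obtain ⟨η, hη, H⟩ := exists_interior_bumps hΩ hS hSΩ
  refine mem_closure_of_smooth_approx hvu hvG fun ε hε => ?_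
  obtain ⟨w, h1, h2, h3, h4⟩ := exists_smooth_approx hΩ hu hG hw h0 hη H hε hδ
  have hsub : Function.support w ⊆ Metric.cthickening δ S := fun x hx => by
    obtain ⟨s, hs, hxs⟩ := h2 x hx
    exact Metric.mem_cthickening_of_dist_le _ s _ _ hs hxs.le
  refine ⟨w, h1, ⟨h1, HasCompactSupport.of_support_subset_isCompact hS.cthickening hsub, ?_⟩, h3, h4⟩
  exact (closure_minimal hsub Metric.isClosed_cthickening).trans hδΩ

theorem mem_closure_smooth (hΩ : IsOpen Ω) {v : H1 Ω} {u : E n → ℂ}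
    {G : E n → EuclideanSpace ℂ (Fin n)} (hvu : toL2 v =ᵐ[volume.restrict Ω] u)
    (hvG : grad v =ᵐ[volume.restrict Ω] G) {S : Set (E n)} {η : ℝ} (hη : 0 < η)
    (H : ∀ ε > 0, ∃ (c : E n) (R : ℝ), 0 < R ∧ ‖c‖ + R < ε ∧
      ∀ x ∈ Ω, ∀ s ∈ S, dist x s < η → ∀ z ∈ Metric.closedBall c R, x - z ∈ Ω)
    (h0 : ∀ x ∉ S, u x = 0 ∧ G x = 0) :
    v ∈ closure {v' : H1 Ω | ∃ w, SmoothRep v' w} := by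
  have hu : MemLp u 2 (volume.restrict Ω) := (memLp_congr_ae hvu).1 (Lp.memLp _)
  have hG : MemLp G 2 (volume.restrict Ω) := (memLp_congr_ae hvG).1 (Lp.memLp _)
  have hw : WeakGrad Ω u G := H1.weakGrad_congr hvu hvG
  refine closure_mono (fun v' => ?_) (mem_closure_of_smooth_approx (P := fun _ => True) hvu hvG
    fun ε hε => ?_)
  · rintro ⟨w, -, hw⟩
    exact ⟨w, hw⟩
  · obtain ⟨w, h1, -, h3, h4⟩ := exists_smooth_approx hΩ hu hG hw h0 hη H hε one_pos
    exact ⟨w, h1, trivial, h3, h4⟩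

/-- The elements of `H¹(Ω)` with a smooth representative. -/
def smoothH1 (Ω : Set (E n)) : Submodule ℂ (H1 Ω) where
  carrier := {v | ∃ w, SmoothRep v w}
  add_mem' := by
    rintro u v ⟨w, hw⟩ ⟨z, hz⟩
    refine ⟨w + z, hw.contDiff.add hz.contDiff,
      (Lp.coeFn_add (toL2 u) (toL2 v)).trans (hw.toL2_ae.add hz.toL2_ae),
      (Lp.coeFn_add (grad u) (grad v)).trans
        ((hw.grad_ae.add hz.grad_ae).trans (Filter.Eventually.of_forall fun x => ?_))⟩
    ext i
    simp only [gradFun, partialDeriv, Pi.add_apply, PiLp.add_apply]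
    rw [fderiv_add (hw.contDiff.differentiable (by simp)).differentiableAt
      (hz.contDiff.differentiable (by simp)).differentiableAt]
    rfl
  zero_mem' := by
    refine ⟨0, contDiff_const, Lp.coeFn_zero _ _ _, (Lp.coeFn_zero _ _ _).trans
      (Filter.Eventually.of_forall fun x => ?_)⟩
    ext i
    simp [gradFun, partialDeriv]
  smul_mem' := by
    rintro c u ⟨w, hw⟩
    refine ⟨c • w, hw.contDiff.const_smul c,
      (Lp.coeFn_smul c (toL2 u)).trans (hw.toL2_ae.const_smul c),
      (Lp.coeFn_smul c (grad u)).trans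
        ((hw.grad_ae.const_smul c).trans (Filter.Eventually.of_forall fun x => ?_))⟩
    ext i
    simp only [gradFun, partialDeriv, Pi.smul_apply, PiLp.smul_apply]
    rw [fderiv_const_smul (hw.contDiff.differentiable (by simp)).differentiableAt]
    rfl

theorem smooth_mul_mem_closure (hΩ : IsOpen Ω) {v v' : H1 Ω} {χ : E n → ℂ} {η : ℝ} (hη : 0 < η)
    (H : ∀ ε > 0, ∃ (c : E n) (R : ℝ), 0 < R ∧ ‖c‖ + R < ε ∧ ∀ x ∈ Ω, ∀ s ∈ tsupport χ ∩ closure Ω,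
      dist x s < η → ∀ z ∈ Metric.closedBall c R, x - z ∈ Ω)
    (h1 : toL2 v' =ᵐ[volume.restrict Ω] fun x => χ x * toL2 v x)
    (h2 : grad v' =ᵐ[volume.restrict Ω] fun x => χ x • grad v x + toL2 v x • gradFun χ x) :
    v' ∈ closure {v' : H1 Ω | ∃ w, SmoothRep v' w} := by
  -- Representatives cut off by the indicator vanish at every point outside `tsupport χ ∩ closure
  -- Ω`, which the support condition asks for pointwise.
  refine mem_closure_smooth hΩ (u := Ω.indicator fun x => χ x * toL2 v x)
    (G := Ω.indicator fun x => χ x • grad v x + toL2 v x • gradFun χ x)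
    (h1.trans ?_) (h2.trans ?_) hη H ?_
  · exact (indicator_ae_eq_restrict hΩ.measurableSet).symm
  · exact (indicator_ae_eq_restrict hΩ.measurableSet).symm
  · intro x hx
    by_cases hxΩ : x ∈ Ω
    · have hxt : x ∉ tsupport χ := fun h => hx ⟨h, subset_closure hxΩ⟩
      rw [Set.indicator_of_mem hxΩ, Set.indicator_of_mem hxΩ,
        gradFun_eq_zero_of_notMem_tsupport hxt, image_eq_zero_of_notMem_tsupport hxt,
        zero_mul, zero_smul, smul_zero, add_zero]
      exact ⟨rfl, rfl⟩
    · rw [Set.indicator_of_notMem hxΩ, Set.indicator_of_notMem hxΩ]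
      exact ⟨rfl, rfl⟩

open scoped Manifold in
theorem exists_smooth_partition {ι : Type} [Fintype ι] {S : Set (E n)} (hS : IsClosed S)
    {U : ι → Set (E n)} (hU : ∀ i, IsOpen (U i)) (hcov : S ⊆ ⋃ i, U i) :
    ∃ χ : ι → E n → ℂ, (∀ i, ContDiff ℝ ∞ (χ i)) ∧ (∀ i, tsupport (χ i) ⊆ U i) ∧
      ∀ x ∈ S, ∑ i, χ i x = 1 := by
  obtain ⟨f, hf⟩ := SmoothPartitionOfUnity.exists_isSubordinate 𝓘(ℝ, E n) hS U hU hcov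
  refine ⟨fun i x => (f i x : ℂ), fun i =>
    Complex.ofRealCLM.contDiff.comp (f i).contMDiff.contDiff, fun i =>
    (tsupport_comp_subset (g := ((↑) : ℝ → ℂ)) rfl (f i)).trans (hf i), fun x hx => ?_⟩
  have := f.sum_eq_one hx
  rw [finsum_eq_sum_of_fintype] at this
  rw [← Complex.ofReal_sum, this, Complex.ofReal_one]

theorem toL2_sum_ae {ι : Type} {v : H1 Ω} {v' : ι → H1 Ω} {χ : ι → E n → ℂ}
    (h : ∀ o, toL2 (v' o) =ᵐ[volume.restrict Ω] fun x => χ o x * toL2 v x) (s : Finset ι) :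
    toL2 (∑ o ∈ s, v' o) =ᵐ[volume.restrict Ω] fun x => (∑ o ∈ s, χ o x) * toL2 v x := by
  classical
  induction s using Finset.induction_on with
  | empty =>
    simp only [Finset.sum_empty, zero_mul]
    exact Lp.coeFn_zero _ _ _
  | insert a s ha ih =>
    rw [Finset.sum_insert ha, toL2_add]
    filter_upwards [Lp.coeFn_add (toL2 (v' a)) (toL2 (∑ o ∈ s, v' o)), h a, ih]
      with x h1 h2 h3
    rw [h1, Pi.add_apply, h2, h3, Finset.sum_insert ha, add_mul]

/-- A partition of unity splits `v` into one interior piece and one piece for each chart. The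
interior piece is mollified with centred bumps, the others with bumps shifted along the cone axis.
-/
theorem ConeData.dense_smoothH1 (D : ConeData Ω) (hΩ : IsOpen Ω) (hb : Bornology.IsBounded Ω) :
    Dense (smoothH1 Ω : Set (H1 Ω)) := by
  -- The index `none` stands for the interior, `some j` for the chart `j`.
  let U : Option (Fin D.N) → Set (E n) := fun o => o.elim Ω D.O
  have hU : ∀ o, IsOpen (U o) := by
    rintro (_ | j)
    · exact hΩ
    · exact D.isOpen_O j
  have hcov : closure Ω ⊆ ⋃ o, U o := by
    intro x hx
    rw [Set.mem_iUnion]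
    by_cases hxΩ : x ∈ Ω
    · exact ⟨none, hxΩ⟩
    · obtain ⟨j, hj⟩ := D.cover x (by rw [hΩ.frontier_eq]; exact ⟨hx, hxΩ⟩)
      exact ⟨some j, hj (Metric.mem_ball_self D.r_pos)⟩
  obtain ⟨χ, hχ, hχs, hsum⟩ := exists_smooth_partition isClosed_closure hU hcov
  intro v
  choose v' hv1 hv2 using fun o => H1.exists_smooth_mul hΩ hb v (hχ o)
  have hv : v = ∑ o, v' o := by
    apply H1.ext_toL2 hΩ
    apply Lp.ext
    filter_upwards [toL2_sum_ae hv1 Finset.univ, ae_restrict_mem hΩ.measurableSet] with x h1 h2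
    rw [h1, hsum x (subset_closure h2), one_mul]
  have hmem : ∀ o, v' o ∈ (smoothH1 Ω).topologicalClosure := by
    intro o
    have hSc : IsCompact (tsupport (χ o) ∩ closure Ω) :=
      hb.isCompact_closure.inter_left (isClosed_tsupport _)
    obtain ⟨η, hη, H⟩ : ∃ η > 0, ∀ ε > 0, ∃ (c : E n) (R : ℝ), 0 < R ∧ ‖c‖ + R < ε ∧
        ∀ x ∈ Ω, ∀ s ∈ tsupport (χ o) ∩ closure Ω, dist x s < η →
          ∀ z ∈ Metric.closedBall c R, x - z ∈ Ω := by
      rcases o with (_ | j)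
      · exact exists_interior_bumps hΩ hSc (Set.inter_subset_left.trans (hχs none))
      · exact D.exists_boundary_bumps j hSc (Set.inter_subset_left.trans (hχs (some j)))
    exact smooth_mul_mem_closure hΩ hη H (hv1 o) (hv2 o)
  rw [hv]
  exact Submodule.sum_mem (smoothH1 Ω).topologicalClosure fun o _ => hmem o

end

section

/-! ### Integrals over interior cones -/

variable {n : ℕ} {Ω : Set (E n)}

/-- The weight `‖w‖⁻ᵐ`. -/
def wt (m : ℕ) (w : E n) : ENNReal := ENNReal.ofReal ((‖w‖ ^ m)⁻¹)

theorem measurable_wt (m : ℕ) : Measurable (wt m : E n → ENNReal) :=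
  ((measurable_norm.pow_const m).inv).ennreal_ofReal

theorem wt_smul (m : ℕ) (w : E n) {s : ℝ} (hs : 0 < s) :
    wt m w = ENNReal.ofReal (s ^ m) * wt m (s • w) := by
  rw [wt, wt, ← ENNReal.ofReal_mul (by positivity), norm_smul, Real.norm_of_nonneg hs.le, mul_pow,
    mul_inv, ← mul_assoc, mul_inv_cancel₀ (by positivity), one_mul]

/-- The part of the boundary that is well inside the chart `j`. -/
def ConeData.S (D : ConeData Ω) (j : Fin D.N) : Set (E n) :=
  frontier Ω ∩ {y | Metric.ball y (D.r / 2) ⊆ D.O j}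

/-- The truncated cone of the chart `j`. -/
def ConeData.Γ (D : ConeData Ω) (j : Fin D.N) : Set (E n) :=
  cone D.κ (D.e j) ∩ Metric.ball 0 (D.r / 4)

theorem isClosed_setOf_ball_subset {X : Type*} [PseudoMetricSpace X] (O : Set X) (r : ℝ) :
    IsClosed {y | Metric.ball y r ⊆ O} := by
  have : {y | Metric.ball y r ⊆ O} = ⋂ z ∈ Oᶜ, {y | r ≤ dist z y} := by
    ext y
    simp only [Set.mem_iInter, Set.mem_compl_iff, Set.mem_ofPred_eq]
    constructor
    · intro h z hz
      by_contra hlt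
      exact hz (h (not_le.1 hlt))
    · intro h z hz
      by_contra hzO
      exact absurd (h z hzO) (not_le.2 hz)
  rw [this]
  exact isClosed_biInter fun z _ => isClosed_le continuous_const (by fun_prop)

theorem ConeData.measurableSet_S (D : ConeData Ω) (j : Fin D.N) : MeasurableSet (D.S j) :=
  (isClosed_frontier.inter (isClosed_setOf_ball_subset _ _)).measurableSet

theorem ConeData.measurableSet_Γ (D : ConeData Ω) (j : Fin D.N) : MeasurableSet (D.Γ j) :=
  ((isOpen_cone _ _).inter Metric.isOpen_ball).measurableSet

theorem ConeData.ball_add_subset (D : ConeData Ω) {j : Fin D.N} {y w : E n} (hy : y ∈ D.S j)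
    (hw : w ∈ D.Γ j) : Metric.ball (y + w) (D.κ * ‖w‖) ⊆ Ω := by
  refine D.cone_subset j y (frontier_subset_closure hy.1) (D.r / 2) hy.2 w hw.1 ?_
  have := hw.2
  rw [Metric.mem_ball, dist_zero_right] at this
  linarith

theorem ConeData.add_mem (D : ConeData Ω) {j : Fin D.N} {y w : E n} (hy : y ∈ D.S j)
    (hw : w ∈ D.Γ j) : y + w ∈ Ω :=
  D.ball_add_subset hy hw
    (Metric.mem_ball_self (mul_pos D.κ_pos (norm_pos_of_mem_cone hw.1)))

/-- The ball of radius `κ‖w‖` about `y + w` lies in the open set `Ω`, so it contains no boundary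
point. Thus a point of a cone is no closer to the boundary than a fixed multiple of its distance
from the vertex. -/
theorem ConeData.mul_norm_le (D : ConeData Ω) (hΩ : IsOpen Ω) {j : Fin D.N} {y w y' : E n}
    (hy : y ∈ D.S j) (hw : w ∈ D.Γ j) (hy' : y' ∈ frontier Ω) : D.κ * ‖w‖ ≤ ‖y + w - y'‖ := by
  by_contra! h
  have : y' ∈ Metric.ball (y + w) (D.κ * ‖w‖) := by
    rwa [Metric.mem_ball, dist_comm, dist_eq_norm]
  rw [hΩ.frontier_eq] at hy'
  exact hy'.2 (D.ball_add_subset hy hw this)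

theorem ConeData.smul_mem_Γ (D : ConeData Ω) {j : Fin D.N} {w : E n} {s : ℝ} (hs : 0 < s)
    (hs1 : s ≤ 1) (hw : w ∈ D.Γ j) : s • w ∈ D.Γ j := by
  refine ⟨smul_mem_cone hw.1 hs, ?_⟩
  have := hw.2
  rw [Metric.mem_ball, dist_zero_right] at this ⊢
  rw [norm_smul, Real.norm_of_nonneg hs.le]
  nlinarith [norm_nonneg w]

theorem ConeData.smul_axis_add_mem_Γ (D : ConeData Ω) {j : Fin D.N} {v : E n} {t : ℝ} (ht : 0 < t)
    (ht' : 2 * t < D.r / 4) (hv : ‖v‖ ≤ D.κ / 4 * t) : t • D.e j + v ∈ D.Γ j := by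
  have hκ := D.κ_pos
  have hκ1 := D.κ_le
  refine ⟨smul_add_mem_cone (by linarith) (D.norm_e j) ht hv hκ, ?_⟩
  rw [Metric.mem_ball, dist_zero_right]
  refine (norm_add_le _ _).trans_lt ?_
  rw [norm_smul, D.norm_e, mul_one, Real.norm_of_nonneg ht.le]
  nlinarith

/-- The half radius in the definition of `D.S` leaves room for a second boundary point in the same
chart, so the cones at both points have the same axis. -/
theorem ConeData.exists_mem_S (D : ConeData Ω) {y y' : E n} (hy : y ∈ frontier Ω)
    (hy' : y' ∈ frontier Ω) (hd : dist y y' ≤ D.r / 2) : ∃ j, y ∈ D.S j ∧ y' ∈ D.S j := by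
  obtain ⟨j, hj⟩ := D.cover y hy
  have hr := D.r_pos
  refine ⟨j, ⟨hy, (Metric.ball_subset_ball (by linarith)).trans hj⟩, hy', ?_⟩
  refine subset_trans (Metric.ball_subset_ball' ?_) hj
  rw [dist_comm]
  linarith

theorem ConeData.iUnion_S (D : ConeData Ω) : ⋃ j, D.S j = frontier Ω := by
  refine subset_antisymm (Set.iUnion_subset fun j => Set.inter_subset_left) fun y hy => ?_
  have hr := D.r_pos
  obtain ⟨j, hj, -⟩ := D.exists_mem_S hy hy (by rw [dist_self]; positivity)
  exact Set.mem_iUnion.2 ⟨j, hj⟩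

/-- A lower bound for the volume of truncated cones. -/
theorem ConeData.volume_Γ_ge (D : ConeData Ω) (j : Fin D.N) {ρ : ℝ} (hρ : 0 < ρ)
    (hρr : ρ ≤ D.r / 4) :
    ENNReal.ofReal ((D.κ / 16 * ρ) ^ n) * volume (Metric.ball (0 : E n) 1) ≤
      volume (D.Γ j ∩ Metric.ball 0 ρ) := by
  have hκ := D.κ_pos
  have hκ1 := D.κ_le
  have h1 : Metric.ball ((ρ / 4) • D.e j) (D.κ / 16 * ρ) ⊆ D.Γ j ∩ Metric.ball 0 ρ := by
    intro w hw
    rw [Metric.mem_ball, dist_eq_norm] at hw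
    have h2 : w = (ρ / 4) • D.e j + (w - (ρ / 4) • D.e j) := by abel
    refine ⟨?_, ?_⟩
    · rw [h2]
      exact D.smul_axis_add_mem_Γ (by positivity) (by linarith) (by linarith)
    · rw [Metric.mem_ball, dist_zero_right, h2]
      refine (norm_add_le _ _).trans_lt ?_
      rw [norm_smul, D.norm_e, mul_one, Real.norm_of_nonneg (by positivity)]
      nlinarith
  refine le_trans (le_of_eq ?_) (measure_mono h1)
  rw [Measure.addHaar_ball_of_pos _ ((ρ / 4) • D.e j) (by positivity), finrank_euclideanSpace_fin]

/-- All vertices whose cones contain `x` are at comparable distances from `x`, by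
`ConeData.mul_norm_le` in both directions. With `t` one of these distances, they lie in a ball of
radius `2t/κ`, where the weight is at most `(κt)^(1-n)`; the Ahlfors upper bound makes the product
independent of `t`. -/
theorem ConeData.lintegral_weight_le (D : ConeData Ω) (hΩ : IsOpen Ω) (j : Fin D.N) (x : E n) :
    ∫⁻ y in D.S j, (D.Γ j).indicator (wt (n - 1)) (x - y) ∂surfaceMeasure Ω ≤
      Ω.indicator (fun _ => ENNReal.ofReal (D.C * (2 / D.κ ^ 2) ^ (n - 1))) x := by
  have hκ := D.κ_pos
  by_cases hne : ∃ y ∈ D.S j, x - y ∈ D.Γ j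
  · obtain ⟨y₀, hy₀, hx₀⟩ := hne
    have hxΩ : x ∈ Ω := by
      have := D.add_mem hy₀ hx₀
      rwa [add_sub_cancel] at this
    rw [Set.indicator_of_mem hxΩ]
    set t := ‖x - y₀‖ with ht
    have ht0 : 0 < t := norm_pos_of_mem_cone hx₀.1
    have hbd : ∀ y ∈ D.S j, (D.Γ j).indicator (wt (n - 1)) (x - y) ≤
        (Metric.ball x (2 * t / D.κ)).indicator
          (fun _ => ENNReal.ofReal (((D.κ * t) ^ (n - 1))⁻¹)) y := by
      intro y hy
      by_cases hxy : x - y ∈ D.Γ j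
      · have h1 := D.mul_norm_le hΩ hy hxy hy₀.1
        have h2 := D.mul_norm_le hΩ hy₀ hx₀ hy.1
        rw [add_sub_cancel] at h1 h2
        have h3 : y ∈ Metric.ball x (2 * t / D.κ) := by
          rw [Metric.mem_ball, dist_comm, dist_eq_norm, lt_div_iff₀ hκ]
          linarith
        rw [Set.indicator_of_mem hxy, Set.indicator_of_mem h3]
        apply ENNReal.ofReal_le_ofReal
        have : 0 < D.κ * t := by positivity
        gcongr
      · rw [Set.indicator_of_notMem hxy]
        exact zero_le
    calc ∫⁻ y in D.S j, (D.Γ j).indicator (wt (n - 1)) (x - y) ∂surfaceMeasure Ω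
        ≤ ∫⁻ y in D.S j, (Metric.ball x (2 * t / D.κ)).indicator
          (fun _ => ENNReal.ofReal (((D.κ * t) ^ (n - 1))⁻¹)) y ∂surfaceMeasure Ω :=
          setLIntegral_mono' (D.measurableSet_S j) hbd
      _ ≤ ∫⁻ y, (Metric.ball x (2 * t / D.κ)).indicator
          (fun _ => ENNReal.ofReal (((D.κ * t) ^ (n - 1))⁻¹)) y ∂surfaceMeasure Ω :=
          setLIntegral_le_lintegral _ _
      _ = ENNReal.ofReal (((D.κ * t) ^ (n - 1))⁻¹) *
          surfaceMeasure Ω (Metric.ball x (2 * t / D.κ)) :=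
          lintegral_indicator_const Metric.isOpen_ball.measurableSet _
      _ ≤ ENNReal.ofReal (((D.κ * t) ^ (n - 1))⁻¹) *
          ENNReal.ofReal (D.C * (2 * t / D.κ) ^ (n - 1)) := by
          gcongr
          exact D.upper _ _ (by positivity)
      _ = ENNReal.ofReal (D.C * (2 / D.κ ^ 2) ^ (n - 1)) := by
          rw [← ENNReal.ofReal_mul (by positivity)]
          congr 1
          have : 2 * t / D.κ = (2 / D.κ ^ 2) * (D.κ * t) := by field_simp
          have h0 : (D.κ * t) ^ (n - 1) ≠ 0 := by positivity
          rw [this, mul_pow (2 / D.κ ^ 2)]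
          field_simp
  · push Not at hne
    have : ∫⁻ y in D.S j, (D.Γ j).indicator (wt (n - 1)) (x - y) ∂surfaceMeasure Ω =
        ∫⁻ y in D.S j, 0 ∂surfaceMeasure Ω :=
      setLIntegral_congr_fun (D.measurableSet_S j) fun y hy => Set.indicator_of_notMem (hne y hy) _
    rw [this, lintegral_zero]
    exact zero_le

/-- Integrating over all the cones with vertices on the boundary, with the weight `‖w‖^(1-n)`, is
controlled by the integral over the domain. -/
theorem ConeData.lintegral_cones_le (D : ConeData Ω) (hΩ : IsOpen Ω)
    [SFinite (surfaceMeasure Ω)] (j : Fin D.N) {φ : E n → ENNReal} (hφ : Measurable φ) :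
    ∫⁻ y in D.S j, (∫⁻ w in D.Γ j, φ (y + w) * wt (n - 1) w) ∂surfaceMeasure Ω ≤
      ENNReal.ofReal (D.C * (2 / D.κ ^ 2) ^ (n - 1)) * ∫⁻ x in Ω, φ x := by
  have hm : Measurable ((D.Γ j).indicator (wt (n - 1))) :=
    (measurable_wt _).indicator (D.measurableSet_Γ j)
  calc ∫⁻ y in D.S j, (∫⁻ w in D.Γ j, φ (y + w) * wt (n - 1) w) ∂surfaceMeasure Ω
      = ∫⁻ y in D.S j, (∫⁻ x, φ x * (D.Γ j).indicator (wt (n - 1)) (x - y)) ∂surfaceMeasure Ω := by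
        congr 1
        ext y
        rw [← lintegral_indicator (D.measurableSet_Γ j),
          ← lintegral_sub_right_eq_self (fun w => (D.Γ j).indicator
            (fun w => φ (y + w) * wt (n - 1) w) w) y]
        congr 1
        ext x
        by_cases hx : x - y ∈ D.Γ j
        · rw [Set.indicator_of_mem hx, Set.indicator_of_mem hx, add_sub_cancel]
        · rw [Set.indicator_of_notMem hx, Set.indicator_of_notMem hx, mul_zero]
    _ = ∫⁻ x, ∫⁻ y in D.S j, φ x * (D.Γ j).indicator (wt (n - 1)) (x - y) ∂surfaceMeasure Ω := by
        apply lintegral_lintegral_swap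
        apply Measurable.aemeasurable
        exact (hφ.comp measurable_snd).mul (hm.comp (measurable_snd.sub measurable_fst))
    _ ≤ ∫⁻ x, Ω.indicator
          (fun x => ENNReal.ofReal (D.C * (2 / D.κ ^ 2) ^ (n - 1)) * φ x) x := by
        refine lintegral_mono fun x => ?_
        rw [lintegral_const_mul]
        · refine (mul_le_mul_right (D.lintegral_weight_le hΩ j x) _).trans (le_of_eq ?_)
          by_cases hx : x ∈ Ω
          · rw [Set.indicator_of_mem hx, Set.indicator_of_mem hx, mul_comm]
          · rw [Set.indicator_of_notMem hx, Set.indicator_of_notMem hx, mul_zero]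
        · exact hm.comp (measurable_const.sub measurable_id)
    _ = ENNReal.ofReal (D.C * (2 / D.κ ^ 2) ^ (n - 1)) * ∫⁻ x in Ω, φ x := by
        rw [lintegral_indicator hΩ.measurableSet, lintegral_const_mul _ hφ]

/-- Points of the cones with vertices on the boundary avoid null sets. -/
theorem ConeData.ae_cone (D : ConeData Ω) {j : Fin D.N} {p : E n → Prop}
    (h : ∀ᵐ x ∂volume.restrict Ω, p x) (hΩ : IsOpen Ω) {y : E n} (hy : y ∈ D.S j) :
    ∀ᵐ w ∂volume.restrict (D.Γ j), p (y + w) := by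
  rw [ae_restrict_iff' hΩ.measurableSet] at h
  rw [ae_restrict_iff' (D.measurableSet_Γ j)]
  filter_upwards [(measurePreserving_add_left volume y).quasiMeasurePreserving.ae h] with w hw hwΓ
  exact hw (D.add_mem hy hwΓ)

/-- The weighted square integral of the differences between `u` on the cones and `g` at their
vertices. -/
def ConeData.coneEnergy (D : ConeData Ω) (j : Fin D.N) (u g : E n → ℂ) : ENNReal :=
  ∫⁻ y in D.S j, (∫⁻ w in D.Γ j, ‖u (y + w) - g y‖ₑ ^ 2 * wt (n + 1) w) ∂surfaceMeasure Ω

theorem enorm_fderiv_apply_le (u : E n → ℂ) (x w : E n) :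
    ‖fderiv ℝ u x w‖ₑ ≤ ‖w‖ₑ * ‖gradFun u x‖ₑ := by
  have h1 : fderiv ℝ u x w = ∑ i, (w i : ℂ) * partialDeriv i u x := by
    have h2 : w = ∑ i, w i • EuclideanSpace.single i (1 : ℝ) := by
      ext k
      simp [Finset.sum_apply, Pi.single_apply]
    conv_lhs => rw [h2, map_sum]
    refine Finset.sum_congr rfl fun i _ => ?_
    rw [map_smul, Complex.real_smul]
    rfl
  have h3 : ‖fderiv ℝ u x w‖ ≤ ‖w‖ * ‖gradFun u x‖ := by
    rw [h1]
    refine (norm_sum_le _ _).trans ?_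
    rw [EuclideanSpace.norm_eq w, EuclideanSpace.norm_eq (gradFun u x)]
    simp only [norm_mul, Complex.norm_real]
    exact Real.sum_mul_le_sqrt_mul_sqrt Finset.univ (fun i => ‖w i‖)
      (fun i => ‖partialDeriv i u x‖)
  rw [← ofReal_norm, ← ofReal_norm w, ← ofReal_norm (gradFun u x),
    ← ENNReal.ofReal_mul (norm_nonneg _)]
  exact ENNReal.ofReal_le_ofReal h3

theorem enorm_sub_le_lintegral_segment {u : E n → ℂ} (hu : ContDiff ℝ ∞ u) (y w : E n) :
    ‖u (y + w) - u y‖ₑ ≤ ‖w‖ₑ * ∫⁻ s in Set.Ioc (0 : ℝ) 1, ‖gradFun u (y + s • w)‖ₑ := by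
  have hd : ∀ s : ℝ, HasDerivAt (fun s : ℝ => u (y + s • w)) (fderiv ℝ u (y + s • w) w) s := by
    intro s
    have h1 : HasFDerivAt u (fderiv ℝ u (y + s • w)) (y + s • w) :=
      (hu.differentiable (by simp)).differentiableAt.hasFDerivAt
    have h2 : HasDerivAt (fun s : ℝ => y + s • w) w s := by
      simpa using ((hasDerivAt_id s).smul_const w).const_add y
    exact h1.comp_hasDerivAt s h2
  have hc : Continuous fun s : ℝ => fderiv ℝ u (y + s • w) w :=
    ((hu.continuous_fderiv (by simp)).comp (by fun_prop)).clm_apply continuous_const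
  have h := intervalIntegral.integral_eq_sub_of_hasDerivAt (a := 0) (b := 1)
    (fun s _ => hd s) (hc.intervalIntegrable _ _)
  simp only [one_smul, zero_smul, add_zero] at h
  rw [← h, intervalIntegral.integral_of_le zero_le_one, ← lintegral_const_mul' _ _ enorm_ne_top]
  refine (enorm_integral_le_lintegral_enorm _).trans (lintegral_mono fun s => ?_)
  exact enorm_fderiv_apply_le u _ w

theorem lintegral_rpow_neg_half :
    ∫⁻ s in Set.Ioc (0 : ℝ) 1, ENNReal.ofReal (s ^ (-(1 / 2) : ℝ)) = 2 := by
  rw [← ofReal_integral_eq_lintegral_ofReal]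
  · rw [← intervalIntegral.integral_of_le zero_le_one, integral_rpow (Or.inl (by norm_num))]
    norm_num
  · have := intervalIntegral.intervalIntegrable_rpow' (a := 0) (b := 1) (r := (-(1 / 2) : ℝ))
      (by norm_num)
    rwa [intervalIntegrable_iff_integrableOn_Ioc_of_le zero_le_one] at this
  · filter_upwards [ae_restrict_mem measurableSet_Ioc] with s hs
    exact Real.rpow_nonneg hs.1.le _

theorem ofReal_rpow_half_mul {s : ℝ} (hs : 0 < s) :
    ENNReal.ofReal (s ^ (-(1 / 2) : ℝ)) * ENNReal.ofReal (s ^ (1 / 2 : ℝ)) = 1 := by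
  rw [← ENNReal.ofReal_mul (by positivity), ← Real.rpow_add hs]
  norm_num

/-- Cauchy-Schwarz with the weight `s^(-1/2)`, whose integral is 2. The gained factor `s^(1/2)`
leaves an integrable power of `s` after rescaling a cone, which costs `s⁻¹`. -/
theorem sq_lintegral_Ioc_le {g : ℝ → ENNReal} (hg : Measurable g) :
    (∫⁻ s in Set.Ioc (0 : ℝ) 1, g s) ^ 2 ≤
      2 * ∫⁻ s in Set.Ioc (0 : ℝ) 1, ENNReal.ofReal (s ^ (1 / 2 : ℝ)) * g s ^ 2 := by
  have hm : ∀ p : ℝ, Measurable fun s : ℝ => ENNReal.ofReal (s ^ p) := fun p =>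
    (measurable_id.pow_const p).ennreal_ofReal
  have h := lintegral_weighted_sq_le (μ := volume.restrict (Set.Ioc (0 : ℝ) 1))
    (a := fun s => ENNReal.ofReal (s ^ (-(1 / 2) : ℝ)))
    (b := fun s => ENNReal.ofReal (s ^ (1 / 2 : ℝ)) * g s) (hm _).aemeasurable
    ((hm _).mul hg).aemeasurable
  rw [lintegral_rpow_neg_half] at h
  refine le_trans (le_of_eq ?_) (h.trans (le_of_eq ?_))
  · congr 1
    refine setLIntegral_congr_fun measurableSet_Ioc fun s hs => ?_
    simp only [← mul_assoc, ofReal_rpow_half_mul hs.1, one_mul]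
  · congr 1
    refine setLIntegral_congr_fun measurableSet_Ioc fun s hs => ?_
    simp only [mul_pow]
    rw [pow_two (ENNReal.ofReal _), ← mul_assoc, ← mul_assoc, ofReal_rpow_half_mul hs.1, one_mul]

theorem lintegral_comp_smul_pos (f : E n → ENNReal) {s : ℝ} (hs : 0 < s) :
    ∫⁻ x, f (s • x) = ENNReal.ofReal (s ^ n)⁻¹ * ∫⁻ x, f x := by
  have h := Measure.map_addHaar_smul (volume : Measure (E n)) hs.ne'
  rw [finrank_euclideanSpace_fin, abs_of_pos (by positivity)] at h
  have h2 := lintegral_map_equiv (μ := (volume : Measure (E n))) f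
    (Homeomorph.smulOfNeZero s hs.ne').toMeasurableEquiv
  rw [← smul_eq_mul, ← lintegral_smul_measure, ← h]
  exact h2.symm

/-- Rescaling the integral over a cone. -/
theorem ConeData.lintegral_Γ_smul_le (D : ConeData Ω) (hn : 1 ≤ n) (j : Fin D.N)
    (φ : E n → ENNReal) (y : E n) {s : ℝ} (hs : 0 < s) (hs1 : s ≤ 1) :
    ∫⁻ w in D.Γ j, φ (y + s • w) * wt (n - 1) w ≤
      ENNReal.ofReal s⁻¹ * ∫⁻ w in D.Γ j, φ (y + w) * wt (n - 1) w := by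
  rw [← lintegral_indicator (D.measurableSet_Γ j), ← lintegral_indicator (D.measurableSet_Γ j)]
  set F : E n → ENNReal := fun w => (D.Γ j).indicator (fun w => φ (y + w) * wt (n - 1) w) w with hF
  have h1 : ∀ w, (D.Γ j).indicator (fun w => φ (y + s • w) * wt (n - 1) w) w ≤
      ENNReal.ofReal (s ^ (n - 1)) * F (s • w) := by
    intro w
    by_cases hw : w ∈ D.Γ j
    · rw [hF]
      simp only
      rw [Set.indicator_of_mem hw, Set.indicator_of_mem (D.smul_mem_Γ hs hs1 hw),
        wt_smul (n - 1) w hs]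
      exact le_of_eq (by ring)
    · rw [Set.indicator_of_notMem hw]
      exact zero_le
  refine (lintegral_mono h1).trans ?_
  rw [lintegral_const_mul' _ _ ENNReal.ofReal_ne_top,
    lintegral_comp_smul_pos F hs, ← mul_assoc, ← ENNReal.ofReal_mul (by positivity)]
  refine le_of_eq ?_
  congr 2
  obtain ⟨m, rfl⟩ : ∃ m, n = m + 1 := ⟨n - 1, by omega⟩
  rw [Nat.add_sub_cancel, pow_succ]
  field_simp

/-- The energy of a smooth function on the cones is controlled by its Dirichlet integral. -/
theorem ConeData.coneEnergy_le (D : ConeData Ω) (hn : 1 ≤ n) (hΩ : IsOpen Ω)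
    [SFinite (surfaceMeasure Ω)] (j : Fin D.N) {u : E n → ℂ} (hu : ContDiff ℝ ∞ u) :
    D.coneEnergy j u u ≤ 4 * (ENNReal.ofReal (D.C * (2 / D.κ ^ 2) ^ (n - 1)) *
      ∫⁻ x in Ω, ‖gradFun u x‖ₑ ^ 2) := by
  set g : E n → ENNReal := fun x => ‖gradFun u x‖ₑ ^ 2 with hg
  have hgc : Continuous (gradFun u) := continuous_gradFun hu
  have hgm : Measurable g := hgc.measurable.enorm.pow_const 2
  set A := ENNReal.ofReal (D.C * (2 / D.κ ^ 2) ^ (n - 1)) * ∫⁻ x in Ω, g x with hA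
  have hpow : Measurable fun s : ℝ => ENNReal.ofReal (s ^ (1 / 2 : ℝ)) :=
    (measurable_id.pow_const _).ennreal_ofReal
  have hpt : ∀ y, ∀ w ∈ D.Γ j, ‖u (y + w) - u y‖ₑ ^ 2 * wt (n + 1) w ≤
      2 * ∫⁻ s in Set.Ioc (0 : ℝ) 1,
        ENNReal.ofReal (s ^ (1 / 2 : ℝ)) * (g (y + s • w) * wt (n - 1) w) := by
    intro y w hw
    have hw0 : 0 < ‖w‖ := norm_pos_of_mem_cone hw.1
    have h1 := pow_le_pow_left' (enorm_sub_le_lintegral_segment hu y w) 2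
    have h2 := sq_lintegral_Ioc_le (g := fun s => ‖gradFun u (y + s • w)‖ₑ)
      ((hgc.comp (by fun_prop : Continuous fun s : ℝ => y + s • w)).measurable.enorm)
    -- The square of the segment length lowers the exponent to `n - 1`, the one for which
    -- integration over all cones is bounded by integration over `Ω`.
    have h3 : ‖w‖ₑ ^ 2 * wt (n + 1) w = wt (n - 1) w := by
      rw [wt, wt, ← ofReal_norm, ← ENNReal.ofReal_pow (norm_nonneg _),
        ← ENNReal.ofReal_mul (by positivity)]
      congr 1
      obtain ⟨m, rfl⟩ : ∃ m, n = m + 1 := ⟨n - 1, by omega⟩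
      rw [Nat.add_sub_cancel]
      field_simp
      ring
    calc ‖u (y + w) - u y‖ₑ ^ 2 * wt (n + 1) w
        ≤ (‖w‖ₑ * ∫⁻ s in Set.Ioc (0 : ℝ) 1, ‖gradFun u (y + s • w)‖ₑ) ^ 2 * wt (n + 1) w := by
          gcongr
      _ = (∫⁻ s in Set.Ioc (0 : ℝ) 1, ‖gradFun u (y + s • w)‖ₑ) ^ 2 * wt (n - 1) w := by
          rw [mul_pow, ← h3]; ring
      _ ≤ (2 * ∫⁻ s in Set.Ioc (0 : ℝ) 1, ENNReal.ofReal (s ^ (1 / 2 : ℝ)) *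
            ‖gradFun u (y + s • w)‖ₑ ^ 2) * wt (n - 1) w := by gcongr
      _ = _ := by
          have : wt (n - 1) w ≠ ⊤ := ENNReal.ofReal_ne_top
          rw [mul_assoc, ← lintegral_mul_const' _ _ this]
          simp only [hg, mul_assoc]
  have hm3 : Measurable fun p : (E n × E n) × ℝ =>
      ENNReal.ofReal (p.2 ^ (1 / 2 : ℝ)) * (g (p.1.1 + p.2 • p.1.2) * wt (n - 1) p.1.2) := by
    refine (hpow.comp measurable_snd).mul ((hgm.comp ?_).mul
      ((measurable_wt _).comp measurable_fst.snd))
    exact (by fun_prop : Continuous fun p : (E n × E n) × ℝ => p.1.1 + p.2 • p.1.2).measurable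
  calc D.coneEnergy j u u
      ≤ ∫⁻ y in D.S j, (∫⁻ w in D.Γ j, 2 * ∫⁻ s in Set.Ioc (0 : ℝ) 1,
        ENNReal.ofReal (s ^ (1 / 2 : ℝ)) * (g (y + s • w) * wt (n - 1) w)) ∂surfaceMeasure Ω :=
        lintegral_mono fun y => setLIntegral_mono' (D.measurableSet_Γ j) (hpt y)
    _ = 2 * ∫⁻ y in D.S j, (∫⁻ s in Set.Ioc (0 : ℝ) 1, ∫⁻ w in D.Γ j,
        ENNReal.ofReal (s ^ (1 / 2 : ℝ)) * (g (y + s • w) * wt (n - 1) w)) ∂surfaceMeasure Ω := by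
        rw [← lintegral_const_mul' _ _ (by norm_num)]
        congr 1
        ext y
        rw [lintegral_const_mul' _ _ (by norm_num)]
        congr 1
        apply lintegral_lintegral_swap
        apply Measurable.aemeasurable
        exact hm3.comp ((measurable_const.prodMk measurable_fst).prodMk measurable_snd)
    _ = 2 * ∫⁻ s in Set.Ioc (0 : ℝ) 1, ∫⁻ y in D.S j, (∫⁻ w in D.Γ j,
        ENNReal.ofReal (s ^ (1 / 2 : ℝ)) * (g (y + s • w) * wt (n - 1) w)) ∂surfaceMeasure Ω := by
        congr 1
        apply lintegral_lintegral_swap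
        apply Measurable.aemeasurable
        have : Measurable fun p : (E n × ℝ) × E n => ENNReal.ofReal (p.1.2 ^ (1 / 2 : ℝ)) *
            (g (p.1.1 + p.1.2 • p.2) * wt (n - 1) p.2) :=
          hm3.comp ((measurable_fst.fst.prodMk measurable_snd).prodMk measurable_fst.snd)
        exact this.lintegral_prod_right'
    -- For fixed `s` the substitution `s • w → w` maps the cone into itself and costs `s⁻¹`;
    -- combined with `s^(1/2)` this leaves `s^(-1/2)`.
    _ ≤ 2 * ∫⁻ s in Set.Ioc (0 : ℝ) 1, ENNReal.ofReal (s ^ (-(1 / 2) : ℝ)) * A := by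
        gcongr 2 * ?_
        refine setLIntegral_mono' measurableSet_Ioc fun s hs => ?_
        have h1 : ∀ y, ∫⁻ w in D.Γ j,
            ENNReal.ofReal (s ^ (1 / 2 : ℝ)) * (g (y + s • w) * wt (n - 1) w) ≤
            ENNReal.ofReal (s ^ (-(1 / 2) : ℝ)) * ∫⁻ w in D.Γ j, g (y + w) * wt (n - 1) w := by
          intro y
          rw [lintegral_const_mul' _ _ ENNReal.ofReal_ne_top]
          refine (mul_le_mul_right (D.lintegral_Γ_smul_le hn j g y hs.1 hs.2) _).trans ?_
          rw [← mul_assoc, ← ENNReal.ofReal_mul (Real.rpow_nonneg hs.1.le _),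
            ← Real.rpow_neg_one, ← Real.rpow_add hs.1]
          norm_num
        refine (lintegral_mono h1).trans ?_
        rw [lintegral_const_mul' _ _ ENNReal.ofReal_ne_top]
        gcongr
        exact D.lintegral_cones_le hΩ j hgm
    _ = 4 * A := by
        have : Measurable fun s : ℝ => ENNReal.ofReal (s ^ (-(1 / 2) : ℝ)) :=
          (measurable_id.pow_const _).ennreal_ofReal
        rw [lintegral_mul_const _ this, lintegral_rpow_neg_half, ← mul_assoc]
        norm_num

end

section

/-! ### Boundary norms and the cone energy -/

variable {n : ℕ} {Ω : Set (E n)}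

theorem ennreal_add_sq_le (a b : ENNReal) : (a + b) ^ 2 ≤ 2 * (a ^ 2 + b ^ 2) := by
  by_cases ha : a = ⊤
  · simp [ha]
  by_cases hb : b = ⊤
  · simp [hb]
  lift a to NNReal using ha
  lift b to NNReal using hb
  exact_mod_cast add_sq_le (a := a) (b := b)

theorem enorm_sq_le_two_mul {F : Type*} [NormedAddCommGroup F] (a b : F) :
    ‖a‖ₑ ^ 2 ≤ 2 * (‖b - a‖ₑ ^ 2 + ‖b‖ₑ ^ 2) := by
  refine le_trans ?_ (ennreal_add_sq_le _ _)
  gcongr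
  calc ‖a‖ₑ = ‖b - (b - a)‖ₑ := by rw [sub_sub_cancel]
    _ ≤ ‖b‖ₑ + ‖b - a‖ₑ := enorm_sub_le
    _ = ‖b - a‖ₑ + ‖b‖ₑ := add_comm _ _

theorem one_le_ofReal_mul_wt {w : E n} {ρ : ℝ} (hw : 0 < ‖w‖) (hwρ : ‖w‖ ≤ ρ) (m : ℕ) :
    1 ≤ ENNReal.ofReal (ρ ^ m) * wt m w := by
  have hρ : 0 ≤ ρ := hw.le.trans hwρ
  rw [wt, ← ENNReal.ofReal_mul (by positivity), ← ENNReal.ofReal_one]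
  apply ENNReal.ofReal_le_ofReal
  rw [← div_eq_mul_inv, one_le_div (by positivity)]
  gcongr

theorem ConeData.measurable_inner (D : ConeData Ω) (j : Fin D.N) {u g : E n → ℂ}
    (hu : Measurable u) (hg : Measurable g) {F : E n × E n → ENNReal} (hF : Measurable F) :
    Measurable fun y => ∫⁻ w in D.Γ j, ‖u (y + w) - g y‖ₑ ^ 2 * F (y, w) := by
  have : Measurable fun p : E n × E n => ‖u (p.1 + p.2) - g p.1‖ₑ ^ 2 * F p :=
    (((hu.comp (measurable_fst.add measurable_snd)).sub
      (hg.comp measurable_fst)).enorm.pow_const 2).mul hF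
  exact this.lintegral_prod_right'

/-- The inequality `|g|² ≤ 2|u - g|² + 2|u|²` is integrated over the cone truncated at radius `ρ`,
where `1 ≤ ρ^m ‖w‖^(-m)` for `m = n ± 1`. Dividing by the volume, of order `ρ^n`, leaves `ρ` in
front of the energy and `ρ⁻¹` in front of the `L²` term. -/
theorem ConeData.lintegral_S_le (D : ConeData Ω) (hn : 1 ≤ n) (hΩ : IsOpen Ω)
    [SFinite (surfaceMeasure Ω)] (j : Fin D.N) {u g : E n → ℂ} (hu : Measurable u)
    (hg : Measurable g) {ρ : ℝ} (hρ : 0 < ρ) (hρr : ρ ≤ D.r / 4) :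
    ENNReal.ofReal ((D.κ / 16) ^ n) * volume (Metric.ball (0 : E n) 1) *
      ∫⁻ y in D.S j, ‖g y‖ₑ ^ 2 ∂surfaceMeasure Ω ≤
      ENNReal.ofReal ρ * (2 * D.coneEnergy j u g) + ENNReal.ofReal ρ⁻¹ *
        (2 * (ENNReal.ofReal (D.C * (2 / D.κ ^ 2) ^ (n - 1)) * ∫⁻ x in Ω, ‖u x‖ₑ ^ 2)) := by
  set v := volume (Metric.ball (0 : E n) 1) with hv
  have hκ := D.κ_pos
  have hpt : ∀ y, ENNReal.ofReal ((D.κ / 16 * ρ) ^ n) * v * ‖g y‖ₑ ^ 2 ≤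
      ENNReal.ofReal (ρ ^ (n + 1)) * (2 * ∫⁻ w in D.Γ j, ‖u (y + w) - g y‖ₑ ^ 2 * wt (n + 1) w) +
      ENNReal.ofReal (ρ ^ (n - 1)) * (2 * ∫⁻ w in D.Γ j, ‖u (y + w)‖ₑ ^ 2 * wt (n - 1) w) := by
    intro y
    have hm1 : Measurable fun w => ‖u (y + w) - g y‖ₑ ^ 2 * wt (n + 1) w :=
      (((hu.comp (measurable_const.add measurable_id)).sub measurable_const).enorm.pow_const 2).mul
        (measurable_wt _)
    calc ENNReal.ofReal ((D.κ / 16 * ρ) ^ n) * v * ‖g y‖ₑ ^ 2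
        ≤ volume (D.Γ j ∩ Metric.ball 0 ρ) * ‖g y‖ₑ ^ 2 := by
          gcongr
          exact D.volume_Γ_ge j hρ hρr
      _ = ∫⁻ w in D.Γ j ∩ Metric.ball 0 ρ, ‖g y‖ₑ ^ 2 := by
          rw [setLIntegral_const, mul_comm]
      _ ≤ ∫⁻ w in D.Γ j ∩ Metric.ball 0 ρ,
          (ENNReal.ofReal (ρ ^ (n + 1)) * (2 * (‖u (y + w) - g y‖ₑ ^ 2 * wt (n + 1) w)) +
          ENNReal.ofReal (ρ ^ (n - 1)) * (2 * (‖u (y + w)‖ₑ ^ 2 * wt (n - 1) w))) := by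
          refine setLIntegral_mono' ((D.measurableSet_Γ j).inter Metric.isOpen_ball.measurableSet)
            fun w hw => ?_
          have hw0 := norm_pos_of_mem_cone hw.1.1
          have hw1 : ‖w‖ ≤ ρ := by
            have := hw.2
            rw [Metric.mem_ball, dist_zero_right] at this
            exact this.le
          refine (enorm_sq_le_two_mul (g y) (u (y + w))).trans ?_
          rw [mul_add]
          refine add_le_add ?_ ?_
          · calc 2 * ‖u (y + w) - g y‖ₑ ^ 2 = 1 * (2 * ‖u (y + w) - g y‖ₑ ^ 2) := (one_mul _).symm
              _ ≤ (ENNReal.ofReal (ρ ^ (n + 1)) * wt (n + 1) w) *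
                  (2 * ‖u (y + w) - g y‖ₑ ^ 2) := by
                  gcongr
                  exact one_le_ofReal_mul_wt hw0 hw1 _
              _ = _ := by ring
          · calc 2 * ‖u (y + w)‖ₑ ^ 2 = 1 * (2 * ‖u (y + w)‖ₑ ^ 2) := (one_mul _).symm
              _ ≤ (ENNReal.ofReal (ρ ^ (n - 1)) * wt (n - 1) w) * (2 * ‖u (y + w)‖ₑ ^ 2) := by
                  gcongr
                  exact one_le_ofReal_mul_wt hw0 hw1 _
              _ = _ := by ring
      _ ≤ ∫⁻ w in D.Γ j,
          (ENNReal.ofReal (ρ ^ (n + 1)) * (2 * (‖u (y + w) - g y‖ₑ ^ 2 * wt (n + 1) w)) +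
          ENNReal.ofReal (ρ ^ (n - 1)) * (2 * (‖u (y + w)‖ₑ ^ 2 * wt (n - 1) w))) :=
          lintegral_mono_set Set.inter_subset_left
      _ = _ := by
          rw [lintegral_add_left ((hm1.const_mul 2).const_mul _),
            lintegral_const_mul' _ _ ENNReal.ofReal_ne_top,
            lintegral_const_mul' _ _ ENNReal.ofReal_ne_top, lintegral_const_mul' _ _ (by norm_num),
            lintegral_const_mul' _ _ (by norm_num)]
  have hint := lintegral_mono (μ := (surfaceMeasure Ω).restrict (D.S j)) hpt
  have hcn : ENNReal.ofReal ((D.κ / 16 * ρ) ^ n) * v ≠ ⊤ :=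
    ENNReal.mul_ne_top ENNReal.ofReal_ne_top measure_ball_lt_top.ne
  have hmm : Measurable fun y => ∫⁻ w in D.Γ j, ‖u (y + w) - g y‖ₑ ^ 2 * wt (n + 1) w :=
    D.measurable_inner j hu hg ((measurable_wt (n + 1)).comp measurable_snd)
  rw [lintegral_const_mul' _ _ hcn, lintegral_add_left ((hmm.const_mul 2).const_mul _),
    lintegral_const_mul' _ _ ENNReal.ofReal_ne_top, lintegral_const_mul' _ _ ENNReal.ofReal_ne_top,
    lintegral_const_mul' _ _ (by norm_num), lintegral_const_mul' _ _ (by norm_num)] at hint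
  have hcone := D.lintegral_cones_le hΩ j (φ := fun x => ‖u x‖ₑ ^ 2) (hu.enorm.pow_const 2)
  have e1 : ENNReal.ofReal ((ρ ^ n)⁻¹) * ENNReal.ofReal ((D.κ / 16 * ρ) ^ n) =
      ENNReal.ofReal ((D.κ / 16) ^ n) := by
    rw [← ENNReal.ofReal_mul (by positivity), mul_pow]
    congr 1
    field_simp
  have e2 : ENNReal.ofReal ((ρ ^ n)⁻¹) * ENNReal.ofReal (ρ ^ (n + 1)) = ENNReal.ofReal ρ := by
    rw [← ENNReal.ofReal_mul (by positivity), pow_succ]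
    congr 1
    field_simp
  have e3 : ENNReal.ofReal ((ρ ^ n)⁻¹) * ENNReal.ofReal (ρ ^ (n - 1)) = ENNReal.ofReal ρ⁻¹ := by
    rw [← ENNReal.ofReal_mul (by positivity)]
    congr 1
    obtain ⟨m, rfl⟩ : ∃ m, n = m + 1 := ⟨n - 1, by omega⟩
    rw [Nat.add_sub_cancel, pow_succ]
    field_simp
  calc ENNReal.ofReal ((D.κ / 16) ^ n) * v * ∫⁻ y in D.S j, ‖g y‖ₑ ^ 2 ∂surfaceMeasure Ω
      = ENNReal.ofReal ((ρ ^ n)⁻¹) * (ENNReal.ofReal ((D.κ / 16 * ρ) ^ n) * v *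
          ∫⁻ y in D.S j, ‖g y‖ₑ ^ 2 ∂surfaceMeasure Ω) := by
        rw [← mul_assoc, ← mul_assoc, e1]
    _ ≤ ENNReal.ofReal ((ρ ^ n)⁻¹) * (ENNReal.ofReal (ρ ^ (n + 1)) * (2 * D.coneEnergy j u g) +
        ENNReal.ofReal (ρ ^ (n - 1)) * (2 *
          (ENNReal.ofReal (D.C * (2 / D.κ ^ 2) ^ (n - 1)) * ∫⁻ x in Ω, ‖u x‖ₑ ^ 2))) := by
        gcongr
        refine hint.trans ?_
        refine add_le_add le_rfl ?_
        gcongr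
    _ = _ := by
        rw [mul_add, ← mul_assoc, ← mul_assoc (ENNReal.ofReal ((ρ ^ n)⁻¹)), e2, e3]

/-- The square integral of `u - g` over the part of the cone at distance about `ρ` of its vertex. -/
def ConeData.shell (D : ConeData Ω) (j : Fin D.N) (u g : E n → ℂ) (y : E n) (ρ : ℝ) : ENNReal :=
  ∫⁻ w in D.Γ j, ‖u (y + w) - g y‖ₑ ^ 2 *
    {q : E n × ℝ | q.2 ≤ ‖q.1‖ ∧ ‖q.1‖ ≤ (8 / D.κ + 2) * q.2}.indicator 1 (w, ρ)

theorem measurableSet_shell (T : ℝ) :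
    MeasurableSet {q : E n × ℝ | q.2 ≤ ‖q.1‖ ∧ ‖q.1‖ ≤ T * q.2} :=
  (measurableSet_le measurable_snd measurable_fst.norm).inter
    (measurableSet_le measurable_fst.norm (measurable_snd.const_mul T))

theorem ConeData.measurable_shell (D : ConeData Ω) (j : Fin D.N) {u g : E n → ℂ}
    (hu : Measurable u) (hg : Measurable g) :
    Measurable fun p : E n × E n => D.shell j u g p.1 ‖p.1 - p.2‖ := by
  have h1 : Measurable fun q : (E n × E n) × E n => ‖u (q.1.1 + q.2) - g q.1.1‖ₑ ^ 2 *
      {q : E n × ℝ | q.2 ≤ ‖q.1‖ ∧ ‖q.1‖ ≤ (8 / D.κ + 2) * q.2}.indicator (1 : E n × ℝ → ENNReal)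
        (q.2, ‖q.1.1 - q.1.2‖) := by
    refine (((hu.comp (measurable_fst.fst.add measurable_snd)).sub
      (hg.comp measurable_fst.fst)).enorm.pow_const 2).mul ?_
    exact (measurable_one.indicator (measurableSet_shell _)).comp
      (measurable_snd.prodMk (measurable_fst.fst.sub measurable_fst.snd).norm)
  exact h1.lintegral_prod_right'

/-- Comparing two boundary values through a ball inside of both cones. -/
theorem ConeData.enorm_sub_sq_le_shell (D : ConeData Ω) (j : Fin D.N) {u g : E n → ℂ}
    (hu : Measurable u) {y y' : E n}
    (h0 : y ≠ y') (hd : ‖y - y'‖ < D.κ * D.r / 64) :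
    volume (Metric.ball (0 : E n) 1) * (‖g y - g y'‖ₑ ^ 2 * wt n (y - y')) ≤
      2 * (wt (2 * n) (y - y') *
        (D.shell j u g y ‖y - y'‖ + D.shell j u g y' ‖y - y'‖)) := by
  set ρ := ‖y - y'‖ with hρ
  have hρ0 : 0 < ρ := norm_pos_iff.2 (sub_ne_zero.2 h0)
  have hκ := D.κ_pos
  have hκ1 := D.κ_le
  -- With `κt = 8ρ`, a perturbation of `t • e` of length at most `2ρ` stays in the cone, which
  -- allows both for `y - y'` and for a ball of radius `ρ`.
  set t := 8 / D.κ * ρ with ht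
  have htρ : D.κ * t = 8 * ρ := by rw [ht]; field_simp
  have ht0 : 0 < t := by positivity
  have ht2 : 2 * t < D.r / 4 := by
    have : D.κ * (2 * t) < D.κ * (D.r / 4) := by linarith
    exact lt_of_mul_lt_mul_left this hκ.le
  have hsh : ∀ (z : E n) (a : E n), ‖a‖ ≤ ρ →
      ∫⁻ v in Metric.ball (0 : E n) ρ, ‖u (z + (t • D.e j + a + v)) - g z‖ₑ ^ 2 ≤
        D.shell j u g z ρ := by
    intro z a ha
    set F : E n → ENNReal := fun w => (D.Γ j).indicator (fun w => ‖u (z + w) - g z‖ₑ ^ 2 *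
      {q : E n × ℝ | q.2 ≤ ‖q.1‖ ∧ ‖q.1‖ ≤ (8 / D.κ + 2) * q.2}.indicator 1 (w, ρ)) w with hF
    rw [ConeData.shell, ← lintegral_indicator (D.measurableSet_Γ j),
      ← lintegral_indicator Metric.isOpen_ball.measurableSet,
      ← lintegral_add_left_eq_self F (t • D.e j + a)]
    refine lintegral_mono fun v => ?_
    by_cases hv : v ∈ Metric.ball (0 : E n) ρ
    · rw [Set.indicator_of_mem hv]
      rw [Metric.mem_ball, dist_zero_right] at hv
      have hav : ‖a + v‖ ≤ 2 * ρ := (norm_add_le _ _).trans (by linarith)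
      have hte : ‖t • D.e j‖ = t := by
        rw [norm_smul, D.norm_e, mul_one, Real.norm_of_nonneg ht0.le]
      have hmem : t • D.e j + a + v ∈ D.Γ j := by
        rw [add_assoc]
        exact D.smul_axis_add_mem_Γ ht0 ht2 (by linarith)
      have hup : ‖t • D.e j + a + v‖ ≤ (8 / D.κ + 2) * ρ := by
        rw [add_assoc, add_mul, ← ht]
        refine (norm_add_le _ _).trans ?_
        rw [hte]; linarith
      have hlow : ρ ≤ ‖t • D.e j + a + v‖ := by
        have h1 : t ≤ ‖t • D.e j + a + v‖ + ‖a + v‖ := by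
          have : t • D.e j = (t • D.e j + a + v) - (a + v) := by abel
          calc t = ‖t • D.e j‖ := hte.symm
            _ = ‖(t • D.e j + a + v) - (a + v)‖ := by rw [← this]
            _ ≤ _ := norm_sub_le _ _
        nlinarith
      have hmem2 : (t • D.e j + a + v, ρ) ∈
          {q : E n × ℝ | q.2 ≤ ‖q.1‖ ∧ ‖q.1‖ ≤ (8 / D.κ + 2) * q.2} := ⟨hlow, hup⟩
      simp only [hF]
      rw [Set.indicator_of_mem hmem, Set.indicator_of_mem hmem2, Pi.one_apply, mul_one]
    · rw [Set.indicator_of_notMem hv]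
      exact zero_le
  have h1 : volume (Metric.ball (0 : E n) ρ) * ‖g y - g y'‖ₑ ^ 2 ≤
      2 * (D.shell j u g y ρ + D.shell j u g y' ρ) := by
    calc volume (Metric.ball (0 : E n) ρ) * ‖g y - g y'‖ₑ ^ 2
        = ∫⁻ v in Metric.ball (0 : E n) ρ, ‖g y - g y'‖ₑ ^ 2 := by
          rw [setLIntegral_const, mul_comm]
      _ ≤ ∫⁻ v in Metric.ball (0 : E n) ρ, 2 * (‖u (y + (t • D.e j + 0 + v)) - g y‖ₑ ^ 2 +
          ‖u (y' + (t • D.e j + (y - y') + v)) - g y'‖ₑ ^ 2) := by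
          refine lintegral_mono fun v => ?_
          -- The same interior point seen from both vertices, so the value of `u` there links `g y`
          -- to `g y'`.
          have h2 : y' + (t • D.e j + (y - y') + v) = y + (t • D.e j + 0 + v) := by abel
          rw [h2]
          set z := u (y + (t • D.e j + 0 + v))
          refine le_trans ?_ (ennreal_add_sq_le _ _)
          gcongr
          have h3 : g y - g y' = (z - g y') - (z - g y) := by abel
          rw [h3, add_comm]
          exact enorm_sub_le
      _ ≤ 2 * (D.shell j u g y ρ + D.shell j u g y' ρ) := by
          rw [lintegral_const_mul' _ _ (by norm_num), lintegral_add_left]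
          · gcongr
            · exact hsh y 0 (by simpa using hρ0.le)
            · exact hsh y' (y - y') le_rfl
          · exact ((hu.comp (by fun_prop)).sub measurable_const).enorm.pow_const 2
  rw [Measure.addHaar_ball_of_pos _ _ hρ0, finrank_euclideanSpace_fin] at h1
  -- The volume `ρ^n` of the averaging ball accounts for the passage from the weight `‖y - y'‖^(-n)`
  -- to `‖y - y'‖^(-2n)`.
  have e1 : wt n (y - y') = wt (2 * n) (y - y') * ENNReal.ofReal (ρ ^ n) := by
    rw [wt, wt, ← ENNReal.ofReal_mul (by positivity), ← hρ]
    congr 1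
    rw [two_mul, pow_add]
    field_simp
  calc volume (Metric.ball (0 : E n) 1) * (‖g y - g y'‖ₑ ^ 2 * wt n (y - y'))
      = wt (2 * n) (y - y') * (ENNReal.ofReal (ρ ^ n) * volume (Metric.ball (0 : E n) 1) *
          ‖g y - g y'‖ₑ ^ 2) := by rw [e1]; ring
    _ ≤ wt (2 * n) (y - y') * (2 * (D.shell j u g y ρ + D.shell j u g y' ρ)) := by gcongr
    _ = _ := by ring

/-- For fixed `w` the shell condition makes `‖y - y'‖` comparable to `‖w‖`, so the weight is of
order `‖w‖^(-2n)` on a boundary ball of measure at most of order `‖w‖^(n-1)`. The product is the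
weight of the cone energy. -/
theorem ConeData.lintegral_wt_shell_le (D : ConeData Ω) (hn : 1 ≤ n) (y : E n) {w : E n}
    (hw : 0 < ‖w‖) (A : Set (E n)) :
    ∫⁻ y' in A, wt (2 * n) (y - y') *
      {q : E n × ℝ | q.2 ≤ ‖q.1‖ ∧ ‖q.1‖ ≤ (8 / D.κ + 2) * q.2}.indicator 1 (w, ‖y - y'‖)
        ∂surfaceMeasure Ω ≤
      ENNReal.ofReal ((8 / D.κ + 2) ^ (2 * n) * D.C * 2 ^ (n - 1)) * wt (n + 1) w := by
  have hκ := D.κ_pos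
  set T := 8 / D.κ + 2 with hT
  have hT0 : 0 < T := by positivity
  have hC := D.one_le_C
  refine (setLIntegral_le_lintegral A _).trans ?_
  calc ∫⁻ y', wt (2 * n) (y - y') *
      {q : E n × ℝ | q.2 ≤ ‖q.1‖ ∧ ‖q.1‖ ≤ T * q.2}.indicator 1 (w, ‖y - y'‖) ∂surfaceMeasure Ω
      ≤ ∫⁻ y', (Metric.ball y (2 * ‖w‖)).indicator
        (fun _ => ENNReal.ofReal (((‖w‖ / T) ^ (2 * n))⁻¹)) y' ∂surfaceMeasure Ω := by
        refine lintegral_mono fun y' => ?_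
        by_cases hq : (w, ‖y - y'‖) ∈ {q : E n × ℝ | q.2 ≤ ‖q.1‖ ∧ ‖q.1‖ ≤ T * q.2}
        · rw [Set.indicator_of_mem hq, Pi.one_apply, mul_one]
          obtain ⟨h1, h2⟩ := hq
          simp only at h1 h2
          have hb : y' ∈ Metric.ball y (2 * ‖w‖) := by
            rw [Metric.mem_ball, dist_comm, dist_eq_norm]
            linarith
          rw [Set.indicator_of_mem hb]
          apply ENNReal.ofReal_le_ofReal
          have : ‖w‖ / T ≤ ‖y - y'‖ := by rwa [div_le_iff₀ hT0, mul_comm]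
          have : 0 < ‖w‖ / T := by positivity
          gcongr
        · rw [Set.indicator_of_notMem hq, mul_zero]
          exact zero_le
    _ = ENNReal.ofReal (((‖w‖ / T) ^ (2 * n))⁻¹) * surfaceMeasure Ω (Metric.ball y (2 * ‖w‖)) :=
        lintegral_indicator_const Metric.isOpen_ball.measurableSet _
    _ ≤ ENNReal.ofReal (((‖w‖ / T) ^ (2 * n))⁻¹) *
        ENNReal.ofReal (D.C * (2 * ‖w‖) ^ (n - 1)) := by
        gcongr
        exact D.upper _ _ (by positivity)
    _ = ENNReal.ofReal (T ^ (2 * n) * D.C * 2 ^ (n - 1)) * wt (n + 1) w := by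
        rw [wt, ← ENNReal.ofReal_mul (by positivity), ← ENNReal.ofReal_mul (by positivity)]
        congr 1
        obtain ⟨m, rfl⟩ : ∃ m, n = m + 1 := ⟨n - 1, by omega⟩
        rw [Nat.add_sub_cancel, div_pow, mul_pow]
        have : ‖w‖ ^ (2 * (m + 1)) = ‖w‖ ^ m * ‖w‖ ^ (m + 1 + 1) := by rw [← pow_add]; congr 1; ring
        rw [this]
        field_simp

/-- Tonelli: integrating over `y'` before `w` turns the shells into the full cone energy by
`lintegral_wt_shell_le`. -/
theorem ConeData.lintegral_shell_le (D : ConeData Ω) (hn : 1 ≤ n)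
    [SFinite (surfaceMeasure Ω)] (j : Fin D.N) {u g : E n → ℂ} (hu : Measurable u) :
    ∫⁻ y in D.S j, (∫⁻ y' in D.S j, wt (2 * n) (y - y') * D.shell j u g y ‖y - y'‖
      ∂surfaceMeasure Ω) ∂surfaceMeasure Ω ≤
      ENNReal.ofReal ((8 / D.κ + 2) ^ (2 * n) * D.C * 2 ^ (n - 1)) * D.coneEnergy j u g := by
  set K := ENNReal.ofReal ((8 / D.κ + 2) ^ (2 * n) * D.C * 2 ^ (n - 1)) with hK
  rw [ConeData.coneEnergy, ← lintegral_const_mul' _ _ ENNReal.ofReal_ne_top]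
  refine lintegral_mono fun y => ?_
  set A := {q : E n × ℝ | q.2 ≤ ‖q.1‖ ∧ ‖q.1‖ ≤ (8 / D.κ + 2) * q.2} with hA
  have hind : Measurable (A.indicator (1 : E n × ℝ → ENNReal)) :=
    measurable_one.indicator (measurableSet_shell _)
  have hm2 : ∀ w, Measurable fun y' => wt (2 * n) (y - y') * A.indicator 1 (w, ‖y - y'‖) :=
    fun w => ((measurable_wt _).comp (measurable_const.sub measurable_id)).mul
      (hind.comp (measurable_const.prodMk (measurable_const.sub measurable_id).norm))
  calc ∫⁻ y' in D.S j, wt (2 * n) (y - y') * D.shell j u g y ‖y - y'‖ ∂surfaceMeasure Ω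
      = ∫⁻ y' in D.S j, (∫⁻ w in D.Γ j, ‖u (y + w) - g y‖ₑ ^ 2 *
          (wt (2 * n) (y - y') * A.indicator 1 (w, ‖y - y'‖))) ∂surfaceMeasure Ω := by
        congr 1
        ext y'
        have hne : wt (2 * n) (y - y') ≠ ⊤ := ENNReal.ofReal_ne_top
        rw [ConeData.shell, ← lintegral_const_mul' _ _ hne]
        congr 1
        ext w
        rw [← hA]
        ring
    _ = ∫⁻ w in D.Γ j, ∫⁻ y' in D.S j, ‖u (y + w) - g y‖ₑ ^ 2 *
          (wt (2 * n) (y - y') * A.indicator 1 (w, ‖y - y'‖)) ∂surfaceMeasure Ω := by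
        apply lintegral_lintegral_swap
        apply Measurable.aemeasurable
        refine (((hu.comp (measurable_const.add measurable_snd)).sub
          measurable_const).enorm.pow_const 2).mul ?_
        exact ((measurable_wt _).comp (measurable_const.sub measurable_fst)).mul
          (hind.comp (measurable_snd.prodMk (measurable_const.sub measurable_fst).norm))
    _ ≤ ∫⁻ w in D.Γ j, K * (‖u (y + w) - g y‖ₑ ^ 2 * wt (n + 1) w) := by
        refine setLIntegral_mono' (D.measurableSet_Γ j) fun w hw => ?_
        rw [lintegral_const_mul _ (hm2 w)]
        refine (mul_le_mul_right (D.lintegral_wt_shell_le hn y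
          (norm_pos_of_mem_cone hw.1) (D.S j)) _).trans (le_of_eq ?_)
        ring
    _ = K * ∫⁻ w in D.Γ j, ‖u (y + w) - g y‖ₑ ^ 2 * wt (n + 1) w :=
        lintegral_const_mul' _ _ ENNReal.ofReal_ne_top

theorem lintegral_lintegral_add_swap {X : Type*} [MeasurableSpace X] {μ : Measure X} [SFinite μ]
    {H : X × X → ENNReal} (hH : Measurable H) :
    ∫⁻ y, (∫⁻ y', (H (y, y') + H (y', y)) ∂μ) ∂μ = 2 * ∫⁻ y, (∫⁻ y', H (y, y') ∂μ) ∂μ := by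
  have h1 : ∀ y, ∫⁻ y', (H (y, y') + H (y', y)) ∂μ =
      ∫⁻ y', H (y, y') ∂μ + ∫⁻ y', H (y', y) ∂μ := fun y =>
    lintegral_add_left (hH.comp (measurable_const.prodMk measurable_id)) _
  simp_rw [h1]
  rw [lintegral_add_left hH.lintegral_prod_right', two_mul]
  congr 1
  exact lintegral_lintegral_swap (f := fun y y' => H (y', y)) (hH.comp measurable_swap).aemeasurable

/-- The two shell terms are exchanged by swapping the variables, so their double integrals agree and
only one has to be estimated. -/
theorem lintegral_lintegral_le_of_symm {X : Type*} [MeasurableSpace X] {μ : Measure X} [SFinite μ]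
    {H F : X × X → ENNReal} (hH : Measurable H) {V K : ENNReal} (hV : V ≠ ⊤)
    (hF : ∀ y y', V * F (y, y') ≤ 2 * (H (y, y') + H (y', y)))
    (hK : ∫⁻ y, (∫⁻ y', H (y, y') ∂μ) ∂μ ≤ K) :
    V * ∫⁻ y, (∫⁻ y', F (y, y') ∂μ) ∂μ ≤ 4 * K := by
  calc V * ∫⁻ y, (∫⁻ y', F (y, y') ∂μ) ∂μ = ∫⁻ y, (∫⁻ y', V * F (y, y') ∂μ) ∂μ := by
        rw [← lintegral_const_mul' _ _ hV]
        exact lintegral_congr fun y => (lintegral_const_mul' _ _ hV).symm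
    _ ≤ ∫⁻ y, (∫⁻ y', 2 * (H (y, y') + H (y', y)) ∂μ) ∂μ :=
        lintegral_mono fun y => lintegral_mono fun y' => hF y y'
    _ = 2 * ∫⁻ y, (∫⁻ y', (H (y, y') + H (y', y)) ∂μ) ∂μ := by
        rw [← lintegral_const_mul' _ _ (by norm_num)]
        exact lintegral_congr fun y => lintegral_const_mul' _ _ (by norm_num)
    _ ≤ 2 * (2 * K) := by
        rw [lintegral_lintegral_add_swap hH]
        gcongr
    _ = 4 * K := by ring

/-- The local part of the Gagliardo seminorm is controlled by the cone energy. -/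
theorem ConeData.lintegral_gagliardo_S_le (D : ConeData Ω) (hn : 1 ≤ n)
    [SFinite (surfaceMeasure Ω)] (j : Fin D.N) {u g : E n → ℂ} (hu : Measurable u)
    (hg : Measurable g) :
    volume (Metric.ball (0 : E n) 1) * ∫⁻ y in D.S j, (∫⁻ y' in D.S j,
      (Metric.ball (0 : E n) (D.κ * D.r / 64)).indicator 1 (y - y') *
        (‖g y - g y'‖ₑ ^ 2 * wt n (y - y')) ∂surfaceMeasure Ω) ∂surfaceMeasure Ω ≤
      4 * (ENNReal.ofReal ((8 / D.κ + 2) ^ (2 * n) * D.C * 2 ^ (n - 1)) *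
        D.coneEnergy j u g) := by
  have hm1 : Measurable fun p : E n × E n => wt (2 * n) (p.1 - p.2) *
      D.shell j u g p.1 ‖p.1 - p.2‖ :=
    ((measurable_wt _).comp (measurable_fst.sub measurable_snd)).mul (D.measurable_shell j hu hg)
  refine lintegral_lintegral_le_of_symm hm1
    (F := fun p => (Metric.ball (0 : E n) (D.κ * D.r / 64)).indicator 1 (p.1 - p.2) *
        (‖g p.1 - g p.2‖ₑ ^ 2 * wt n (p.1 - p.2))) measure_ball_lt_top.ne ?_
    (D.lintegral_shell_le hn j hu)
  intro y y'
  dsimp only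
  by_cases hb : y - y' ∈ Metric.ball (0 : E n) (D.κ * D.r / 64)
  · rw [Set.indicator_of_mem hb, Pi.one_apply, one_mul]
    rw [Metric.mem_ball, dist_zero_right] at hb
    by_cases h0 : y = y'
    · subst h0
      simp
    · refine (D.enorm_sub_sq_le_shell j hu h0 hb).trans (le_of_eq ?_)
      have : wt (2 * n) (y' - y) = wt (2 * n) (y - y') := by rw [wt, wt, norm_sub_rev]
      rw [this, norm_sub_rev y' y, mul_add]
  · rw [Set.indicator_of_notMem hb, zero_mul, mul_zero]
    exact zero_le

end

section

/-! ### Gagliardo seminorms of cone traces -/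

variable {n : ℕ} {Ω : Set (E n)}

/-- The square of the Gagliardo seminorm. -/
def gagliardoSq (Ω : Set (E n)) (g : E n → ℂ) : ENNReal :=
  ∫⁻ p, ‖g p.1 - g p.2‖ₑ ^ 2 * wt n (p.1 - p.2) ∂(surfaceMeasure Ω).prod (surfaceMeasure Ω)

theorem enorm_gagliardoQuotient_sq (g : E n → ℂ) (p : E n × E n) :
    ‖gagliardoQuotient g p‖ₑ ^ 2 = ‖g p.1 - g p.2‖ₑ ^ 2 * wt n (p.1 - p.2) := by
  rw [gagliardoQuotient, wt, ← ofReal_norm, ← ofReal_norm, ← ENNReal.ofReal_pow (norm_nonneg _),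
    ← ENNReal.ofReal_pow (norm_nonneg _), ← ENNReal.ofReal_mul (by positivity), norm_div,
    Complex.norm_real, Real.norm_of_nonneg (by positivity), div_pow, div_eq_mul_inv,
    ← Real.rpow_natCast (‖p.1 - p.2‖ ^ ((n : ℝ) / 2)), ← Real.rpow_mul (norm_nonneg _)]
  norm_num

theorem measurable_gagliardoQuotient {g : E n → ℂ} (hg : Measurable g) :
    Measurable (gagliardoQuotient g) := by
  unfold gagliardoQuotient
  refine ((hg.comp measurable_fst).sub (hg.comp measurable_snd)).div ?_
  exact Complex.measurable_ofReal.comp ((measurable_fst.sub measurable_snd).norm.pow_const _)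

theorem measurable_gagliardo {g : E n → ℂ} (hg : Measurable g) :
    Measurable fun p : E n × E n => ‖g p.1 - g p.2‖ₑ ^ 2 * wt n (p.1 - p.2) :=
  (((hg.comp measurable_fst).sub (hg.comp measurable_snd)).enorm.pow_const 2).mul
    ((measurable_wt n).comp (measurable_fst.sub measurable_snd))

theorem gagliardoQuotient_congr [SFinite (surfaceMeasure Ω)] {g h : E n → ℂ}
    (hgh : g =ᵐ[surfaceMeasure Ω] h) :
    gagliardoQuotient g =ᵐ[(surfaceMeasure Ω).prod (surfaceMeasure Ω)] gagliardoQuotient h := by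
  filter_upwards [Measure.quasiMeasurePreserving_fst.ae hgh,
    Measure.quasiMeasurePreserving_snd.ae hgh] with p h1 h2
  rw [gagliardoQuotient, gagliardoQuotient, h1, h2]

theorem H12.enorm_sq [SFinite (surfaceMeasure Ω)] {t : H12 Ω} {g : E n → ℂ}
    (h : toL2Bdry t =ᵐ[surfaceMeasure Ω] g) :
    ‖t‖ₑ ^ 2 = ∫⁻ y, ‖g y‖ₑ ^ 2 ∂surfaceMeasure Ω + gagliardoSq Ω g := by
  have h1 : ‖t‖ ^ 2 = ‖toL2Bdry t‖ ^ 2 + ‖t.1.snd‖ ^ 2 := WithLp.prod_norm_sq_eq_of_L2 t.1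
  have h2 : ‖t‖ₑ ^ 2 = ‖toL2Bdry t‖ₑ ^ 2 + ‖t.1.snd‖ₑ ^ 2 := by
    simp only [← ofReal_norm, ← ENNReal.ofReal_pow (norm_nonneg _)]
    rw [← ENNReal.ofReal_add (by positivity) (by positivity), h1]
  have h3 : t.1.snd =ᵐ[(surfaceMeasure Ω).prod (surfaceMeasure Ω)]
      gagliardoQuotient (toL2Bdry t) := t.2
  rw [h2, Lp.enorm_sq_eq_of_ae_eq h,
    Lp.enorm_sq_eq_of_ae_eq (h3.trans (gagliardoQuotient_congr h)), gagliardoSq]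
  congr 1
  exact lintegral_congr fun p => enorm_gagliardoQuotient_sq g p

theorem exists_H12 [SFinite (surfaceMeasure Ω)] {g : E n → ℂ} (hg : Measurable g)
    (h1 : ∫⁻ y, ‖g y‖ₑ ^ 2 ∂surfaceMeasure Ω < ⊤) (h2 : gagliardoSq Ω g < ⊤) :
    ∃ t : H12 Ω, toL2Bdry t =ᵐ[surfaceMeasure Ω] g := by
  have m1 : MemLp g 2 (surfaceMeasure Ω) :=
    memLp_two_of_lintegral_lt_top hg.aestronglyMeasurable h1
  have m2 : MemLp (gagliardoQuotient g) 2 ((surfaceMeasure Ω).prod (surfaceMeasure Ω)) := by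
    refine memLp_two_of_lintegral_lt_top (measurable_gagliardoQuotient hg).aestronglyMeasurable ?_
    refine lt_of_eq_of_lt ?_ h2
    exact lintegral_congr fun p => enorm_gagliardoQuotient_sq g p
  refine ⟨⟨WithLp.toLp 2 (m1.toLp g, m2.toLp _), ?_⟩, m1.coeFn_toLp⟩
  exact m2.coeFn_toLp.trans (gagliardoQuotient_congr m1.coeFn_toLp.symm)

/-- The difference quotient is a function of the boundary values, so it carries no further
information. -/
theorem H12.ext_toL2Bdry [SFinite (surfaceMeasure Ω)] {s t : H12 Ω}
    (h : toL2Bdry s = toL2Bdry t) : s = t := by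
  have h1 : toL2Bdry (s - t) =ᵐ[surfaceMeasure Ω] fun _ => 0 := by
    have : toL2Bdry (s - t) = toL2Bdry s - toL2Bdry t := rfl
    rw [this, h, sub_self]
    exact Lp.coeFn_zero _ _ _
  have h2 := H12.enorm_sq h1
  simp only [gagliardoSq, sub_self, enorm_zero] at h2
  simp at h2
  exact sub_eq_zero.1 (enorm_eq_zero.1 h2)

theorem ae_mem_frontier : ∀ᵐ y ∂surfaceMeasure Ω, y ∈ frontier Ω :=
  ae_restrict_mem isClosed_frontier.measurableSet

theorem ConeData.lintegral_bdry_le_sum (D : ConeData Ω) (F : E n → ENNReal) :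
    ∫⁻ y, F y ∂surfaceMeasure Ω ≤ ∑ j, ∫⁻ y in D.S j, F y ∂surfaceMeasure Ω := by
  have h : (surfaceMeasure Ω).restrict (⋃ j, D.S j) = surfaceMeasure Ω := by
    rw [D.iUnion_S]
    exact Measure.restrict_eq_self_of_ae_mem ae_mem_frontier
  calc ∫⁻ y, F y ∂surfaceMeasure Ω = ∫⁻ y in ⋃ j, D.S j, F y ∂surfaceMeasure Ω := by rw [h]
    _ ≤ ∑' j, ∫⁻ y in D.S j, F y ∂surfaceMeasure Ω := lintegral_iUnion_le _ _
    _ = _ := tsum_fintype _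

/-- A trace inequality with a small constant in front of the energy. -/
theorem ConeData.exists_lintegral_bdry_le (D : ConeData Ω) (hn : 1 ≤ n) (hΩ : IsOpen Ω)
    [SFinite (surfaceMeasure Ω)] {ε : ℝ} (hε : 0 < ε) :
    ∃ K : ENNReal, K ≠ ⊤ ∧ ∀ u g : E n → ℂ, Measurable u → Measurable g →
      ∫⁻ y, ‖g y‖ₑ ^ 2 ∂surfaceMeasure Ω ≤
        ENNReal.ofReal ε * ∑ j, D.coneEnergy j u g + K * ∫⁻ x in Ω, ‖u x‖ₑ ^ 2 := by
  have hκ := D.κ_pos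
  have hr := D.r_pos
  set V := volume (Metric.ball (0 : E n) 1) with hV
  have hVt : V ≠ ⊤ := measure_ball_lt_top.ne
  have hV0 : V ≠ 0 := (Metric.measure_ball_pos volume 0 one_pos).ne'
  set c0 := ENNReal.ofReal ((D.κ / 16) ^ n) * V with hc0
  have hc0t : c0 ≠ ⊤ := ENNReal.mul_ne_top ENNReal.ofReal_ne_top hVt
  have hc00 : c0 ≠ 0 := mul_ne_zero (by simp; positivity) hV0
  set c := c0.toReal with hc
  have hcp : 0 < c := ENNReal.toReal_pos hc00 hc0t
  have hcc : c0 = ENNReal.ofReal c := (ENNReal.ofReal_toReal hc0t).symm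
  -- Chosen so that `2ρ ≤ εc`, where `c` is the constant on the left of `ConeData.lintegral_S_le`;
  -- the price is the large factor `ρ⁻¹` in `K1`.
  set ρ := min (D.r / 4) (ε * c / 2) with hρ
  have hρ0 : 0 < ρ := lt_min (by positivity) (by positivity)
  set K1 := ENNReal.ofReal ρ⁻¹ * (2 * ENNReal.ofReal (D.C * (2 / D.κ ^ 2) ^ (n - 1))) with hK1
  have hK1t : K1 ≠ ⊤ := ENNReal.mul_ne_top ENNReal.ofReal_ne_top
    (ENNReal.mul_ne_top (by norm_num) ENNReal.ofReal_ne_top)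
  refine ⟨D.N * (c0⁻¹ * K1), ENNReal.mul_ne_top (by simp) (ENNReal.mul_ne_top
    (ENNReal.inv_ne_top.2 hc00) hK1t), fun u g hu hg => ?_⟩
  have hj : ∀ j, ∫⁻ y in D.S j, ‖g y‖ₑ ^ 2 ∂surfaceMeasure Ω ≤
      ENNReal.ofReal ε * D.coneEnergy j u g + c0⁻¹ * K1 * ∫⁻ x in Ω, ‖u x‖ₑ ^ 2 := by
    intro j
    have h1 := D.lintegral_S_le hn hΩ j hu hg hρ0 (min_le_left _ _)
    have h2 : ENNReal.ofReal ρ * 2 ≤ c0 * ENNReal.ofReal ε := by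
      rw [hcc, ← ENNReal.ofReal_mul hcp.le,
        show (2 : ENNReal) = ENNReal.ofReal 2 by norm_num, ← ENNReal.ofReal_mul hρ0.le]
      apply ENNReal.ofReal_le_ofReal
      have := min_le_right (D.r / 4) (ε * c / 2)
      linarith
    calc ∫⁻ y in D.S j, ‖g y‖ₑ ^ 2 ∂surfaceMeasure Ω
        = c0⁻¹ * (c0 * ∫⁻ y in D.S j, ‖g y‖ₑ ^ 2 ∂surfaceMeasure Ω) := by
          rw [← mul_assoc, ENNReal.inv_mul_cancel hc00 hc0t, one_mul]
      _ ≤ c0⁻¹ * (ENNReal.ofReal ρ * 2 * D.coneEnergy j u g + K1 * ∫⁻ x in Ω, ‖u x‖ₑ ^ 2) := by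
          gcongr
          refine h1.trans (le_of_eq ?_)
          rw [hK1]
          ring
      _ ≤ c0⁻¹ * (c0 * ENNReal.ofReal ε * D.coneEnergy j u g + K1 * ∫⁻ x in Ω, ‖u x‖ₑ ^ 2) := by
          gcongr
      _ = _ := by
          rw [mul_add, ← mul_assoc, ← mul_assoc, ENNReal.inv_mul_cancel hc00 hc0t, one_mul,
            ← mul_assoc]
  refine (D.lintegral_bdry_le_sum _).trans ((Finset.sum_le_sum fun j _ => hj j).trans
    (le_of_eq ?_))
  rw [Finset.sum_add_distrib, ← Finset.mul_sum, Finset.sum_const, Finset.card_univ,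
    Fintype.card_fin, nsmul_eq_mul]
  ring

/-- Near the diagonal two boundary points share a chart and the cone energy applies. Away from it
the kernel is bounded, and the finite surface measure reduces the integral to the `L²` norm. -/
theorem ConeData.gagliardoSq_le (D : ConeData Ω) (hn : 1 ≤ n)
    [IsFiniteMeasure (surfaceMeasure Ω)] :
    ∃ K : ENNReal, K ≠ ⊤ ∧ ∀ u g : E n → ℂ, Measurable u → Measurable g →
      gagliardoSq Ω g ≤ K * (∑ j, D.coneEnergy j u g + ∫⁻ y, ‖g y‖ₑ ^ 2 ∂surfaceMeasure Ω) := by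
  have hκ := D.κ_pos
  have hκ1 := D.κ_le
  have hr := D.r_pos
  set σ := surfaceMeasure Ω with hσ
  set V := volume (Metric.ball (0 : E n) 1) with hV
  have hVt : V ≠ ⊤ := measure_ball_lt_top.ne
  have hV0 : V ≠ 0 := (Metric.measure_ball_pos volume 0 one_pos).ne'
  -- The distance below which two vertices can be compared through a common interior ball, as in
  -- `ConeData.enorm_sub_sq_le_shell`.
  set r1 := D.κ * D.r / 64 with hr1
  have hr10 : 0 < r1 := by positivity
  have hr12 : r1 ≤ D.r / 2 := by nlinarith
  set K0 := ENNReal.ofReal ((8 / D.κ + 2) ^ (2 * n) * D.C * 2 ^ (n - 1)) with hK0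
  set A := V⁻¹ * (4 * K0) with hA
  set B := ENNReal.ofReal ((r1 ^ n)⁻¹) * (4 * σ Set.univ) with hB
  have hAt : A ≠ ⊤ := ENNReal.mul_ne_top (ENNReal.inv_ne_top.2 hV0)
    (ENNReal.mul_ne_top (by norm_num) ENNReal.ofReal_ne_top)
  have hBt : B ≠ ⊤ := ENNReal.mul_ne_top ENNReal.ofReal_ne_top
    (ENNReal.mul_ne_top (by norm_num) (measure_ne_top _ _))
  refine ⟨A + B, ENNReal.add_ne_top.2 ⟨hAt, hBt⟩, fun u g hu hg => ?_⟩
  set H : E n × E n → ENNReal := fun p => ‖g p.1 - g p.2‖ₑ ^ 2 * wt n (p.1 - p.2) with hH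
  have hHm : Measurable H := measurable_gagliardo hg
  set W : Set (E n × E n) := {p | p.1 - p.2 ∈ Metric.ball (0 : E n) r1} with hW
  have hWm : MeasurableSet W :=
    (measurable_fst.sub measurable_snd) Metric.isOpen_ball.measurableSet
  have hnear : ∀ j, ∫⁻ p in (D.S j ×ˢ D.S j) ∩ W, H p ∂σ.prod σ ≤ A * D.coneEnergy j u g := by
    intro j
    have h1 := D.lintegral_gagliardo_S_le hn j hu hg
    calc ∫⁻ p in (D.S j ×ˢ D.S j) ∩ W, H p ∂σ.prod σ
        = ∫⁻ p, W.indicator H p ∂(σ.restrict (D.S j)).prod (σ.restrict (D.S j)) := by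
          rw [Measure.prod_restrict, lintegral_indicator hWm, Measure.restrict_restrict hWm,
            Set.inter_comm]
      _ = ∫⁻ y in D.S j, (∫⁻ y' in D.S j, W.indicator H (y, y') ∂σ) ∂σ :=
          lintegral_prod _ (hHm.indicator hWm).aemeasurable
      _ = V⁻¹ * (V * ∫⁻ y in D.S j, (∫⁻ y' in D.S j,
          (Metric.ball (0 : E n) r1).indicator 1 (y - y') *
            (‖g y - g y'‖ₑ ^ 2 * wt n (y - y')) ∂σ) ∂σ) := by
          rw [← mul_assoc, ENNReal.inv_mul_cancel hV0 hVt, one_mul]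
          refine lintegral_congr fun y => lintegral_congr fun y' => ?_
          by_cases h : y - y' ∈ Metric.ball (0 : E n) r1
          · rw [Set.indicator_of_mem h, Set.indicator_of_mem (show (y, y') ∈ W from h),
              Pi.one_apply, one_mul]
          · rw [Set.indicator_of_notMem h, Set.indicator_of_notMem (show (y, y') ∉ W from h),
              zero_mul]
      _ ≤ V⁻¹ * (4 * (K0 * D.coneEnergy j u g)) := by gcongr
      _ = _ := by rw [hA]; ring
  have hfar : ∫⁻ p in Wᶜ, H p ∂σ.prod σ ≤ B * ∫⁻ y, ‖g y‖ₑ ^ 2 ∂σ := by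
    have hgm : Measurable fun y => ‖g y‖ₑ ^ 2 := hg.enorm.pow_const 2
    have hg1 : Measurable fun p : E n × E n => ‖g p.1‖ₑ ^ 2 := hgm.comp measurable_fst
    have hg2 : Measurable fun p : E n × E n => ‖g p.2‖ₑ ^ 2 := hgm.comp measurable_snd
    calc ∫⁻ p in Wᶜ, H p ∂σ.prod σ
        ≤ ∫⁻ p in Wᶜ, ENNReal.ofReal ((r1 ^ n)⁻¹) *
            (2 * (‖g p.1‖ₑ ^ 2 + ‖g p.2‖ₑ ^ 2)) ∂σ.prod σ := by
          refine setLIntegral_mono' hWm.compl fun p hp => ?_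
          have hHp : H p = wt n (p.1 - p.2) * ‖g p.1 - g p.2‖ₑ ^ 2 := mul_comm _ _
          rw [hHp]
          have hp' : r1 ≤ ‖p.1 - p.2‖ := by
            by_contra h
            refine hp ?_
            change p.1 - p.2 ∈ Metric.ball 0 r1
            rw [Metric.mem_ball, dist_zero_right]
            exact not_le.1 h
          refine mul_le_mul' ?_ ?_
          · apply ENNReal.ofReal_le_ofReal
            gcongr
          · refine le_trans ?_ (ennreal_add_sq_le _ _)
            gcongr
            exact enorm_sub_le
      _ ≤ ∫⁻ p, ENNReal.ofReal ((r1 ^ n)⁻¹) *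
            (2 * (‖g p.1‖ₑ ^ 2 + ‖g p.2‖ₑ ^ 2)) ∂σ.prod σ := setLIntegral_le_lintegral _ _
      _ = B * ∫⁻ y, ‖g y‖ₑ ^ 2 ∂σ := by
          rw [lintegral_const_mul' _ _ ENNReal.ofReal_ne_top, lintegral_const_mul' _ _ (by norm_num),
            lintegral_add_left hg1, lintegral_prod _ hg1.aemeasurable,
            lintegral_prod _ hg2.aemeasurable]
          simp only [lintegral_const]
          rw [lintegral_mul_const _ hgm, hB]
          ring
  have hcov : ∀ᵐ p ∂σ.prod σ, p ∈ (⋃ j, (D.S j ×ˢ D.S j) ∩ W) ∪ Wᶜ := by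
    filter_upwards [Measure.quasiMeasurePreserving_fst.ae (ae_mem_frontier (Ω := Ω)),
      Measure.quasiMeasurePreserving_snd.ae (ae_mem_frontier (Ω := Ω))] with p h1 h2
    by_cases hp : p ∈ W
    · left
      have hd : dist p.1 p.2 ≤ D.r / 2 := by
        have : p.1 - p.2 ∈ Metric.ball 0 r1 := hp
        rw [Metric.mem_ball, dist_zero_right] at this
        rw [dist_eq_norm]
        linarith
      obtain ⟨j, h3, h4⟩ := D.exists_mem_S h1 h2 hd
      exact Set.mem_iUnion.2 ⟨j, ⟨h3, h4⟩, hp⟩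
    · exact Or.inr hp
  calc gagliardoSq Ω g = ∫⁻ p in (⋃ j, (D.S j ×ˢ D.S j) ∩ W) ∪ Wᶜ, H p ∂σ.prod σ := by
        rw [Measure.restrict_eq_self_of_ae_mem hcov, gagliardoSq]
    _ ≤ ∫⁻ p in ⋃ j, (D.S j ×ˢ D.S j) ∩ W, H p ∂σ.prod σ + ∫⁻ p in Wᶜ, H p ∂σ.prod σ :=
        lintegral_union_le _ _ _
    _ ≤ A * ∑ j, D.coneEnergy j u g + B * ∫⁻ y, ‖g y‖ₑ ^ 2 ∂σ := by
        refine add_le_add ?_ hfar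
        refine (lintegral_iUnion_le _ _).trans ?_
        rw [tsum_fintype, Finset.mul_sum]
        exact Finset.sum_le_sum fun j _ => hnear j
    _ ≤ (A + B) * ∑ j, D.coneEnergy j u g + (A + B) * ∫⁻ y, ‖g y‖ₑ ^ 2 ∂σ := by
        gcongr
        · exact le_self_add
        · exact le_add_self
    _ = _ := (mul_add _ _ _).symm

theorem ConeData.exists_H12_bound (D : ConeData Ω) (hn : 1 ≤ n) (hΩ : IsOpen Ω)
    [IsFiniteMeasure (surfaceMeasure Ω)] :
    ∃ K : ENNReal, K ≠ ⊤ ∧ ∀ u g : E n → ℂ, Measurable u → Measurable g →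
      ∫⁻ y, ‖g y‖ₑ ^ 2 ∂surfaceMeasure Ω + gagliardoSq Ω g ≤
        K * (∑ j, D.coneEnergy j u g + ∫⁻ x in Ω, ‖u x‖ₑ ^ 2) := by
  obtain ⟨K1, hK1, H1⟩ := D.exists_lintegral_bdry_le hn hΩ one_pos
  obtain ⟨K2, hK2, H2⟩ := D.gagliardoSq_le hn
  refine ⟨(1 + K1) + K2 * (1 + (1 + K1)), by simp [ENNReal.mul_eq_top, hK1, hK2],
    fun u g hu hg => ?_⟩
  set P := ∑ j, D.coneEnergy j u g
  set Q := ∫⁻ x in Ω, ‖u x‖ₑ ^ 2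
  have h1 : ∫⁻ y, ‖g y‖ₑ ^ 2 ∂surfaceMeasure Ω ≤ (1 + K1) * (P + Q) := by
    refine (H1 u g hu hg).trans ?_
    rw [ENNReal.ofReal_one, mul_add]
    gcongr
    · exact le_self_add
    · exact le_add_self
  calc ∫⁻ y, ‖g y‖ₑ ^ 2 ∂surfaceMeasure Ω + gagliardoSq Ω g
      ≤ (1 + K1) * (P + Q) + K2 * ((P + Q) + (1 + K1) * (P + Q)) := by
        refine add_le_add h1 ((H2 u g hu hg).trans ?_)
        gcongr
        exact le_self_add
    _ = _ := by ring

end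

section

/-! ### The trace operator -/

variable {n : ℕ} {Ω : Set (E n)}

/-- For each vertex, translation carries null sets of `Ω` to null sets of the cone, so the energy
depends only on classes in `L²`. -/
theorem ConeData.coneEnergy_congr (D : ConeData Ω) (hΩ : IsOpen Ω) (j : Fin D.N)
    {u u' g g' : E n → ℂ} (hu : u =ᵐ[volume.restrict Ω] u') (hg : g =ᵐ[surfaceMeasure Ω] g') :
    D.coneEnergy j u g = D.coneEnergy j u' g' := by
  refine setLIntegral_congr_fun_ae (D.measurableSet_S j) ?_
  filter_upwards [hg] with y hy hyS
  refine lintegral_congr_ae ?_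
  filter_upwards [D.ae_cone hu hΩ hyS] with w hw
  rw [hw, hy]

theorem exists_subseq_ae_tendsto {α F : Type*} [MeasurableSpace α] [NormedAddCommGroup F]
    {μ : Measure α} {f : ℕ → Lp F 2 μ} {f₀ : Lp F 2 μ}
    (h : Filter.Tendsto f Filter.atTop (nhds f₀)) :
    ∃ φ : ℕ → ℕ, StrictMono φ ∧
      ∀ᵐ x ∂μ, Filter.Tendsto (fun k => f (φ k) x) Filter.atTop (nhds (f₀ x)) :=
  (tendstoInMeasure_of_tendsto_Lp h).exists_seq_tendsto_ae

/-- Lower semicontinuity: Fatou's lemma is applied in `w` and then in `y`, along a subsequence for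
which functions and boundary values converge almost everywhere. -/
theorem ConeData.coneEnergy_le_of_tendsto (D : ConeData Ω) (hΩ : IsOpen Ω) (j : Fin D.N)
    {v : ℕ → L2 Ω} {v₀ : L2 Ω} {g : ℕ → L2Bdry Ω} {g₀ : L2Bdry Ω} {b : ℕ → ENNReal}
    {b₀ : ENNReal} (hv : Filter.Tendsto v Filter.atTop (nhds v₀))
    (hg : Filter.Tendsto g Filter.atTop (nhds g₀))
    (hb : Filter.Tendsto b Filter.atTop (nhds b₀))
    (h : ∀ k, D.coneEnergy j (v k) (g k) ≤ b k) : D.coneEnergy j v₀ g₀ ≤ b₀ := by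
  obtain ⟨φ, hφ, hvφ⟩ := exists_subseq_ae_tendsto hv
  obtain ⟨ψ, hψ, hgψ⟩ := exists_subseq_ae_tendsto (hg.comp hφ.tendsto_atTop)
  set θ := φ ∘ ψ with hθ
  have hθt : Filter.Tendsto θ Filter.atTop Filter.atTop :=
    hφ.tendsto_atTop.comp hψ.tendsto_atTop
  have hmv : ∀ u : L2 Ω, Measurable u := fun u => (Lp.stronglyMeasurable u).measurable
  have hmg : ∀ u : L2Bdry Ω, Measurable u := fun u => (Lp.stronglyMeasurable u).measurable
  have hin : ∀ k, Measurable fun y => ∫⁻ w in D.Γ j,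
      ‖v (θ k) (y + w) - g (θ k) y‖ₑ ^ 2 * wt (n + 1) w := fun k =>
    D.measurable_inner j (hmv _) (hmg _) ((measurable_wt (n + 1)).comp measurable_snd)
  calc D.coneEnergy j v₀ g₀
      ≤ ∫⁻ y in D.S j, Filter.liminf (fun k => ∫⁻ w in D.Γ j,
          ‖v (θ k) (y + w) - g (θ k) y‖ₑ ^ 2 * wt (n + 1) w) Filter.atTop ∂surfaceMeasure Ω := by
        refine setLIntegral_mono_ae' (D.measurableSet_S j) ?_
        filter_upwards [hgψ] with y hy hyS
        have hpt : ∀ᵐ w ∂volume.restrict (D.Γ j), ‖v₀ (y + w) - g₀ y‖ₑ ^ 2 * wt (n + 1) w =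
            Filter.liminf (fun k => ‖v (θ k) (y + w) - g (θ k) y‖ₑ ^ 2 * wt (n + 1) w)
              Filter.atTop := by
          filter_upwards [D.ae_cone hvφ hΩ hyS] with w hw
          refine (Filter.Tendsto.liminf_eq ?_).symm
          have h1 := ((hw.comp hψ.tendsto_atTop).sub hy).enorm
          have h2 : wt (n + 1) w ≠ ⊤ := ENNReal.ofReal_ne_top
          exact ENNReal.Tendsto.mul_const (ENNReal.Tendsto.pow h1) (Or.inr h2)
        rw [lintegral_congr_ae hpt]
        refine lintegral_liminf_le fun k => ?_
        exact ((((hmv _).comp (measurable_const.add measurable_id)).sub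
          measurable_const).enorm.pow_const 2).mul (measurable_wt _)
    _ ≤ Filter.liminf (fun k => D.coneEnergy j (v (θ k)) (g (θ k))) Filter.atTop :=
        lintegral_liminf_le hin
    _ ≤ Filter.liminf (fun k => b (θ k)) Filter.atTop :=
        Filter.liminf_le_liminf (Filter.Eventually.of_forall fun k => h _)
    _ = b₀ := (hb.comp hθt).liminf_eq

/-- A function with finite weighted integral over a cone attains its value as a limit. -/
theorem ConeData.eq_of_tendsto_cone (D : ConeData Ω) (j : Fin D.N) {U : E n → ℂ} {a L : ℂ}
    (hI : ∫⁻ w in D.Γ j, ‖U w - a‖ₑ ^ 2 * wt (n + 1) w ≠ ⊤)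
    (hL : ∀ ε > 0, ∃ ρ > 0, ∀ᵐ w ∂volume.restrict (D.Γ j), ‖w‖ < ρ → ‖U w - L‖ ≤ ε) :
    a = L := by
  by_contra hne
  have hκ := D.κ_pos
  have hr := D.r_pos
  set V := volume (Metric.ball (0 : E n) 1) with hV
  have hVt : V ≠ ⊤ := measure_ball_lt_top.ne
  have hV0 : V ≠ 0 := (Metric.measure_ball_pos volume 0 one_pos).ne'
  set δ := ‖a - L‖ / 2 with hδ
  have hδ0 : 0 < δ := by
    have := norm_pos_iff.2 (sub_ne_zero.2 hne)
    positivity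
  obtain ⟨ρ, hρ, hρL⟩ := hL δ hδ0
  set c := ENNReal.ofReal (δ ^ 2) * (ENNReal.ofReal ((D.κ / 16) ^ n) * V) with hc
  have hc0 : c ≠ 0 := by
    refine mul_ne_zero ?_ (mul_ne_zero ?_ hV0) <;> simp <;> positivity
  have hct : c ≠ ⊤ := ENNReal.mul_ne_top ENNReal.ofReal_ne_top
    (ENNReal.mul_ne_top ENNReal.ofReal_ne_top hVt)
  set I := ∫⁻ w in D.Γ j, ‖U w - a‖ₑ ^ 2 * wt (n + 1) w with hIdef
  -- If `a ≠ L`, then `‖U w - a‖ ≥ δ` near the vertex. The cone truncated at radius `s` has volume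
  -- at least of order `s^n` and weight at least `s^(-n-1)`, so the integral exceeds a multiple of
  -- `s⁻¹` for every small `s`.
  have key : ∀ s, 0 < s → s ≤ ρ → s ≤ D.r / 4 → c * ENNReal.ofReal s⁻¹ ≤ I := by
    intro s hs hsρ hsr
    have hsub : D.Γ j ∩ Metric.ball 0 s ⊆ D.Γ j := Set.inter_subset_left
    calc c * ENNReal.ofReal s⁻¹
        = ENNReal.ofReal (δ ^ 2) * ENNReal.ofReal ((s ^ (n + 1))⁻¹) *
          (ENNReal.ofReal ((D.κ / 16 * s) ^ n) * V) := by
          have e : ENNReal.ofReal ((s ^ (n + 1))⁻¹) * ENNReal.ofReal ((D.κ / 16 * s) ^ n) =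
              ENNReal.ofReal ((D.κ / 16) ^ n) * ENNReal.ofReal s⁻¹ := by
            rw [← ENNReal.ofReal_mul (by positivity), ← ENNReal.ofReal_mul (by positivity), mul_pow,
              pow_succ]
            congr 1
            field_simp
          calc c * ENNReal.ofReal s⁻¹ = ENNReal.ofReal (δ ^ 2) *
                (ENNReal.ofReal ((D.κ / 16) ^ n) * ENNReal.ofReal s⁻¹) * V := by rw [hc]; ring
            _ = _ := by rw [← e]; ring
      _ ≤ ENNReal.ofReal (δ ^ 2) * ENNReal.ofReal ((s ^ (n + 1))⁻¹) *
          volume (D.Γ j ∩ Metric.ball 0 s) := by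
          gcongr
          exact D.volume_Γ_ge j hs hsr
      _ = ∫⁻ w in D.Γ j ∩ Metric.ball 0 s,
          ENNReal.ofReal (δ ^ 2) * ENNReal.ofReal ((s ^ (n + 1))⁻¹) := by
          rw [setLIntegral_const]
      _ ≤ ∫⁻ w in D.Γ j ∩ Metric.ball 0 s, ‖U w - a‖ₑ ^ 2 * wt (n + 1) w := by
          refine setLIntegral_mono_ae'
            ((D.measurableSet_Γ j).inter Metric.isOpen_ball.measurableSet) ?_
          rw [ae_restrict_iff' (D.measurableSet_Γ j)] at hρL
          filter_upwards [hρL] with w hw hwΓ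
          have hws : ‖w‖ < s := by
            have := hwΓ.2
            rwa [Metric.mem_ball, dist_zero_right] at this
          have hw0 := norm_pos_of_mem_cone hwΓ.1.1
          have h1 := hw hwΓ.1 (hws.trans_le hsρ)
          have h2 : δ ≤ ‖U w - a‖ := by
            have h3 : ‖a - L‖ ≤ ‖U w - L‖ + ‖U w - a‖ := by
              rw [show a - L = (U w - L) - (U w - a) by abel]
              exact norm_sub_le _ _
            linarith
          refine mul_le_mul' ?_ ?_
          · rw [← ofReal_norm, ← ENNReal.ofReal_pow (norm_nonneg _)]
            apply ENNReal.ofReal_le_ofReal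
            gcongr
          · apply ENNReal.ofReal_le_ofReal
            gcongr
      _ ≤ I := lintegral_mono_set hsub
  set T := (c⁻¹ * I).toReal with hT
  have hIt : c⁻¹ * I ≠ ⊤ := ENNReal.mul_ne_top (ENNReal.inv_ne_top.2 hc0) hI
  have hT0 : 0 ≤ T := ENNReal.toReal_nonneg
  set s := min (min ρ (D.r / 4)) (T + 1)⁻¹ with hs
  have hs0 : 0 < s := lt_min (lt_min hρ (by positivity)) (by positivity)
  have h1 := key s hs0 ((min_le_left _ _).trans (min_le_left _ _))
    ((min_le_left _ _).trans (min_le_right _ _))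
  have h2 : ENNReal.ofReal s⁻¹ ≤ c⁻¹ * I := by
    calc ENNReal.ofReal s⁻¹ = c⁻¹ * (c * ENNReal.ofReal s⁻¹) := by
          rw [← mul_assoc, ENNReal.inv_mul_cancel hc0 hct, one_mul]
      _ ≤ c⁻¹ * I := by gcongr
  rw [← ENNReal.ofReal_toReal hIt, ENNReal.ofReal_le_ofReal_iff hT0] at h2
  have h3 : T + 1 ≤ s⁻¹ := by
    rw [le_inv_comm₀ (by positivity) hs0]
    exact min_le_right _ _
  linarith

theorem SmoothRep.add {v v' : H1 Ω} {w w' : E n → ℂ} (h : SmoothRep v w) (h' : SmoothRep v' w') :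
    SmoothRep (v + v') (w + w') := by
  refine ⟨h.contDiff.add h'.contDiff,
    (Lp.coeFn_add (toL2 v) (toL2 v')).trans (h.toL2_ae.add h'.toL2_ae),
    (Lp.coeFn_add (grad v) (grad v')).trans
      ((h.grad_ae.add h'.grad_ae).trans (Filter.Eventually.of_forall fun x => ?_))⟩
  ext i
  simp only [gradFun, partialDeriv, Pi.add_apply, PiLp.add_apply]
  rw [fderiv_add (h.contDiff.differentiable (by simp)).differentiableAt
    (h'.contDiff.differentiable (by simp)).differentiableAt]
  rfl

theorem SmoothRep.smul (c : ℂ) {v : H1 Ω} {w : E n → ℂ} (h : SmoothRep v w) :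
    SmoothRep (c • v) (c • w) := by
  refine ⟨h.contDiff.const_smul c,
    (Lp.coeFn_smul c (toL2 v)).trans (h.toL2_ae.const_smul c),
    (Lp.coeFn_smul c (grad v)).trans
      ((h.grad_ae.const_smul c).trans (Filter.Eventually.of_forall fun x => ?_))⟩
  ext i
  simp only [gradFun, partialDeriv, Pi.smul_apply, PiLp.smul_apply]
  rw [fderiv_const_smul (h.contDiff.differentiable (by simp)).differentiableAt]
  rfl

/-- Pairs of an element of `H¹(Ω)` with a smooth representative and its restriction to `∂Ω`. -/
def smoothTrace (Ω : Set (E n)) : Submodule ℂ (H1 Ω × H12 Ω) where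
  carrier := {p | ∃ w, SmoothRep p.1 w ∧ toL2Bdry p.2 =ᵐ[surfaceMeasure Ω] w}
  add_mem' := by
    rintro p q ⟨w, hw, hwt⟩ ⟨z, hz, hzt⟩
    exact ⟨w + z, hw.add hz,
      (Lp.coeFn_add (toL2Bdry p.2) (toL2Bdry q.2)).trans (hwt.add hzt)⟩
  zero_mem' := by
    refine ⟨0, ⟨contDiff_const, Lp.coeFn_zero _ _ _, (Lp.coeFn_zero _ _ _).trans ?_⟩,
      Lp.coeFn_zero _ _ _⟩
    refine Filter.Eventually.of_forall fun x => ?_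
    ext i
    simp [gradFun, partialDeriv]
  smul_mem' := by
    rintro c p ⟨w, hw, hwt⟩
    exact ⟨c • w, hw.smul c, (Lp.coeFn_smul c (toL2Bdry p.2)).trans (hwt.const_smul c)⟩

theorem H1.enorm_sq (v : H1 Ω) : ‖v‖ₑ ^ 2 = ‖toL2 v‖ₑ ^ 2 + ‖grad v‖ₑ ^ 2 := by
  simp only [← ofReal_norm, ← ENNReal.ofReal_pow (norm_nonneg _)]
  rw [← ENNReal.ofReal_add (by positivity) (by positivity), H1.norm_sq]

theorem norm_le_of_enorm_sq_le {F G : Type*} [NormedAddCommGroup F] [NormedAddCommGroup G]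
    {a : F} {b : G} {K : ENNReal} (hK : K ≠ ⊤) (h : ‖a‖ₑ ^ 2 ≤ K * ‖b‖ₑ ^ 2) :
    ‖a‖ ≤ √K.toReal * ‖b‖ := by
  rw [← ofReal_norm, ← ofReal_norm, ← ENNReal.ofReal_pow (norm_nonneg _),
    ← ENNReal.ofReal_pow (norm_nonneg _), ← ENNReal.ofReal_toReal hK,
    ← ENNReal.ofReal_mul ENNReal.toReal_nonneg, ENNReal.ofReal_le_ofReal_iff (by positivity)] at h
  refine abs_le_of_sq_le_sq' ?_ (by positivity) |>.2
  rw [mul_pow, Real.sq_sqrt ENNReal.toReal_nonneg]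
  exact h

theorem ConeData.exists_coneEnergy_smooth_le (D : ConeData Ω) (hn : 1 ≤ n) (hΩ : IsOpen Ω)
    [SFinite (surfaceMeasure Ω)] :
    ∃ K : ENNReal, K ≠ ⊤ ∧ ∀ (v : H1 Ω) (w : E n → ℂ), SmoothRep v w → ∀ j,
      D.coneEnergy j w w ≤ K * ‖grad v‖ₑ ^ 2 := by
  refine ⟨4 * ENNReal.ofReal (D.C * (2 / D.κ ^ 2) ^ (n - 1)),
    ENNReal.mul_ne_top (by norm_num) ENNReal.ofReal_ne_top, fun v w hw j => ?_⟩
  refine (D.coneEnergy_le hn hΩ j hw.contDiff).trans (le_of_eq ?_)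
  rw [Lp.enorm_sq_eq_of_ae_eq hw.grad_ae, mul_assoc]

/-- The bound makes the linear relation single valued, so it is a bounded operator on a dense
subspace and extends by continuity. -/
theorem exists_clm_of_dense_graph {X Y : Type*} [NormedAddCommGroup X] [NormedSpace ℂ X]
    [NormedAddCommGroup Y] [NormedSpace ℂ Y] [CompleteSpace Y] (M : Submodule ℂ (X × Y)) {C : ℝ}
    (hM : ∀ p ∈ M, ‖p.2‖ ≤ C * ‖p.1‖) (hd : Dense {x : X | ∃ y, (x, y) ∈ M}) :
    ∃ γ : X →L[ℂ] Y, ∀ p ∈ M, γ p.1 = p.2 := by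
  let e : M →ₗ[ℂ] X := LinearMap.fst ℂ X Y ∘ₗ M.subtype
  let f : M →ₗ[ℂ] Y := LinearMap.snd ℂ X Y ∘ₗ M.subtype
  have hdense : DenseRange e := hd.mono <| by
    rintro x ⟨y, hy⟩
    exact ⟨⟨(x, y), hy⟩, rfl⟩
  exact ⟨f.extendOfNorm e, fun p hp =>
    LinearMap.extendOfNorm_eq hdense ⟨C, fun x => hM x.1 x.2⟩ ⟨p, hp⟩⟩

theorem ConeData.exists_smooth_bound (D : ConeData Ω) (hn : 1 ≤ n) (hΩ : IsOpen Ω)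
    [IsFiniteMeasure (surfaceMeasure Ω)] :
    ∃ C : ENNReal, C ≠ ⊤ ∧ ∀ (v : H1 Ω) (w : E n → ℂ), SmoothRep v w →
      ∫⁻ y, ‖w y‖ₑ ^ 2 ∂surfaceMeasure Ω + gagliardoSq Ω w ≤ C * ‖v‖ₑ ^ 2 := by
  obtain ⟨K, hK, hKE⟩ := D.exists_coneEnergy_smooth_le hn hΩ
  obtain ⟨K', hK', hKB⟩ := D.exists_H12_bound hn hΩ
  have hCt : K' * (D.N * K + 1) ≠ ⊤ := ENNReal.mul_ne_top hK'
    (ENNReal.add_ne_top.2 ⟨ENNReal.mul_ne_top (by simp) hK, by simp⟩)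
  refine ⟨_, hCt, fun v w hw => ?_⟩
  refine (hKB w w hw.contDiff.continuous.measurable hw.contDiff.continuous.measurable).trans ?_
  rw [mul_assoc, ← Lp.enorm_sq_eq_of_ae_eq hw.toL2_ae, H1.enorm_sq]
  refine mul_le_mul' le_rfl ?_
  calc ∑ j, D.coneEnergy j w w + ‖toL2 v‖ₑ ^ 2
      ≤ ∑ _j : Fin D.N, K * ‖grad v‖ₑ ^ 2 + ‖toL2 v‖ₑ ^ 2 :=
        add_le_add (Finset.sum_le_sum fun j _ => hKE v w hw j) le_rfl
    _ = D.N * K * ‖grad v‖ₑ ^ 2 + 1 * ‖toL2 v‖ₑ ^ 2 := by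
        rw [Finset.sum_const, Finset.card_univ, Fintype.card_fin, nsmul_eq_mul, mul_assoc,
          one_mul]
    _ ≤ (D.N * K + 1) * ‖grad v‖ₑ ^ 2 + (D.N * K + 1) * ‖toL2 v‖ₑ ^ 2 :=
        add_le_add (mul_le_mul' le_self_add le_rfl) (mul_le_mul' le_add_self le_rfl)
    _ = _ := by ring

theorem ConeData.mem_closure_smoothH1 (D : ConeData Ω) (hΩ : IsOpen Ω)
    (hb : Bornology.IsBounded Ω) (v : H1 Ω) : v ∈ closure (smoothH1 Ω : Set (H1 Ω)) :=
  D.dense_smoothH1 hΩ hb v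

set_option maxHeartbeats 800000 in
-- Restriction to the boundary is bounded on the dense subspace of elements with smooth
-- representatives, and `H^{1/2}(∂Ω)` is complete.
theorem ConeData.exists_smooth_trace (D : ConeData Ω) (hn : 1 ≤ n) (hΩ : IsOpen Ω)
    (hb : Bornology.IsBounded Ω) :
    ∃ γ : H1 Ω →L[ℂ] H12 Ω, ∀ v w, SmoothRep v w → toL2Bdry (γ v) =ᵐ[surfaceMeasure Ω] w := by
  have := D.isFiniteMeasure hb
  have : CompleteSpace (H12 Ω) := isClosed_H12.completeSpace_coe
  obtain ⟨C, hCt, hC⟩ := D.exists_smooth_bound hn hΩ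
  have hmem : ∀ (v : H1 Ω) w, SmoothRep v w → ∃ t : H12 Ω, toL2Bdry t =ᵐ[surfaceMeasure Ω] w := by
    intro v w hw
    have h1 := (hC v w hw).trans_lt
      (ENNReal.mul_lt_top hCt.lt_top (ENNReal.pow_lt_top enorm_lt_top))
    exact exists_H12 hw.contDiff.continuous.measurable
      (lt_of_le_of_lt le_self_add h1) (lt_of_le_of_lt le_add_self h1)
  have hM : ∀ p ∈ smoothTrace Ω, ‖p.2‖ ≤ √C.toReal * ‖p.1‖ := by
    rintro p ⟨w, hw, hwt⟩
    refine norm_le_of_enorm_sq_le hCt ?_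
    rw [H12.enorm_sq hwt]
    exact hC _ w hw
  have hd : Dense {v : H1 Ω | ∃ t, (v, t) ∈ smoothTrace Ω} := by
    intro v
    have hsub : (smoothH1 Ω : Set (H1 Ω)) ⊆ {v : H1 Ω | ∃ t, (v, t) ∈ smoothTrace Ω} := by
      rintro v ⟨w, hw⟩
      obtain ⟨t, ht⟩ := hmem v w hw
      exact ⟨t, w, hw, ht⟩
    exact closure_mono hsub (D.mem_closure_smoothH1 hΩ hb v)
  obtain ⟨γ, hγ⟩ := exists_clm_of_dense_graph (smoothTrace Ω) hM hd
  refine ⟨γ, fun v w hw => ?_⟩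
  obtain ⟨t, ht⟩ := hmem v w hw
  rw [hγ (v, t) ⟨w, hw, ht⟩]
  exact ht

theorem continuous_toL2 : Continuous (toL2 : H1 Ω → L2 Ω) :=
  (WithLp.prod_continuous_ofLp 2 _ _).fst.comp continuous_subtype_val

theorem continuous_grad : Continuous (grad : H1 Ω → L2Vec Ω) :=
  (WithLp.prod_continuous_ofLp 2 _ _).snd.comp continuous_subtype_val

theorem continuous_toL2Bdry : Continuous (toL2Bdry : H12 Ω → L2Bdry Ω) :=
  (WithLp.prod_continuous_ofLp 2 _ _).fst.comp continuous_subtype_val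

set_option maxHeartbeats 800000 in
-- The energy bound is known for smooth elements and passes to limits by lower semicontinuity. It
-- links an arbitrary element of `H¹(Ω)` to its trace.
theorem ConeData.exists_trace (D : ConeData Ω) (hn : 1 ≤ n) (hΩ : IsOpen Ω)
    (hb : Bornology.IsBounded Ω) :
    ∃ γ : H1 Ω →L[ℂ] H12 Ω, (∀ v w, SmoothRep v w → toL2Bdry (γ v) =ᵐ[surfaceMeasure Ω] w) ∧
      ∃ K : ENNReal, K ≠ ⊤ ∧ ∀ v j,
        D.coneEnergy j (toL2 v) (toL2Bdry (γ v)) ≤ K * ‖grad v‖ₑ ^ 2 := by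
  have := D.isFiniteMeasure hb
  obtain ⟨K, hK, hKE⟩ := D.exists_coneEnergy_smooth_le hn hΩ
  obtain ⟨γ, hγ⟩ := D.exists_smooth_trace hn hΩ hb
  refine ⟨γ, hγ, K, hK, fun v j => ?_⟩
  obtain ⟨s, hs, hsv⟩ := mem_closure_iff_seq_limit.1 (D.mem_closure_smoothH1 hΩ hb v)
  have h1 : Filter.Tendsto (fun k => toL2 (s k)) Filter.atTop (nhds (toL2 v)) :=
    (continuous_toL2.tendsto v).comp hsv
  have h2 : Filter.Tendsto (fun k => toL2Bdry (γ (s k))) Filter.atTop (nhds (toL2Bdry (γ v))) :=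
    ((continuous_toL2Bdry.comp γ.continuous).tendsto v).comp hsv
  have h3 : Filter.Tendsto (fun k => K * ‖grad (s k)‖ₑ ^ 2) Filter.atTop
      (nhds (K * ‖grad v‖ₑ ^ 2)) := by
    refine ENNReal.Tendsto.const_mul (ENNReal.Tendsto.pow ?_) (Or.inr hK)
    exact ((continuous_grad.tendsto v).comp hsv).enorm
  refine D.coneEnergy_le_of_tendsto hΩ j h1 h2 h3 fun k => ?_
  obtain ⟨w, hw⟩ := hs k
  refine le_trans (le_of_eq ?_) (hKE (s k) w hw j)
  exact D.coneEnergy_congr hΩ j hw.toL2_ae (hγ _ w hw)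

/-- A bounded operator whose values have finite cone energy restricts functions that are continuous
up to the boundary. -/
theorem ConeData.toL2Bdry_ae_eq (D : ConeData Ω)
    [SFinite (surfaceMeasure Ω)] {v : L2 Ω} {g : L2Bdry Ω}
    (h : ∀ j, D.coneEnergy j v g ≠ ⊤) {w : E n → ℂ}
    (hw : ∀ j, ∀ᵐ y ∂surfaceMeasure Ω, y ∈ D.S j → ∀ ε > 0, ∃ ρ > 0,
      ∀ᵐ z ∂volume.restrict (D.Γ j), ‖z‖ < ρ → ‖v (y + z) - w y‖ ≤ ε) :
    g =ᵐ[surfaceMeasure Ω] w := by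
  have hmv : Measurable v := (Lp.stronglyMeasurable v).measurable
  have hmg : Measurable g := (Lp.stronglyMeasurable g).measurable
  have h1 : ∀ j, ∀ᵐ y ∂surfaceMeasure Ω, y ∈ D.S j → g y = w y := by
    intro j
    have hm : Measurable fun y => ∫⁻ z in D.Γ j, ‖v (y + z) - g y‖ₑ ^ 2 * wt (n + 1) z :=
      D.measurable_inner j hmv hmg ((measurable_wt (n + 1)).comp measurable_snd)
    -- Finite total energy makes the energy in the single cone finite at almost every vertex, where
    -- `eq_of_tendsto_cone` identifies the value.
    have h2 := ae_lt_top hm (h j)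
    rw [ae_restrict_iff' (D.measurableSet_S j)] at h2
    filter_upwards [h2, hw j] with y hy hy' hyS
    exact D.eq_of_tendsto_cone j (U := fun z => v (y + z)) (hy hyS).ne (hy' hyS)
  rw [← ae_all_iff] at h1
  filter_upwards [h1, ae_mem_frontier (Ω := Ω)] with y hy hyf
  rw [← D.iUnion_S] at hyf
  obtain ⟨j, hj⟩ := Set.mem_iUnion.1 hyf
  exact hy j hj

/-- A representative that is continuous up to the boundary has its boundary value as limit in every
cone, and finite energy identifies this limit with the trace. -/
theorem ConeData.exists_dirichletTrace (D : ConeData Ω) (hn : 1 ≤ n) (hΩ : IsOpen Ω)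
    (hb : Bornology.IsBounded Ω) :
    ∃ γ : H1 Ω →L[ℂ] H12 Ω, IsDirichletTrace γ ∧ ∃ K : ENNReal, K ≠ ⊤ ∧ ∀ v j,
        D.coneEnergy j (toL2 v) (toL2Bdry (γ v)) ≤ K * ‖grad v‖ₑ ^ 2 := by
  have := D.isFiniteMeasure hb
  obtain ⟨γ, -, K, hK, hγ⟩ := D.exists_trace hn hΩ hb
  refine ⟨γ, fun u w hw huw => ?_, K, hK, hγ⟩
  refine D.toL2Bdry_ae_eq (v := toL2 u) (fun j => ne_top_of_le_ne_top
    (ENNReal.mul_ne_top hK (ENNReal.pow_lt_top enorm_lt_top).ne) (hγ u j)) fun j => ?_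
  refine Filter.Eventually.of_forall fun y hy ε hε => ?_
  have hyc : y ∈ closure Ω := frontier_subset_closure hy.1
  obtain ⟨ρ, hρ, h1⟩ := Metric.continuousWithinAt_iff.1 (hw y hyc) ε hε
  refine ⟨ρ, hρ, ?_⟩
  filter_upwards [D.ae_cone huw hΩ hy, ae_restrict_mem (D.measurableSet_Γ j)] with z hz hzΓ hzρ
  rw [hz, ← dist_eq_norm]
  refine (h1 (subset_closure (D.add_mem hy hzΓ)) ?_).le
  rwa [dist_eq_norm, add_sub_cancel_left]

/-- Smooth representatives are continuous on the closure, so two traces agree on a dense subspace.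
-/
theorem ConeData.dirichletTrace_unique (D : ConeData Ω) (hΩ : IsOpen Ω)
    (hb : Bornology.IsBounded Ω) {γ γ' : H1 Ω →L[ℂ] H12 Ω} (h : IsDirichletTrace γ)
    (h' : IsDirichletTrace γ') : γ = γ' := by
  have := D.isFiniteMeasure hb
  have h1 : Set.EqOn γ γ' (smoothH1 Ω : Set (H1 Ω)) := by
    rintro v ⟨w, hw⟩
    refine H12.ext_toL2Bdry (Lp.ext ?_)
    exact (h v w hw.contDiff.continuous.continuousOn hw.toL2_ae).trans
      (h' v w hw.contDiff.continuous.continuousOn hw.toL2_ae).symm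
  exact DFunLike.coe_injective (γ.continuous.ext_on (D.dense_smoothH1 hΩ hb) γ'.continuous h1)

theorem ConeData.dirichletTrace_spec (D : ConeData Ω) (hn : 1 ≤ n) (hΩ : IsOpen Ω)
    (hb : Bornology.IsBounded Ω) :
    IsDirichletTrace (dirichletTrace Ω) ∧ ∃ K : ENNReal, K ≠ ⊤ ∧ ∀ v j,
        D.coneEnergy j (toL2 v) (toL2Bdry (dirichletTrace Ω v)) ≤ K * ‖grad v‖ₑ ^ 2 := by
  obtain ⟨γ, hγ, K, hK, h⟩ := D.exists_dirichletTrace hn hΩ hb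
  have h1 : ∃ γ : H1 Ω →L[ℂ] H12 Ω, IsDirichletTrace γ := ⟨γ, hγ⟩
  have h2 : IsDirichletTrace (dirichletTrace Ω) := by
    rw [dirichletTrace, dif_pos h1]
    exact h1.choose_spec
  rw [D.dirichletTrace_unique hΩ hb h2 hγ]
  exact ⟨hγ, K, hK, h⟩

end

section

/-! ### Averages with the kernel `|x - y|^(-2n)` -/

variable {n : ℕ}

/-- The kernel `|x - y|^(-2n)`. -/
def kr (x y : E n) : ℝ := (‖x - y‖ ^ (2 * n))⁻¹

/-- The derivative of `|x - y|^(-2n)` with respect to `x`. -/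
def kDer (x y : E n) : E n →L[ℝ] ℝ :=
  (-(2 * n) * (‖x - y‖ ^ (2 * n + 2))⁻¹) • innerSL ℝ (x - y)

theorem ofReal_kr (x y : E n) : ENNReal.ofReal (kr x y) = wt (2 * n) (x - y) := rfl

theorem kr_nonneg (x y : E n) : 0 ≤ kr x y := by unfold kr; positivity

theorem measurable_kr : Measurable fun p : E n × E n => kr p.1 p.2 :=
  ((measurable_fst.sub measurable_snd).norm.pow_const _).inv

theorem kr_le {x y : E n} {d : ℝ} (hd : 0 < d) (h : d ≤ ‖x - y‖) : kr x y ≤ (d ^ (2 * n))⁻¹ := by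
  unfold kr
  gcongr

theorem hasFDerivAt_kr {x y : E n} (h : x ≠ y) :
    HasFDerivAt (fun x => kr x y) (kDer x y) x := by
  have h0 : ‖x - y‖ ≠ 0 := norm_ne_zero_iff.2 (sub_ne_zero.2 h)
  -- The even exponent lets the kernel be differentiated as a function of the squared norm.
  have h1 : HasFDerivAt (fun x => ‖x - y‖ ^ 2) (2 • innerSL ℝ (x - y)) x := by
    simpa using ((hasFDerivAt_id x).sub_const y).norm_sq
  have h2 : HasDerivAt (fun s : ℝ => (s ^ n)⁻¹) (-(n * (‖x - y‖ ^ 2) ^ (n - 1)) /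
      ((‖x - y‖ ^ 2) ^ n) ^ 2) (‖x - y‖ ^ 2) :=
    (hasDerivAt_pow n _).fun_inv (by positivity)
  have h3 := h2.comp_hasFDerivAt x h1
  have e1 : ((fun s : ℝ => (s ^ n)⁻¹) ∘ fun x => ‖x - y‖ ^ 2) = fun x => kr x y := by
    funext z
    simp only [Function.comp, kr, pow_mul]
  rw [e1] at h3
  refine h3.congr_fderiv ?_
  rw [kDer, ← Nat.cast_smul_eq_nsmul ℝ, smul_smul]
  congr 1
  rcases Nat.eq_zero_or_pos n with hn | hn
  · simp [hn]
  · obtain ⟨m, rfl⟩ : ∃ m, n = m + 1 := ⟨n - 1, by omega⟩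
    rw [Nat.add_sub_cancel, ← pow_mul, ← pow_mul, ← pow_mul]
    have e2 : ‖x - y‖ ^ (2 * ((m + 1) * 2)) = ‖x - y‖ ^ (2 * m) * ‖x - y‖ ^ (2 * (m + 1) + 2) := by
      rw [← pow_add]; congr 1; ring
    rw [e2]
    field_simp
    push_cast
    ring

theorem norm_kDer_le {x y : E n} {d : ℝ} (hd : 0 < d) (h : d ≤ ‖x - y‖) :
    ‖kDer x y‖ ≤ 2 * n / d * kr x y := by
  have h0 : 0 < ‖x - y‖ := hd.trans_le h
  rw [kDer, norm_smul, innerSL_apply_norm, Real.norm_eq_abs, abs_mul, abs_neg,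
    abs_of_nonneg (by positivity : (0 : ℝ) ≤ 2 * n), abs_of_nonneg (by positivity)]
  calc 2 * n * (‖x - y‖ ^ (2 * n + 2))⁻¹ * ‖x - y‖ = 2 * n / ‖x - y‖ * kr x y := by
        rw [kr, pow_add]
        field_simp
    _ ≤ 2 * n / d * kr x y := by
        have := kr_nonneg x y
        gcongr

section average

variable {F : Type*} [NormedAddCommGroup F] [NormedSpace ℝ F] {μ : Measure (E n)}

/-- The integral of `f` against the kernel. -/
def kInt (μ : Measure (E n)) (f : E n → F) (x : E n) : F := ∫ y, kr x y • f y ∂μ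

theorem aestronglyMeasurable_kr_smul {f : E n → F} (hf : AEStronglyMeasurable f μ) (x : E n) :
    AEStronglyMeasurable (fun y => kr x y • f y) μ :=
  (measurable_kr.comp (measurable_const.prodMk measurable_id)).aestronglyMeasurable.smul hf

theorem integrable_kr_smul {f : E n → F} (hf : Integrable f μ) {x : E n} {d : ℝ} (hd : 0 < d)
    (h : ∀ᵐ y ∂μ, d ≤ ‖x - y‖) : Integrable (fun y => kr x y • f y) μ := by
  refine (hf.norm.const_mul (d ^ (2 * n))⁻¹).mono' (aestronglyMeasurable_kr_smul hf.1 x) ?_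
  filter_upwards [h] with y hy
  rw [norm_smul, Real.norm_of_nonneg (kr_nonneg x y)]
  gcongr
  exact kr_le hd hy

theorem aestronglyMeasurable_kDer {f : E n → F} (hf : AEStronglyMeasurable f μ) (x : E n) :
    AEStronglyMeasurable (fun y => (kDer x y).smulRight (f y)) μ := by
  have h1 : Continuous fun p : E n × F => (innerSL ℝ p.1).smulRight p.2 := by
    have := (ContinuousLinearMap.smulRightL ℝ (E n) F).isBoundedBilinearMap.continuous
    exact this.comp ((innerSL ℝ).continuous.comp continuous_fst |>.prodMk continuous_snd)
  have h2 : AEStronglyMeasurable (fun y => (x - y,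
      (-(2 * n) * (‖x - y‖ ^ (2 * n + 2))⁻¹ : ℝ) • f y)) μ := by
    refine (measurable_const.sub measurable_id).aestronglyMeasurable.prodMk ?_
    refine AEStronglyMeasurable.smul (Measurable.aestronglyMeasurable ?_) hf
    exact measurable_const.mul ((measurable_const.sub measurable_id).norm.pow_const _).inv
  refine (h1.comp_aestronglyMeasurable h2).congr (Filter.Eventually.of_forall fun y => ?_)
  ext v
  simp only [kDer, ContinuousLinearMap.smulRight_apply, smul_apply, smul_smul,
    smul_eq_mul]
  congr 1
  ring

theorem norm_kDer_smulRight_le (f : F) {x y : E n} {d : ℝ} (hd : 0 < d)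
    (h : d ≤ ‖x - y‖) : ‖(kDer x y).smulRight f‖ ≤ 2 * n / d * kr x y * ‖f‖ := by
  rw [ContinuousLinearMap.norm_smulRight_apply]
  gcongr
  exact norm_kDer_le hd h

theorem integrable_kDer {f : E n → F} (hf : Integrable f μ) {x : E n} {d : ℝ} (hd : 0 < d)
    (h : ∀ᵐ y ∂μ, d ≤ ‖x - y‖) : Integrable (fun y => (kDer x y).smulRight (f y)) μ := by
  refine ((integrable_kr_smul hf hd h).norm.const_mul (2 * n / d)).mono'
    (aestronglyMeasurable_kDer hf.1 x) ?_
  filter_upwards [h] with y hy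
  refine (norm_kDer_smulRight_le _ hd hy).trans (le_of_eq ?_)
  rw [norm_smul, Real.norm_of_nonneg (kr_nonneg x y), mul_assoc]

/-- On the ball of radius `d / 2` the kernel stays away from its singularity, which gives an
integrable bound for differentiating under the integral. -/
theorem hasFDerivAt_kInt {f : E n → F} (hf : Integrable f μ) {x : E n} {d : ℝ} (hd : 0 < d)
    (h : ∀ᵐ y ∂μ, d ≤ ‖x - y‖) :
    HasFDerivAt (kInt μ f) (∫ y, (kDer x y).smulRight (f y) ∂μ) x := by
  have hball : ∀ z ∈ Metric.ball x (d / 2), ∀ y, d ≤ ‖x - y‖ → d / 2 ≤ ‖z - y‖ := by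
    intro z hz y hy
    rw [Metric.mem_ball, dist_comm, dist_eq_norm] at hz
    have : ‖x - y‖ ≤ ‖x - z‖ + ‖z - y‖ := norm_sub_le_norm_sub_add_norm_sub x z y
    linarith
  refine hasFDerivAt_integral_of_dominated_of_fderiv_le (s := Metric.ball x (d / 2))
    (bound := fun y => 2 * n / (d / 2) * ((d / 2) ^ (2 * n))⁻¹ * ‖f y‖)
    (F := fun x y => kr x y • f y) (F' := fun x y => (kDer x y).smulRight (f y))
    (Metric.ball_mem_nhds x (by positivity))
    (Filter.Eventually.of_forall fun z => aestronglyMeasurable_kr_smul hf.1 z)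
    (integrable_kr_smul hf hd h) (aestronglyMeasurable_kDer hf.1 x) ?_
    (hf.norm.const_mul _) ?_
  · filter_upwards [h] with y hy z hz
    have h1 := hball z hz y hy
    refine (norm_kDer_smulRight_le _ (by positivity) h1).trans ?_
    gcongr
    exact kr_le (by positivity) h1
  · filter_upwards [h] with y hy z hz
    have h1 := hball z hz y hy
    have hzy : z ≠ y := by
      rintro rfl
      rw [sub_self, norm_zero] at h1
      linarith
    exact (hasFDerivAt_kr hzy).smul_const (f y)

theorem ofReal_kInt_one [IsFiniteMeasure μ] {x : E n} {d : ℝ} (hd : 0 < d)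
    (h : ∀ᵐ y ∂μ, d ≤ ‖x - y‖) :
    ENNReal.ofReal (kInt μ (fun _ => (1 : ℝ)) x) = ∫⁻ y, wt (2 * n) (x - y) ∂μ := by
  have h1 := integrable_kr_smul (integrable_const (μ := μ) (1 : ℝ)) hd h
  rw [kInt, ofReal_integral_eq_lintegral_ofReal h1 (Filter.Eventually.of_forall fun y => by
    simpa using kr_nonneg x y)]
  simp only [smul_eq_mul, mul_one, ofReal_kr]

/-- The average of `f` with respect to the kernel. -/
def kAvg (μ : Measure (E n)) (f : E n → ℂ) (x : E n) : ℂ :=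
  (kInt μ (fun _ => (1 : ℝ)) x)⁻¹ • kInt μ f x

theorem measurable_kInt [SFinite μ] [SecondCountableTopology F] [MeasurableSpace F] [BorelSpace F]
    {f : E n → F} (hf : Measurable f) : Measurable (kInt μ f) := by
  have h1 : StronglyMeasurable fun p : E n × E n => kr p.1 p.2 • f p.2 :=
    (measurable_kr.smul (hf.comp measurable_snd)).stronglyMeasurable
  exact h1.integral_prod_right.measurable

theorem measurable_kAvg [SFinite μ] {f : E n → ℂ} (hf : Measurable f) :
    Measurable (kAvg μ f) :=
  Measurable.smul (f := fun x => (kInt μ (fun _ => (1 : ℝ)) x)⁻¹)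
    (measurable_kInt measurable_const).inv (measurable_kInt hf)

variable [IsFiniteMeasure μ] {f : E n → ℂ} {x : E n} {d : ℝ}

/-- Averages reproduce constants, so the quotient rule can be grouped with `f y` replaced by `f y -
kAvg μ f x`. This grouping makes the gradient depend only on the oscillation of `f`. -/
theorem hasFDerivAt_kAvg (hf : Integrable f μ) (hd : 0 < d)
    (h : ∀ᵐ y ∂μ, d ≤ ‖x - y‖) (hpos : 0 < kInt μ (fun _ => (1 : ℝ)) x) :
    HasFDerivAt (kAvg μ f) ((kInt μ (fun _ => (1 : ℝ)) x)⁻¹ •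
      ∫ y, (kDer x y).smulRight (f y - kAvg μ f x) ∂μ) x := by
  set q := kInt μ (fun _ => (1 : ℝ)) x with hq
  have h1 := hasFDerivAt_kInt (integrable_const (μ := μ) (1 : ℝ)) hd h
  have h2 := hasFDerivAt_kInt hf hd h
  have h3 := (hasDerivAt_inv hpos.ne').comp_hasFDerivAt x h1
  have h4 := h3.smul h2
  refine h4.congr_fderiv ?_
  have e1 : ∫ y, (kDer x y).smulRight (f y - kAvg μ f x) ∂μ =
      (∫ y, (kDer x y).smulRight (f y) ∂μ) -
        (∫ y, (kDer x y).smulRight (1 : ℝ) ∂μ).smulRight (kAvg μ f x) := by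
    have e2 : (∫ y, (kDer x y).smulRight (1 : ℝ) ∂μ).smulRight (kAvg μ f x) =
        ∫ y, (kDer x y).smulRight (kAvg μ f x) ∂μ := by
      have e3 : ∫ y, ((kDer x y).smulRight (1 : ℝ)).smulRight (kAvg μ f x) ∂μ =
          (∫ y, (kDer x y).smulRight (1 : ℝ) ∂μ).smulRight (kAvg μ f x) :=
        ((ContinuousLinearMap.smulRightL ℝ (E n) ℂ).flip (kAvg μ f x)).integral_comp_comm
          (integrable_kDer (integrable_const (μ := μ) (1 : ℝ)) hd h)
      rw [← e3]
      congr 1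
      ext y v
      simp
    rw [e2, ← integral_sub (integrable_kDer hf hd h) (integrable_kDer (integrable_const _) hd h)]
    congr 1
    ext y v
    simp [mul_sub]
  rw [e1]
  ext v
  simp only [add_apply, smul_apply,
    ContinuousLinearMap.smulRight_apply, sub_apply, Function.comp, ← hq, kAvg,
    smul_sub, smul_smul, smul_eq_mul]
  rw [sub_eq_add_neg, ← neg_smul]
  congr 2
  field_simp

/-- Jensen's inequality for the normalised kernel, kept in the multiplied form. -/
theorem enorm_kAvg_sub_sq_le (hf : Integrable f μ) (hfm : Measurable f) (hd : 0 < d)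
    (h : ∀ᵐ y ∂μ, d ≤ ‖x - y‖) (hpos : 0 < kInt μ (fun _ => (1 : ℝ)) x) (a : ℂ) :
    ‖kAvg μ f x - a‖ₑ ^ 2 * ∫⁻ y, wt (2 * n) (x - y) ∂μ ≤
      ∫⁻ y, wt (2 * n) (x - y) * ‖f y - a‖ₑ ^ 2 ∂μ := by
  set q := kInt μ (fun _ => (1 : ℝ)) x with hq
  have hW := ofReal_kInt_one (μ := μ) hd h
  rw [← hq] at hW
  set W := ∫⁻ y, wt (2 * n) (x - y) ∂μ with hWdef
  have hW0 : W ≠ 0 := by rw [← hW]; simpa using hpos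
  have hWt : W ≠ ⊤ := by rw [← hW]; exact ENNReal.ofReal_ne_top
  have hm : Measurable fun y => wt (2 * n) (x - y) :=
    (measurable_wt _).comp (measurable_const.sub measurable_id)
  have h1 : q • (kAvg μ f x - a) = ∫ y, kr x y • (f y - a) ∂μ := by
    have e1 : ∫ y, kr x y • a ∂μ = q • a := by
      have e2 := integral_smul_const (μ := μ) (fun y => kr x y) a
      rw [e2, hq, kInt]
      simp
    simp only [smul_sub]
    rw [integral_sub (integrable_kr_smul hf hd h) (integrable_kr_smul (integrable_const a) hd h),
      e1, kAvg, ← hq, smul_smul, mul_inv_cancel₀ hpos.ne', one_smul, kInt]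
  have h2 : ‖kAvg μ f x - a‖ₑ * W ≤ ∫⁻ y, wt (2 * n) (x - y) * ‖f y - a‖ₑ ∂μ := by
    calc ‖kAvg μ f x - a‖ₑ * W = ‖q • (kAvg μ f x - a)‖ₑ := by
          rw [enorm_smul, ← hW, mul_comm, Real.enorm_of_nonneg hpos.le]
      _ ≤ ∫⁻ y, ‖kr x y • (f y - a)‖ₑ ∂μ := by
          rw [h1]
          exact enorm_integral_le_lintegral_enorm _
      _ = _ := by
          refine lintegral_congr fun y => ?_
          rw [enorm_smul, Real.enorm_of_nonneg (kr_nonneg x y), ofReal_kr]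
  have h3 : (‖kAvg μ f x - a‖ₑ * W) ^ 2 ≤ W * ∫⁻ y, wt (2 * n) (x - y) * ‖f y - a‖ₑ ^ 2 ∂μ := by
    refine le_trans (by gcongr) (lintegral_weighted_sq_le hm.aemeasurable
      (hfm.sub measurable_const).enorm.aemeasurable)
  have h4 : W * (‖kAvg μ f x - a‖ₑ ^ 2 * W) ≤
      W * ∫⁻ y, wt (2 * n) (x - y) * ‖f y - a‖ₑ ^ 2 ∂μ := by
    refine le_trans (le_of_eq ?_) h3
    ring
  exact (ENNReal.mul_le_mul_iff_right hW0 hWt).1 h4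

/-- The kernel's derivative is at most `2n/d` times the kernel. Cauchy-Schwarz gives an average of
`|f y - kAvg f x|²`, and Jensen, with `a = f y`, turns it into a double average of `|f y' - f y|²`.
-/
theorem enorm_fderiv_kAvg_sq_le (hf : Integrable f μ) (hfm : Measurable f) (hd : 0 < d)
    (h : ∀ᵐ y ∂μ, d ≤ ‖x - y‖) (hpos : 0 < kInt μ (fun _ => (1 : ℝ)) x) :
    ‖fderiv ℝ (kAvg μ f) x‖ₑ ^ 2 * (∫⁻ y, wt (2 * n) (x - y) ∂μ) ^ 2 ≤
      ENNReal.ofReal ((2 * n / d) ^ 2) * ∫⁻ y, wt (2 * n) (x - y) *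
        (∫⁻ y', wt (2 * n) (x - y') * ‖f y' - f y‖ₑ ^ 2 ∂μ) ∂μ := by
  set q := kInt μ (fun _ => (1 : ℝ)) x with hq
  have hW := ofReal_kInt_one (μ := μ) hd h
  rw [← hq] at hW
  set W := ∫⁻ y, wt (2 * n) (x - y) ∂μ with hWdef
  have hWt : W ≠ ⊤ := by rw [← hW]; exact ENNReal.ofReal_ne_top
  have hm : Measurable fun y => wt (2 * n) (x - y) :=
    (measurable_wt _).comp (measurable_const.sub measurable_id)
  have h1 : q • fderiv ℝ (kAvg μ f) x = ∫ y, (kDer x y).smulRight (f y - kAvg μ f x) ∂μ := by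
    rw [(hasFDerivAt_kAvg hf hd h hpos).fderiv, smul_smul, mul_inv_cancel₀ hpos.ne', one_smul]
  have h2 : ‖fderiv ℝ (kAvg μ f) x‖ₑ * W ≤
      ENNReal.ofReal (2 * n / d) * ∫⁻ y, wt (2 * n) (x - y) * ‖f y - kAvg μ f x‖ₑ ∂μ := by
    calc ‖fderiv ℝ (kAvg μ f) x‖ₑ * W = ‖q • fderiv ℝ (kAvg μ f) x‖ₑ := by
          rw [enorm_smul, ← hW, mul_comm, Real.enorm_of_nonneg hpos.le]
      _ ≤ ∫⁻ y, ‖(kDer x y).smulRight (f y - kAvg μ f x)‖ₑ ∂μ := by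
          rw [h1]
          exact enorm_integral_le_lintegral_enorm _
      _ ≤ ∫⁻ y, ENNReal.ofReal (2 * n / d) * (wt (2 * n) (x - y) * ‖f y - kAvg μ f x‖ₑ) ∂μ := by
          refine lintegral_mono_ae ?_
          filter_upwards [h] with y hy
          rw [← ofReal_norm, ← ofReal_norm, ← ofReal_kr, ← ENNReal.ofReal_mul (kr_nonneg x y),
            ← ENNReal.ofReal_mul (by positivity)]
          apply ENNReal.ofReal_le_ofReal
          rw [← mul_assoc]
          exact norm_kDer_smulRight_le _ hd hy
      _ = _ := lintegral_const_mul' _ _ ENNReal.ofReal_ne_top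
  have h3 : (‖fderiv ℝ (kAvg μ f) x‖ₑ * W) ^ 2 ≤ ENNReal.ofReal ((2 * n / d) ^ 2) *
      (W * ∫⁻ y, wt (2 * n) (x - y) * ‖f y - kAvg μ f x‖ₑ ^ 2 ∂μ) := by
    calc (‖fderiv ℝ (kAvg μ f) x‖ₑ * W) ^ 2 ≤ (ENNReal.ofReal (2 * n / d) *
          ∫⁻ y, wt (2 * n) (x - y) * ‖f y - kAvg μ f x‖ₑ ∂μ) ^ 2 := by gcongr
      _ = ENNReal.ofReal ((2 * n / d) ^ 2) *
          (∫⁻ y, wt (2 * n) (x - y) * ‖f y - kAvg μ f x‖ₑ ∂μ) ^ 2 := by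
          rw [mul_pow, ENNReal.ofReal_pow (by positivity)]
      _ ≤ _ := by
          gcongr
          exact lintegral_weighted_sq_le hm.aemeasurable
            (hfm.sub measurable_const).enorm.aemeasurable
  rw [← mul_pow]
  refine h3.trans ?_
  gcongr
  rw [← lintegral_const_mul' _ _ hWt]
  refine lintegral_mono fun y => ?_
  calc W * (wt (2 * n) (x - y) * ‖f y - kAvg μ f x‖ₑ ^ 2)
      = wt (2 * n) (x - y) * (‖kAvg μ f x - f y‖ₑ ^ 2 * W) := by
        rw [← enorm_neg, neg_sub]; ring
    _ ≤ _ := by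
        gcongr
        exact enorm_kAvg_sub_sq_le hf hfm hd h hpos (f y)

end average

end

section

/-! ### Extension of boundary functions -/

variable {n : ℕ} {Ω : Set (E n)}

theorem infDist_le_norm_sub (hΩ : IsOpen Ω) (x : E n) {y : E n} (hy : y ∈ frontier Ω) :
    Metric.infDist x Ωᶜ ≤ ‖x - y‖ := by
  rw [← dist_eq_norm]
  rw [hΩ.frontier_eq] at hy
  exact Metric.infDist_le_dist_of_mem hy.2

theorem infDist_compl_pos (hΩ : IsOpen Ω) {x : E n} (hx : x ∈ Ω) (hne : Ωᶜ.Nonempty) :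
    0 < Metric.infDist x Ωᶜ :=
  (hΩ.isClosed_compl.notMem_iff_infDist_pos hne).1 fun h => h hx

theorem exists_frontier_norm_sub_eq (hΩ : IsOpen Ω) {x : E n} (hx : x ∈ Ω) (hne : Ωᶜ.Nonempty) :
    ∃ y ∈ frontier Ω, ‖x - y‖ = Metric.infDist x Ωᶜ := by
  obtain ⟨y, hy, hxy⟩ := hΩ.isClosed_compl.exists_infDist_eq_dist hne x
  have hpos := infDist_compl_pos hΩ hx hne
  refine ⟨y, ?_, by rw [hxy, dist_eq_norm]⟩
  rw [hΩ.frontier_eq]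
  refine ⟨?_, hy⟩
  have h1 : Metric.ball x (Metric.infDist x Ωᶜ) ⊆ Ω := by
    intro z hz
    by_contra hzΩ
    have := Metric.infDist_le_dist_of_mem (x := x) (show z ∈ Ωᶜ from hzΩ)
    rw [Metric.mem_ball, dist_comm] at hz
    linarith
  refine closure_mono h1 ?_
  rw [closure_ball x hpos.ne', Metric.mem_closedBall, dist_comm, hxy]

theorem nonempty_compl_of_isBounded (hn : 1 ≤ n) (hb : Bornology.IsBounded Ω) : Ωᶜ.Nonempty := by
  have : Nonempty (Fin n) := ⟨⟨0, hn⟩⟩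
  have : Nontrivial (E n) := by
    refine ⟨EuclideanSpace.single ⟨0, hn⟩ 1, 0, ?_⟩
    simp
  by_contra h
  rw [Set.not_nonempty_iff_eq_empty, Set.compl_empty_iff] at h
  rw [h] at hb
  exact NormedSpace.unbounded_univ ℝ (E n) hb

/-- With `d` the distance of `x` from `Ωᶜ`, boundary points within `τd` of a nearest point are at
distance at most `2d` from `x`, and their measure is at least of order `d^(n-1)`; against `d^(-2n)`
this gives `d^(-n-1)`. -/
theorem ConeData.exists_kernel_lower (D : ConeData Ω) (hn : 1 ≤ n) (hΩ : IsOpen Ω)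
    (hb : Bornology.IsBounded Ω) :
    ∃ c > 0, ∀ x ∈ Ω, ENNReal.ofReal ((c * Metric.infDist x Ωᶜ ^ (n + 1))⁻¹) ≤
      ∫⁻ y, wt (2 * n) (x - y) ∂surfaceMeasure Ω := by
  have hr := D.r_pos
  have hc := D.c_pos
  have hne := nonempty_compl_of_isBounded hn hb
  obtain ⟨R, hR0, hR⟩ := hb.exists_pos_norm_le
  obtain ⟨z, hz⟩ := hne
  set M := R + ‖z‖ with hM
  have hM0 : 0 < M := by positivity
  -- Since `d ≤ M`, the radius `τd` does not exceed `r`, below which the lower Ahlfors bound is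
  -- available.
  set τ := min 1 (D.r / M) with hτ
  have hτ0 : 0 < τ := lt_min one_pos (by positivity)
  refine ⟨2 ^ (2 * n) * (D.c * τ ^ (n - 1))⁻¹, by positivity, fun x hx => ?_⟩
  obtain ⟨y0, hy0, hxy0⟩ := exists_frontier_norm_sub_eq hΩ hx ⟨z, hz⟩
  have hd := infDist_compl_pos hΩ hx ⟨z, hz⟩
  set d := Metric.infDist x Ωᶜ with hddef
  have hdM : d ≤ M := by
    have := Metric.infDist_le_dist_of_mem (x := x) hz
    rw [dist_eq_norm] at this
    linarith [norm_sub_le x z, hR x hx]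
  have hρr : τ * d ≤ D.r := by
    calc τ * d ≤ D.r / M * M := by
          have := min_le_right 1 (D.r / M)
          gcongr
      _ = D.r := by field_simp
  have hρd : τ * d ≤ d := by
    have := min_le_left 1 (D.r / M)
    nlinarith
  calc ENNReal.ofReal ((2 ^ (2 * n) * (D.c * τ ^ (n - 1))⁻¹ * d ^ (n + 1))⁻¹)
      = ENNReal.ofReal (((2 * d) ^ (2 * n))⁻¹) * ENNReal.ofReal (D.c * (τ * d) ^ (n - 1)) := by
        rw [← ENNReal.ofReal_mul (by positivity)]
        congr 1
        have e : d ^ (2 * n) = d ^ (n - 1) * d ^ (n + 1) := by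
          rw [← pow_add]; congr 1; omega
        rw [mul_pow, mul_pow, e]
        field_simp
    _ ≤ ENNReal.ofReal (((2 * d) ^ (2 * n))⁻¹) * surfaceMeasure Ω (Metric.ball y0 (τ * d)) := by
        gcongr
        exact D.lower y0 hy0 _ (by positivity) hρr
    _ = ∫⁻ _y in Metric.ball y0 (τ * d), ENNReal.ofReal (((2 * d) ^ (2 * n))⁻¹)
          ∂surfaceMeasure Ω := by
        rw [setLIntegral_const]
    _ ≤ ∫⁻ y in Metric.ball y0 (τ * d), wt (2 * n) (x - y) ∂surfaceMeasure Ω := by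
        refine setLIntegral_mono_ae' Metric.isOpen_ball.measurableSet ?_
        filter_upwards [ae_mem_frontier (Ω := Ω)] with y hyf hy
        apply ENNReal.ofReal_le_ofReal
        have h1 := infDist_le_norm_sub hΩ x hyf
        have h2 : 0 < ‖x - y‖ := hd.trans_le h1
        have h3 : ‖x - y‖ ≤ 2 * d := by
          rw [Metric.mem_ball, dist_comm, dist_eq_norm] at hy
          have := norm_sub_le_norm_sub_add_norm_sub x y0 y
          linarith
        gcongr
    _ ≤ _ := setLIntegral_le_lintegral _ _

theorem lintegral_wt_Ω_lt_top (hn : 1 ≤ n) (R : ℝ) :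
    ∫⁻ x in Metric.ball (0 : E n) R, wt (n - 1) x < ⊤ := by
  have h := integrableOn_ball_of_norm_le_rpow (E := E n) (μ := volume)
    (f := fun x => (‖x‖ ^ (n - 1))⁻¹) (C := 1) (α := ((n - 1 : ℕ) : ℝ)) (r := R)
    (by rw [finrank_euclideanSpace_fin]; exact hn)
    (by rw [finrank_euclideanSpace_fin]; exact_mod_cast Nat.sub_lt hn one_pos)
    (Filter.Eventually.of_forall fun x => by
      rw [Real.rpow_neg (norm_nonneg _), Real.rpow_natCast, one_mul,
        Real.norm_of_nonneg (by positivity)])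
    (measurable_norm.pow_const _).inv.aestronglyMeasurable
  refine lt_of_eq_of_lt (lintegral_congr fun x => ?_) h.2
  rw [wt, Real.enorm_of_nonneg (by positivity)]

theorem exists_lintegral_wt_le (hn : 1 ≤ n) (hΩ : IsOpen Ω) (hb : Bornology.IsBounded Ω) :
    ∃ K : ENNReal, K ≠ ⊤ ∧ ∀ y ∈ frontier Ω, ∫⁻ x in Ω, wt (n - 1) (x - y) ≤ K := by
  obtain ⟨R, hR0, hR⟩ := hb.exists_pos_norm_le
  refine ⟨_, (lintegral_wt_Ω_lt_top hn (2 * R + 1)).ne, fun y hy => ?_⟩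
  have hyR : ‖y‖ ≤ R := by
    have h1 : closure Ω ⊆ Metric.closedBall 0 R :=
      closure_minimal (fun x hx => by simpa using hR x hx) Metric.isClosed_closedBall
    simpa using h1 (frontier_subset_closure hy)
  calc ∫⁻ x in Ω, wt (n - 1) (x - y)
      ≤ ∫⁻ x, (Metric.ball (0 : E n) (2 * R + 1)).indicator (wt (n - 1)) (x - y) := by
        refine le_trans (setLIntegral_mono' hΩ.measurableSet fun x hx => ?_)
          (setLIntegral_le_lintegral Ω _)
        have hmem : x - y ∈ Metric.ball (0 : E n) (2 * R + 1) := by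
          rw [Metric.mem_ball, dist_zero_right]
          linarith [norm_sub_le x y, hR x hx]
        rw [Set.indicator_of_mem hmem]
    _ = ∫⁻ x, (Metric.ball (0 : E n) (2 * R + 1)).indicator (wt (n - 1)) x :=
        lintegral_sub_right_eq_self _ y
    _ = _ := lintegral_indicator Metric.isOpen_ball.measurableSet _

/-- Translation and scaling by `δ`. The resulting power `δ^(-n)`, with `δ = ‖y - y'‖`, is the
Gagliardo weight, which explains the exponent `2n` of the kernel. -/
theorem lintegral_add_norm_pow {y : E n} {δ : ℝ} (hδ : 0 < δ) :
    ∫⁻ x : E n, ENNReal.ofReal (((δ + ‖x - y‖) ^ (2 * n))⁻¹) = ENNReal.ofReal ((δ ^ n)⁻¹) *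
      ∫⁻ x : E n, ENNReal.ofReal (((1 + ‖x‖) ^ (2 * n))⁻¹) := by
  have h1 := lintegral_sub_right_eq_self (μ := (volume : Measure (E n)))
    (fun x => ENNReal.ofReal (((δ + ‖x‖) ^ (2 * n))⁻¹)) y
  have h2 := lintegral_comp_smul_pos (fun x : E n => ENNReal.ofReal (((δ + ‖x‖) ^ (2 * n))⁻¹)) hδ
  have h3 : ∀ x : E n, ENNReal.ofReal (((δ + ‖δ • x‖) ^ (2 * n))⁻¹) =
      ENNReal.ofReal ((δ ^ (2 * n))⁻¹) * ENNReal.ofReal (((1 + ‖x‖) ^ (2 * n))⁻¹) := by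
    intro x
    rw [← ENNReal.ofReal_mul (by positivity), ← mul_inv, ← mul_pow, norm_smul,
      Real.norm_of_nonneg hδ.le]
    congr 4
    ring
  simp_rw [h3] at h2
  rw [lintegral_const_mul' _ _ ENNReal.ofReal_ne_top] at h2
  rw [h1]
  calc ∫⁻ x : E n, ENNReal.ofReal (((δ + ‖x‖) ^ (2 * n))⁻¹)
      = ENNReal.ofReal (δ ^ n) * (ENNReal.ofReal ((δ ^ n)⁻¹) *
          ∫⁻ x : E n, ENNReal.ofReal (((δ + ‖x‖) ^ (2 * n))⁻¹)) := by
        rw [← mul_assoc, ← ENNReal.ofReal_mul (by positivity),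
          mul_inv_cancel₀ (by positivity), ENNReal.ofReal_one, one_mul]
    _ = _ := by
        rw [← h2, ← mul_assoc, ← ENNReal.ofReal_mul (by positivity)]
        congr 2
        rw [two_mul, pow_add]
        field_simp

theorem lintegral_one_add_norm_lt_top (hn : 1 ≤ n) :
    ∫⁻ x : E n, ENNReal.ofReal (((1 + ‖x‖) ^ (2 * n))⁻¹) < ⊤ := by
  have h := finite_integral_one_add_norm (E := E n) (μ := volume) (r := ((2 * n : ℕ) : ℝ))
    (by rw [finrank_euclideanSpace_fin]; exact_mod_cast (by omega : n < 2 * n))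
  refine lt_of_eq_of_lt (lintegral_congr fun x => ?_) h
  rw [Real.rpow_neg (by positivity), Real.rpow_natCast]

/-- With `A = ‖x - y‖` and `B = ‖x - y'‖`, both at least `d`, one has `d(‖y - y'‖ + A) ≤ d(2A + B) ≤
3AB`. -/
theorem ofReal_mul_wt_mul_wt_le {x y y' : E n} {d : ℝ} (hd : 0 < d) (h : d ≤ ‖x - y‖)
    (h' : d ≤ ‖x - y'‖) :
    ENNReal.ofReal (d ^ (2 * n)) * (wt (2 * n) (x - y) * wt (2 * n) (x - y')) ≤
      ENNReal.ofReal (3 ^ (2 * n)) * ENNReal.ofReal (((‖y - y'‖ + ‖x - y‖) ^ (2 * n))⁻¹) := by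
  have hA : 0 < ‖x - y‖ := hd.trans_le h
  have hB : 0 < ‖x - y'‖ := hd.trans_le h'
  rw [wt, wt, ← ENNReal.ofReal_mul (by positivity), ← ENNReal.ofReal_mul (by positivity),
    ← ENNReal.ofReal_mul (by positivity)]
  apply ENNReal.ofReal_le_ofReal
  rw [← mul_inv, ← mul_pow, ← div_eq_mul_inv, ← div_eq_mul_inv, ← div_pow, ← div_pow]
  gcongr ?_ ^ _
  rw [div_le_div_iff₀ (by positivity) (by positivity)]
  have h3 : ‖y - y'‖ ≤ ‖x - y‖ + ‖x - y'‖ := by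
    rw [show y - y' = (x - y') - (x - y) by abel, add_comm]
    exact norm_sub_le _ _
  nlinarith

theorem le_ofReal_mul_of_mul_le {X W Y : ENNReal} {a : ℝ} (ha : 0 < a)
    (hW : ENNReal.ofReal a⁻¹ ≤ W) (h : X * W ≤ Y) : X ≤ ENNReal.ofReal a * Y := by
  calc X = ENNReal.ofReal a * (X * ENNReal.ofReal a⁻¹) := by
        rw [mul_comm X, ← mul_assoc, ← ENNReal.ofReal_mul ha.le, mul_inv_cancel₀ ha.ne',
          ENNReal.ofReal_one, one_mul]
    _ ≤ ENNReal.ofReal a * Y := by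
        gcongr
        exact le_trans (by gcongr) h

theorem enorm_gradFun_sq_le (w : E n → ℂ) (x : E n) :
    ‖gradFun w x‖ₑ ^ 2 ≤ n * ‖fderiv ℝ w x‖ₑ ^ 2 := by
  have h1 : ‖gradFun w x‖ ^ 2 ≤ n * ‖fderiv ℝ w x‖ ^ 2 := by
    rw [EuclideanSpace.norm_sq_eq]
    calc ∑ i, ‖(gradFun w x) i‖ ^ 2 ≤ ∑ _i : Fin n, ‖fderiv ℝ w x‖ ^ 2 := by
          refine Finset.sum_le_sum fun i _ => ?_
          have : ‖(gradFun w x) i‖ ≤ ‖fderiv ℝ w x‖ := by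
            refine ((fderiv ℝ w x).le_opNorm (EuclideanSpace.single i 1)).trans ?_
            simp
          gcongr
      _ = _ := by simp
  rw [← ofReal_norm, ← ofReal_norm, ← ENNReal.ofReal_pow (norm_nonneg _),
    ← ENNReal.ofReal_pow (norm_nonneg _), ← ENNReal.ofReal_natCast,
    ← ENNReal.ofReal_mul (by positivity)]
  exact ENNReal.ofReal_le_ofReal h1

theorem measurable_gradFun (w : E n → ℂ) : Measurable (gradFun w) := by
  unfold gradFun partialDeriv
  exact (WithLp.measurable_toLp 2 _).comp
    (measurable_pi_lambda _ fun i => measurable_fderiv_apply_const ℝ w _)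

end

section

/-! ### Surjectivity of the trace -/

variable {n : ℕ} {Ω : Set (E n)}

theorem kAvg_spec (hΩ : IsOpen Ω) [IsFiniteMeasure (surfaceMeasure Ω)] {c : ℝ} (hc : 0 < c)
    (hlow : ∀ x ∈ Ω, ENNReal.ofReal ((c * Metric.infDist x Ωᶜ ^ (n + 1))⁻¹) ≤
      ∫⁻ y, wt (2 * n) (x - y) ∂surfaceMeasure Ω) {x : E n} (hx : x ∈ Ω) (hne : Ωᶜ.Nonempty) :
    0 < Metric.infDist x Ωᶜ ∧ (∀ᵐ y ∂surfaceMeasure Ω, Metric.infDist x Ωᶜ ≤ ‖x - y‖) ∧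
      0 < kInt (surfaceMeasure Ω) (fun _ => (1 : ℝ)) x := by
  have hd := infDist_compl_pos hΩ hx hne
  have h1 : ∀ᵐ y ∂surfaceMeasure Ω, Metric.infDist x Ωᶜ ≤ ‖x - y‖ :=
    ae_mem_frontier.mono fun y hy => infDist_le_norm_sub hΩ x hy
  refine ⟨hd, h1, ?_⟩
  have h2 := hlow x hx
  rw [← ofReal_kInt_one hd h1] at h2
  have h3 : 0 < (c * Metric.infDist x Ωᶜ ^ (n + 1))⁻¹ := by positivity
  exact ENNReal.ofReal_pos.1 ((ENNReal.ofReal_pos.2 h3).trans_le h2)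

/-- Normalising costs `d^(n+1) ≤ ‖x - y‖^(n+1)`, so the normalised kernel is at most a multiple of
`‖x - y‖^(1-n)`, which is integrable over `Ω` uniformly in `y`. -/
theorem enorm_kAvg_sq_le (hn : 1 ≤ n) (hΩ : IsOpen Ω) [IsFiniteMeasure (surfaceMeasure Ω)]
    (hne : Ωᶜ.Nonempty) {c : ℝ} (hc : 0 < c)
    (hlow : ∀ x ∈ Ω, ENNReal.ofReal ((c * Metric.infDist x Ωᶜ ^ (n + 1))⁻¹) ≤
      ∫⁻ y, wt (2 * n) (x - y) ∂surfaceMeasure Ω) {f : E n → ℂ}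
    (hf : Integrable f (surfaceMeasure Ω)) (hfm : Measurable f) {x : E n} (hx : x ∈ Ω) :
    ‖kAvg (surfaceMeasure Ω) f x‖ₑ ^ 2 ≤
      ENNReal.ofReal c * ∫⁻ y, wt (n - 1) (x - y) * ‖f y‖ₑ ^ 2 ∂surfaceMeasure Ω := by
  obtain ⟨hd, h1, hpos⟩ := kAvg_spec hΩ hc hlow hx hne
  have h2 := enorm_kAvg_sub_sq_le hf hfm hd h1 hpos 0
  simp only [sub_zero] at h2
  have h3 := le_ofReal_mul_of_mul_le (by positivity) (hlow x hx) h2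
  refine h3.trans ?_
  rw [ENNReal.ofReal_mul hc.le, mul_assoc, ← lintegral_const_mul' _ _ ENNReal.ofReal_ne_top]
  refine mul_le_mul' le_rfl (lintegral_mono_ae ?_)
  filter_upwards [h1] with y hy
  rw [← mul_assoc]
  gcongr
  rw [wt, wt, ← ENNReal.ofReal_mul (by positivity)]
  apply ENNReal.ofReal_le_ofReal
  have h0 : 0 < ‖x - y‖ := hd.trans_le hy
  have e : ‖x - y‖ ^ (2 * n) = ‖x - y‖ ^ (n + 1) * ‖x - y‖ ^ (n - 1) := by
    rw [← pow_add]; congr 1; omega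
  calc Metric.infDist x Ωᶜ ^ (n + 1) * (‖x - y‖ ^ (2 * n))⁻¹
      ≤ ‖x - y‖ ^ (n + 1) * (‖x - y‖ ^ (2 * n))⁻¹ := by gcongr
    _ = _ := by rw [e]; field_simp

theorem lintegral_kAvg_sq_lt_top (hn : 1 ≤ n) (hΩ : IsOpen Ω) (hb : Bornology.IsBounded Ω)
    [IsFiniteMeasure (surfaceMeasure Ω)]
    (hne : Ωᶜ.Nonempty) {c : ℝ} (hc : 0 < c)
    (hlow : ∀ x ∈ Ω, ENNReal.ofReal ((c * Metric.infDist x Ωᶜ ^ (n + 1))⁻¹) ≤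
      ∫⁻ y, wt (2 * n) (x - y) ∂surfaceMeasure Ω) {f : E n → ℂ}
    (hf : Integrable f (surfaceMeasure Ω)) (hfm : Measurable f)
    (hf2 : ∫⁻ y, ‖f y‖ₑ ^ 2 ∂surfaceMeasure Ω < ⊤) :
    ∫⁻ x in Ω, ‖kAvg (surfaceMeasure Ω) f x‖ₑ ^ 2 < ⊤ := by
  obtain ⟨K, hK, hKy⟩ := exists_lintegral_wt_le hn hΩ hb
  have hm : Measurable fun p : E n × E n => wt (n - 1) (p.1 - p.2) * ‖f p.2‖ₑ ^ 2 :=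
    ((measurable_wt _).comp (measurable_fst.sub measurable_snd)).mul
      ((hfm.comp measurable_snd).enorm.pow_const 2)
  calc ∫⁻ x in Ω, ‖kAvg (surfaceMeasure Ω) f x‖ₑ ^ 2
      ≤ ∫⁻ x in Ω, ENNReal.ofReal c *
          ∫⁻ y, wt (n - 1) (x - y) * ‖f y‖ₑ ^ 2 ∂surfaceMeasure Ω :=
        setLIntegral_mono' hΩ.measurableSet fun x hx => enorm_kAvg_sq_le hn hΩ hne hc hlow hf hfm hx
    _ = ENNReal.ofReal c * ∫⁻ y, (∫⁻ x in Ω, wt (n - 1) (x - y) * ‖f y‖ₑ ^ 2)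
          ∂surfaceMeasure Ω := by
        rw [lintegral_const_mul' _ _ ENNReal.ofReal_ne_top]
        congr 1
        exact lintegral_lintegral_swap (f := fun x y => wt (n - 1) (x - y) * ‖f y‖ₑ ^ 2)
          hm.aemeasurable
    _ ≤ ENNReal.ofReal c * ∫⁻ y, K * ‖f y‖ₑ ^ 2 ∂surfaceMeasure Ω := by
        refine mul_le_mul' le_rfl (lintegral_mono_ae ?_)
        refine (ae_mem_frontier.mono fun y hy => ?_)
        have hmy : Measurable fun x : E n => wt (n - 1) (x - y) :=
          (measurable_wt _).comp (measurable_id.sub measurable_const)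
        rw [lintegral_mul_const _ hmy]
        gcongr
        exact hKy y hy
    _ < ⊤ := by
        rw [lintegral_const_mul' _ _ hK]
        exact ENNReal.mul_lt_top ENNReal.ofReal_lt_top (ENNReal.mul_lt_top hK.lt_top hf2)

/-- The squared normalisation gives `d^(2n+2)` and the derivative of the kernel `d^(-2)`. The
remaining `d^(2n)` tames the product of two kernels, by `ofReal_mul_wt_mul_wt_le`. -/
theorem enorm_fderiv_kAvg_sq_le_prod (hΩ : IsOpen Ω) [IsFiniteMeasure (surfaceMeasure Ω)]
    (hne : Ωᶜ.Nonempty) {c : ℝ} (hc : 0 < c)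
    (hlow : ∀ x ∈ Ω, ENNReal.ofReal ((c * Metric.infDist x Ωᶜ ^ (n + 1))⁻¹) ≤
      ∫⁻ y, wt (2 * n) (x - y) ∂surfaceMeasure Ω) {f : E n → ℂ}
    (hf : Integrable f (surfaceMeasure Ω)) (hfm : Measurable f) {x : E n} (hx : x ∈ Ω) :
    ‖fderiv ℝ (kAvg (surfaceMeasure Ω) f) x‖ₑ ^ 2 ≤
      ENNReal.ofReal ((2 * n * c) ^ 2 * 3 ^ (2 * n)) *
        ∫⁻ p, ENNReal.ofReal (((‖p.1 - p.2‖ + ‖x - p.1‖) ^ (2 * n))⁻¹) *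
          ‖f p.1 - f p.2‖ₑ ^ 2 ∂(surfaceMeasure Ω).prod (surfaceMeasure Ω) := by
  set σ := surfaceMeasure Ω with hσ
  obtain ⟨hd, h1, hpos⟩ := kAvg_spec hΩ hc hlow hx hne
  have h2 := enorm_fderiv_kAvg_sq_le hf hfm hd h1 hpos
  set d := Metric.infDist x Ωᶜ with hdd
  have hW : ENNReal.ofReal (((c * d ^ (n + 1)) ^ 2)⁻¹) ≤ (∫⁻ y, wt (2 * n) (x - y) ∂σ) ^ 2 := by
    rw [← inv_pow, ENNReal.ofReal_pow (by positivity)]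
    gcongr
    exact hlow x hx
  have h3 := le_ofReal_mul_of_mul_le (by positivity) hW h2
  have hm1 : Measurable fun p : E n × E n => wt (2 * n) (x - p.2) * ‖f p.2 - f p.1‖ₑ ^ 2 :=
    ((measurable_wt _).comp (measurable_const.sub measurable_snd)).mul
      (((hfm.comp measurable_snd).sub (hfm.comp measurable_fst)).enorm.pow_const 2)
  have hm2 : Measurable fun p : E n × E n =>
      wt (2 * n) (x - p.1) * (wt (2 * n) (x - p.2) * ‖f p.2 - f p.1‖ₑ ^ 2) :=
    ((measurable_wt _).comp (measurable_const.sub measurable_fst)).mul hm1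
  have h4 : ∫⁻ y, wt (2 * n) (x - y) *
        (∫⁻ y', wt (2 * n) (x - y') * ‖f y' - f y‖ₑ ^ 2 ∂σ) ∂σ =
      ∫⁻ p, wt (2 * n) (x - p.1) * (wt (2 * n) (x - p.2) * ‖f p.2 - f p.1‖ₑ ^ 2) ∂σ.prod σ := by
    rw [lintegral_prod _ hm2.aemeasurable]
    refine lintegral_congr fun y => ?_
    have hne : wt (2 * n) (x - y) ≠ ⊤ := ENNReal.ofReal_ne_top
    rw [lintegral_const_mul' _ _ hne]
  rw [h4] at h3
  refine h3.trans ?_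
  rw [← mul_assoc, ← ENNReal.ofReal_mul (by positivity)]
  have e1 : (c * d ^ (n + 1)) ^ 2 * (2 * n / d) ^ 2 = (2 * n * c) ^ 2 * d ^ (2 * n) := by
    rw [mul_pow, div_pow, ← pow_mul, show (n + 1) * 2 = 2 * n + 2 by ring, pow_add]
    field_simp
  rw [e1, ENNReal.ofReal_mul (by positivity), ENNReal.ofReal_mul (by positivity)]
  generalize ENNReal.ofReal ((2 * n * c) ^ 2) = A
  rw [mul_assoc, mul_assoc]
  refine mul_le_mul' le_rfl ?_
  rw [← lintegral_const_mul' _ _ ENNReal.ofReal_ne_top,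
    ← lintegral_const_mul' _ _ ENNReal.ofReal_ne_top]
  refine lintegral_mono_ae ?_
  filter_upwards [Measure.quasiMeasurePreserving_fst.ae h1,
    Measure.quasiMeasurePreserving_snd.ae h1] with p hp1 hp2
  have h5 := ofReal_mul_wt_mul_wt_le hd hp1 hp2
  calc ENNReal.ofReal (d ^ (2 * n)) *
        (wt (2 * n) (x - p.1) * (wt (2 * n) (x - p.2) * ‖f p.2 - f p.1‖ₑ ^ 2))
      = (ENNReal.ofReal (d ^ (2 * n)) * (wt (2 * n) (x - p.1) * wt (2 * n) (x - p.2))) *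
        ‖f p.1 - f p.2‖ₑ ^ 2 := by
        rw [← enorm_neg (f p.2 - f p.1), neg_sub]
        ring
    _ ≤ _ := (mul_le_mul' h5 le_rfl).trans (le_of_eq (mul_assoc _ _ _))

theorem setLIntegral_kernel_mul_le (f : E n → ℂ) (p : E n × E n) :
    ∫⁻ x in Ω, ENNReal.ofReal (((‖p.1 - p.2‖ + ‖x - p.1‖) ^ (2 * n))⁻¹) * ‖f p.1 - f p.2‖ₑ ^ 2 ≤
      (∫⁻ x : E n, ENNReal.ofReal (((1 + ‖x‖) ^ (2 * n))⁻¹)) *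
        (‖f p.1 - f p.2‖ₑ ^ 2 * wt n (p.1 - p.2)) := by
  have hmp : Measurable fun x : E n =>
      ENNReal.ofReal (((‖p.1 - p.2‖ + ‖x - p.1‖) ^ (2 * n))⁻¹) := by
    refine ENNReal.measurable_ofReal.comp (Measurable.inv (Measurable.pow_const ?_ _))
    exact measurable_const.add (measurable_id.sub measurable_const).norm
  rw [lintegral_mul_const _ hmp]
  by_cases hp : p.1 = p.2
  · simp [hp]
  · have hδ : 0 < ‖p.1 - p.2‖ := norm_pos_iff.2 (sub_ne_zero.2 hp)
    refine (mul_le_mul' (setLIntegral_le_lintegral _ _) le_rfl).trans (le_of_eq ?_)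
    rw [lintegral_add_norm_pow hδ, wt]
    ring

set_option maxHeartbeats 800000 in
-- Tonelli: after integration over `x` the kernel becomes a multiple of `‖y - y'‖^(-n)`, and the
-- Gagliardo seminorm of `f` appears.
theorem lintegral_fderiv_kAvg_sq_lt_top (hn : 1 ≤ n) (hΩ : IsOpen Ω)
    [IsFiniteMeasure (surfaceMeasure Ω)]
    (hne : Ωᶜ.Nonempty) {c : ℝ} (hc : 0 < c)
    (hlow : ∀ x ∈ Ω, ENNReal.ofReal ((c * Metric.infDist x Ωᶜ ^ (n + 1))⁻¹) ≤
      ∫⁻ y, wt (2 * n) (x - y) ∂surfaceMeasure Ω) {f : E n → ℂ}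
    (hf : Integrable f (surfaceMeasure Ω)) (hfm : Measurable f)
    (hf2 : gagliardoSq Ω f < ⊤) :
    ∫⁻ x in Ω, ‖fderiv ℝ (kAvg (surfaceMeasure Ω) f) x‖ₑ ^ 2 < ⊤ := by
  set σ := surfaceMeasure Ω with hσ
  set J : E n → E n × E n → ENNReal := fun x p =>
    ENNReal.ofReal (((‖p.1 - p.2‖ + ‖x - p.1‖) ^ (2 * n))⁻¹) with hJ
  set K0 := ∫⁻ x : E n, ENNReal.ofReal (((1 + ‖x‖) ^ (2 * n))⁻¹) with hK0
  have hK0t : K0 < ⊤ := lintegral_one_add_norm_lt_top hn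
  have hJm : Measurable fun q : E n × (E n × E n) => J q.1 q.2 := by
    refine ENNReal.measurable_ofReal.comp (Measurable.inv (Measurable.pow_const ?_ _))
    exact (measurable_snd.fst.sub measurable_snd.snd).norm.add
      (measurable_fst.sub measurable_snd.fst).norm
  have hm : Measurable fun q : E n × (E n × E n) => J q.1 q.2 * ‖f q.2.1 - f q.2.2‖ₑ ^ 2 :=
    hJm.mul (((hfm.comp measurable_snd.fst).sub (hfm.comp measurable_snd.snd)).enorm.pow_const 2)
  calc ∫⁻ x in Ω, ‖fderiv ℝ (kAvg σ f) x‖ₑ ^ 2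
      ≤ ∫⁻ x in Ω, ENNReal.ofReal ((2 * n * c) ^ 2 * 3 ^ (2 * n)) *
        ∫⁻ p, J x p * ‖f p.1 - f p.2‖ₑ ^ 2 ∂σ.prod σ :=
        setLIntegral_mono' hΩ.measurableSet fun x hx =>
          enorm_fderiv_kAvg_sq_le_prod hΩ hne hc hlow hf hfm hx
    _ = ENNReal.ofReal ((2 * n * c) ^ 2 * 3 ^ (2 * n)) *
        ∫⁻ p, (∫⁻ x in Ω, J x p * ‖f p.1 - f p.2‖ₑ ^ 2) ∂σ.prod σ := by
        rw [lintegral_const_mul' _ _ ENNReal.ofReal_ne_top]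
        congr 1
        exact lintegral_lintegral_swap (f := fun x p => J x p * ‖f p.1 - f p.2‖ₑ ^ 2)
          hm.aemeasurable
    _ ≤ ENNReal.ofReal ((2 * n * c) ^ 2 * 3 ^ (2 * n)) *
        ∫⁻ p, K0 * (‖f p.1 - f p.2‖ₑ ^ 2 * wt n (p.1 - p.2)) ∂σ.prod σ := by
        exact mul_le_mul' le_rfl (lintegral_mono fun p => setLIntegral_kernel_mul_le f p)
    _ < ⊤ := by
        rw [lintegral_const_mul' _ _ hK0t.ne]
        exact ENNReal.mul_lt_top ENNReal.ofReal_lt_top (ENNReal.mul_lt_top hK0t hf2)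

/-- At `x = y + w` in the cone, `‖x - y'‖` is bounded below both by `κ‖w‖` and by a multiple of `‖y
- y'‖`. Of the `2n` factors of the kernel, half are bounded by each; with `d^(n+1) ≤ ‖w‖^(n+1)` a
single power of `‖w‖` is left. -/
theorem ConeData.enorm_kAvg_sub_cone (D : ConeData Ω) (hΩ : IsOpen Ω)
    [IsFiniteMeasure (surfaceMeasure Ω)] (hne : Ωᶜ.Nonempty) {c : ℝ} (hc : 0 < c)
    (hlow : ∀ x ∈ Ω, ENNReal.ofReal ((c * Metric.infDist x Ωᶜ ^ (n + 1))⁻¹) ≤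
      ∫⁻ y, wt (2 * n) (x - y) ∂surfaceMeasure Ω) {f : E n → ℂ}
    (hf : Integrable f (surfaceMeasure Ω)) (hfm : Measurable f) {j : Fin D.N} {y w : E n}
    (hy : y ∈ D.S j) (hw : w ∈ D.Γ j) :
    ‖kAvg (surfaceMeasure Ω) f (y + w) - f y‖ₑ ^ 2 ≤
      ENNReal.ofReal (c * ((1 + D.κ) / D.κ ^ 2) ^ n * ‖w‖) *
        ∫⁻ y', ‖f y - f y'‖ₑ ^ 2 * wt n (y - y') ∂surfaceMeasure Ω := by
  have hκ := D.κ_pos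
  have hw0 := norm_pos_of_mem_cone hw.1
  have hx := D.add_mem hy hw
  obtain ⟨hd, h1, hpos⟩ := kAvg_spec hΩ hc hlow hx hne
  have h3 := le_ofReal_mul_of_mul_le (by positivity) (hlow _ hx)
    (enorm_kAvg_sub_sq_le hf hfm hd h1 hpos (f y))
  set d := Metric.infDist (y + w) Ωᶜ with hdd
  have hdw : d ≤ ‖w‖ := by
    have := infDist_le_norm_sub hΩ (y + w) hy.1
    rwa [add_sub_cancel_left] at this
  refine h3.trans ?_
  calc ENNReal.ofReal (c * d ^ (n + 1)) *
        ∫⁻ y', wt (2 * n) (y + w - y') * ‖f y' - f y‖ₑ ^ 2 ∂surfaceMeasure Ω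
      ≤ ENNReal.ofReal (c * ‖w‖ ^ (n + 1)) *
        ∫⁻ y', ENNReal.ofReal (((1 + D.κ) / (D.κ ^ 2 * ‖w‖)) ^ n) *
          (‖f y - f y'‖ₑ ^ 2 * wt n (y - y')) ∂surfaceMeasure Ω := by
        gcongr ?_ * ?_
        · apply ENNReal.ofReal_le_ofReal
          gcongr
        · refine lintegral_mono_ae (ae_mem_frontier.mono fun y' hy' => ?_)
          by_cases hyy : y = y'
          · subst hyy
            simp
          have h5 : 0 < ‖y - y'‖ := norm_pos_iff.2 (sub_ne_zero.2 hyy)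
          have h6 := D.mul_norm_le hΩ hy hw hy'
          have h7 : 0 < ‖y + w - y'‖ := lt_of_lt_of_le (by positivity) h6
          have h8 : D.κ * ‖y - y'‖ ≤ (1 + D.κ) * ‖y + w - y'‖ := by
            have : ‖y - y'‖ ≤ ‖y + w - y'‖ + ‖w‖ := by
              rw [show y - y' = (y + w - y') - w by abel]
              exact norm_sub_le _ _
            nlinarith
          have h9 : wt (2 * n) (y + w - y') ≤
              ENNReal.ofReal (((1 + D.κ) / (D.κ ^ 2 * ‖w‖)) ^ n) * wt n (y - y') := by
            rw [wt, wt, ← ENNReal.ofReal_mul (by positivity)]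
            apply ENNReal.ofReal_le_ofReal
            rw [pow_mul, ← inv_pow (‖y + w - y'‖ ^ 2), ← inv_pow ‖y - y'‖, ← mul_pow]
            gcongr ?_ ^ n
            rw [inv_le_comm₀ (by positivity) (by positivity), mul_inv, inv_inv, inv_div,
              div_mul_eq_mul_div, div_le_iff₀ (by positivity)]
            calc D.κ ^ 2 * ‖w‖ * ‖y - y'‖ = (D.κ * ‖w‖) * (D.κ * ‖y - y'‖) := by ring
              _ ≤ ‖y + w - y'‖ * ((1 + D.κ) * ‖y + w - y'‖) := by gcongr
              _ = _ := by ring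
          calc wt (2 * n) (y + w - y') * ‖f y' - f y‖ₑ ^ 2
              ≤ (ENNReal.ofReal (((1 + D.κ) / (D.κ ^ 2 * ‖w‖)) ^ n) * wt n (y - y')) *
                ‖f y - f y'‖ₑ ^ 2 := by
                rw [← enorm_neg (f y' - f y), neg_sub]
                gcongr
            _ = _ := by ring
    _ = _ := by
        rw [lintegral_const_mul' _ _ ENNReal.ofReal_ne_top, ← mul_assoc,
          ← ENNReal.ofReal_mul (by positivity)]
        congr 2
        rw [div_pow, div_pow, mul_pow, pow_succ]
        field_simp

theorem H12.lintegral_sq_lt_top [SFinite (surfaceMeasure Ω)] (t : H12 Ω) :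
    ∫⁻ y, ‖toL2Bdry t y‖ₑ ^ 2 ∂surfaceMeasure Ω < ⊤ ∧ gagliardoSq Ω (toL2Bdry t) < ⊤ := by
  have h := H12.enorm_sq (Filter.EventuallyEq.refl _ (toL2Bdry t) : toL2Bdry t =ᵐ[surfaceMeasure Ω] _)
  have h2 : ‖t‖ₑ ^ 2 < ⊤ := ENNReal.pow_lt_top enorm_lt_top
  rw [h] at h2
  exact ⟨lt_of_le_of_lt le_self_add h2, lt_of_le_of_lt le_add_self h2⟩

theorem exists_kAvg_H1 (hn : 1 ≤ n) (hΩ : IsOpen Ω) (hb : Bornology.IsBounded Ω)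
    [IsFiniteMeasure (surfaceMeasure Ω)]
    (hne : Ωᶜ.Nonempty) {c : ℝ} (hc : 0 < c)
    (hlow : ∀ x ∈ Ω, ENNReal.ofReal ((c * Metric.infDist x Ωᶜ ^ (n + 1))⁻¹) ≤
      ∫⁻ y, wt (2 * n) (x - y) ∂surfaceMeasure Ω) {f : E n → ℂ}
    (hf : Integrable f (surfaceMeasure Ω)) (hfm : Measurable f)
    (hf2 : ∫⁻ y, ‖f y‖ₑ ^ 2 ∂surfaceMeasure Ω < ⊤) (hfg : gagliardoSq Ω f < ⊤) :
    ∃ v : H1 Ω, toL2 v =ᵐ[volume.restrict Ω] kAvg (surfaceMeasure Ω) f := by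
  set u := kAvg (surfaceMeasure Ω) f with hu
  have hum : Measurable u := measurable_kAvg hfm
  have hu2 : MemLp u 2 (volume.restrict Ω) := memLp_two_of_lintegral_lt_top
    hum.aestronglyMeasurable (lintegral_kAvg_sq_lt_top hn hΩ hb hne hc hlow hf hfm hf2)
  have hg2 : MemLp (gradFun u) 2 (volume.restrict Ω) := by
    refine memLp_two_of_lintegral_lt_top (measurable_gradFun u).aestronglyMeasurable ?_
    refine (lintegral_mono fun x => enorm_gradFun_sq_le u x).trans_lt ?_
    rw [lintegral_const_mul' _ _ (by simp)]
    exact ENNReal.mul_lt_top (by simp)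
      (lintegral_fderiv_kAvg_sq_lt_top hn hΩ hne hc hlow hf hfm hfg)
  have hwg : WeakGrad Ω u (gradFun u) := by
    refine WeakGrad.of_differentiableAt hu2 hg2 (fun x hx => ?_)
      (fun i => Filter.Eventually.of_forall fun x => rfl)
    obtain ⟨hd, h1, hpos⟩ := kAvg_spec hΩ hc hlow hx hne
    exact (hasFDerivAt_kAvg hf hd h1 hpos).differentiableAt
  obtain ⟨v, hv, -⟩ := exists_H1 hu2 hg2 hwg
  exact ⟨v, hv⟩

/-- The inner Gagliardo integral is finite at almost every `y`, and there the bound of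
`enorm_kAvg_sub_cone` is linear in `‖w‖`. -/
theorem ConeData.ae_tendsto_kAvg (D : ConeData Ω) (hΩ : IsOpen Ω)
    [IsFiniteMeasure (surfaceMeasure Ω)] (hne : Ωᶜ.Nonempty) {c : ℝ} (hc : 0 < c)
    (hlow : ∀ x ∈ Ω, ENNReal.ofReal ((c * Metric.infDist x Ωᶜ ^ (n + 1))⁻¹) ≤
      ∫⁻ y, wt (2 * n) (x - y) ∂surfaceMeasure Ω) {f : E n → ℂ}
    (hf : Integrable f (surfaceMeasure Ω)) (hfm : Measurable f) (hfg : gagliardoSq Ω f < ⊤)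
    (j : Fin D.N) :
    ∀ᵐ y ∂surfaceMeasure Ω, y ∈ D.S j → ∀ ε > 0, ∃ ρ > 0, ∀ w ∈ D.Γ j, ‖w‖ < ρ →
      ‖kAvg (surfaceMeasure Ω) f (y + w) - f y‖ ≤ ε := by
  have hA : ∀ᵐ y ∂surfaceMeasure Ω,
      ∫⁻ y', ‖f y - f y'‖ₑ ^ 2 * wt n (y - y') ∂surfaceMeasure Ω < ⊤ := by
    refine ae_lt_top (measurable_gagliardo hfm).lintegral_prod_right' ?_
    rw [gagliardoSq, lintegral_prod _ (measurable_gagliardo hfm).aemeasurable] at hfg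
    exact hfg.ne
  filter_upwards [hA] with y hyA hyS ε hε
  set A := ∫⁻ y', ‖f y - f y'‖ₑ ^ 2 * wt n (y - y') ∂surfaceMeasure Ω with hAdef
  set c' := c * ((1 + D.κ) / D.κ ^ 2) ^ n with hc'
  have hκ := D.κ_pos
  have hc'0 : 0 < c' := by positivity
  have hA0 : 0 ≤ A.toReal := ENNReal.toReal_nonneg
  refine ⟨ε ^ 2 / (c' * (A.toReal + 1)), by positivity, fun w hwΓ hwρ => ?_⟩
  have h1 := D.enorm_kAvg_sub_cone hΩ hne hc hlow hf hfm hyS hwΓ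
  rw [← hAdef, ← ofReal_norm, ← ENNReal.ofReal_pow (norm_nonneg _),
    ← ENNReal.ofReal_toReal hyA.ne, ← ENNReal.ofReal_mul (by positivity),
    ENNReal.ofReal_le_ofReal_iff (by positivity)] at h1
  refine abs_le_of_sq_le_sq' (h1.trans ?_) hε.le |>.2
  rw [lt_div_iff₀ (by positivity)] at hwρ
  have h2 : c' * ‖w‖ * A.toReal ≤ ‖w‖ * (c' * (A.toReal + 1)) := by
    have := norm_nonneg w
    nlinarith [mul_nonneg hc'0.le this]
  linarith

set_option maxHeartbeats 800000 in
-- The kernel average of `t` lies in `H¹(Ω)` and has `t` as cone limit almost everywhere, so the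
-- finite cone energy forces its trace to be `t`.
theorem ConeData.surjective_dirichletTrace (D : ConeData Ω) (hn : 1 ≤ n) (hΩ : IsOpen Ω)
    (hb : Bornology.IsBounded Ω) : Function.Surjective (dirichletTrace Ω) := by
  intro t
  have := D.isFiniteMeasure hb
  have hne := nonempty_compl_of_isBounded hn hb
  obtain ⟨c, hc, hlow⟩ := D.exists_kernel_lower hn hΩ hb
  have hfm : Measurable (toL2Bdry t) := (Lp.stronglyMeasurable (toL2Bdry t)).measurable
  have hfi : Integrable (toL2Bdry t) (surfaceMeasure Ω) :=
    (Lp.memLp (toL2Bdry t)).integrable (by norm_num)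
  obtain ⟨hf2, hfg⟩ := H12.lintegral_sq_lt_top t
  obtain ⟨v, hv⟩ := exists_kAvg_H1 hn hΩ hb hne hc hlow hfi hfm hf2 hfg
  obtain ⟨-, K, hK, hγ⟩ := D.dirichletTrace_spec hn hΩ hb
  have hE : ∀ j, D.coneEnergy j (toL2 v) (toL2Bdry (dirichletTrace Ω v)) ≠ ⊤ := fun j =>
    ne_top_of_le_ne_top (ENNReal.mul_ne_top hK (ENNReal.pow_lt_top enorm_lt_top).ne) (hγ v j)
  refine ⟨v, H12.ext_toL2Bdry (Lp.ext (D.toL2Bdry_ae_eq hE fun j => ?_))⟩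
  filter_upwards [D.ae_tendsto_kAvg hΩ hne hc hlow hfi hfm hfg j] with y hy hyS ε hε
  obtain ⟨ρ, hρ, h⟩ := hy hyS ε hε
  refine ⟨ρ, hρ, ?_⟩
  filter_upwards [D.ae_cone hv hΩ hyS, ae_restrict_mem (D.measurableSet_Γ j)] with w hw hwΓ hwρ
  rw [hw]
  exact h w hwΓ hwρ

end

section

/-! ### A Hardy inequality -/

variable {n : ℕ} {Ω : Set (E n)}

theorem ConeData.lintegral_cones_eq (D : ConeData Ω)
    [SFinite (surfaceMeasure Ω)] (j : Fin D.N) {φ : E n → ENNReal} (hφ : Measurable φ) (m : ℕ) :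
    ∫⁻ y in D.S j, (∫⁻ w in D.Γ j, φ (y + w) * wt m w) ∂surfaceMeasure Ω =
      ∫⁻ x, φ x * ∫⁻ y in D.S j, (D.Γ j).indicator (wt m) (x - y) ∂surfaceMeasure Ω := by
  have hm : Measurable ((D.Γ j).indicator (wt m)) :=
    (measurable_wt _).indicator (D.measurableSet_Γ j)
  calc ∫⁻ y in D.S j, (∫⁻ w in D.Γ j, φ (y + w) * wt m w) ∂surfaceMeasure Ω
      = ∫⁻ y in D.S j, (∫⁻ x, φ x * (D.Γ j).indicator (wt m) (x - y)) ∂surfaceMeasure Ω := by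
        congr 1
        ext y
        rw [← lintegral_indicator (D.measurableSet_Γ j),
          ← lintegral_sub_right_eq_self (fun w => (D.Γ j).indicator
            (fun w => φ (y + w) * wt m w) w) y]
        congr 1
        ext x
        by_cases hx : x - y ∈ D.Γ j
        · rw [Set.indicator_of_mem hx, Set.indicator_of_mem hx, add_sub_cancel]
        · rw [Set.indicator_of_notMem hx, Set.indicator_of_notMem hx, mul_zero]
    _ = ∫⁻ x, ∫⁻ y in D.S j, φ x * (D.Γ j).indicator (wt m) (x - y) ∂surfaceMeasure Ω := by
        apply lintegral_lintegral_swap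
        apply Measurable.aemeasurable
        exact (hφ.comp measurable_snd).mul (hm.comp (measurable_snd.sub measurable_fst))
    _ = _ := by
        refine lintegral_congr fun x => ?_
        exact lintegral_const_mul _ (hm.comp (measurable_const.sub measurable_id))

/-- A point at small distance `d` from the boundary lies above a boundary point at vertical distance
`t` comparable to `d`. It lies in the cones of all boundary points within `κt/4` of this foot; their
measure `t^(n-1)` and the weight `t^(-n-1)` give `d^(-2)`. -/
theorem ConeData.exists_weight_lower (D : ConeData Ω) (hn : 1 ≤ n) (hΩ : IsOpen Ω)
    (hne : Ωᶜ.Nonempty) :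
    ∃ c > 0, ∃ s > 0, ∀ x ∈ Ω, Metric.infDist x Ωᶜ < s → ∃ j,
      ENNReal.ofReal ((c * Metric.infDist x Ωᶜ ^ 2)⁻¹) ≤
        ∫⁻ y in D.S j, (D.Γ j).indicator (wt (n + 1)) (x - y) ∂surfaceMeasure Ω := by
  have hκ := D.κ_pos
  have hκ1 := D.κ_le
  have hr := D.r_pos
  have hc := D.c_pos
  have hC : 0 < D.C := lt_of_lt_of_le one_pos D.one_le_C
  -- The threshold yields `t ≤ C * d < r / 16`, so `x` lies in the truncated cones and the boundary
  -- points near its foot belong to `D.S j`.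
  refine ⟨2 ^ (n + 1) * D.C ^ 2 / (D.c * (D.κ / 4) ^ (n - 1)), by positivity, D.r / (16 * D.C),
    by positivity, fun x hx hxs => ?_⟩
  have hd := infDist_compl_pos hΩ hx hne
  set d := Metric.infDist x Ωᶜ with hdd
  rw [lt_div_iff₀ (by positivity)] at hxs
  have hCd : D.C * d < D.r / 16 := by linarith
  obtain ⟨j, t, hy0, hdt, htC, hO⟩ := D.vertical x hx (by linarith)
  set y0 := x - t • D.e j with hy0def
  have ht0 : 0 < t := hd.trans_le hdt
  have htr : t < D.r / 16 := htC.trans_lt hCd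
  set ρ := D.κ / 4 * t with hρ
  have hρ0 : 0 < ρ := by positivity
  have hρr : ρ ≤ D.r / 2 := by nlinarith
  have hρt : ρ ≤ t := by nlinarith
  refine ⟨j, ?_⟩
  have hin : ∀ y ∈ Metric.ball y0 ρ, y ∈ frontier Ω → y ∈ D.S j ∧ x - y ∈ D.Γ j ∧
      ‖x - y‖ ≤ 2 * t := by
    intro y hy hyf
    have hxy : x - y = t • D.e j + (y0 - y) := by rw [hy0def]; abel
    rw [Metric.mem_ball, dist_comm, dist_eq_norm] at hy
    refine ⟨⟨hyf, (Metric.ball_subset_ball' ?_).trans hO⟩, ?_, ?_⟩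
    · rw [dist_comm, dist_eq_norm]
      linarith
    · rw [hxy]
      exact D.smul_axis_add_mem_Γ ht0 (by linarith) hy.le
    · rw [hxy]
      refine (norm_add_le _ _).trans ?_
      rw [norm_smul, D.norm_e, mul_one, Real.norm_of_nonneg ht0.le]
      linarith
  calc ENNReal.ofReal ((2 ^ (n + 1) * D.C ^ 2 / (D.c * (D.κ / 4) ^ (n - 1)) * d ^ 2)⁻¹)
      ≤ ENNReal.ofReal (((2 * t) ^ (n + 1))⁻¹ * (D.c * ρ ^ (n - 1))) := by
        apply ENNReal.ofReal_le_ofReal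
        have e : t ^ (n + 1) = t ^ (n - 1) * t ^ 2 := by rw [← pow_add]; congr 1; omega
        have e2 : ((2 * t) ^ (n + 1))⁻¹ * (D.c * ρ ^ (n - 1)) =
            (2 ^ (n + 1) / (D.c * (D.κ / 4) ^ (n - 1)) * t ^ 2)⁻¹ := by
          rw [mul_pow, e, hρ, mul_pow]
          field_simp
        rw [e2]
        refine inv_anti₀ (by positivity) ?_
        calc 2 ^ (n + 1) / (D.c * (D.κ / 4) ^ (n - 1)) * t ^ 2
            ≤ 2 ^ (n + 1) / (D.c * (D.κ / 4) ^ (n - 1)) * (D.C * d) ^ 2 := by gcongr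
          _ = _ := by ring
    _ = ENNReal.ofReal (((2 * t) ^ (n + 1))⁻¹) * ENNReal.ofReal (D.c * ρ ^ (n - 1)) :=
        ENNReal.ofReal_mul (by positivity)
    _ ≤ ENNReal.ofReal (((2 * t) ^ (n + 1))⁻¹) * surfaceMeasure Ω (Metric.ball y0 ρ) := by
        gcongr
        exact D.lower y0 hy0 ρ hρ0 (by linarith)
    _ = ∫⁻ _y in Metric.ball y0 ρ, ENNReal.ofReal (((2 * t) ^ (n + 1))⁻¹) ∂surfaceMeasure Ω := by
        rw [setLIntegral_const]
    _ ≤ ∫⁻ y, (D.S j).indicator (fun y => (D.Γ j).indicator (wt (n + 1)) (x - y)) y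
          ∂surfaceMeasure Ω := by
        rw [← lintegral_indicator Metric.isOpen_ball.measurableSet]
        refine lintegral_mono_ae (ae_mem_frontier.mono fun y hyf => ?_)
        by_cases hy : y ∈ Metric.ball y0 ρ
        · obtain ⟨h1, h2, h3⟩ := hin y hy hyf
          have h0 := norm_pos_of_mem_cone h2.1
          rw [Set.indicator_of_mem hy, Set.indicator_of_mem h1, Set.indicator_of_mem h2]
          apply ENNReal.ofReal_le_ofReal
          gcongr
        · rw [Set.indicator_of_notMem hy]
          exact zero_le
    _ = _ := lintegral_indicator (D.measurableSet_S j) _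

theorem measurableSet_infDist_lt (s : ℝ) : MeasurableSet {x : E n | Metric.infDist x Ωᶜ < s} :=
  (isOpen_lt (Metric.continuous_infDist_pt _) continuous_const).measurableSet

/-- With zero boundary values the cone energy is, by Tonelli, the integral of `|u|²` against the
weight bounded below in `exists_weight_lower`. -/
theorem ConeData.exists_hardy (D : ConeData Ω) (hn : 1 ≤ n) (hΩ : IsOpen Ω)
    (hb : Bornology.IsBounded Ω) :
    ∃ c > 0, ∃ s > 0, ∀ u : E n → ℂ, Measurable u →
      ∫⁻ x in Ω ∩ {x | Metric.infDist x Ωᶜ < s},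
        ‖u x‖ₑ ^ 2 * ENNReal.ofReal ((c * Metric.infDist x Ωᶜ ^ 2)⁻¹) ≤
          ∑ j, D.coneEnergy j u 0 := by
  have := D.isFiniteMeasure hb
  obtain ⟨c, hc, s, hs, h⟩ := D.exists_weight_lower hn hΩ (nonempty_compl_of_isBounded hn hb)
  refine ⟨c, hc, s, hs, fun u hu => ?_⟩
  have hu2 : Measurable fun x => ‖u x‖ₑ ^ 2 := hu.enorm.pow_const 2
  set W : Fin D.N → E n → ENNReal := fun j x =>
    ∫⁻ y in D.S j, (D.Γ j).indicator (wt (n + 1)) (x - y) ∂surfaceMeasure Ω with hW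
  have hWm : ∀ j, Measurable (W j) := by
    intro j
    have h1 : Measurable fun p : E n × E n => (D.Γ j).indicator (wt (n + 1)) (p.1 - p.2) :=
      ((measurable_wt _).indicator (D.measurableSet_Γ j)).comp (measurable_fst.sub measurable_snd)
    exact h1.lintegral_prod_right'
  have hm : ∀ j, Measurable fun x => ‖u x‖ₑ ^ 2 * W j x := fun j => hu2.mul (hWm j)
  calc ∫⁻ x in Ω ∩ {x | Metric.infDist x Ωᶜ < s},
        ‖u x‖ₑ ^ 2 * ENNReal.ofReal ((c * Metric.infDist x Ωᶜ ^ 2)⁻¹)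
      ≤ ∫⁻ x in Ω ∩ {x | Metric.infDist x Ωᶜ < s}, ∑ j, ‖u x‖ₑ ^ 2 * W j x := by
        refine setLIntegral_mono' (hΩ.measurableSet.inter (measurableSet_infDist_lt s))
          fun x hx => ?_
        obtain ⟨j, hj⟩ := h x hx.1 hx.2
        refine le_trans ?_ (Finset.single_le_sum (f := fun j => ‖u x‖ₑ ^ 2 * W j x)
          (fun _ _ => zero_le) (Finset.mem_univ j))
        exact mul_le_mul' le_rfl hj
    _ ≤ ∫⁻ x, ∑ j, ‖u x‖ₑ ^ 2 * W j x := setLIntegral_le_lintegral _ _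
    _ = ∑ j, D.coneEnergy j u 0 := by
        rw [lintegral_finsetSum _ fun j _ => hm j]
        refine Finset.sum_congr rfl fun j _ => ?_
        rw [← D.lintegral_cones_eq j hu2, ConeData.coneEnergy]
        simp

/-! ### Cutoff functions -/

theorem abs_min_max_sub_le (a b : ℝ) :
    |min 1 (max 0 a) - min 1 (max 0 b)| ≤ |a - b| := by
  rcases le_total a b with h | h
  · rw [abs_sub_comm, abs_sub_comm a b, abs_of_nonneg (by linarith : 0 ≤ b - a), abs_le]
    constructor <;> rcases le_total 0 a with h1 | h1 <;> rcases le_total 0 b with h2 | h2 <;>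
      simp only [min_def, max_def] <;> split_ifs <;> linarith
  · rw [abs_of_nonneg (by linarith : 0 ≤ a - b), abs_le]
    constructor <;> rcases le_total 0 a with h1 | h1 <;> rcases le_total 0 b with h2 | h2 <;>
      simp only [min_def, max_def] <;> split_ifs <;> linarith

/-- A Lipschitz function of the distance from the complement of `Ω`. -/
def distCutoff (Ω : Set (E n)) (ε : ℝ) (x : E n) : ℂ :=
  ((min 1 (max 0 (Metric.infDist x Ωᶜ / ε - 1)) : ℝ) : ℂ)

theorem norm_distCutoff_sub_le {ε : ℝ} (hε : 0 < ε) (x y : E n) :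
    ‖distCutoff Ω ε x - distCutoff Ω ε y‖ ≤ ε⁻¹ * ‖x - y‖ := by
  rw [distCutoff, distCutoff, ← Complex.ofReal_sub, Complex.norm_real, Real.norm_eq_abs]
  refine (abs_min_max_sub_le _ _).trans ?_
  rw [sub_sub_sub_cancel_right, ← sub_div, abs_div, abs_of_pos hε, div_eq_inv_mul]
  gcongr
  rw [← dist_eq_norm, ← Real.dist_eq]
  exact (Metric.lipschitz_infDist_pt Ωᶜ).dist_le_mul x y |>.trans (by simp)

theorem continuous_distCutoff (ε : ℝ) : Continuous (distCutoff Ω ε) := by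
  unfold distCutoff
  have := Metric.continuous_infDist_pt (α := E n) Ωᶜ
  fun_prop

theorem norm_one_sub_distCutoff_le (ε : ℝ) (x : E n) : ‖1 - distCutoff Ω ε x‖ ≤ 1 := by
  rw [distCutoff, ← Complex.ofReal_one, ← Complex.ofReal_sub, Complex.norm_real, Real.norm_eq_abs,
    abs_le]
  constructor <;> simp only [min_def, max_def] <;> split_ifs <;> linarith

theorem distCutoff_eq_one {ε : ℝ} (hε : 0 < ε) {x : E n} (hx : 2 * ε ≤ Metric.infDist x Ωᶜ) :
    distCutoff Ω ε x = 1 := by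
  rw [distCutoff, min_eq_left, Complex.ofReal_one]
  refine le_max_of_le_right ?_
  rw [le_sub_iff_add_le, le_div_iff₀ hε]
  linarith

theorem distCutoff_eq_zero {ε : ℝ} (hε : 0 < ε) {x : E n} (hx : Metric.infDist x Ωᶜ ≤ ε) :
    distCutoff Ω ε x = 0 := by
  rw [distCutoff, max_eq_left, min_eq_right zero_le_one, Complex.ofReal_zero]
  rw [sub_nonpos, div_le_one hε]
  exact hx

/-- The piecewise linear cutoff rises from 0 to 1 between distances `ε` and `2ε`. Mollification at
scale `ε / 2` preserves the Lipschitz constant `ε⁻¹` and widens the transition zone by at most `ε /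
2` on each side. -/
theorem exists_smooth_cutoff {ε : ℝ} (hε : 0 < ε) :
    ∃ η : E n → ℂ, ContDiff ℝ ∞ η ∧ (∀ x, ‖η x - 1‖ ≤ 2) ∧ (∀ x, ‖fderiv ℝ η x‖ ≤ ε⁻¹) ∧
      (∀ x, 3 * ε ≤ Metric.infDist x Ωᶜ → η x = 1) ∧
      (∀ x, Metric.infDist x Ωᶜ ≤ ε / 2 → η x = 0) := by
  let b : ContDiffBump (0 : E n) := ⟨ε / 4, ε / 2, by positivity, by linarith⟩
  set V := distCutoff Ω ε with hV
  have hVc : Continuous V := continuous_distCutoff ε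
  have hdist : ∀ x, ∀ z ∈ Metric.ball x (ε / 2),
      |Metric.infDist z Ωᶜ - Metric.infDist x Ωᶜ| ≤ ε / 2 := by
    intro x z hz
    rw [← Real.dist_eq]
    exact ((Metric.lipschitz_infDist_pt Ωᶜ).dist_le_mul z x).trans (by
      rw [Metric.mem_ball] at hz
      simpa using hz.le)
  have hint : ∀ x, Integrable fun t => b.normed volume t • V (x - t) := by
    intro x
    refine Continuous.integrable_of_hasCompactSupport ?_ ?_
    · exact b.continuous_normed.smul (hVc.comp (continuous_const.sub continuous_id))
    · exact (b.hasCompactSupport_normed (μ := volume)).smul_right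
  have hlip : ∀ x y, ‖mollify b V x - mollify b V y‖ ≤ ε⁻¹ * ‖x - y‖ := by
    intro x y
    rw [mollify_apply, mollify_apply, ← integral_sub (hint x) (hint y)]
    calc ‖∫ t, (b.normed volume t • V (x - t) - b.normed volume t • V (y - t))‖
        ≤ ∫ t, b.normed volume t * (ε⁻¹ * ‖x - y‖) := by
          refine norm_integral_le_of_norm_le (b.integrable_normed.mul_const _)
            (Filter.Eventually.of_forall fun t => ?_)
          rw [← smul_sub, norm_smul, Real.norm_of_nonneg (b.nonneg_normed t)]
          refine mul_le_mul_of_nonneg_left ?_ (b.nonneg_normed t)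
          refine (norm_distCutoff_sub_le hε _ _).trans (le_of_eq ?_)
          rw [sub_sub_sub_cancel_right]
      _ = ε⁻¹ * ‖x - y‖ := by rw [integral_mul_const, b.integral_normed, one_mul]
  refine ⟨mollify b V, contDiff_mollify b hVc.locallyIntegrable, fun x => ?_, fun x => ?_,
    fun x hx => ?_, fun x hx => ?_⟩
  · have h1 : dist (mollify b V x) (V x) ≤ 1 := by
      refine b.dist_normed_convolution_le hVc.aestronglyMeasurable fun z hz => ?_
      rw [dist_eq_norm]
      refine (norm_distCutoff_sub_le hε _ _).trans ?_
      have hz' : ‖z - x‖ < ε / 2 := by rwa [Metric.mem_ball, dist_eq_norm] at hz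
      rw [inv_mul_le_iff₀ hε]
      linarith
    have h2 := norm_one_sub_distCutoff_le (Ω := Ω) ε x
    rw [dist_eq_norm] at h1
    calc ‖mollify b V x - 1‖ = ‖(mollify b V x - V x) - (1 - V x)‖ := by congr 1; ring
      _ ≤ ‖mollify b V x - V x‖ + ‖1 - V x‖ := norm_sub_le _ _
      _ ≤ 2 := by linarith
  · have h3 : LipschitzWith (ε⁻¹).toNNReal (mollify b V) :=
      LipschitzWith.of_dist_le_mul fun x y => by
        rw [dist_eq_norm, dist_eq_norm, Real.coe_toNNReal _ (by positivity)]
        exact hlip x y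
    have := norm_fderiv_le_of_lipschitz ℝ h3 (x₀ := x)
    rwa [Real.coe_toNNReal _ (by positivity)] at this
  · have h1 : V x = 1 := distCutoff_eq_one hε (by linarith)
    rw [← h1]
    refine b.normed_convolution_eq_right fun z hz => ?_
    have := abs_le.1 (hdist x z hz)
    rw [h1]
    exact distCutoff_eq_one hε (by linarith)
  · have h1 : V x = 0 := distCutoff_eq_zero hε (by linarith)
    rw [← h1]
    refine b.normed_convolution_eq_right fun z hz => ?_
    have := abs_le.1 (hdist x z hz)
    rw [h1]
    exact distCutoff_eq_zero hε (by linarith)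

/-- The collars of `Ω` shrink to the empty set, so their measures tend to zero and absolute
continuity of the integral applies. -/
theorem exists_lintegral_near_lt (hΩ : IsOpen Ω) (hb : Bornology.IsBounded Ω) (hne : Ωᶜ.Nonempty)
    {G : E n → ENNReal} {s : ℝ} (hs : 0 < s)
    (hG : ∫⁻ x in Ω ∩ {x | Metric.infDist x Ωᶜ < s}, G x ≠ ⊤) {δ : ENNReal} (hδ : 0 < δ) :
    ∃ ρ > 0, ρ ≤ s ∧ ∫⁻ x in Ω ∩ {x | Metric.infDist x Ωᶜ < ρ}, G x < δ := by
  set μ := volume.restrict (Ω ∩ {x | Metric.infDist x Ωᶜ < s}) with hμ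
  set A : ℕ → Set (E n) := fun k => {x | Metric.infDist x Ωᶜ < s / (k + 1)} with hA
  have hsk : ∀ k : ℕ, 0 < s / (k + 1) := fun k => by positivity
  have hsk1 : ∀ k : ℕ, s / (k + 1) ≤ s := fun k => div_le_self hs.le (by
    have : (0 : ℝ) ≤ k := by positivity
    linarith)
  have hAm : ∀ k, MeasurableSet (A k) := fun k => measurableSet_infDist_lt _
  have hsub : ∀ k, A k ∩ (Ω ∩ {x | Metric.infDist x Ωᶜ < s}) =
      Ω ∩ {x | Metric.infDist x Ωᶜ < s / (k + 1)} := by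
    intro k
    ext x
    constructor
    · rintro ⟨h1, h2, -⟩
      exact ⟨h2, h1⟩
    · rintro ⟨h1, h2⟩
      exact ⟨h2, h1, lt_of_lt_of_le h2 (hsk1 k)⟩
  have hanti : Antitone A := by
    intro k l hkl x hx
    have hx' : Metric.infDist x Ωᶜ < s / (l + 1) := hx
    change Metric.infDist x Ωᶜ < s / (k + 1)
    refine hx'.trans_le ?_
    have : (k : ℝ) ≤ l := by exact_mod_cast hkl
    gcongr
  have hfin : μ (A 0) ≠ ⊤ := by
    rw [hμ, Measure.restrict_apply (hAm 0), hsub]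
    exact ((hb.subset Set.inter_subset_left).measure_lt_top).ne
  have h1 := tendsto_measure_iInter_atTop (μ := μ) (fun k => (hAm k).nullMeasurableSet) hanti
    ⟨0, hfin⟩
  have h2 : μ (⋂ k, A k) = 0 := by
    rw [hμ, Measure.restrict_apply (MeasurableSet.iInter hAm)]
    convert measure_empty (μ := (volume : Measure (E n)))
    rw [Set.eq_empty_iff_forall_notMem]
    rintro x ⟨hx1, hx2, -⟩
    have hpos := infDist_compl_pos hΩ hx2 hne
    obtain ⟨k, hk⟩ := exists_nat_gt (s / Metric.infDist x Ωᶜ)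
    have hxk : Metric.infDist x Ωᶜ < s / (k + 1) := Set.mem_iInter.1 hx1 k
    rw [div_lt_iff₀ hpos] at hk
    rw [lt_div_iff₀ (by positivity)] at hxk
    nlinarith
  rw [h2] at h1
  have h3 := tendsto_setLIntegral_zero hG h1
  obtain ⟨k, hk⟩ := (h3.eventually (gt_mem_nhds hδ)).exists
  refine ⟨s / (k + 1), hsk k, hsk1 k, ?_⟩
  rwa [hμ, Measure.restrict_restrict (hAm k), hsub] at hk

end

section

/-! ### The kernel of the Dirichlet trace -/

variable {n : ℕ} {Ω : Set (E n)}

theorem gradFun_eq_zero_of_eventuallyEq_const {η : E n → ℂ} {c : ℂ} {x : E n}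
    (h : η =ᶠ[nhds x] fun _ => c) : gradFun η x = 0 := by
  ext i
  change fderiv ℝ η x _ = 0
  rw [h.fderiv_eq]
  simp

/-- The integrand that controls the error of cutting off near the boundary. -/
def cutoffError (v : H1 Ω) (c : ℝ) (x : E n) : ENNReal :=
  8 * ‖toL2 v x‖ₑ ^ 2 + 8 * ‖grad v x‖ₑ ^ 2 +
    2 * (n * ENNReal.ofReal (16 * c)) *
      (‖toL2 v x‖ₑ ^ 2 * ENNReal.ofReal ((c * Metric.infDist x Ωᶜ ^ 2)⁻¹))

set_option maxHeartbeats 1000000 in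
-- Multiplication by the cutoff gives a function with compact support in `Ω`, hence in the closure
-- of the test functions. The error lives in a collar and consists of `(η - 1)v`, `(η - 1)∇v` and
-- `v∇η`.
theorem exists_cutoff_mem_closure (hΩ : IsOpen Ω) (hb : Bornology.IsBounded Ω)
    (hne : Ωᶜ.Nonempty) (v : H1 Ω) {c : ℝ} (hc : 0 < c) {ε : ℝ} (hε : 0 < ε) :
    ∃ v' ∈ closure {v' : H1 Ω | ∃ φ, IsTestFunction Ω φ ∧ SmoothRep v' φ},
      ‖v' - v‖ₑ ^ 2 ≤
        2 * ∫⁻ x in Ω ∩ {x | Metric.infDist x Ωᶜ < 4 * ε}, cutoffError v c x := by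
  obtain ⟨η, hη, hη2, hηd, hη1, hη0⟩ := exists_smooth_cutoff (Ω := Ω) hε
  obtain ⟨v', h1, h2⟩ := H1.exists_smooth_mul hΩ hb v hη
  have hdc : Continuous fun x : E n => Metric.infDist x Ωᶜ := Metric.continuous_infDist_pt _
  have hg1 : ∀ x, 3 * ε < Metric.infDist x Ωᶜ → gradFun η x = 0 := fun x hx =>
    gradFun_eq_zero_of_eventuallyEq_const (c := 1) <| by
      filter_upwards [(isOpen_lt continuous_const hdc).mem_nhds hx] with y hy
      exact hη1 y (le_of_lt hy)
  have hg0 : ∀ x, Metric.infDist x Ωᶜ < ε / 2 → gradFun η x = 0 := fun x hx =>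
    gradFun_eq_zero_of_eventuallyEq_const (c := 0) <| by
      filter_upwards [(isOpen_lt hdc continuous_const).mem_nhds hx] with y hy
      exact hη0 y (le_of_lt hy)
  refine ⟨v', ?_, ?_⟩
  · set u : E n → ℂ := Ω.indicator fun x => η x * toL2 v x with hu
    set G : E n → EuclideanSpace ℂ (Fin n) :=
      Ω.indicator fun x => η x • grad v x + toL2 v x • gradFun η x with hG
    have e1 : toL2 v' =ᵐ[volume.restrict Ω] u :=
      h1.trans (indicator_ae_eq_restrict hΩ.measurableSet).symm
    have e2 : grad v' =ᵐ[volume.restrict Ω] G :=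
      h2.trans (indicator_ae_eq_restrict hΩ.measurableSet).symm
    refine mem_closure_test hΩ e1 e2 (S := closure Ω ∩ {x | ε / 2 ≤ Metric.infDist x Ωᶜ})
      (hb.isCompact_closure.inter_right (isClosed_le continuous_const hdc)) ?_ ?_
    · rintro x ⟨-, hx⟩
      by_contra hxΩ
      have h0 : Metric.infDist x Ωᶜ = 0 := Metric.infDist_zero_of_mem hxΩ
      have hx' : ε / 2 ≤ Metric.infDist x Ωᶜ := hx
      linarith
    · intro x hx
      by_cases hxΩ : x ∈ Ω
      · have hxd : Metric.infDist x Ωᶜ < ε / 2 := by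
          by_contra h
          exact hx ⟨subset_closure hxΩ, not_lt.1 h⟩
        rw [hu, hG, Set.indicator_of_mem hxΩ, Set.indicator_of_mem hxΩ, hη0 x hxd.le, hg0 x hxd]
        simp
      · rw [hu, hG, Set.indicator_of_notMem hxΩ, Set.indicator_of_notMem hxΩ]
        simp
  · set A : Set (E n) := {x | Metric.infDist x Ωᶜ < 4 * ε} with hA
    have hAm : MeasurableSet A := measurableSet_infDist_lt _
    have e1 : toL2 (v' - v) =ᵐ[volume.restrict Ω] fun x => (η x - 1) * toL2 v x := by
      refine (Lp.coeFn_sub (toL2 v') (toL2 v)).trans ?_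
      filter_upwards [h1] with x hx
      rw [Pi.sub_apply, hx]
      ring
    have e2 : grad (v' - v) =ᵐ[volume.restrict Ω]
        fun x => (η x - 1) • grad v x + toL2 v x • gradFun η x := by
      refine (Lp.coeFn_sub (grad v') (grad v)).trans ?_
      filter_upwards [h2] with x hx
      rw [Pi.sub_apply, hx, sub_smul, one_smul]
      abel
    have hη4 : ∀ x, ‖η x - 1‖ₑ ^ 2 ≤ 4 := fun x => by
      rw [← ofReal_norm, ← ENNReal.ofReal_pow (norm_nonneg _)]
      calc ENNReal.ofReal (‖η x - 1‖ ^ 2) ≤ ENNReal.ofReal (2 ^ 2) := by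
            gcongr
            exact hη2 x
        _ = 4 := by norm_num
    have key : ∀ x ∈ Ω, ‖(η x - 1) * toL2 v x‖ₑ ^ 2 ≤ A.indicator (cutoffError v c) x ∧
        ‖(η x - 1) • grad v x + toL2 v x • gradFun η x‖ₑ ^ 2 ≤
          A.indicator (cutoffError v c) x := by
      intro x hx
      by_cases hxA : x ∈ A
      · rw [Set.indicator_of_mem hxA]
        have hd := infDist_compl_pos hΩ hx hne
        have hgη : ‖gradFun η x‖ₑ ^ 2 ≤ n * ENNReal.ofReal (16 * c) *
            ENNReal.ofReal ((c * Metric.infDist x Ωᶜ ^ 2)⁻¹) := by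
          refine (enorm_gradFun_sq_le η x).trans ?_
          rw [mul_assoc, ← ENNReal.ofReal_mul (by positivity), ← ofReal_norm,
            ← ENNReal.ofReal_pow (norm_nonneg _)]
          refine mul_le_mul' le_rfl (ENNReal.ofReal_le_ofReal ?_)
          have hx4 : Metric.infDist x Ωᶜ < 4 * ε := hxA
          calc ‖fderiv ℝ η x‖ ^ 2 ≤ (ε⁻¹) ^ 2 := by
                gcongr
                exact hηd x
            -- In the collar the distance is less than `4ε`, so the gradient of the cutoff is
            -- absorbed by the Hardy weight.
            _ ≤ (4 / Metric.infDist x Ωᶜ) ^ 2 := by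
                gcongr
                rw [inv_eq_one_div, div_le_div_iff₀ hε hd]
                linarith
            _ = _ := by
                field_simp
                norm_num
        constructor
        · rw [enorm_mul, mul_pow]
          calc ‖η x - 1‖ₑ ^ 2 * ‖toL2 v x‖ₑ ^ 2 ≤ 8 * ‖toL2 v x‖ₑ ^ 2 := by
                gcongr
                exact (hη4 x).trans (by norm_num)
            _ ≤ _ := by
                rw [cutoffError, add_assoc]
                exact le_self_add
        · calc ‖(η x - 1) • grad v x + toL2 v x • gradFun η x‖ₑ ^ 2
              ≤ (‖(η x - 1) • grad v x‖ₑ + ‖toL2 v x • gradFun η x‖ₑ) ^ 2 := by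
                gcongr
                exact enorm_add_le _ _
            _ ≤ 2 * (‖(η x - 1) • grad v x‖ₑ ^ 2 + ‖toL2 v x • gradFun η x‖ₑ ^ 2) :=
                ennreal_add_sq_le _ _
            _ = 2 * (‖η x - 1‖ₑ ^ 2 * ‖grad v x‖ₑ ^ 2) +
                  2 * (‖toL2 v x‖ₑ ^ 2 * ‖gradFun η x‖ₑ ^ 2) := by
                rw [enorm_smul, enorm_smul, mul_pow, mul_pow, mul_add]
            _ ≤ 2 * (4 * ‖grad v x‖ₑ ^ 2) + 2 * (‖toL2 v x‖ₑ ^ 2 *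
                  (n * ENNReal.ofReal (16 * c) *
                    ENNReal.ofReal ((c * Metric.infDist x Ωᶜ ^ 2)⁻¹))) := by
                gcongr
                exact hη4 x
            _ = 8 * ‖grad v x‖ₑ ^ 2 + 2 * (n * ENNReal.ofReal (16 * c)) *
                  (‖toL2 v x‖ₑ ^ 2 * ENNReal.ofReal ((c * Metric.infDist x Ωᶜ ^ 2)⁻¹)) := by
                ring
            _ ≤ _ := by
                rw [cutoffError, add_assoc]
                exact le_add_self
      · have hx4 : 4 * ε ≤ Metric.infDist x Ωᶜ := not_lt.1 hxA
        rw [hη1 x (by linarith), hg1 x (by linarith)]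
        simp
    have hint : ∀ f : E n → ENNReal, (∀ x ∈ Ω, f x ≤ A.indicator (cutoffError v c) x) →
        ∫⁻ x in Ω, f x ≤ ∫⁻ x in Ω ∩ A, cutoffError v c x := by
      intro f hf
      refine (setLIntegral_mono' hΩ.measurableSet hf).trans (le_of_eq ?_)
      rw [setLIntegral_indicator hAm, Set.inter_comm]
    rw [H1.enorm_sq, Lp.enorm_sq_eq_of_ae_eq e1, Lp.enorm_sq_eq_of_ae_eq e2, two_mul]
    exact add_le_add (hint _ fun x hx => (key x hx).1) (hint _ fun x hx => (key x hx).2)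

set_option maxHeartbeats 1000000 in
-- Zero trace and finite cone energy make the Hardy weighted integral finite, so the cutoff error
-- tends to zero as the collar shrinks.
theorem ConeData.mem_closure_test_of_dirichletTrace_eq_zero (D : ConeData Ω) (hn : 1 ≤ n)
    (hΩ : IsOpen Ω) (hb : Bornology.IsBounded Ω) {v : H1 Ω} (hv : dirichletTrace Ω v = 0) :
    v ∈ closure {v' : H1 Ω | ∃ φ, IsTestFunction Ω φ ∧ SmoothRep v' φ} := by
  have := D.isFiniteMeasure hb
  have hne := nonempty_compl_of_isBounded hn hb
  obtain ⟨-, K, hK, hKE⟩ := D.dirichletTrace_spec hn hΩ hb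
  obtain ⟨c, hc, s, hs, hH⟩ := D.exists_hardy hn hΩ hb
  have hmu : Measurable (toL2 v) := (Lp.stronglyMeasurable (toL2 v)).measurable
  have hmG : Measurable (grad v) := (Lp.stronglyMeasurable (grad v)).measurable
  have hE : ∀ j, D.coneEnergy j (toL2 v) 0 ≠ ⊤ := fun j => by
    have h0 : toL2Bdry (dirichletTrace Ω v) =ᵐ[surfaceMeasure Ω] (0 : E n → ℂ) := by
      rw [hv]
      exact Lp.coeFn_zero ℂ 2 (surfaceMeasure Ω)
    rw [← D.coneEnergy_congr hΩ j Filter.EventuallyEq.rfl h0]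
    exact ((hKE v j).trans_lt (ENNReal.mul_lt_top hK.lt_top (by simp))).ne
  have hfin : ∫⁻ x in Ω ∩ {x | Metric.infDist x Ωᶜ < s}, cutoffError v c x ≠ ⊤ := by
    have m1 : Measurable fun x => 8 * ‖toL2 v x‖ₑ ^ 2 := (hmu.enorm.pow_const 2).const_mul 8
    have m2 : Measurable fun x => 8 * ‖grad v x‖ₑ ^ 2 := (hmG.enorm.pow_const 2).const_mul 8
    have m12 : Measurable fun x => 8 * ‖toL2 v x‖ₑ ^ 2 + 8 * ‖grad v x‖ₑ ^ 2 := m1.add m2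
    have hK2 : 2 * ((n : ENNReal) * ENNReal.ofReal (16 * c)) ≠ ⊤ := by finiteness
    unfold cutoffError
    rw [lintegral_add_left m12, lintegral_add_left m1,
      lintegral_const_mul' _ _ (by simp), lintegral_const_mul' _ _ (by simp),
      lintegral_const_mul' _ _ hK2]
    have i1 : ∫⁻ x in Ω ∩ {x | Metric.infDist x Ωᶜ < s}, ‖toL2 v x‖ₑ ^ 2 ≠ ⊤ := by
      refine ((lintegral_mono_set Set.inter_subset_left).trans_lt ?_).ne
      rw [Lp.lintegral_enorm_sq]
      finiteness
    have i2 : ∫⁻ x in Ω ∩ {x | Metric.infDist x Ωᶜ < s}, ‖grad v x‖ₑ ^ 2 ≠ ⊤ := by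
      refine ((lintegral_mono_set Set.inter_subset_left).trans_lt ?_).ne
      rw [Lp.lintegral_enorm_sq]
      finiteness
    have i3 := ((hH _ hmu).trans_lt (ENNReal.sum_lt_top.2 fun j _ => (hE j).lt_top)).ne
    finiteness
  rw [← closure_closure, Metric.mem_closure_iff]
  intro δ hδ
  obtain ⟨ρ, hρ, -, hlt⟩ := exists_lintegral_near_lt hΩ hb hne hs hfin
    (δ := ENNReal.ofReal (δ ^ 2 / 2)) (by simpa using by positivity)
  obtain ⟨v', hv', hle⟩ := exists_cutoff_mem_closure hΩ hb hne v hc (ε := ρ / 4) (by positivity)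
  refine ⟨v', hv', ?_⟩
  rw [mul_div_cancel₀ _ (by norm_num)] at hle
  have h3 : ‖v' - v‖ₑ ^ 2 < ENNReal.ofReal (δ ^ 2) := by
    calc _ ≤ _ := hle
      _ < 2 * ENNReal.ofReal (δ ^ 2 / 2) :=
        (ENNReal.mul_lt_mul_iff_right (by simp) (by simp)).2 hlt
      _ = ENNReal.ofReal (δ ^ 2) := by
        rw [← ENNReal.ofReal_ofNat, ← ENNReal.ofReal_mul (by norm_num)]
        congr 1
        ring
  rw [← ofReal_norm, ← ENNReal.ofReal_pow (norm_nonneg _),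
    ENNReal.ofReal_lt_ofReal_iff (by positivity)] at h3
  rw [dist_comm, dist_eq_norm]
  exact lt_of_pow_lt_pow_left₀ 2 hδ.le h3

/-! ### Green's formula for test functions -/

theorem laplacian_eq_sum_partialDeriv {φ : E n → ℂ} (hφ : ContDiff ℝ ∞ φ) (x : E n) :
    (Δ φ) x = ∑ i, partialDeriv i (partialDeriv i φ) x := by
  rw [InnerProductSpace.laplacian_eq_iteratedFDeriv_orthonormalBasis φ
    (EuclideanSpace.basisFun (Fin n) ℝ)]
  refine Finset.sum_congr rfl fun i _ => ?_
  rw [iteratedFDeriv_two_apply]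
  have hd : DifferentiableAt ℝ (fderiv ℝ φ) x :=
    ((hφ.fderiv_right (m := ∞) (by simp)).differentiable (by simp)).differentiableAt
  change _ = fderiv ℝ (fun y => fderiv ℝ φ y (EuclideanSpace.single i 1)) x
    (EuclideanSpace.single i 1)
  rw [fderiv_clm_apply hd (differentiableAt_const _)]
  simp

theorem IsTestFunction.conj {φ : E n → ℂ} (hφ : IsTestFunction Ω φ) :
    IsTestFunction Ω (fun x => conj (φ x)) where
  contDiff := Complex.conjCLE.contDiff.comp hφ.contDiff
  hasCompactSupport := hφ.hasCompactSupport.comp_left (g := conj) (map_zero _)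
  tsupport_subset := (tsupport_comp_subset (g := conj) (map_zero _) φ).trans hφ.tsupport_subset

theorem partialDeriv_conj {φ : E n → ℂ} (hφ : ContDiff ℝ ∞ φ) (i : Fin n) (x : E n) :
    partialDeriv i (fun x => conj (φ x)) x = conj (partialDeriv i φ x) := by
  have hd : DifferentiableAt ℝ φ x := (hφ.differentiable (by simp)).differentiableAt
  have h := (Complex.conjCLE : ℂ ≃L[ℝ] ℂ).hasFDerivAt.comp x hd.hasFDerivAt
  change fderiv ℝ (fun x => conj (φ x)) x _ = _
  have e : HasFDerivAt (fun x => conj (φ x)) ((Complex.conjCLE : ℂ →L[ℝ] ℂ).comp (fderiv ℝ φ x)) x :=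
    h
  rw [e.fderiv]
  rfl

theorem inner_toL2_smoothRep (f : L2 Ω) {v : H1 Ω} {φ : E n → ℂ} (hv : SmoothRep v φ) :
    inner ℂ (toL2 v) f = ∫ x in Ω, f x * conj (φ x) := by
  rw [MeasureTheory.L2.inner_def]
  refine integral_congr_ae ?_
  filter_upwards [hv.toL2_ae] with x hx
  rw [hx, RCLike.inner_apply]

/-- The derivatives of a test function are test functions, so the definition of the weak gradient
applies to each of them and moves the remaining derivative from `u`. -/
theorem inner_grad_smoothRep (u : H1 Ω) {v : H1 Ω} {φ : E n → ℂ} (hφ : IsTestFunction Ω φ)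
    (hv : SmoothRep v φ) :
    inner ℂ (grad v) (grad u) = -∫ x in Ω, toL2 u x * (Δ fun x => conj (φ x)) x := by
  have hc := hφ.conj
  have h2 : inner ℂ (grad v) (grad u) =
      ∑ i, ∫ x in Ω, grad u x i * partialDeriv i (fun x => conj (φ x)) x := by
    rw [MeasureTheory.L2.inner_def,
      ← integral_finsetSum _ fun i _ => integrable_vec_mul (grad u) (hc.partialDeriv i) i]
    refine integral_congr_ae ?_
    filter_upwards [hv.grad_ae] with x hx
    rw [hx, PiLp.inner_apply]
    refine Finset.sum_congr rfl fun i _ => ?_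
    rw [partialDeriv_conj hφ.contDiff, RCLike.inner_apply]
    rfl
  have h3 : ∀ i, ∫ x in Ω, grad u x i * partialDeriv i (fun x => conj (φ x)) x =
      -∫ x in Ω, toL2 u x * partialDeriv i (partialDeriv i fun x => conj (φ x)) x := fun i => by
    rw [H1.weakGrad u _ (hc.partialDeriv i) i, neg_neg]
  rw [h2, Finset.sum_congr rfl fun i _ => h3 i, Finset.sum_neg_distrib,
    ← integral_finsetSum _ fun i _ =>
      (hc.partialDeriv i).integrable_partialDeriv i (toL2 u), neg_inj]
  refine integral_congr_ae (Filter.Eventually.of_forall fun x => ?_)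
  dsimp only
  rw [laplacian_eq_sum_partialDeriv hc.contDiff, Finset.mul_sum]

theorem HasWeakLaplacian.green_test {u v : H1 Ω} {f : L2 Ω} (h : HasWeakLaplacian (toL2 u) f)
    {φ : E n → ℂ} (hφ : IsTestFunction Ω φ) (hv : SmoothRep v φ) :
    inner ℂ (grad v) (grad u) + inner ℂ (toL2 v) f = 0 := by
  rw [inner_grad_smoothRep u hφ hv, inner_toL2_smoothRep f hv, h _ hφ.conj, neg_add_cancel]

/-- The identity holds for test functions by the definition of the weak Laplacian and is a closed
condition on `v`. -/
theorem ConeData.green_of_dirichletTrace_eq_zero (D : ConeData Ω) (hn : 1 ≤ n)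
    (hΩ : IsOpen Ω) (hb : Bornology.IsBounded Ω) {u v : H1 Ω} {f : L2 Ω}
    (h : HasWeakLaplacian (toL2 u) f) (hv : dirichletTrace Ω v = 0) :
    inner ℂ (grad v) (grad u) + inner ℂ (toL2 v) f = 0 := by
  have hcl : IsClosed {v : H1 Ω | inner ℂ (grad v) (grad u) + inner ℂ (toL2 v) f = 0} := by
    refine isClosed_eq ?_ continuous_const
    exact (continuous_grad.inner continuous_const).add (continuous_toL2.inner continuous_const)
  have hsub : {v' : H1 Ω | ∃ φ, IsTestFunction Ω φ ∧ SmoothRep v' φ} ⊆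
      {v : H1 Ω | inner ℂ (grad v) (grad u) + inner ℂ (toL2 v) f = 0} := by
    rintro v' ⟨φ, hφ, hv'⟩
    exact h.green_test hφ hv'
  exact closure_minimal hsub hcl (D.mem_closure_test_of_dirichletTrace_eq_zero hn hΩ hb hv)

end

section

/-! ### Abstract form methods -/

variable {V W H B : Type*} [NormedAddCommGroup V] [InnerProductSpace ℂ V]
  [NormedAddCommGroup W] [InnerProductSpace ℂ W]
  [NormedAddCommGroup H] [InnerProductSpace ℂ H]
  [NormedAddCommGroup B] [NormedSpace ℂ B]

/-- `u` solves the variational equation of the form `⟨G ·, G u⟩ + ⟨γ ·, Θ γ u⟩` with data `g` and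
`h`. -/
def WeakEq (G : V →L[ℂ] W) (ι : V →L[ℂ] H) (γ : V →L[ℂ] B)
    (Θ : B →L[ℂ] (B →SL[starRingEnd ℂ] ℂ)) (u : V) (g : B →SL[starRingEnd ℂ] ℂ) (h : H) : Prop :=
  ∀ v, inner ℂ (G v) (G u) + Θ (γ u) (γ v) = g (γ v) + inner ℂ (ι v) h

variable (G : V →L[ℂ] W) (ι : V →L[ℂ] H) (γ : V →L[ℂ] B) (Θ : B →L[ℂ] (B →SL[starRingEnd ℂ] ℂ))

/-- `R` is the resolvent at `z` of the operator associated with the form. -/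
def IsFormResolvent (z : ℂ) (R : H →L[ℂ] H) : Prop :=
  (∀ f, ∃ u, ι u = R f ∧ WeakEq G ι γ Θ u 0 (f + z • R f)) ∧
    ∀ u q, WeakEq G ι γ Θ u 0 q → R (q - z • ι u) = ι u

/-- The form is bounded from below relative to `H`. -/
def IsFormCoercive : Prop :=
  ∃ c > 0, ∃ m : ℝ, ∀ u, c * ‖u‖ ^ 2 ≤ ‖G u‖ ^ 2 + (Θ (γ u) (γ u)).re + m * ‖ι u‖ ^ 2

variable {G ι γ Θ}

/-- The difference of two solutions has homogeneous data, and the left inverse property of the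
resolvent annihilates it. -/
theorem IsFormResolvent.solution_unique {z : ℂ} {R : H →L[ℂ] H}
    (hR : IsFormResolvent G ι γ Θ z R) {u u' : V} {g : B →SL[starRingEnd ℂ] ℂ}
    (hu : WeakEq G ι γ Θ u g (z • ι u)) (hu' : WeakEq G ι γ Θ u' g (z • ι u')) : ι u = ι u' := by
  have h : WeakEq G ι γ Θ (u - u') 0 (z • ι (u - u')) := fun v => by
    have h1 := hu v
    have h2 := hu' v
    simp only [map_sub, inner_sub_right, sub_apply, zero_apply, smul_sub]
    linear_combination h1 - h2
  have h0 := hR.2 _ _ h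
  rw [sub_self, map_zero, map_sub] at h0
  exact sub_eq_zero.1 h0.symm

/-- Each equation is tested with the other solution. The form is hermitian and the spectral terms
are conjugate, so only the boundary data remain. -/
theorem WeakEq.symm (hΘ : ∀ f g, Θ g f = conj (Θ f g)) {z : ℂ} {u v : V}
    {g g' : B →SL[starRingEnd ℂ] ℂ} (hu : WeakEq G ι γ Θ u g (z • ι u))
    (hv : WeakEq G ι γ Θ v g' (conj z • ι v)) : g' (γ u) = conj (g (γ v)) := by
  have h1 := congrArg conj (hu v)
  have h2 := hv u
  rw [map_add, map_add, ← hΘ, inner_conj_symm, inner_smul_right, map_mul, inner_conj_symm] at h1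
  rw [inner_smul_right] at h2
  linear_combination h1 - h2

variable [CompleteSpace V] [CompleteSpace W] [CompleteSpace H]

omit [CompleteSpace W] [CompleteSpace H] in
-- The functional factors through the surjection `γ`. The open mapping theorem provides preimages of
-- controlled norm, which bounds the quotient functional.
theorem exists_antidual_of_ker_le [CompleteSpace B] (γ : V →L[ℂ] B) (hγ : Function.Surjective γ)
    (w : V) (h : ∀ v, γ v = 0 → inner ℂ v w = 0) :
    ∃ ν : B →SL[starRingEnd ℂ] ℂ, ∀ v, ν (γ v) = inner ℂ v w := by
  obtain ⟨C, -, hC⟩ := γ.exists_preimage_norm_le hγ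
  choose s hs hsC using hC
  have key : ∀ v v', γ v = γ v' → inner ℂ v w = inner ℂ v' w := fun v v' hv => by
    rw [← sub_eq_zero, ← inner_sub_left]
    exact h _ (by rw [map_sub, hv, sub_self])
  let ν : B →ₛₗ[starRingEnd ℂ] ℂ :=
    { toFun := fun b => inner ℂ (s b) w
      map_add' := fun a b => by
        rw [← inner_add_left]
        exact key _ _ (by rw [map_add, hs, hs, hs])
      map_smul' := fun c b => by
        rw [smul_eq_mul, ← inner_smul_left]
        exact key _ _ (by rw [map_smul, hs, hs]) }
  refine ⟨ν.mkContinuous (‖w‖ * C) fun b => ?_, fun v => key _ _ (hs _)⟩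
  calc ‖inner ℂ (s b) w‖ ≤ ‖s b‖ * ‖w‖ := norm_inner_le_norm _ _
    _ ≤ (C * ‖b‖) * ‖w‖ := by gcongr; exact hsC b
    _ = _ := by ring

theorem exists_antidual_of_form_eq_zero [CompleteSpace B] (G : V →L[ℂ] W) (ι : V →L[ℂ] H)
    (γ : V →L[ℂ] B) (hγ : Function.Surjective γ) (w : W) (f : H)
    (h : ∀ v, γ v = 0 → inner ℂ (G v) w + inner ℂ (ι v) f = 0) :
    ∃ ν : B →SL[starRingEnd ℂ] ℂ, ∀ v, ν (γ v) = inner ℂ (G v) w + inner ℂ (ι v) f := by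
  have e : ∀ v, inner ℂ v (G.adjoint w + ι.adjoint f) = inner ℂ (G v) w + inner ℂ (ι v) f :=
    fun v => by
      rw [inner_add_right, ContinuousLinearMap.adjoint_inner_right,
        ContinuousLinearMap.adjoint_inner_right]
  obtain ⟨ν, hν⟩ := exists_antidual_of_ker_le γ hγ (G.adjoint w + ι.adjoint f)
    fun v hv => (e v).trans (h v hv)
  exact ⟨ν, fun v => (hν v).trans (e v)⟩

omit [CompleteSpace W] [CompleteSpace H] in
/-- The transpose of a bounded operator, acting on conjugate linear functionals. -/
theorem exists_antidual_transpose (γ : V →L[ℂ] B) :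
    ∃ P : (B →SL[starRingEnd ℂ] ℂ) →L[ℂ] V, ∀ v g, inner ℂ v (P g) = g (γ v) := by
  have h : ∀ g : B →SL[starRingEnd ℂ] ℂ, ∃ w : V, ∀ v, inner ℂ v w = g (γ v) := fun g => by
    let ℓ : V →ₗ[ℂ] ℂ :=
      { toFun := fun v => conj (g (γ v))
        map_add' := fun a b => by rw [map_add, map_add, map_add]
        map_smul' := fun c a => by
          rw [map_smul, map_smulₛₗ, smul_eq_mul, map_mul, Complex.conj_conj]
          rfl }
    refine ⟨(InnerProductSpace.toDual ℂ V).symm (ℓ.mkContinuous (‖g‖ * ‖γ‖) fun v => ?_),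
      fun v => ?_⟩
    · calc ‖conj (g (γ v))‖ = ‖g (γ v)‖ := RCLike.norm_conj _
        _ ≤ ‖g‖ * ‖γ v‖ := g.le_opNorm _
        _ ≤ ‖g‖ * (‖γ‖ * ‖v‖) := by gcongr; exact γ.le_opNorm v
        _ = _ := by ring
    · rw [← inner_conj_symm, InnerProductSpace.toDual_symm_apply]
      exact Complex.conj_conj _
  choose P hP using h
  let P' : (B →SL[starRingEnd ℂ] ℂ) →ₗ[ℂ] V :=
    { toFun := P
      map_add' := fun g g' => ext_inner_left ℂ fun v => by
        rw [inner_add_right, hP, hP, hP]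
        rfl
      map_smul' := fun c g => ext_inner_left ℂ fun v => by
        rw [inner_smul_right, hP, hP]
        rfl }
  refine ⟨P'.mkContinuous ‖γ‖ fun g => ?_, fun v g => hP g v⟩
  change ‖P g‖ ≤ _
  have h1 : ‖P g‖ * ‖P g‖ ≤ ‖γ‖ * ‖g‖ * ‖P g‖ := by
    calc ‖P g‖ * ‖P g‖ = ‖inner ℂ (P g) (P g)‖ := by
          rw [inner_self_eq_norm_sq_to_K]
          simp [sq]
      _ = ‖g (γ (P g))‖ := by rw [hP]
      _ ≤ ‖g‖ * ‖γ (P g)‖ := g.le_opNorm _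
      _ ≤ ‖g‖ * (‖γ‖ * ‖P g‖) := by gcongr; exact γ.le_opNorm _
      _ = _ := by ring
  rcases (norm_nonneg (P g)).eq_or_lt with h0 | h0
  · rw [← h0]
    positivity
  · exact le_of_mul_le_mul_right h1 h0

variable (G ι γ Θ)

/-- By Riesz the form is represented by `A = G* G + P Θ γ` on `V`, with `P` the transpose of `γ`,
and the variational equation becomes an equation in `V`. -/
theorem exists_formOperator (hΘ : ∀ f g, Θ g f = conj (Θ f g)) :
    ∃ (A : V →L[ℂ] V) (P : (B →SL[starRingEnd ℂ] ℂ) →L[ℂ] V),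
      (∀ u g h, WeakEq G ι γ Θ u g h ↔ A u = P g + ι.adjoint h) ∧
      (∀ u v, inner ℂ (A u) v = inner ℂ u (A v)) ∧
      ∀ u, (inner ℂ u (A u)).re = ‖G u‖ ^ 2 + (Θ (γ u) (γ u)).re := by
  obtain ⟨P, hP⟩ := exists_antidual_transpose γ
  set A : V →L[ℂ] V := G.adjoint ∘L G + P ∘L Θ ∘L γ with hA
  have hAi : ∀ v u, inner ℂ v (A u) = inner ℂ (G v) (G u) + Θ (γ u) (γ v) := fun v u => by
    have e : A u = G.adjoint (G u) + P (Θ (γ u)) := rfl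
    rw [e, inner_add_right, ContinuousLinearMap.adjoint_inner_right, hP]
  refine ⟨A, P, fun u g h => ?_, fun u v => ?_, fun u => ?_⟩
  · constructor
    · intro hw
      refine ext_inner_left ℂ fun v => ?_
      rw [hAi, inner_add_right, hP, ContinuousLinearMap.adjoint_inner_right]
      exact hw v
    · intro hw v
      rw [← hAi, hw, inner_add_right, hP, ContinuousLinearMap.adjoint_inner_right]
  · rw [← inner_conj_symm, hAi, hAi, map_add, inner_conj_symm, hΘ (γ u) (γ v)]
  · rw [hAi, Complex.add_re, inner_self_eq_norm_sq_to_K]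
    norm_cast

/-- Lax-Milgram for the shifted operator, with inverse `T`. The constant `m` in the conclusion is
minus the shift, so `T` inverts `A - m ι* ι`. -/
theorem IsFormCoercive.exists_inverse (hΘ : ∀ f g, Θ g f = conj (Θ f g))
    (hc : IsFormCoercive G ι γ Θ) :
    ∃ (A : V →L[ℂ] V) (P : (B →SL[starRingEnd ℂ] ℂ) →L[ℂ] V) (m : ℝ) (T : V →L[ℂ] V),
      (∀ u g h, WeakEq G ι γ Θ u g h ↔ A u = P g + ι.adjoint h) ∧
      (∀ u v, inner ℂ (A u) v = inner ℂ u (A v)) ∧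
      (∀ w, A (T w) = w + (m : ℂ) • ι.adjoint (ι (T w))) ∧
      ∀ u w, A u = w + (m : ℂ) • ι.adjoint (ι u) → T w = u := by
  obtain ⟨A, P, h1, h2, h3⟩ := exists_formOperator G ι γ Θ hΘ
  obtain ⟨c, hc0, m, hm⟩ := hc
  set S : V →L[ℂ] V := A + (m : ℂ) • (ι.adjoint ∘L ι) with hS
  have hSu : ∀ u, S u = A u + (m : ℂ) • ι.adjoint (ι u) := fun u => rfl
  have hunit : IsUnit S := by
    refine ContinuousLinearMap.isUnit_of_forall_le_norm_inner_map S (c := ⟨c, hc0.le⟩) hc0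
      fun u => ?_
    rw [norm_inner_symm]
    refine le_trans ?_ (Complex.re_le_norm _)
    rw [hSu, inner_add_right, inner_smul_right, ContinuousLinearMap.adjoint_inner_right,
      Complex.add_re, h3, inner_self_eq_norm_sq_to_K, Complex.re_ofReal_mul]
    have := hm u
    norm_cast
    rw [mul_comm]
    exact this
  obtain ⟨U, hU⟩ := hunit
  have hr : ∀ w, S ((↑U⁻¹ : V →L[ℂ] V) w) = w := fun w => by
    rw [← hU, ← mul_apply_eq_comp, Units.mul_inv, one_apply_eq_self]
  have hl : ∀ w, (↑U⁻¹ : V →L[ℂ] V) (S w) = w := fun w => by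
    rw [← hU, ← mul_apply_eq_comp, Units.inv_mul, one_apply_eq_self]
  refine ⟨A, P, -m, ↑U⁻¹, h1, h2, fun w => ?_, fun u w hu => ?_⟩
  · have := hr w
    rw [hSu] at this
    rw [Complex.ofReal_neg, neg_smul, ← sub_eq_add_neg, eq_sub_iff_add_eq]
    exact this
  · rw [Complex.ofReal_neg, neg_smul, ← sub_eq_add_neg, eq_sub_iff_add_eq] at hu
    rw [← hu, ← hSu, hl]

variable {G ι γ Θ}

/-- `T (P g)` solves the problem with `m` in place of `z`. The residual `(z - m) ι* ι (T (P g))`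
comes from `H`, and the resolvent at `z` removes it. -/
theorem IsFormResolvent.exists_solution (hΘ : ∀ f g, Θ g f = conj (Θ f g))
    (hc : IsFormCoercive G ι γ Θ) {z : ℂ} {R : H →L[ℂ] H} (hR : IsFormResolvent G ι γ Θ z R) :
    ∃ S : (B →SL[starRingEnd ℂ] ℂ) →L[ℂ] V, ∀ g, WeakEq G ι γ Θ (S g) g (z • ι (S g)) := by
  obtain ⟨A, P, m, T, h1, -, h3, h4⟩ := hc.exists_inverse G ι γ Θ hΘ
  let F : V →L[ℂ] H := (z - m) • ι
  -- The resolvent lifted to a bounded operator into `V`: its values satisfy `ι (Q f) = R f` and `A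
  -- (Q f) = ι* (f + z R f)`.
  let Q : H →L[ℂ] V := T ∘L ι.adjoint ∘L (ContinuousLinearMap.id ℂ H + (z - m) • R)
  have hQ : ∀ f, ι (Q f) = R f ∧ A (Q f) = ι.adjoint (f + z • R f) := fun f => by
    obtain ⟨u, hu, hw⟩ := hR.1 f
    rw [h1, map_zero, zero_add] at hw
    have e : Q f = u := by
      refine h4 u (ι.adjoint (f + (z - m) • R f)) ?_
      rw [hw, hu, ← map_smul ι.adjoint, ← map_add ι.adjoint]
      congr 1
      module
    rw [e]
    exact ⟨hu, hw⟩
  refine ⟨T ∘L P + Q ∘L F ∘L T ∘L P, fun g => ?_⟩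
  obtain ⟨q1, q2⟩ := hQ (F (T (P g)))
  change WeakEq G ι γ Θ (T (P g) + Q (F (T (P g)))) g (z • ι (T (P g) + Q (F (T (P g)))))
  rw [h1, map_add, h3, q2, map_add ι, q1, add_assoc, ← map_smul, ← map_add]
  congr 2
  change (m : ℂ) • ι (T (P g)) + ((z - m) • ι (T (P g)) + z • R (F (T (P g)))) = _
  module

/-- Symmetry of `A` gives at once that the adjoint is a left inverse. That its values come from
solutions in `V` is shown by solving the equation with spectral parameter `m` and comparing with the
left inverse identity. -/
theorem IsFormResolvent.adjoint (hΘ : ∀ f g, Θ g f = conj (Θ f g))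
    (hc : IsFormCoercive G ι γ Θ) {z : ℂ} {R : H →L[ℂ] H} (hR : IsFormResolvent G ι γ Θ z R) :
    IsFormResolvent G ι γ Θ (conj z) R.adjoint := by
  obtain ⟨A, P, m, T, h1, h2, h3, h4⟩ := hc.exists_inverse G ι γ Θ hΘ
  have hsnd : ∀ u q, A u = ι.adjoint q → R.adjoint (q - conj z • ι u) = ι u := by
    intro u q hu
    refine ext_inner_left ℂ fun f => ?_
    obtain ⟨t, ht, hw⟩ := hR.1 f
    rw [h1, map_zero, zero_add] at hw
    have e := h2 t u
    rw [hw, hu, ContinuousLinearMap.adjoint_inner_left, ContinuousLinearMap.adjoint_inner_right,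
      inner_add_left, inner_smul_left, ← ht] at e
    rw [ContinuousLinearMap.adjoint_inner_right, ← ht, inner_sub_right, inner_smul_right, ← e]
    ring
  refine ⟨fun f => ?_, fun u q hu => hsnd u q (by rwa [h1, map_zero, zero_add] at hu)⟩
  set p := R.adjoint f with hp
  set u := T (ι.adjoint (f + (conj z - m) • p)) with hu
  have hAu : A u = ι.adjoint ((m : ℂ) • ι u + (f + (conj z - m) • p)) := by
    rw [hu, h3, map_add ι.adjoint ((m : ℂ) • _), map_smul, add_comm]
  have he := hsnd _ _ hAu
  -- The discrepancy lies in the kernel of the adjoint of `1 + (z - m) R`.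
  have he' : (p - ι u) + (conj z - m) • R.adjoint (p - ι u) = 0 := by
    have : (m : ℂ) • ι u + (f + (conj z - m) • p) - conj z • ι u =
        f + (conj z - m) • (p - ι u) := by module
    rw [this, map_add, map_smul, ← hp] at he
    rw [sub_add_eq_add_sub, he, sub_self]
  have hpu : p - ι u = 0 := by
    rw [← inner_self_eq_zero (𝕜 := ℂ)]
    -- The operator `1 + (z - m) R` is onto, since `h - (z - m) ι (T (ι* h))` is a preimage of `h`;
    -- hence its adjoint is injective.
    have hsurj : ∀ h : H, ∃ f, f + (z - m) • R f = h := fun h => by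
      set s := T (ι.adjoint h) with hs
      have hAs : A s = ι.adjoint (h + (m : ℂ) • ι s) := by
        rw [hs, h3, map_add ι.adjoint h, map_smul]
      have e := hR.2 s _ ((h1 _ _ _).2 (by rw [map_zero, zero_add]; exact hAs))
      have e2 : h + (m : ℂ) • ι s - z • ι s = h - (z - m) • ι s := by module
      rw [e2] at e
      exact ⟨h - (z - m) • ι s, by rw [e]; module⟩
    obtain ⟨f', hf'⟩ := hsurj (p - ι u)
    calc inner ℂ (p - ι u) (p - ι u) = inner ℂ (f' + (z - m) • R f') (p - ι u) := by rw [hf']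
      _ = inner ℂ f' ((p - ι u) + (conj z - m) • R.adjoint (p - ι u)) := by
          rw [inner_add_left, inner_add_right, inner_smul_left, inner_smul_right,
            ContinuousLinearMap.adjoint_inner_right, map_sub, Complex.conj_ofReal]
      _ = 0 := by rw [he', inner_zero_right]
  refine ⟨u, (sub_eq_zero.1 hpu).symm, ?_⟩
  rw [h1, map_zero, zero_add, hAu, ← sub_eq_zero.1 hpu]
  congr 1
  module

end

section

/-! ### The Neumann trace -/

variable {n : ℕ} {Ω : Set (E n)}

/-- The inclusion of `H¹(Ω)` into `L²(Ω)` as a bounded operator. -/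
def toL2L (Ω : Set (E n)) : H1 Ω →L[ℂ] L2 Ω where
  toFun := toL2
  map_add' := toL2_add
  map_smul' := toL2_smul
  cont := continuous_toL2

/-- The gradient as a bounded operator. -/
def gradL (Ω : Set (E n)) : H1 Ω →L[ℂ] L2Vec Ω where
  toFun := grad
  map_add' := grad_add
  map_smul' := grad_smul
  cont := continuous_grad

theorem HasWeakLaplacian.unique (hΩ : IsOpen Ω) {u f f' : L2 Ω} (h : HasWeakLaplacian u f)
    (h' : HasWeakLaplacian u f') : f = f' := by
  have h1 := h.add (h'.smul (-1))
  rw [neg_one_smul, neg_one_smul, add_neg_cancel] at h1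
  exact add_neg_eq_zero.1 (h1.eq_zero hΩ)

/-- Existence: Green's functional vanishes on the kernel of the Dirichlet trace and so descends to
`H^{1/2}(∂Ω)`. Uniqueness: the trace is onto and the weak Laplacian is unique. -/
theorem ConeData.existsUnique_neumannTrace (D : ConeData Ω) (hn : 1 ≤ n) (hΩ : IsOpen Ω)
    (hb : Bornology.IsBounded Ω) {u : H1 Ω} {f : L2 Ω} (h : HasWeakLaplacian (toL2 u) f) :
    ∃! ν : Hm12 Ω, HasNeumannTrace u ν := by
  have := D.isFiniteMeasure hb
  have : CompleteSpace (H12 Ω) := isClosed_H12.completeSpace_coe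
  have hs := D.surjective_dirichletTrace hn hΩ hb
  obtain ⟨ν, hν⟩ := exists_antidual_of_form_eq_zero (gradL Ω) (toL2L Ω) (dirichletTrace Ω) hs
    (grad u) f fun v hv => D.green_of_dirichletTrace_eq_zero hn hΩ hb h hv
  refine ⟨ν, ⟨f, h, hν⟩, ?_⟩
  rintro μ ⟨f', hf', hμ⟩
  obtain rfl := h.unique hΩ hf'
  ext b
  obtain ⟨v, rfl⟩ := hs b
  exact (hμ v).trans (hν v).symm

/-! ### The form of the Robin Laplacian -/

theorem IsTestFunction.exists_smoothRep {φ : E n → ℂ} (hφ : IsTestFunction Ω φ) :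
    ∃ v : H1 Ω, SmoothRep v φ := by
  have h1 : MemLp (gradFun φ) 2 (volume.restrict Ω) :=
    MemLp.of_eval_piLp fun i => hφ.memLp_partialDeriv i
  obtain ⟨v, hv, hv'⟩ := exists_H1 hφ.memLp h1 (WeakGrad.of_differentiableAt hφ.memLp h1
    (fun x _ => (hφ.contDiff.differentiable (by simp)).differentiableAt)
    fun i => Filter.Eventually.of_forall fun x => rfl)
  exact ⟨v, hφ.contDiff, hv, hv'⟩

theorem IsDirichletTrace.eq_zero_of_smoothRep [SFinite (surfaceMeasure Ω)]
    {γ : H1 Ω →L[ℂ] H12 Ω} (hγ : IsDirichletTrace γ) (hΩ : IsOpen Ω) {φ : E n → ℂ}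
    (hφ : IsTestFunction Ω φ) {v : H1 Ω} (hv : SmoothRep v φ) : γ v = 0 := by
  apply H12.ext_toL2Bdry
  apply Lp.ext
  refine (hγ v φ hv.contDiff.continuous.continuousOn hv.toL2_ae).trans ?_
  refine Filter.EventuallyEq.trans ?_ (Lp.coeFn_zero ℂ 2 (surfaceMeasure Ω)).symm
  filter_upwards [ae_mem_frontier] with y hy
  by_contra h0
  have h1 : y ∈ Ω := hφ.tsupport_subset (subset_tsupport _ h0)
  rw [hΩ.frontier_eq] at hy
  exact hy.2 h1

/-- The variational form of the Robin problem. -/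
abbrev RobinWeakEq (Θ : H12 Ω →L[ℂ] Hm12 Ω) (u : H1 Ω) (g : Hm12 Ω) (h : L2 Ω) : Prop :=
  WeakEq (gradL Ω) (toL2L Ω) (dirichletTrace Ω) Θ u g h

set_option maxHeartbeats 800000 in
-- Test functions have zero trace, so testing with them removes all boundary terms and leaves the
-- differential equation.
theorem IsDirichletTrace.hasWeakLaplacian_of_robinWeakEq [SFinite (surfaceMeasure Ω)]
    (hγ : IsDirichletTrace (dirichletTrace Ω)) (hΩ : IsOpen Ω) {Θ : H12 Ω →L[ℂ] Hm12 Ω} {u : H1 Ω}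
    {g : Hm12 Ω} {h : L2 Ω} (hw : RobinWeakEq Θ u g h) : HasWeakLaplacian (toL2 u) (-h) := by
  intro φ hφ
  obtain ⟨v, hv⟩ := hφ.conj.exists_smoothRep
  have h0 := hγ.eq_zero_of_smoothRep hΩ hφ.conj hv
  have h1 : inner ℂ (grad v) (grad u) + Θ (dirichletTrace Ω u) (dirichletTrace Ω v) =
    g (dirichletTrace Ω v) + inner ℂ (toL2 v) h := hw v
  rw [h0, map_zero, map_zero, add_zero, zero_add, inner_grad_smoothRep u hφ.conj hv] at h1
  have h2 := inner_toL2_smoothRep (-h) hv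
  rw [inner_neg_right, ← h1, neg_neg] at h2
  simpa only [Complex.conj_conj] using h2

set_option maxHeartbeats 800000 in
theorem RobinWeakEq.hasRobinTrace {Θ : H12 Ω →L[ℂ] Hm12 Ω} {u : H1 Ω} {g : Hm12 Ω} {h : L2 Ω}
    (hw : RobinWeakEq Θ u g h) (hl : HasWeakLaplacian (toL2 u) (-h)) : HasRobinTrace Θ u g := by
  refine ⟨g - Θ (dirichletTrace Ω u), ⟨-h, hl, fun v => ?_⟩, sub_add_cancel _ _⟩
  have h1 : inner ℂ (grad v) (grad u) + Θ (dirichletTrace Ω u) (dirichletTrace Ω v) =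
    g (dirichletTrace Ω v) + inner ℂ (toL2 v) h := hw v
  rw [pairing, sub_apply, inner_neg_right]
  linear_combination -h1

set_option maxHeartbeats 800000 in
theorem HasRobinTrace.robinWeakEq (hΩ : IsOpen Ω) {Θ : H12 Ω →L[ℂ] Hm12 Ω} {u : H1 Ω} {g : Hm12 Ω}
    {h : L2 Ω} (hr : HasRobinTrace Θ u g) (hl : HasWeakLaplacian (toL2 u) (-h)) :
    RobinWeakEq Θ u g h := by
  obtain ⟨ν, ⟨f, hf, hν⟩, rfl⟩ := hr
  intro v
  obtain rfl := hl.unique hΩ hf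
  have h1 : ν (dirichletTrace Ω v) = inner ℂ (grad v) (grad u) + inner ℂ (toL2 v) (-h) := hν v
  change inner ℂ (grad v) (grad u) + Θ (dirichletTrace Ω u) (dirichletTrace Ω v) =
    (ν + Θ (dirichletTrace Ω u)) (dirichletTrace Ω v) + inner ℂ (toL2 v) h
  rw [add_apply, h1, inner_neg_right]
  ring

theorem ConeData.robinWeakEq_iff (D : ConeData Ω) (hn : 1 ≤ n) (hΩ : IsOpen Ω)
    (hb : Bornology.IsBounded Ω) (Θ : H12 Ω →L[ℂ] Hm12 Ω) (u : H1 Ω) (g : Hm12 Ω) (h : L2 Ω) :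
    RobinWeakEq Θ u g h ↔ HasWeakLaplacian (toL2 u) (-h) ∧ HasRobinTrace Θ u g := by
  have := D.isFiniteMeasure hb
  obtain ⟨hγ, -⟩ := D.dirichletTrace_spec hn hΩ hb
  refine ⟨fun hw => ?_, fun hw => hw.2.robinWeakEq hΩ hw.1⟩
  have hl := hγ.hasWeakLaplacian_of_robinWeakEq hΩ hw
  exact ⟨hl, hw.hasRobinTrace hl⟩

theorem ConeData.isRobinSolution_iff (D : ConeData Ω) (hn : 1 ≤ n) (hΩ : IsOpen Ω)
    (hb : Bornology.IsBounded Ω) (Θ : H12 Ω →L[ℂ] Hm12 Ω) (z : ℂ) (g : Hm12 Ω) (u : H1 Ω) :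
    IsRobinSolution Θ z g u ↔ RobinWeakEq Θ u g (z • toL2L Ω u) :=
  (D.robinWeakEq_iff hn hΩ hb Θ u g _).symm

theorem ConeData.mem_robinGraph_iff (D : ConeData Ω) (hn : 1 ≤ n) (hΩ : IsOpen Ω)
    (hb : Bornology.IsBounded Ω) (Θ : H12 Ω →L[ℂ] Hm12 Ω) (p q : L2 Ω) :
    (p, q) ∈ robinGraph Θ ↔ ∃ u, toL2L Ω u = p ∧ RobinWeakEq Θ u 0 q := by
  constructor
  · rintro ⟨u, rfl, h⟩
    exact ⟨u, rfl, (D.robinWeakEq_iff hn hΩ hb Θ u 0 q).2 h⟩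
  · rintro ⟨u, rfl, h⟩
    exact ⟨u, rfl, (D.robinWeakEq_iff hn hΩ hb Θ u 0 q).1 h⟩

theorem notMem_pmapSpectrum_iff {H : Type*} [NormedAddCommGroup H] [NormedSpace ℂ H]
    (A : H →ₗ.[ℂ] H) (z : ℂ) :
    z ∉ pmapSpectrum A ↔ ∃ R : H →L[ℂ] H, (∀ f, (R f, f + z • R f) ∈ A.graph) ∧
      ∀ u q, (u, q) ∈ A.graph → R (q - z • u) = u := by
  rw [pmapSpectrum, Set.notMem_ofPred_iff, not_not]
  refine exists_congr fun R => and_congr (forall_congr' fun f => ?_) ?_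
  · rw [LinearPMap.mem_graph_iff]
    constructor
    · rintro ⟨h, hf⟩
      exact ⟨⟨R f, h⟩, rfl, sub_eq_iff_eq_add.1 hf⟩
    · rintro ⟨⟨y, hy⟩, rfl, h2⟩
      exact ⟨hy, sub_eq_iff_eq_add.2 h2⟩
  · constructor
    · intro h u q huq
      obtain ⟨y, rfl, rfl⟩ := (LinearPMap.mem_graph_iff A).1 huq
      exact h y
    · intro h u
      exact h u (A u) (A.mem_graph u)

/-- Elements of the graph of the Robin Laplacian are the solutions of the variational equation with
zero boundary datum, so operator resolvents and form resolvents coincide. -/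
theorem ConeData.notMem_spectrum_iff (D : ConeData Ω) (hn : 1 ≤ n) (hΩ : IsOpen Ω)
    (hb : Bornology.IsBounded Ω) (Θ : H12 Ω →L[ℂ] Hm12 Ω) (z : ℂ) :
    z ∉ pmapSpectrum (robinLaplacian Θ) ↔
      ∃ R, IsFormResolvent (gradL Ω) (toL2L Ω) (dirichletTrace Ω) Θ z R := by
  rw [notMem_pmapSpectrum_iff, robinLaplacian_graph hΩ]
  refine exists_congr fun R => and_congr (forall_congr' fun f => ?_) ?_
  · rw [D.mem_robinGraph_iff hn hΩ hb]
  · constructor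
    · intro h u q hu
      exact h _ _ ((D.mem_robinGraph_iff hn hΩ hb Θ _ _).2 ⟨u, rfl, hu⟩)
    · intro h p q hpq
      obtain ⟨u, rfl, hu⟩ := (D.mem_robinGraph_iff hn hΩ hb Θ _ _).1 hpq
      exact h u q hu

/-- The trace inequality is applied with `δ / M`, where `M` exceeds the factor `N * K` picked up by
summing the energy bound over the charts. -/
theorem ConeData.exists_norm_sq_bdry_le (D : ConeData Ω) (hn : 1 ≤ n) (hΩ : IsOpen Ω)
    (hb : Bornology.IsBounded Ω) {K : ENNReal} (hK : K ≠ ⊤) {δ : ℝ} (hδ : 0 < δ) :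
    ∃ C : ℝ, ∀ (u : L2 Ω) (g : L2Bdry Ω) (a : ℝ), 0 ≤ a →
      (∀ j, D.coneEnergy j u g ≤ K * ENNReal.ofReal a) → ‖g‖ ^ 2 ≤ δ * a + C * ‖u‖ ^ 2 := by
  have := D.isFiniteMeasure hb
  set M : ℝ := D.N * K.toReal + 1 with hM
  have hM0 : 0 < M := by positivity
  obtain ⟨C, hC, h⟩ := D.exists_lintegral_bdry_le hn hΩ (ε := δ / M) (by positivity)
  refine ⟨C.toReal, fun u g a ha hE => ?_⟩
  have h1 := h u g (Lp.stronglyMeasurable _).measurable (Lp.stronglyMeasurable _).measurable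
  rw [Lp.lintegral_enorm_sq, Lp.lintegral_enorm_sq] at h1
  have h2 : ∑ j, D.coneEnergy j u g ≤ ENNReal.ofReal (D.N * K.toReal) * ENNReal.ofReal a := by
    refine (Finset.sum_le_sum fun j _ => hE j).trans (le_of_eq ?_)
    rw [Finset.sum_const, Finset.card_univ, Fintype.card_fin, nsmul_eq_mul,
      ENNReal.ofReal_mul (by positivity), ENNReal.ofReal_toReal hK, ENNReal.ofReal_natCast,
      mul_assoc]
  have h3 : ‖g‖ₑ ^ 2 ≤ ENNReal.ofReal (δ * a + C.toReal * ‖u‖ ^ 2) := by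
    rw [ENNReal.ofReal_add (by positivity) (by positivity), ENNReal.ofReal_mul (by positivity),
      ENNReal.ofReal_mul (by positivity), ENNReal.ofReal_toReal hC,
      ENNReal.ofReal_pow (norm_nonneg _), ofReal_norm]
    refine h1.trans (add_le_add ?_ le_rfl)
    calc _ ≤ ENNReal.ofReal (δ / M) * (ENNReal.ofReal (D.N * K.toReal) * ENNReal.ofReal a) :=
          mul_le_mul' le_rfl h2
      _ = ENNReal.ofReal (δ / M * (D.N * K.toReal)) * ENNReal.ofReal a := by
          rw [← mul_assoc, ← ENNReal.ofReal_mul (by positivity)]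
      _ ≤ _ := by
          gcongr
          rw [div_mul_eq_mul_div, div_le_iff₀ hM0]
          gcongr
          rw [hM]
          linarith
  rwa [← ofReal_norm, ← ENNReal.ofReal_pow (norm_nonneg _),
    ENNReal.ofReal_le_ofReal_iff (by positivity)] at h3

theorem ConeData.norm_sq_trace_le (D : ConeData Ω) (hn : 1 ≤ n) (hΩ : IsOpen Ω)
    (hb : Bornology.IsBounded Ω) {δ : ℝ} (hδ : 0 < δ) :
    ∃ C : ℝ, ∀ u : H1 Ω,
      ‖toL2Bdry (dirichletTrace Ω u)‖ ^ 2 ≤ δ * ‖grad u‖ ^ 2 + C * ‖toL2 u‖ ^ 2 := by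
  obtain ⟨-, K, hK, hKE⟩ := D.dirichletTrace_spec hn hΩ hb
  obtain ⟨C, hC⟩ := D.exists_norm_sq_bdry_le hn hΩ hb hK hδ
  refine ⟨C, fun u => hC _ _ _ (by positivity) fun j => ?_⟩
  rw [ENNReal.ofReal_pow (norm_nonneg _), ofReal_norm]
  exact hKE u j

/-- The constant `(2(|c| + 1))⁻¹` is chosen so that the negative boundary term consumes at most half
of the gradient term `a`. -/
theorem half_add_le_of_mul_le {c C a b t r : ℝ} (h1 : c * t ≤ r)
    (h2 : t ≤ (2 * (|c| + 1))⁻¹ * a + C * b) (ha : 0 ≤ a) (ht : 0 ≤ t) :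
    1 / 2 * (b + a) ≤ a + r + (|c| * C + 1 / 2) * b := by
  have h3 := mul_le_mul_of_nonneg_left h2 (abs_nonneg c)
  have h4 : -|c| * t ≤ c * t := by
    gcongr
    exact neg_abs_le c
  have h5 : |c| * ((2 * (|c| + 1))⁻¹ * a) ≤ 1 / 2 * a := by
    rw [← mul_assoc]
    gcongr
    rw [mul_inv_le_iff₀ (by positivity)]
    linarith
  linarith

set_option maxHeartbeats 800000 in
theorem ConeData.isFormCoercive (D : ConeData Ω) (hn : 1 ≤ n) (hΩ : IsOpen Ω)
    (hb : Bornology.IsBounded Ω) {Θ : H12 Ω →L[ℂ] Hm12 Ω} (hΘ : IsBoundaryOperator Θ) :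
    IsFormCoercive (gradL Ω) (toL2L Ω) (dirichletTrace Ω) Θ := by
  obtain ⟨c, hc⟩ := hΘ.bounded_below
  obtain ⟨C, hC⟩ := D.norm_sq_trace_le hn hΩ hb (δ := (2 * (|c| + 1))⁻¹) (by positivity)
  refine ⟨1 / 2, by norm_num, |c| * C + 1 / 2, fun u => ?_⟩
  rw [H1.norm_sq]
  exact half_add_le_of_mul_le (hc _) (hC u) (sq_nonneg _) (sq_nonneg _)

end

section

/-! ### Algebra of boundary maps -/

section BoundaryMaps

variable {V B : Type*} [NormedAddCommGroup V] [NormedSpace ℂ V] [NormedAddCommGroup B]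
  [NormedSpace ℂ B] {Θ₁ Θ₂ : B →L[ℂ] (B →SL[starRingEnd ℂ] ℂ)} {γ : V →L[ℂ] B}

theorem neg_add_eq_of_add_eq {c g : B →SL[starRingEnd ℂ] ℂ} {b : B} (h : c + Θ₁ b = g) :
    -(c + Θ₂ b) = -g + (Θ₁ - Θ₂) b := by
  rw [← h, sub_apply]
  abel

/-- The hypothesis states that the `Θ₂` solution for `g` is the `Θ₁` solution for minus its image.
By linearity the second application produces `Θ₁ - Θ₂` on the same trace with opposite sign, and
everything but `g` cancels. -/
theorem boundaryMap_comp {S₁ S₂ : (B →SL[starRingEnd ℂ] ℂ) →L[ℂ] V} {g : B →SL[starRingEnd ℂ] ℂ}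
    (h : S₁ (-(-g + (Θ₂ - Θ₁) (γ (S₂ g)))) = S₂ g) :
    -(-g + (Θ₂ - Θ₁) (γ (S₂ g))) + (Θ₁ - Θ₂) (γ (S₁ (-g + (Θ₂ - Θ₁) (γ (S₂ g))))) = g := by
  set d := -g + (Θ₂ - Θ₁) (γ (S₂ g)) with hd
  have h2 : S₁ d = -S₂ g := by rw [← h, map_neg, neg_neg]
  have h4 : (Θ₁ - Θ₂) (γ (S₁ d)) = (Θ₂ - Θ₁) (γ (S₂ g)) := by
    rw [h2, map_neg, map_neg, ← neg_sub Θ₂ Θ₁, neg_apply, neg_neg]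
  rw [h4, hd]
  abel

theorem boundaryMap_adjoint {S S' : (B →SL[starRingEnd ℂ] ℂ) →L[ℂ] V}
    (hΘ₁ : ∀ f g, Θ₁ g f = conj (Θ₁ f g)) (hΘ₂ : ∀ f g, Θ₂ g f = conj (Θ₂ f g)) (f g : B)
    (h : (Θ₁ - Θ₂) f (γ (S ((Θ₁ - Θ₂) g))) = conj ((Θ₁ - Θ₂) g (γ (S' ((Θ₁ - Θ₂) f))))) :
    (-(Θ₁ - Θ₂) g + (Θ₁ - Θ₂) (γ (S ((Θ₁ - Θ₂) g)))) f =
      conj ((-(Θ₁ - Θ₂) f + (Θ₁ - Θ₂) (γ (S' ((Θ₁ - Θ₂) f)))) g) := by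
  have hs : ∀ f g, (Θ₁ - Θ₂) g f = conj ((Θ₁ - Θ₂) f g) := fun f g => by
    rw [sub_apply, sub_apply, sub_apply, sub_apply, hΘ₁, hΘ₂, map_sub]
  rw [add_apply, add_apply, neg_apply, neg_apply, map_add, map_neg, ← hs, ← hs,
    hs f (γ _), h, Complex.conj_conj]

end BoundaryMaps

/-! ### The Robin problem and the Robin-to-Robin maps -/

variable {n : ℕ} {Ω : Set (E n)} {Θ Θ₁ Θ₂ : H12 Ω →L[ℂ] Hm12 Ω} {z : ℂ}

/-- Existence with bounded linear dependence comes from the form. Uniqueness holds first in `L²(Ω)`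
through the resolvent, then in `H¹(Ω)` by injectivity of the inclusion. -/
theorem ConeData.exists_solutionOperator (D : ConeData Ω) (hn : 1 ≤ n) (hΩ : IsOpen Ω)
    (hb : Bornology.IsBounded Ω) (hΘ : IsBoundaryOperator Θ)
    (hz : z ∉ pmapSpectrum (robinLaplacian Θ)) :
    ∃ S : Hm12 Ω →L[ℂ] H1 Ω, ∀ g u, IsRobinSolution Θ z g u ↔ u = S g := by
  obtain ⟨R, hR⟩ := (D.notMem_spectrum_iff hn hΩ hb Θ z).1 hz
  obtain ⟨S, hS⟩ := hR.exists_solution hΘ.symm (D.isFormCoercive hn hΩ hb hΘ)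
  refine ⟨S, fun g u => ⟨fun hu => ?_, fun hu => ?_⟩⟩
  · rw [D.isRobinSolution_iff hn hΩ hb] at hu
    exact H1.ext_toL2 hΩ (hR.solution_unique hu (hS g))
  · rw [hu, D.isRobinSolution_iff hn hΩ hb]
    exact hS g

theorem ConeData.conj_notMem_spectrum (D : ConeData Ω) (hn : 1 ≤ n) (hΩ : IsOpen Ω)
    (hb : Bornology.IsBounded Ω) (hΘ : IsBoundaryOperator Θ)
    (hz : z ∉ pmapSpectrum (robinLaplacian Θ)) :
    conj z ∉ pmapSpectrum (robinLaplacian Θ) := by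
  obtain ⟨R, hR⟩ := (D.notMem_spectrum_iff hn hΩ hb Θ z).1 hz
  exact (D.notMem_spectrum_iff hn hΩ hb Θ _).2
    ⟨_, hR.adjoint hΘ.symm (D.isFormCoercive hn hΩ hb hΘ)⟩

theorem robinSolution_eq {S : Hm12 Ω →L[ℂ] H1 Ω}
    (hS : ∀ g u, IsRobinSolution Θ z g u ↔ u = S g) (g : Hm12 Ω) : robinSolution Θ z g = S g := by
  have h : ∃ u : H1 Ω, IsRobinSolution Θ z g u := ⟨S g, (hS g _).2 rfl⟩
  rw [robinSolution, dif_pos h]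
  exact (hS g _).1 h.choose_spec

theorem robinToDirichlet_eq {S : Hm12 Ω →L[ℂ] H1 Ω}
    (hS : ∀ g u, IsRobinSolution Θ z g u ↔ u = S g) :
    robinToDirichlet Θ z = dirichletTrace Ω ∘L S := by
  funext g
  rw [robinToDirichlet, robinSolution_eq hS]
  rfl

theorem ConeData.neumannTrace_eq (D : ConeData Ω) (hn : 1 ≤ n) (hΩ : IsOpen Ω)
    (hb : Bornology.IsBounded Ω) {u : H1 Ω} {ν : Hm12 Ω} (h : HasNeumannTrace u ν) :
    neumannTrace u = ν := by
  have h1 : ∃ ν : Hm12 Ω, HasNeumannTrace u ν := ⟨ν, h⟩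
  rw [neumannTrace, dif_pos h1]
  obtain ⟨f, hf, -⟩ := id h
  exact (D.existsUnique_neumannTrace hn hΩ hb hf).unique h1.choose_spec h

theorem ConeData.robinToRobin_eq (D : ConeData Ω) (hn : 1 ≤ n) (hΩ : IsOpen Ω)
    (hb : Bornology.IsBounded Ω) {S : Hm12 Ω →L[ℂ] H1 Ω}
    (hS : ∀ g u, IsRobinSolution Θ₁ z g u ↔ u = S g) (g : Hm12 Ω) :
    robinToRobin Θ₁ Θ₂ z g = -g + (Θ₁ - Θ₂) (dirichletTrace Ω (S g)) := by
  obtain ⟨-, ν, hν, hg⟩ := (hS g (S g)).2 rfl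
  have e1 : robinSolution Θ₁ z g = S g := robinSolution_eq hS g
  have e2 : neumannTrace (S g) = ν := D.neumannTrace_eq hn hΩ hb hν
  have h1 : robinToRobin Θ₁ Θ₂ z g = -(neumannTrace (S g) + Θ₂ (dirichletTrace Ω (S g))) :=
    congrArg (fun u => -(neumannTrace u + Θ₂ (dirichletTrace Ω u))) e1
  rw [e2] at h1
  exact h1.trans (neg_add_eq_of_add_eq hg)

/-- The differential equation does not involve the boundary operator, so a solution for `Θ₂` solves
the problem for `Θ₁` with its own Robin trace as datum. -/
theorem IsRobinSolution.change_datum {g : Hm12 Ω} {u : H1 Ω} (h : IsRobinSolution Θ₂ z g u) :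
    IsRobinSolution Θ₁ z (-(-g + (Θ₂ - Θ₁) (dirichletTrace Ω u))) u := by
  obtain ⟨hl, ν, hν, hg⟩ := h
  refine ⟨hl, ν, hν, ?_⟩
  have h1 : -(ν + Θ₁ (dirichletTrace Ω u)) = -g + (Θ₂ - Θ₁) (dirichletTrace Ω u) :=
    neg_add_eq_of_add_eq hg
  rw [← h1, neg_neg]

theorem ConeData.robinToRobin_comp (D : ConeData Ω) (hn : 1 ≤ n) (hΩ : IsOpen Ω)
    (hb : Bornology.IsBounded Ω) {S₁ S₂ : Hm12 Ω →L[ℂ] H1 Ω}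
    (hS₁ : ∀ g u, IsRobinSolution Θ₁ z g u ↔ u = S₁ g)
    (hS₂ : ∀ g u, IsRobinSolution Θ₂ z g u ↔ u = S₂ g) (g : Hm12 Ω) :
    robinToRobin Θ₁ Θ₂ z (robinToRobin Θ₂ Θ₁ z g) = g := by
  rw [D.robinToRobin_eq hn hΩ hb hS₂, D.robinToRobin_eq hn hΩ hb hS₁]
  exact boundaryMap_comp ((hS₁ _ _).1 ((hS₂ g _).2 rfl).change_datum).symm

theorem ConeData.pairing_dirichletTrace_symm (D : ConeData Ω) (hn : 1 ≤ n) (hΩ : IsOpen Ω)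
    (hb : Bornology.IsBounded Ω) (hΘ : IsBoundaryOperator Θ) {u v : H1 Ω} {g g' : Hm12 Ω}
    (hu : IsRobinSolution Θ z g u) (hv : IsRobinSolution Θ (conj z) g' v) :
    pairing (dirichletTrace Ω u) g' = conj (pairing (dirichletTrace Ω v) g) := by
  rw [D.isRobinSolution_iff hn hΩ hb] at hu hv
  exact WeakEq.symm hΘ.symm hu hv

set_option maxHeartbeats 800000 in
theorem ConeData.isDualAdjoint_robinToRobin (D : ConeData Ω) (hn : 1 ≤ n) (hΩ : IsOpen Ω)
    (hb : Bornology.IsBounded Ω) (hΘ₁ : IsBoundaryOperator Θ₁) (hΘ₂ : IsBoundaryOperator Θ₂)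
    {S S' : Hm12 Ω →L[ℂ] H1 Ω}
    (hS : ∀ g u, IsRobinSolution Θ₁ z g u ↔ u = S g)
    (hS' : ∀ g u, IsRobinSolution Θ₁ (conj z) g u ↔ u = S' g) :
    IsDualAdjoint (fun f => robinToRobin Θ₁ Θ₂ z ((Θ₁ - Θ₂) f))
      (fun f => robinToRobin Θ₁ Θ₂ (conj z) ((Θ₁ - Θ₂) f)) := by
  intro f g
  have h1 := D.pairing_dirichletTrace_symm hn hΩ hb hΘ₁ ((hS ((Θ₁ - Θ₂) g) _).2 rfl)
    ((hS' ((Θ₁ - Θ₂) f) _).2 rfl)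
  dsimp only
  rw [D.robinToRobin_eq hn hΩ hb hS, D.robinToRobin_eq hn hΩ hb hS']
  exact boundaryMap_adjoint hΘ₁.symm hΘ₂.symm f g h1

theorem ConeData.existsUnique_dirichletTrace (D : ConeData Ω) (hn : 1 ≤ n) (hΩ : IsOpen Ω)
    (hb : Bornology.IsBounded Ω) : ∃! γ : H1 Ω →L[ℂ] H12 Ω, IsDirichletTrace γ := by
  obtain ⟨hγ, -⟩ := D.dirichletTrace_spec hn hΩ hb
  exact ⟨_, hγ, fun γ h => D.dirichletTrace_unique hΩ hb h hγ⟩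

theorem isBoundedLinearMap_robinToDirichlet {S : Hm12 Ω →L[ℂ] H1 Ω}
    (hS : ∀ g u, IsRobinSolution Θ z g u ↔ u = S g) :
    IsBoundedLinearMap ℂ (robinToDirichlet Θ z) := by
  rw [robinToDirichlet_eq hS]
  exact ContinuousLinearMap.isBoundedLinearMap (𝕜 := ℂ) (E := Hm12 Ω) (F := H12 Ω)
    (dirichletTrace Ω ∘L S)

theorem ConeData.robinToRobin_eq_robinToDirichlet (D : ConeData Ω) (hn : 1 ≤ n) (hΩ : IsOpen Ω)
    (hb : Bornology.IsBounded Ω) {S : Hm12 Ω →L[ℂ] H1 Ω}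
    (hS : ∀ g u, IsRobinSolution Θ₁ z g u ↔ u = S g) (g : Hm12 Ω) :
    robinToRobin Θ₁ Θ₂ z g = -g + (Θ₁ - Θ₂) (robinToDirichlet Θ₁ z g) := by
  rw [D.robinToRobin_eq hn hΩ hb hS, robinToDirichlet_eq hS]
  rfl

theorem ConeData.isBoundedLinearMap_robinToRobin (D : ConeData Ω) (hn : 1 ≤ n) (hΩ : IsOpen Ω)
    (hb : Bornology.IsBounded Ω) {S : Hm12 Ω →L[ℂ] H1 Ω}
    (hS : ∀ g u, IsRobinSolution Θ₁ z g u ↔ u = S g) :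
    IsBoundedLinearMap ℂ (robinToRobin Θ₁ Θ₂ z) := by
  let M : Hm12 Ω →L[ℂ] Hm12 Ω :=
    -ContinuousLinearMap.id ℂ (Hm12 Ω) + (Θ₁ - Θ₂) ∘L dirichletTrace Ω ∘L S
  have e : robinToRobin Θ₁ Θ₂ z = M := funext fun g => D.robinToRobin_eq hn hΩ hb hS g
  rw [e]
  exact ContinuousLinearMap.isBoundedLinearMap (𝕜 := ℂ) (E := Hm12 Ω) (F := Hm12 Ω) M

set_option maxHeartbeats 800000 in
theorem ConeData.robinMaps_of_notMem_spectrum (D : ConeData Ω) (hn : 1 ≤ n) (hΩ : IsOpen Ω)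
    (hb : Bornology.IsBounded Ω) (hΘ₁ : IsBoundaryOperator Θ₁) (hΘ₂ : IsBoundaryOperator Θ₂)
    (hz : z ∉ pmapSpectrum (robinLaplacian Θ₁)) :
    (∀ g : Hm12 Ω, ∃! u : H1 Ω, IsRobinSolution Θ₁ z g u) ∧
      IsBoundedLinearMap ℂ (robinToDirichlet Θ₁ z) ∧
      IsBoundedLinearMap ℂ (robinToRobin Θ₁ Θ₂ z) ∧
      (∀ g : Hm12 Ω,
        robinToRobin Θ₁ Θ₂ z g = -g + (Θ₁ - Θ₂) (robinToDirichlet Θ₁ z g)) ∧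
      (∀ f : H12 Ω, robinToRobin Θ₁ Θ₂ z ((Θ₁ - Θ₂) f) =
          -(Θ₁ - Θ₂) f + (Θ₁ - Θ₂) (robinToDirichlet Θ₁ z ((Θ₁ - Θ₂) f))) ∧
      conj z ∉ pmapSpectrum (robinLaplacian Θ₁) ∧
      IsDualAdjoint (fun f => robinToRobin Θ₁ Θ₂ z ((Θ₁ - Θ₂) f))
        (fun f => robinToRobin Θ₁ Θ₂ (conj z) ((Θ₁ - Θ₂) f)) := by
  have hz' := D.conj_notMem_spectrum hn hΩ hb hΘ₁ hz
  obtain ⟨S, hS⟩ := D.exists_solutionOperator hn hΩ hb hΘ₁ hz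
  obtain ⟨S', hS'⟩ := D.exists_solutionOperator hn hΩ hb hΘ₁ hz'
  have e := D.robinToRobin_eq_robinToDirichlet (Θ₂ := Θ₂) hn hΩ hb hS
  exact ⟨fun g => ⟨S g, (hS g _).2 rfl, fun u hu => (hS g u).1 hu⟩,
    isBoundedLinearMap_robinToDirichlet hS, D.isBoundedLinearMap_robinToRobin hn hΩ hb hS, e,
    fun f => e _, hz', D.isDualAdjoint_robinToRobin hn hΩ hb hΘ₁ hΘ₂ hS hS'⟩

theorem ConeData.robinToRobin_leftInverse (D : ConeData Ω) (hn : 1 ≤ n) (hΩ : IsOpen Ω)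
    (hb : Bornology.IsBounded Ω) (hΘ₁ : IsBoundaryOperator Θ₁) (hΘ₂ : IsBoundaryOperator Θ₂)
    (hz₁ : z ∉ pmapSpectrum (robinLaplacian Θ₁)) (hz₂ : z ∉ pmapSpectrum (robinLaplacian Θ₂)) :
    Function.LeftInverse (robinToRobin Θ₁ Θ₂ z) (robinToRobin Θ₂ Θ₁ z) := by
  obtain ⟨S₁, hS₁⟩ := D.exists_solutionOperator hn hΩ hb hΘ₁ hz₁
  obtain ⟨S₂, hS₂⟩ := D.exists_solutionOperator hn hΩ hb hΘ₂ hz₂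
  exact D.robinToRobin_comp hn hΩ hb hS₁ hS₂

end

end

end RobinMaps

set_option maxHeartbeats 1000000 in
theorem theorem5p3 {n : ℕ} (hn : 2 ≤ n) {Ω : Set (EuclideanSpace ℝ (Fin n))}
    (hΩ : RobinMaps.IsBoundedLipschitzDomain Ω)
    (Θ₁ Θ₂ : RobinMaps.H12 Ω →L[ℂ] RobinMaps.Hm12 Ω)
    (hΘ₁ : RobinMaps.IsBoundaryOperator Θ₁) (hΘ₂ : RobinMaps.IsBoundaryOperator Θ₂) :
    -- the trace operators are well defined
    (∃! γ : RobinMaps.H1 Ω →L[ℂ] RobinMaps.H12 Ω, RobinMaps.IsDirichletTrace γ) ∧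
    (∀ (u : RobinMaps.H1 Ω) (f : RobinMaps.L2 Ω),
      RobinMaps.HasWeakLaplacian (RobinMaps.toL2 u) f →
        ∃! ν : RobinMaps.Hm12 Ω, RobinMaps.HasNeumannTrace u ν) ∧
    -- statements for `z` outside the spectrum of the first Robin Laplacian
    (∀ z : ℂ, z ∉ RobinMaps.pmapSpectrum (RobinMaps.robinLaplacian Θ₁) →
      -- the boundary value problem defining the maps is uniquely solvable
      (∀ g : RobinMaps.Hm12 Ω, ∃! u : RobinMaps.H1 Ω, RobinMaps.IsRobinSolution Θ₁ z g u) ∧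
      IsBoundedLinearMap ℂ (RobinMaps.robinToDirichlet Θ₁ z) ∧
      -- the Robin-to-Robin map is bounded
      IsBoundedLinearMap ℂ (RobinMaps.robinToRobin Θ₁ Θ₂ z) ∧
      (∀ g : RobinMaps.Hm12 Ω,
        RobinMaps.robinToRobin Θ₁ Θ₂ z g =
          -g + (Θ₁ - Θ₂) (RobinMaps.robinToDirichlet Θ₁ z g)) ∧
      (∀ f : RobinMaps.H12 Ω,
        RobinMaps.robinToRobin Θ₁ Θ₂ z ((Θ₁ - Θ₂) f) =
          -(Θ₁ - Θ₂) f + (Θ₁ - Θ₂) (RobinMaps.robinToDirichlet Θ₁ z ((Θ₁ - Θ₂) f))) ∧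
      starRingEnd ℂ z ∉ RobinMaps.pmapSpectrum (RobinMaps.robinLaplacian Θ₁) ∧
      RobinMaps.IsDualAdjoint
        (fun f => RobinMaps.robinToRobin Θ₁ Θ₂ z ((Θ₁ - Θ₂) f))
        (fun f => RobinMaps.robinToRobin Θ₁ Θ₂ (starRingEnd ℂ z) ((Θ₁ - Θ₂) f))) ∧
    -- the two Robin-to-Robin maps are inverse to each other
    (∀ z : ℂ, z ∉ RobinMaps.pmapSpectrum (RobinMaps.robinLaplacian Θ₁) ∪
          RobinMaps.pmapSpectrum (RobinMaps.robinLaplacian Θ₂) →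
      Function.LeftInverse (RobinMaps.robinToRobin Θ₁ Θ₂ z) (RobinMaps.robinToRobin Θ₂ Θ₁ z) ∧
      Function.RightInverse (RobinMaps.robinToRobin Θ₁ Θ₂ z) (RobinMaps.robinToRobin Θ₂ Θ₁ z)) := by
  have hn1 : 1 ≤ n := by omega
  obtain ⟨D⟩ := hΩ.exists_coneData hn1
  exact ⟨D.existsUnique_dirichletTrace hn1 hΩ.isOpen hΩ.isBounded,
    fun _ _ h => D.existsUnique_neumannTrace hn1 hΩ.isOpen hΩ.isBounded h,
    fun _ hz => D.robinMaps_of_notMem_spectrum hn1 hΩ.isOpen hΩ.isBounded hΘ₁ hΘ₂ hz,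
    -- A right inverse is a left inverse with the roles of `Θ₁` and `Θ₂` exchanged, so the same
    -- lemma serves twice.
    fun _ hz =>
      ⟨D.robinToRobin_leftInverse hn1 hΩ.isOpen hΩ.isBounded hΘ₁ hΘ₂
        (fun h => hz (Or.inl h)) (fun h => hz (Or.inr h)),
      D.robinToRobin_leftInverse hn1 hΩ.isOpen hΩ.isBounded hΘ₂ hΘ₁
        (fun h => hz (Or.inr h)) (fun h => hz (Or.inl h))⟩⟩
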